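/- Let $\beta>0$. Let $W,B$ be independent standard real Brownian motions; hyperbolic Brownian motion in the upper half plane $\mathbb H=\{x+iy:\ y>0\}$ started from $i$ is the continuous process $X_t+iY_t$ that solves $dX_t=Y_t\,dW_t$, $dY_t=Y_t\,dB_t$, $(X_0,Y_0)=(0,1)$, i.e. $Y_t=e^{-t/2+B_t}$ and $X_t=\int_0^tY_s\,dW_s$ (its generator is $\frac12y^2(\partial_x^2+\partial_y^2)$); started from $x+iy$ it is the image of this process under the isometry $w\mapsto x+yw$. Hyperbolic branching Brownian motion with branching rate $\beta$ starts with one particle at $i$; each particle moves as a hyperbolic Brownian motion and, after an exponential time of rate $\beta$, is replaced by two particles at its current position, which behave in the same way; all motions and lifetimes are independent. Let $\mathcal N(t)$ be the set of particles alive at time $t$, and let $Z_u(t)\in\mathbb D=\{|z|<1\}$ be the image of the position of $u\in\mathcal N(t)$ under the isometry $w\mapsto\frac{w-i}{w+i}$ from $\mathbb H$ to the Poincaré disk, which maps $i$ to the origin. Put $$\mu_t=\frac1{|\mathcal N(t)|}\sum_{u\in\mathcal N(t)}\delta_{Z_u(t)} .$$ Then, almost surely, $\mu_t$ converges weakly,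 as $t\to\infty$, to a probability measure $\mu_\infty$ on the closed disk that is carried by the circle $\partial\mathbb D=\{|z|=1\}$, and the following hold. (i) $\mu_\infty$ has no atoms. (ii) For every $\gamma\in[0,\tfrac12\wedge\tfrac\beta3)$ the function $\theta\mapsto\mu_\infty(\{e^{i\varphi}:0\le\varphi\le\theta\})$ on $[0,2\pi]$ is Hölder continuous with exponent $\gamma$ (with a random constant). (iii) If $\beta>1/2$, then $\mu_\infty$ has a density with respect to Lebesgue measure (arc length) on $\partial\mathbb D$. -/

import Mathlib

open MeasureTheory ProbabilityTheory Filter Topology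
open scoped NNReal ENNReal BoundedContinuousFunction

noncomputable section

namespace HypBBM

variable {Ω : Type*} [MeasurableSpace Ω]

/-- The left-point Riemann sum `∑_{k < n} H_{kt/n} (W_{(k+1)t/n} - W_{kt/n})`. -/
def itoSum (H W : ℝ≥0 → Ω → ℝ) (t : ℝ≥0) (n : ℕ) (ω : Ω) : ℝ :=
  ∑ k ∈ Finset.range n,
    H (k * t / n) ω * (W ((k + 1) * t / n) ω - W (k * t / n) ω)

/-- `I = ∫₀ᵗ H_s dW_s` as an Itô integral, for a continuous adapted integrand `H`: the limit in
probability of the left-point Riemann sums. -/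
def IsItoIntegral (H W : ℝ≥0 → Ω → ℝ) (t : ℝ≥0) (I : Ω → ℝ) (P : Measure Ω) : Prop :=
  TendstoInMeasure P (itoSum H W t) atTop I

/-- Hyperbolic Brownian motion `Z = X + iY` in the upper half plane, started from `i`:
the solution with continuous paths of
`dX = Y dW`, `dY = Y dB`, `(X₀, Y₀) = (0, 1)`, with `W`, `B` independent standard Brownian motions.
The second equation is the one of geometric Brownian motion, `Y_t = exp (-t/2 + B_t)`; the first
one says that `X_t` is the Itô integral of `Y` against `W`. The generator is
`(1/2) y² (∂ₓ² + ∂ᵧ²)`. -/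
structure IsHyperbolicBM (Z : ℝ≥0 → Ω → ℂ) (P : Measure Ω) : Prop where
  measurable : ∀ t, Measurable (Z t)
  continuous : ∀ᵐ ω ∂P, Continuous fun t => Z t ω
  sde : ∃ W B : ℝ≥0 → Ω → ℝ,
    IsBrownianReal W P ∧ IsBrownianReal B P ∧
    IndepFun (fun ω t => W t ω) (fun ω t => B t ω) P ∧
    (∀ᵐ ω ∂P, ∀ t : ℝ≥0, (Z t ω).im = Real.exp (-(t : ℝ) / 2 + B t ω)) ∧
    ∀ t : ℝ≥0, IsItoIntegral (fun s ω => (Z s ω).im) W t (fun ω => (Z t ω).re) P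

/-- The random inputs of branching hyperbolic Brownian motion with branching rate `β`. Particles
are labelled by finite binary words: `[]` is the initial particle, and `false :: u`, `true :: u`
are the two offspring of `u`. Particle `u` lives for an exponential time `τ u` of rate `β`, and
moves as an isometric copy of the hyperbolic Brownian motion `Z u`. All lifetimes and
motions are independent. -/
structure IsBBMInput (β : ℝ) (τ : List Bool → Ω → ℝ) (Z : List Bool → ℝ≥0 → Ω → ℂ)
    (P : Measure Ω) : Prop where
  measurable_lifetime : ∀ u, Measurable (τ u)
  lifetime_law : ∀ u, HasLaw (τ u) (expMeasure β) P
  motion : ∀ u, IsHyperbolicBM (Z u) P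
  indep_lifetime_motion : ∀ u, IndepFun (τ u) (fun ω t => Z u t ω) P
  indep_particles : iIndepFun (fun u ω => (τ u ω, fun t : ℝ≥0 => Z u t ω)) P

/-- The isometry `w ↦ x + y w` of the upper half plane which maps `i` to `z = x + iy`. -/
def moveTo (z w : ℂ) : ℂ := z.re + z.im * w

/-- Time at which particle `u` is born. -/
def birthTime (τ : List Bool → Ω → ℝ) : List Bool → Ω → ℝ
  | [], _ => 0
  | _ :: u, ω => birthTime τ u ω + τ u ω

/-- Place in the upper half plane at which particle `u` is born: `i` for the initial particle, and
the place of death of the parent for the others. -/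
def birthPlace (τ : List Bool → Ω → ℝ) (Z : List Bool → ℝ≥0 → Ω → ℂ) : List Bool → Ω → ℂ
  | [], _ => Complex.I
  | _ :: u, ω => moveTo (birthPlace τ Z u ω) (Z u (τ u ω).toNNReal ω)

/-- Position in the upper half plane, at time `t`, of a particle `u` that is alive at that time. -/
def position (τ : List Bool → Ω → ℝ) (Z : List Bool → ℝ≥0 → Ω → ℂ) (u : List Bool) (t : ℝ≥0)
    (ω : Ω) : ℂ :=
  moveTo (birthPlace τ Z u ω) (Z u ((t : ℝ) - birthTime τ u ω).toNNReal ω)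

/-- The set of particles alive at time `t`. -/
def alive (τ : List Bool → Ω → ℝ) (t : ℝ≥0) (ω : Ω) : Set (List Bool) :=
  {u | birthTime τ u ω ≤ t ∧ (t : ℝ) < birthTime τ u ω + τ u ω}

/-- The isometry from the upper half plane to the unit disk that maps `i` to `0`; it is the inverse
of `z ↦ i (1 + z) / (1 - z)`. -/
def toDisk (w : ℂ) : ℂ := (w - Complex.I) / (w + Complex.I)

/-- The normalised empirical measure at time `t`, in the disk model. -/
def empiricalMeasure (τ : List Bool → Ω → ℝ) (Z : List Bool → ℝ≥0 → Ω → ℂ) (t : ℝ≥0) (ω : Ω) :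
    Measure ℂ :=
  ((alive τ t ω).encard : ℝ≥0∞)⁻¹ •
    Measure.sum fun u : alive τ t ω => Measure.dirac (toDisk (position τ Z u t ω))

/-- `μ` is the probability measure on the boundary circle to which the empirical measures converge
weakly as `t → ∞`. (All the measures live on the closed unit disk.) -/
structure IsLimitMeasure (τ : List Bool → Ω → ℝ) (Z : List Bool → ℝ≥0 → Ω → ℂ) (ω : Ω)
    (μ : Measure ℂ) : Prop where
  isProbabilityMeasure : IsProbabilityMeasure μ
  boundary : μ (Metric.sphere (0 : ℂ) 1)ᶜ = 0
  tendsto : ∀ f : ℂ →ᵇ ℝ,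
    Tendsto (fun t : ℝ≥0 => ∫ z, f z ∂(empiricalMeasure τ Z t ω)) atTop (𝓝 (∫ z, f z ∂μ))

/-- The closed arc of the unit circle with angles between `0` and `θ`. -/
def arc (θ : ℝ) : Set ℂ := (fun φ : ℝ => Complex.exp (φ * Complex.I)) '' Set.Icc 0 θ

/-- The distribution function `θ ↦ μ([0, θ])` of a measure on the unit circle. -/
def circleCDF (μ : Measure ℂ) (θ : ℝ) : ℝ := μ.real (arc θ)

/-- Lebesgue measure (arc length) on the unit circle. -/
def circleLebesgue : Measure ℂ :=
  (volume.restrict (Set.Ico 0 (2 * Real.pi))).map fun φ : ℝ => Complex.exp (φ * Complex.I)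

end HypBBM

end

/-! The limit is a cascade on the genealogical tree. Let τ be the lifetime of the initial particle
and X + iY the place of its death. Seen from i, the unnormalised limit m on the boundary line of the
half plane is e^(-βτ) times the sum of the images, under r ↦ X + Y r, of the limits m' and m'' of
the two subtrees, which are independent of each other and of (τ, X, Y). Its total mass is the Yule
limit W = lim e^(-βt) |N(t)|, which is positive and finite. Every estimate is an affine recursion
along this branching, and it closes as soon as the relevant factor 2 E[e^(-lτ) Y^q] = 2β / (β + l -
q(q-1)/2) is less than 1. Laws of different particles need not coincide, so all bounds are uniform
over the admissible mark laws (`IsMarkLaw`).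

Convergence. For small a > 0 the factor 2 E[e^(-βτ) Y^a] is less than 1 because a(a-1) < 0. Hence
the total displacement to the power a, over all particles at time t, is at most of order e^(βt)
(`Compat.lintegral_displacement_le`), and replacing the particles by their ancestors in generation n
costs an error that vanishes as n grows (`ae_tendsto_remainder`, `eventually_popMean_sub_le`). The
measure `approxLimit β n` puts the right mass at each particle of generation n, smeared uniformly
over the image of [0, 1]. On the compact circle these measures converge along an ultrafilter, and
the error estimate turns this into convergence of the empirical measures, and of the whole sequence
of approximations (`exists_tendsto_diskApprox`).

Hölder continuity. For s < min(1, β) the expected energy of order s of the approximations is bounded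
in n. The part where both points descend from the same child is multiplied by 2 E[e^(-2βτ) Y^(-s)] <
1; the mutual energies of different children are finite since X + Y r has a density of order
t^(-1/2) at time t. The chordal distance of the images of r and r' on the circle is 2|r - r'| /
√((1+r²)(1+r'²)), so energies with the weight |r|^(2s) are needed as well
(`exists_lintegral_energy_mom_le`). A set of diameter δ then has squared mass at most a constant
times δ^s (`approxLimit_sq_le`), which excludes atoms and gives every exponent below min(1/2, β/2),
more than is claimed.

Density. If β > 1/2, the mean densities are bounded, and for 1 < p < min(2, 2β) the factor 2
E[e^(-pβτ) Y^(1-p)] is less than 1. So the approximations are bounded in L^p along a subsequence,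
and the limit is absolutely continuous (`absolutelyContinuous`).

The estimates for hyperbolic Brownian motion need no stochastic calculus: given B, the Riemann sums
of ∫ Y dW are centred Gaussian with explicit variance, and bounds for them pass to the limit by
Fatou's lemma. -/

noncomputable section

namespace HypBBM

/-! ### Families indexed by binary words -/

section Tree

variable {α : Type*}

/-- The part of a family indexed by binary words that lies above the child `b` of the root. -/
def sub (b : Bool) (c : List Bool → α) : List Bool → α := fun u => c (u ++ [b])

/-- Glue a root and two subtrees. -/
def glue (m : α) (c₀ c₁ : List Bool → α) (u : List Bool) : α :=
  match u.reverse with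
  | [] => m
  | false :: v => c₀ v.reverse
  | true :: v => c₁ v.reverse

@[simp] lemma glue_nil (m : α) (c₀ c₁ : List Bool → α) : glue m c₀ c₁ [] = m := rfl

@[simp] lemma glue_false (m : α) (c₀ c₁ : List Bool → α) (u : List Bool) :
    glue m c₀ c₁ (u ++ [false]) = c₀ u := by simp [glue]

@[simp] lemma glue_true (m : α) (c₀ c₁ : List Bool → α) (u : List Bool) :
    glue m c₀ c₁ (u ++ [true]) = c₁ u := by simp [glue]

@[simp] lemma sub_false_glue (m : α) (c₀ c₁ : List Bool → α) : sub false (glue m c₀ c₁) = c₀ := by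
  ext u; simp [sub]

@[simp] lemma sub_true_glue (m : α) (c₀ c₁ : List Bool → α) : sub true (glue m c₀ c₁) = c₁ := by
  ext u; simp [sub]

/-- New letters are put at the head of a word, so the branch taken at the root is the last letter.
Recursions from the root therefore peel words from the right. -/
lemma word_cases (u : List Bool) : u = [] ∨ ∃ v b, u = v ++ [b] := by
  rcases u.eq_nil_or_concat with h | ⟨v, b, h⟩
  · exact .inl h
  · exact .inr ⟨v, b, by simpa using h⟩

variable [MeasurableSpace α]

@[fun_prop] lemma measurable_sub (b : Bool) : Measurable (sub b : (List Bool → α) → _) :=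
  measurable_pi_lambda _ fun _ => measurable_pi_apply _

lemma measurable_glue :
    Measurable fun p : α × (List Bool → α) × (List Bool → α) => glue p.1 p.2.1 p.2.2 := by
  refine measurable_pi_lambda _ fun u => ?_
  rcases word_cases u with rfl | ⟨v, b, rfl⟩
  · simpa using measurable_fst
  · cases b
    · simpa using! (measurable_pi_apply v).comp (measurable_fst.comp measurable_snd)
    · simpa using! (measurable_pi_apply v).comp (measurable_snd.comp measurable_snd)

/-- The law of a family of independent marks. -/
abbrev treeLaw (ν : List Bool → Measure α) : Measure (List Bool → α) := Measure.infinitePi ν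

/-- The branching property behind all recursions. A product measure is determined by cylinders, and
under `glue` a cylinder pulls back to the product of a set of root marks and one cylinder in each
subtree. -/
lemma treeLaw_eq_map_glue (ν : List Bool → Measure α) [∀ u, IsProbabilityMeasure (ν u)] :
    ((ν []).prod ((treeLaw (sub false ν)).prod (treeLaw (sub true ν)))).map
      (fun p => glue p.1 p.2.1 p.2.2) = treeLaw ν := by
  have : ∀ b u, IsProbabilityMeasure (sub b ν u) := fun b u => by unfold sub; infer_instance
  refine Measure.eq_infinitePi _ fun s t ht => ?_
  classical
  rw [Measure.map_apply measurable_glue (MeasurableSet.pi s.countable_toSet fun i _ => ht i)]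
  have inj : ∀ b : Bool, Function.Injective fun u : List Bool => u ++ [b] :=
    fun b u v h => by simpa using h
  set S : Bool → Finset (List Bool) := fun b => s.preimage (· ++ [b]) (inj b).injOn
  set r : Set α := if [] ∈ s then t [] else Set.univ
  have hpre : (fun p : α × (List Bool → α) × (List Bool → α) => glue p.1 p.2.1 p.2.2) ⁻¹'
      (Set.pi s t) = r ×ˢ ((Set.pi (S false) fun u => t (u ++ [false])) ×ˢ
        (Set.pi (S true) fun u => t (u ++ [true]))) := by
    ext ⟨m, c₀, c₁⟩
    simp only [Set.mem_preimage, Set.mem_pi, Set.mem_prod, S, r, Finset.mem_coe,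
      Finset.mem_preimage]
    constructor
    · intro h
      refine ⟨?_, fun u hu => by simpa using h _ hu, fun u hu => by simpa using h _ hu⟩
      split_ifs with h0
      · simpa using h _ h0
      · trivial
    · rintro ⟨h0, h1, h2⟩ u hu
      rcases word_cases u with rfl | ⟨v, b, rfl⟩
      · simpa [hu] using h0
      · cases b
        · simpa using h1 v hu
        · simpa using h2 v hu
  rw [hpre, Measure.prod_prod, Measure.prod_prod, Measure.infinitePi_pi _ (fun u _ => ht _),
    Measure.infinitePi_pi _ (fun u _ => ht _)]
  have hs : s = (if [] ∈ s then {[]} else ∅) ∪ ((S false).image (· ++ [false]) ∪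
      (S true).image (· ++ [true])) := by
    ext u
    rcases word_cases u with rfl | ⟨v, b, rfl⟩
    · by_cases h : [] ∈ s <;> simp [h]
    · by_cases h : [] ∈ s <;> cases b <;> simp [h, S]
  conv_rhs => rw [hs]
  rw [Finset.prod_union, Finset.prod_union, Finset.prod_image (fun _ _ _ _ h => inj _ h),
    Finset.prod_image (fun _ _ _ _ h => inj _ h)]
  · congr 1
    by_cases h : [] ∈ s <;> simp [h, r]
  · simp [Finset.disjoint_left]
  · by_cases h : [] ∈ s <;> simp [h, Finset.disjoint_left]

lemma map_root_treeLaw (ν : List Bool → Measure α) [∀ u, IsProbabilityMeasure (ν u)] :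
    (treeLaw ν).map (fun c => (c [], sub false c, sub true c)) =
      (ν []).prod ((treeLaw (sub false ν)).prod (treeLaw (sub true ν))) := by
  rw [← treeLaw_eq_map_glue ν, Measure.map_map (by fun_prop) measurable_glue]
  simp [Function.comp_def]

instance (ν : List Bool → Measure α) [∀ u, IsProbabilityMeasure (ν u)] (b : Bool) (u : List Bool) :
    IsProbabilityMeasure (sub b ν u) := by unfold sub; infer_instance

lemma lintegral_treeLaw (ν : List Bool → Measure α) [∀ u, IsProbabilityMeasure (ν u)]
    {F : α → (List Bool → α) → (List Bool → α) → ℝ≥0∞}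
    (hF : Measurable fun p : α × (List Bool → α) × (List Bool → α) => F p.1 p.2.1 p.2.2) :
    ∫⁻ c, F (c []) (sub false c) (sub true c) ∂treeLaw ν =
      ∫⁻ m, ∫⁻ c₀, ∫⁻ c₁, F m c₀ c₁ ∂treeLaw (sub true ν) ∂treeLaw (sub false ν) ∂ν [] := by
  have h := lintegral_map (μ := treeLaw ν) hF
    (g := fun c => (c [], sub false c, sub true c)) (by fun_prop)
  rw [← h, map_root_treeLaw, lintegral_prod _ hF.aemeasurable]
  refine lintegral_congr fun m => ?_
  exact lintegral_prod _ (hF.comp measurable_prodMk_left).aemeasurable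

lemma integral_treeLaw (ν : List Bool → Measure α) [∀ u, IsProbabilityMeasure (ν u)]
    {F : α → (List Bool → α) → (List Bool → α) → ℝ} {C : ℝ}
    (hF : Measurable fun p : α × (List Bool → α) × (List Bool → α) => F p.1 p.2.1 p.2.2)
    (hC : ∀ m c₀ c₁, |F m c₀ c₁| ≤ C) :
    ∫ c, F (c []) (sub false c) (sub true c) ∂treeLaw ν =
      ∫ m, ∫ c₀, ∫ c₁, F m c₀ c₁ ∂treeLaw (sub true ν) ∂treeLaw (sub false ν) ∂ν [] := by
  have h := integral_map (μ := treeLaw ν) (φ := fun c => (c [], sub false c, sub true c))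
    (by fun_prop) (f := fun p => F p.1 p.2.1 p.2.2) hF.aestronglyMeasurable
  rw [← h, map_root_treeLaw, integral_prod]
  · refine integral_congr_ae (.of_forall fun m => ?_)
    simp only
    rw [integral_prod]
    exact .of_bound (hF.comp measurable_prodMk_left).aestronglyMeasurable C
      (.of_forall fun p => hC _ _ _)
  · exact .of_bound hF.aestronglyMeasurable C (.of_forall fun p => hC _ _ _)

/-- A property that holds almost surely, for the laws of all subtrees, holds almost surely on all
subtrees. -/
lemma ae_forall_subtree {ν : List Bool → Measure α} [∀ u, IsProbabilityMeasure (ν u)]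
    {p : (List Bool → α) → Prop}
    (h : ∀ v, ∀ᵐ c ∂treeLaw (fun u => ν (u ++ v)), p c) :
    ∀ᵐ c ∂treeLaw ν, ∀ v : List Bool, p fun u => c (u ++ v) := by
  rw [ae_all_iff]
  intro v
  have : (treeLaw ν).map (fun c u => c (u ++ v)) = treeLaw fun u => ν (u ++ v) :=
    Measure.map_infinitePi_infinitePi_of_inj (P := ν) (f := fun u : List Bool => u ++ v)
      fun u w h => by simpa using h
  exact ae_of_ae_map (f := fun (c : List Bool → α) u => c (u ++ v))
    (measurable_pi_lambda _ fun _ => measurable_pi_apply _).aemeasurable (this ▸ h v)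

lemma ae_sub {ν : List Bool → Measure α} [∀ u, IsProbabilityMeasure (ν u)] (b : Bool)
    {p : (List Bool → α) → Prop} (h : ∀ᵐ c ∂treeLaw (sub b ν), p c) :
    ∀ᵐ c ∂treeLaw ν, p (sub b c) := by
  have : (treeLaw ν).map (sub b) = treeLaw (sub b ν) :=
    Measure.map_infinitePi_infinitePi_of_inj (P := ν) (f := fun u : List Bool => u ++ [b])
      fun u w h => by simpa using h
  exact ae_of_ae_map (by fun_prop) (this ▸ h)

end Tree

/-! ### Marks of particles -/

/-- The mark of a particle: its lifetime `t`, the real part and the logarithm of the imaginary part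
of its motion at time `t`, and the largest displacement of its motion until time `t`. -/
abbrev Mark := ℝ≥0 × ℝ × ℝ × ℝ≥0∞

/-- The exponential law of rate `β`, as a measure on the nonnegative reals. -/
def lifeLaw (β : ℝ) : Measure ℝ≥0 := (expMeasure β).map Real.toNNReal

/-- The properties of the marginal law at time `t` of hyperbolic Brownian motion that we use. -/
structure IsMotionLaw (C t : ℝ≥0) (κ : Measure (ℝ × ℝ × ℝ≥0∞)) : Prop where
  isProbabilityMeasure : IsProbabilityMeasure κ
  -- The second coordinate is log Y = -t/2 + B, so these are Gaussian exponential moments.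
  moment : ∀ q : ℝ, ∫⁻ z, .ofReal (Real.exp (q * z.2.1)) ∂κ =
    .ofReal (Real.exp (q * (q - 1) / 2 * t))
  -- A bound for E[X²/Y]: it pays for the horizontal shift when weights |x|^(2s) are transported by
  -- the motion.
  shear : ∫⁻ z, .ofReal (Real.exp (-z.2.1) * z.1 ^ 2) ∂κ ≤ .ofReal (t * Real.exp t)
  -- The boundary point r is sent to X + Y r, whose density is at most t^(-1/2) e^t.
  density : t ≠ 0 → ∀ (φ : ℝ → ℝ≥0∞) (r : ℝ), Measurable φ →
    ∫⁻ z, φ (z.1 + Real.exp z.2.1 * r) ∂κ ≤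
      .ofReal ((t : ℝ) ^ (-(1 / 2) : ℝ) * Real.exp t) * ∫⁻ x, φ x
  displacement : ∫⁻ z, z.2.2 ∂κ ≤ .ofReal (C * Real.exp (8 * t))

/-- The law of a mark: a motion run for an independent exponential time of rate `β`. -/
def IsMarkLaw (β : ℝ) (C : ℝ≥0) (ν : Measure Mark) : Prop :=
  ∃ κ : ℝ≥0 → Measure (ℝ × ℝ × ℝ≥0∞), (∀ t, IsMotionLaw C t (κ t)) ∧
    ∀ F : Mark → ℝ≥0∞, Measurable F → ∫⁻ m, F m ∂ν = ∫⁻ t, ∫⁻ z, F (t, z) ∂κ t ∂lifeLaw β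

variable {β : ℝ} {C : ℝ≥0}

lemma isProbabilityMeasure_lifeLaw (hβ : 0 < β) : IsProbabilityMeasure (lifeLaw β) :=
  have := isProbabilityMeasure_expMeasure hβ
  Measure.isProbabilityMeasure_map (by fun_prop)

lemma lintegral_lifeLaw {f : ℝ≥0 → ℝ≥0∞} (hf : Measurable f) :
    ∫⁻ t, f t ∂lifeLaw β =
      ∫⁻ x in Set.Ioi (0 : ℝ), .ofReal (β * Real.exp (-(β * x))) * f x.toNNReal := by
  rw [lifeLaw, lintegral_map hf (by fun_prop), expMeasure, gammaMeasure,
    lintegral_withDensity_eq_lintegral_mul _ (f := gammaPDF 1 β)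
      (measurable_gammaPDFReal 1 β).ennreal_ofReal (by fun_prop)]
  rw [← lintegral_add_compl _ measurableSet_Ioi (A := Set.Ioi (0 : ℝ))]
  have h0 : ∫⁻ x in (Set.Ioi (0 : ℝ))ᶜ, (gammaPDF 1 β * fun a : ℝ => f a.toNNReal) x = 0 := by
    rw [Set.compl_Ioi, setLIntegral_congr Iio_ae_eq_Iic.symm, setLIntegral_congr_fun measurableSet_Iio
      (g := fun _ => 0) (fun x hx => by simp [gammaPDF_of_neg hx])]
    simp
  rw [h0, add_zero]
  refine setLIntegral_congr_fun measurableSet_Ioi fun x hx => ?_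
  have := exponentialPDF_of_nonneg (r := β) (le_of_lt hx)
  rw [exponentialPDF, exponentialPDFReal] at this
  simp only [Pi.mul_apply, gammaPDF, this]

/-- A Gamma integral: -1 < a controls the singularity at 0 and 0 < β + b the behaviour at infinity.
-/
lemma lintegral_lifeLaw_rpow_lt_top {a b : ℝ} (ha : -1 < a) (hb : 0 < β + b) :
    ∫⁻ t : ℝ≥0, .ofReal ((t : ℝ) ^ a * Real.exp (-b * t)) ∂lifeLaw β < ∞ := by
  rw [lintegral_lifeLaw (by fun_prop)]
  have h := (integrableOn_rpow_mul_exp_neg_mul_rpow ha one_pos hb).const_mul β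
  refine lt_of_le_of_lt (setLIntegral_mono_ae' (g := fun x : ℝ => ENNReal.ofReal
    |β * (x ^ a * Real.exp (-(β + b) * x ^ (1 : ℝ)))|) measurableSet_Ioi (.of_forall fun x hx => ?_))
    ?_
  · have hx' : (0 : ℝ) ≤ x := le_of_lt hx
    rw [Real.coe_toNNReal x hx', ← ENNReal.ofReal_mul' (by positivity)]
    refine ENNReal.ofReal_le_ofReal (le_trans (le_of_eq ?_) (le_abs_self _))
    rw [Real.rpow_one, show -(β + b) * x = -(β * x) + -b * x by ring, Real.exp_add]
    ring
  · have := h.2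
    simpa [HasFiniteIntegral, Real.enorm_eq_ofReal_abs] using this

lemma lintegral_lifeLaw_exp (hβ : 0 < β) {b : ℝ} (hb : 0 < β + b) :
    ∫⁻ t : ℝ≥0, .ofReal (Real.exp (-b * t)) ∂lifeLaw β = .ofReal (β / (β + b)) := by
  rw [lintegral_lifeLaw (by fun_prop)]
  have e : ∀ x ∈ Set.Ioi (0 : ℝ), ENNReal.ofReal (β * Real.exp (-(β * x))) *
      ENNReal.ofReal (Real.exp (-b * x.toNNReal)) =
      ENNReal.ofReal (β * Real.exp (-(β + b) * x)) := fun x hx => by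
    rw [Real.coe_toNNReal x (le_of_lt hx), ← ENNReal.ofReal_mul (by positivity), mul_assoc,
      ← Real.exp_add]
    congr 3; ring
  rw [setLIntegral_congr_fun measurableSet_Ioi e,
    ← ofReal_integral_eq_lintegral_ofReal ((exp_neg_integrableOn_Ioi 0 hb).const_mul β)
      (.of_forall fun x => by positivity), integral_const_mul,
    integral_exp_mul_Ioi (by linarith)]
  congr 1
  rw [mul_zero, Real.exp_zero, neg_div_neg_eq, mul_one_div]

namespace IsMarkLaw

variable {ν : Measure Mark}

lemma isProbabilityMeasure (hβ : 0 < β) (h : IsMarkLaw β C ν) : IsProbabilityMeasure ν := by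
  obtain ⟨κ, hκ, hF⟩ := h
  have := isProbabilityMeasure_lifeLaw hβ
  have := fun t => (hκ t).isProbabilityMeasure
  exact ⟨by simpa using hF 1 measurable_one⟩

lemma lintegral_fst (h : IsMarkLaw β C ν) {f : ℝ≥0 → ℝ≥0∞} (hf : Measurable f) :
    ∫⁻ m, f m.1 ∂ν = ∫⁻ t, f t ∂lifeLaw β := by
  obtain ⟨κ, hκ, hF⟩ := h
  have := fun t => (hκ t).isProbabilityMeasure
  simpa using hF (fun m => f m.1) (by fun_prop)

/-- Bound on an expectation, from a bound at every deterministic time. -/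
lemma lintegral_le (h : IsMarkLaw β C ν) {f : ℝ≥0 → ℝ≥0∞} {F : Mark → ℝ≥0∞}
    (hF : Measurable F) (hle : ∀ t : ℝ≥0, t ≠ 0 → ∀ κ, IsMotionLaw C t κ →
      ∫⁻ z, F (t, z) ∂κ ≤ f t) : ∫⁻ m, F m ∂ν ≤ ∫⁻ t, f t ∂lifeLaw β := by
  obtain ⟨κ, hκ, hF'⟩ := h
  rw [hF' F hF]
  refine lintegral_mono_ae ?_
  -- The exponential law does not charge 0, so bounds that blow up at t = 0, such as t^(-1/2), are
  -- admissible.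
  have : ∀ᵐ t ∂lifeLaw β, t ≠ 0 := by
    have h0 : lifeLaw β {0} = 0 := by
      rw [← setLIntegral_one, ← lintegral_indicator (measurableSet_singleton 0),
        lintegral_lifeLaw (measurable_const.indicator (measurableSet_singleton 0)),
        setLIntegral_congr_fun (g := fun _ => 0) measurableSet_Ioi]
      · simp
      · intro x hx
        have : x.toNNReal ≠ 0 := by simpa using hx
        simp [this]
    exact compl_mem_ae_iff.2 h0
  filter_upwards [this] with t ht using hle t ht _ (hκ t)

/-- The source of all contraction factors: the Gaussian moment e^(q(q-1)t/2) and e^(-lt) are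
integrated against the exponential lifetime. A value q in (0, 1) gains, as q(q-1) is then negative.
-/
lemma lintegral_exp (hβ : 0 < β) (h : IsMarkLaw β C ν) {l q : ℝ}
    (hl : 0 < β + l - q * (q - 1) / 2) :
    ∫⁻ m, .ofReal (Real.exp (-l * m.1 + q * m.2.2.1)) ∂ν =
      .ofReal (β / (β + l - q * (q - 1) / 2)) := by
  obtain ⟨κ, hκ, hF⟩ := h
  rw [hF _ (by fun_prop)]
  have e : ∀ t : ℝ≥0, ∫⁻ z, .ofReal (Real.exp (-l * t + q * z.2.1)) ∂κ t =
      ENNReal.ofReal (Real.exp (-(l - q * (q - 1) / 2) * t)) := fun t => by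
    simp_rw [Real.exp_add, ENNReal.ofReal_mul (Real.exp_nonneg _)]
    rw [lintegral_const_mul' _ _ ENNReal.ofReal_ne_top, (hκ t).moment,
      ← ENNReal.ofReal_mul (Real.exp_nonneg _), ← Real.exp_add]
    congr 2; ring
  simp_rw [e]
  rw [lintegral_lifeLaw_exp hβ (by linarith)]
  congr 2; ring

end IsMarkLaw

/-! ### Moments over an exponential lifetime -/

/-- The order of the moment of the displacement during a lifetime that we use. -/
def dispExp (β : ℝ) : ℝ := min (1 / 2) (β / 16)

lemma dispExp_pos (hβ : 0 < β) : 0 < dispExp β := by unfold dispExp; positivity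

lemma dispExp_le : dispExp β ≤ 1 / 2 := min_le_left _ _

/-- Jensen's inequality for concave powers. -/
lemma lintegral_rpow_le_rpow_lintegral {α : Type*} [MeasurableSpace α] (μ : Measure α)
    [IsProbabilityMeasure μ] {f : α → ℝ≥0∞} (hf : AEMeasurable f μ) {a : ℝ} (ha : 0 < a)
    (ha1 : a ≤ 1) : ∫⁻ x, f x ^ a ∂μ ≤ (∫⁻ x, f x ∂μ) ^ a := by
  have h := eLpNorm'_le_eLpNorm'_of_exponent_le ha ha1 μ hf.aestronglyMeasurable
  simp only [eLpNorm', enorm_eq_self, ENNReal.rpow_one, div_one] at h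
  calc _ = ((∫⁻ x, f x ^ a ∂μ) ^ (1 / a)) ^ a := by
        rw [← ENNReal.rpow_mul, one_div_mul_cancel ha.ne', ENNReal.rpow_one]
    _ ≤ _ := by gcongr

namespace IsMarkLaw

lemma exists_lintegral_displacement_le (hβ : 0 < β) (C : ℝ≥0) :
    ∃ A < ∞, ∀ ν, IsMarkLaw β C ν → ∫⁻ m, m.2.2.2 ^ dispExp β ∂ν ≤ A := by
  set a := dispExp β
  have ha : 0 < a := dispExp_pos hβ
  -- By Jensen the displacement contributes e^(8at), which is integrable against β e^(-βt) since 8a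
  -- ≤ β/2.
  have hab : a ≤ β / 16 := min_le_right _ _
  refine ⟨∫⁻ t : ℝ≥0, .ofReal (C ^ a) * .ofReal ((t : ℝ) ^ (0 : ℝ) * Real.exp (-(-8 * a) * t))
    ∂lifeLaw β, ?_, fun ν hν => hν.lintegral_le (by fun_prop) fun t ht κ hκ => ?_⟩
  · rw [lintegral_const_mul' _ _ ENNReal.ofReal_ne_top]
    exact ENNReal.mul_lt_top ENNReal.ofReal_lt_top
      (lintegral_lifeLaw_rpow_lt_top (by norm_num) (by linarith))
  · have := hκ.isProbabilityMeasure
    calc _ ≤ (∫⁻ z, z.2.2 ∂κ) ^ a :=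
          lintegral_rpow_le_rpow_lintegral κ (by fun_prop) ha (dispExp_le.trans (by norm_num))
      _ ≤ (ENNReal.ofReal (C * Real.exp (8 * t))) ^ a := by
          gcongr; exact hκ.displacement
      _ = _ := by
          rw [ENNReal.ofReal_rpow_of_nonneg (by positivity) ha.le,
            Real.mul_rpow (by positivity) (by positivity), ← Real.exp_mul,
            ENNReal.ofReal_mul (by positivity), Real.rpow_zero, one_mul]
          congr 3; ring

/-- At a fixed time, Jensen's inequality with the concave power s bounds E[(X²/Y)^s] by (t e^t)^s;
the integral over the lifetime converges because s < β + l. -/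
lemma exists_lintegral_shear_le {s l : ℝ} (hs : 0 < s) (hs1 : s ≤ 1) (hl : s < β + l) (C : ℝ≥0) :
    ∃ K < ∞, ∀ ν, IsMarkLaw β C ν →
      ∫⁻ m, .ofReal (Real.exp (-l * m.1)) *
        (.ofReal (Real.exp (-s * m.2.2.1)) * .ofReal (|m.2.1| ^ (2 * s))) ∂ν ≤ K := by
  refine ⟨∫⁻ t : ℝ≥0, .ofReal ((t : ℝ) ^ s * Real.exp (-(l - s) * t)) ∂lifeLaw β,
    lintegral_lifeLaw_rpow_lt_top (by linarith) (by linarith),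
    fun ν hν => hν.lintegral_le (by fun_prop) fun t ht κ hκ => ?_⟩
  have := hκ.isProbabilityMeasure
  dsimp only
  rw [lintegral_const_mul' _ _ ENNReal.ofReal_ne_top]
  have e : ∀ z : ℝ × ℝ × ℝ≥0∞, ENNReal.ofReal (Real.exp (-s * z.2.1)) * .ofReal (|z.1| ^ (2 * s)) =
      (ENNReal.ofReal (Real.exp (-z.2.1) * z.1 ^ 2)) ^ s := fun z => by
    rw [ENNReal.ofReal_rpow_of_nonneg (by positivity) hs.le,
      Real.mul_rpow (by positivity) (by positivity), ← Real.exp_mul,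
      ← ENNReal.ofReal_mul (by positivity), ← sq_abs, ← Real.rpow_natCast,
      ← Real.rpow_mul (abs_nonneg _)]
    congr 3; ring
  simp_rw [e]
  calc _ ≤ ENNReal.ofReal (Real.exp (-l * t)) *
        (∫⁻ z, .ofReal (Real.exp (-z.2.1) * z.1 ^ 2) ∂κ) ^ s := by
        gcongr
        exact lintegral_rpow_le_rpow_lintegral κ (by fun_prop) hs hs1
    _ ≤ ENNReal.ofReal (Real.exp (-l * t)) * (ENNReal.ofReal (t * Real.exp t)) ^ s := by
        gcongr; exact hκ.shear
    _ = _ := by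
        rw [ENNReal.ofReal_rpow_of_nonneg (by positivity) hs.le,
          Real.mul_rpow (by positivity) (by positivity), ← Real.exp_mul,
          ← ENNReal.ofReal_mul (by positivity)]
        congr 1
        rw [show -(l - s) * (t : ℝ) = -l * t + t * s by ring, Real.exp_add]
        ring

/-- This is where β > 1/2 enters: the weight e^(-βt), the exponential density and the growth e^t of
the bound at time t leave e^(-(2β-1)t). -/
lemma exists_lintegral_density_le (hβ : 1 / 2 < β) (C : ℝ≥0) :
    ∃ K < ∞, ∀ ν, IsMarkLaw β C ν → ∀ (φ : ℝ → ℝ≥0∞) (r : ℝ), Measurable φ →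
      ∫⁻ m, .ofReal (Real.exp (-β * m.1)) * φ (m.2.1 + Real.exp m.2.2.1 * r) ∂ν ≤
        K * ∫⁻ x, φ x := by
  refine ⟨∫⁻ t : ℝ≥0, .ofReal ((t : ℝ) ^ (-(1 / 2) : ℝ) * Real.exp (-(β - 1) * t)) ∂lifeLaw β,
    lintegral_lifeLaw_rpow_lt_top (by norm_num) (by linarith), fun ν hν φ r hφ => ?_⟩
  rw [← lintegral_mul_const _ (by fun_prop)]
  refine hν.lintegral_le (by fun_prop) fun t ht κ hκ => ?_
  dsimp only
  rw [lintegral_const_mul' _ _ ENNReal.ofReal_ne_top]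
  calc _ ≤ ENNReal.ofReal (Real.exp (-β * t)) * (.ofReal ((t : ℝ) ^ (-(1 / 2) : ℝ) * Real.exp t) *
        ∫⁻ x, φ x) := by gcongr; exact hκ.density ht φ r hφ
    _ = _ := by
        rw [← mul_assoc, ← ENNReal.ofReal_mul (by positivity)]
        congr 2
        rw [show -(β - 1) * (t : ℝ) = -β * t + t by ring, Real.exp_add]
        ring

end IsMarkLaw

/-! ### Riesz kernels of moved boundary points -/

/-- The Riesz kernel of order `s` on the line. -/
def riesz (s : ℝ) (x y : ℝ) : ℝ≥0∞ := ‖x - y‖ₑ ^ (-s)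

lemma measurable_riesz (s : ℝ) : Measurable fun p : ℝ × ℝ => riesz s p.1 p.2 := by
  unfold riesz; fun_prop

lemma riesz_comm (s x y : ℝ) : riesz s x y = riesz s y x := by
  rw [riesz, riesz, ← enorm_neg, neg_sub]

lemma riesz_affine (s x y a b : ℝ) :
    riesz s (a + Real.exp b * x) (a + Real.exp b * y) =
      .ofReal (Real.exp (-s * b)) * riesz s x y := by
  rw [riesz, riesz, show a + Real.exp b * x - (a + Real.exp b * y) = Real.exp b * (x - y) by ring,
    enorm_mul, ENNReal.mul_rpow_of_ne_top (by simp) (by simp), Real.enorm_eq_ofReal (by positivity),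
    ENNReal.ofReal_rpow_of_pos (by positivity), ← Real.exp_mul]
  congr 3; ring

lemma lintegral_riesz_ball_le {s r : ℝ} (hs1 : s < 1) (hr : 0 < r) (y : ℝ) :
    ∫⁻ x in Metric.ball y r, riesz s x y ≤ .ofReal (2 / (1 - s) * r ^ (1 - s)) := by
  have h0 : ∫⁻ x in Set.Ioc 0 r, ‖x‖ₑ ^ (-s) = .ofReal (1 / (1 - s) * r ^ (1 - s)) := by
    have hi := intervalIntegral.intervalIntegrable_rpow' (a := 0) (b := r) (r := -s) (by linarith)
    rw [intervalIntegrable_iff_integrableOn_Ioc_of_le hr.le] at hi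
    rw [setLIntegral_congr_fun (g := fun x => ENNReal.ofReal (x ^ (-s))) measurableSet_Ioc,
      ← ofReal_integral_eq_lintegral_ofReal hi, ← intervalIntegral.integral_of_le hr.le,
      integral_rpow (Or.inl (by linarith))]
    · have : (1 : ℝ) - s ≠ 0 := by linarith
      rw [show -s + 1 = 1 - s by ring, Real.zero_rpow this]
      congr 1; ring
    · exact (ae_restrict_iff' measurableSet_Ioc).2 (.of_forall fun x hx =>
        Real.rpow_nonneg hx.1.le _)
    · intro x hx
      simp only
      rw [Real.enorm_eq_ofReal hx.1.le, ENNReal.ofReal_rpow_of_pos hx.1]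
  have h1 : ∫⁻ x in (fun x => x - y) ⁻¹' Set.Ioc 0 r, ‖x - y‖ₑ ^ (-s) =
      ∫⁻ x in Set.Ioc 0 r, ‖x‖ₑ ^ (-s) :=
    (measurePreserving_sub_right volume y).setLIntegral_comp_preimage_emb
      (MeasurableEquiv.subRight y).measurableEmbedding (fun x => ‖x‖ₑ ^ (-s)) _
  have h2 : ∫⁻ x in (fun x => y - x) ⁻¹' Set.Ioc 0 r, ‖y - x‖ₑ ^ (-s) =
      ∫⁻ x in Set.Ioc 0 r, ‖x‖ₑ ^ (-s) :=
    (Measure.measurePreserving_sub_left volume y).setLIntegral_comp_preimage_emb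
      (MeasurableEquiv.subLeft y).measurableEmbedding (fun x => ‖x‖ₑ ^ (-s)) _
  have hsub : Metric.ball y r ⊆ (fun x => x - y) ⁻¹' Set.Ioc 0 r ∪
      ((fun x => y - x) ⁻¹' Set.Ioc 0 r ∪ {y}) := by
    intro x hx
    rw [Metric.mem_ball, Real.dist_eq, abs_lt] at hx
    rcases lt_trichotomy x y with h | h | h
    · exact .inr (.inl ⟨by linarith, by linarith⟩)
    · exact .inr (.inr h)
    · exact .inl ⟨by linarith, by linarith⟩
  calc _ ≤ _ := lintegral_mono_set hsub
    _ ≤ _ := (lintegral_union_le _ _ _).trans (add_le_add_right (lintegral_union_le _ _ _) _)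
    _ = (∫⁻ x in (fun x => x - y) ⁻¹' Set.Ioc 0 r, ‖x - y‖ₑ ^ (-s)) +
        ∫⁻ x in (fun x => y - x) ⁻¹' Set.Ioc 0 r, ‖y - x‖ₑ ^ (-s) := by
      simp only [riesz, lintegral_singleton, Real.volume_singleton, mul_zero, add_zero]
      congr 1
      refine lintegral_congr fun x => ?_
      rw [← enorm_neg, neg_sub]
    _ = _ := by
      have : (0 : ℝ) < 1 - s := by linarith
      rw [h1, h2, h0, ← ENNReal.ofReal_add (by positivity) (by positivity)]
      congr 1; ring

/-- A random point with density at most 1/ρ satisfies E|x - y|^(-s) ≤ const · ρ^(-s) uniformly in y;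
here ρ^(-s) = t^(-s/2) e^(st), and integrability over the lifetime needs s < 2β. -/
lemma IsMarkLaw.exists_lintegral_riesz_le {s : ℝ} (hs : 0 < s) (hs1 : s < 1) (hβ : s < 2 * β)
    (C : ℝ≥0) :
    ∃ K < ∞, ∀ ν, IsMarkLaw β C ν → ∀ r y : ℝ,
      ∫⁻ m, .ofReal (Real.exp (-β * m.1)) * riesz s (m.2.1 + Real.exp m.2.2.1 * r) y ∂ν ≤ K := by
  refine ⟨∫⁻ t : ℝ≥0, .ofReal (1 + 2 / (1 - s)) *
      .ofReal ((t : ℝ) ^ (-(s / 2)) * Real.exp (-(β - s) * t)) ∂lifeLaw β, ?_, fun ν hν r y => ?_⟩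
  · rw [lintegral_const_mul' _ _ ENNReal.ofReal_ne_top]
    exact ENNReal.mul_lt_top ENNReal.ofReal_lt_top
      (lintegral_lifeLaw_rpow_lt_top (by linarith) (by linarith))
  have hm := measurable_riesz s
  refine hν.lintegral_le (by fun_prop) fun t ht κ hκ => ?_
  have := hκ.isProbabilityMeasure
  have ht0 : (0 : ℝ) < t := by simpa using pos_iff_ne_zero.2 ht
  dsimp only
  rw [lintegral_const_mul' _ _ ENNReal.ofReal_ne_top]
  -- The inverse of the density bound. Outside the ball of radius ρ the kernel is at most ρ^(-s);
  -- inside, the density bound 1/ρ times the integral of the kernel over the ball has the same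
  -- order.
  set ρ : ℝ := (t : ℝ) ^ (1 / 2 : ℝ) * Real.exp (-t) with hρ
  have hρ0 : 0 < ρ := by positivity
  have hle : ∀ x, riesz s x y ≤ .ofReal (ρ ^ (-s)) +
      (Metric.ball y ρ).indicator (fun x => riesz s x y) x := fun x => by
    by_cases hx : x ∈ Metric.ball y ρ
    · simp [hx]
    · refine le_add_of_le_left ?_
      rw [Metric.mem_ball, not_lt, Real.dist_eq] at hx
      rw [riesz, Real.enorm_eq_ofReal_abs, ENNReal.ofReal_rpow_of_pos (by linarith)]
      exact ENNReal.ofReal_le_ofReal (Real.rpow_le_rpow_of_nonpos hρ0 hx (by linarith))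
  have hρi : (t : ℝ) ^ (-(1 / 2) : ℝ) * Real.exp t = ρ⁻¹ := by
    rw [hρ, mul_inv, Real.exp_neg, inv_inv, Real.rpow_neg ht0.le]
  have hm' : Measurable ((Metric.ball y ρ).indicator (fun x => riesz s x y)) :=
    Measurable.indicator (by fun_prop) measurableSet_ball
  have key : ∫⁻ z, riesz s (z.1 + Real.exp z.2.1 * r) y ∂κ ≤
      .ofReal ((1 + 2 / (1 - s)) * ρ ^ (-s)) := by
    calc _ ≤ ∫⁻ z, (.ofReal (ρ ^ (-s)) + (Metric.ball y ρ).indicator (fun x => riesz s x y)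
          (z.1 + Real.exp z.2.1 * r)) ∂κ := lintegral_mono fun z => hle _
      _ = .ofReal (ρ ^ (-s)) + ∫⁻ z, (Metric.ball y ρ).indicator (fun x => riesz s x y)
          (z.1 + Real.exp z.2.1 * r) ∂κ := by
          rw [lintegral_add_left measurable_const]; simp
      _ ≤ .ofReal (ρ ^ (-s)) + .ofReal ρ⁻¹ * .ofReal (2 / (1 - s) * ρ ^ (1 - s)) := by
          gcongr
          refine (hκ.density ht _ r hm').trans ?_
          rw [hρi, lintegral_indicator measurableSet_ball]
          gcongr
          exact lintegral_riesz_ball_le hs1 hρ0 y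
      _ = _ := by
          have : (0 : ℝ) < 1 - s := by linarith
          rw [← ENNReal.ofReal_mul (by positivity), ← ENNReal.ofReal_add (by positivity)
            (by positivity), show 1 - s = -s + 1 by ring, Real.rpow_add_one hρ0.ne']
          congr 1
          field_simp
  calc _ ≤ ENNReal.ofReal (Real.exp (-β * t)) * .ofReal ((1 + 2 / (1 - s)) * ρ ^ (-s)) := by
        gcongr
    _ = _ := by
        have : (0 : ℝ) < 1 - s := by linarith
        rw [← ENNReal.ofReal_mul (by positivity), ← ENNReal.ofReal_mul (by positivity), hρ,
          Real.mul_rpow (by positivity) (by positivity), ← Real.exp_mul, ← Real.rpow_mul ht0.le,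
          show -(β - s) * (t : ℝ) = -β * t + -t * -s by ring, Real.exp_add]
        congr 1
        ring_nf

/-! ### The Yule process -/

variable {β : ℝ} {C : ℝ≥0}

lemma IsMarkLaw.integral_fst {ν : Measure Mark} (h : IsMarkLaw β C ν) (hβ : 0 < β)
    {f : ℝ≥0 → ℝ} (hf : Measurable f) (h0 : ∀ t, 0 ≤ f t) :
    ∫ m, f m.1 ∂ν = ∫ x in Set.Ioi (0 : ℝ), β * Real.exp (-(β * x)) * f x.toNNReal := by
  rw [integral_eq_lintegral_of_nonneg_ae (.of_forall fun m => h0 _)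
      (hf.comp measurable_fst).aestronglyMeasurable,
    integral_eq_lintegral_of_nonneg_ae (.of_forall fun x => mul_nonneg (by positivity) (h0 _))
      (by fun_prop), h.lintegral_fst (f := fun t => ENNReal.ofReal (f t)) (by fun_prop),
    lintegral_lifeLaw (by fun_prop)]
  congr 1
  refine lintegral_congr fun x => ?_
  rw [← ENNReal.ofReal_mul (by positivity)]

lemma IsMarkLaw.integral_exp_fst {ν : Measure Mark} (h : IsMarkLaw β C ν) (hβ : 0 < β) {l : ℝ}
    (hl : 0 < β + l) : ∫ m, Real.exp (-l * m.1) ∂ν = β / (β + l) := by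
  have := h.lintegral_exp hβ (l := l) (q := 0) (by simpa)
  rw [integral_eq_lintegral_of_nonneg_ae (.of_forall fun m => by positivity) (by fun_prop)]
  simp only [zero_mul, add_zero, zero_div, sub_zero] at this
  rw [this, ENNReal.toReal_ofReal (by positivity)]

lemma integrable_exp_fst {ν : Measure Mark} [IsFiniteMeasure ν] {l : ℝ} (hl : 0 < l) :
    Integrable (fun m : Mark => Real.exp (-l * m.1)) ν := by
  refine .of_bound (by fun_prop) 1 (.of_forall fun m => ?_)
  rw [Real.norm_eq_abs, abs_of_nonneg (by positivity), neg_mul]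
  exact Real.exp_le_one_iff.2 (by have := mul_nonneg hl.le m.1.2; simpa using this)

/-- One branching step preserves the mean mass: e^(-βt) e^(-βt) + ∫₀ᵗ 2β e^(-2βx) dx = 1. The
summands in 1 + 1 stand for the means of the two subtrees. -/
lemma IsMarkLaw.integral_split {ν : Measure Mark} (h : IsMarkLaw β C ν) (hβ : 0 < β) {t : ℝ}
    (ht : 0 ≤ t) :
    ∫ m, (if t < (m.1 : ℝ) then Real.exp (-(β * t)) else Real.exp (-(β * m.1)) * (1 + 1)) ∂ν = 1 := by
  rw [h.integral_fst hβ (f := fun s : ℝ≥0 => if t < (s : ℝ) then Real.exp (-(β * t)) else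
    Real.exp (-(β * s)) * (1 + 1)) (Measurable.ite (measurableSet_lt (by fun_prop) (by fun_prop))
      (by fun_prop) (by fun_prop)) (fun s => by positivity)]
  have e : ∀ x ∈ Set.Ioi (0 : ℝ), β * Real.exp (-(β * x)) *
      (if t < (x.toNNReal : ℝ) then Real.exp (-(β * t)) else
        Real.exp (-(β * x.toNNReal)) * (1 + 1)) =
      2 * β * Real.exp (-(2 * β) * x) + (Set.Ioi t).indicator (fun x =>
        β * Real.exp (-(β * t)) * Real.exp (-β * x) - 2 * β * Real.exp (-(2 * β) * x)) x := by
    intro x hx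
    have e1 : Real.exp (-(2 * β) * x) = Real.exp (-(β * x)) * Real.exp (-(β * x)) := by
      rw [← Real.exp_add]; ring_nf
    rw [Real.coe_toNNReal x (le_of_lt hx), e1]
    by_cases hxt : t < x
    · simp only [hxt, if_true, Set.mem_Ioi, Set.indicator_of_mem]
      rw [e1, neg_mul]; ring
    · simp only [hxt, if_false]
      rw [Set.indicator_of_notMem (by exact hxt)]; ring
  have i1 : ∀ a : ℝ, IntegrableOn (fun x => 2 * β * Real.exp (-(2 * β) * x)) (Set.Ioi a) :=
    fun a => (exp_neg_integrableOn_Ioi a (by linarith)).const_mul _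
  have i2 : IntegrableOn (fun x => β * Real.exp (-(β * t)) * Real.exp (-β * x)) (Set.Ioi t) :=
    (exp_neg_integrableOn_Ioi t hβ).const_mul _
  rw [setIntegral_congr_fun measurableSet_Ioi e, integral_add (i1 0), setIntegral_indicator
    measurableSet_Ioi, Set.Ioi_inter_Ioi, max_eq_right ht, integral_sub i2 (i1 t),
    integral_const_mul, integral_const_mul, integral_const_mul, integral_exp_mul_Ioi (by linarith),
    integral_exp_mul_Ioi (by linarith), integral_exp_mul_Ioi (by linarith)]
  · have e1 : Real.exp (-(2 * β) * t) = Real.exp (-(β * t)) * Real.exp (-(β * t)) := by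
      rw [← Real.exp_add]; ring_nf
    rw [e1, mul_zero, Real.exp_zero, neg_mul]
    field_simp
    ring
  · exact ((i2.sub (i1 t)).integrable_indicator measurableSet_Ioi).integrableOn

/-- The mass at time `t`, where the particles of generation `n` are frozen, and a particle
frozen at time `s` has mass `exp (-β s)`. -/
def frozenMass (β : ℝ) : ℕ → ℝ → (List Bool → Mark) → ℝ
  | 0, _, _ => 1
  | n + 1, t, c => if t < (c []).1 then Real.exp (-(β * t)) else
      Real.exp (-(β * (c []).1)) * (frozenMass β n (t - (c []).1) (sub false c) +
        frozenMass β n (t - (c []).1) (sub true c))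

/-- The number of particles at time `t`, where the particles of generation `n` are frozen. -/
def frozenCard : ℕ → ℝ → (List Bool → Mark) → ℕ
  | 0, _, _ => 1
  | n + 1, t, c => if t < (c []).1 then 1 else
      frozenCard n (t - (c []).1) (sub false c) + frozenCard n (t - (c []).1) (sub true c)

/-- The number of particles of generation `n` that are born until time `t`. -/
def bornCard : ℕ → ℝ → (List Bool → Mark) → ℕ
  | 0, _, _ => 1
  | n + 1, t, c => if t < (c []).1 then 0 else
      bornCard n (t - (c []).1) (sub false c) + bornCard n (t - (c []).1) (sub true c)

@[fun_prop] lemma measurable_frozenMass (n : ℕ) :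
    Measurable fun p : ℝ × (List Bool → Mark) => frozenMass β n p.1 p.2 := by
  induction n with
  | zero => exact measurable_const
  | succ n ih =>
    refine Measurable.ite (measurableSet_lt (by fun_prop) (by fun_prop)) (by fun_prop) ?_
    have h : ∀ b, Measurable fun p : ℝ × (List Bool → Mark) =>
        frozenMass β n (p.1 - (p.2 []).1) (sub b p.2) := fun b =>
      ih.comp (f := fun p : ℝ × (List Bool → Mark) => (p.1 - (p.2 []).1, sub b p.2)) (by fun_prop)
    have h0 := h false
    have h1 := h true
    fun_prop

lemma measurable_frozenCard (n : ℕ) :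
    Measurable fun p : ℝ × (List Bool → Mark) => frozenCard n p.1 p.2 := by
  induction n with
  | zero => exact measurable_const
  | succ n ih =>
    refine Measurable.ite (measurableSet_lt (by fun_prop) (by fun_prop)) (by fun_prop) ?_
    have h : ∀ b, Measurable fun p : ℝ × (List Bool → Mark) =>
        frozenCard n (p.1 - (p.2 []).1) (sub b p.2) := fun b =>
      ih.comp (f := fun p : ℝ × (List Bool → Mark) => (p.1 - (p.2 []).1, sub b p.2)) (by fun_prop)
    exact (h false).add (h true)

lemma measurable_bornCard (n : ℕ) :
    Measurable fun p : ℝ × (List Bool → Mark) => bornCard n p.1 p.2 := by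
  induction n with
  | zero => exact measurable_const
  | succ n ih =>
    refine Measurable.ite (measurableSet_lt (by fun_prop) (by fun_prop)) (by fun_prop) ?_
    have h : ∀ b, Measurable fun p : ℝ × (List Bool → Mark) =>
        bornCard n (p.1 - (p.2 []).1) (sub b p.2) := fun b =>
      ih.comp (f := fun p : ℝ × (List Bool → Mark) => (p.1 - (p.2 []).1, sub b p.2)) (by fun_prop)
    exact (h false).add (h true)

lemma measurable_frozenMass_right (n : ℕ) (t : ℝ) : Measurable (frozenMass β n t) :=
  (measurable_frozenMass n).comp (f := fun c => (t, c)) (by fun_prop)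

lemma measurable_bornCard_right (n : ℕ) (t : ℝ) : Measurable (bornCard n t) :=
  (measurable_bornCard n).comp (f := fun c => (t, c)) (by fun_prop)

lemma exp_neg_mul_le_one (hβ : 0 < β) {t : ℝ} (ht : 0 ≤ t) : Real.exp (-(β * t)) ≤ 1 :=
  Real.exp_le_one_iff.2 (by have := mul_nonneg hβ.le ht; linarith)

lemma frozenMass_nonneg (n : ℕ) (t : ℝ) (c : List Bool → Mark) : 0 ≤ frozenMass β n t c := by
  induction n generalizing t c with
  | zero => simp [frozenMass]
  | succ n ih =>
    rw [frozenMass]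
    split_ifs
    · positivity
    · exact mul_nonneg (by positivity) (add_nonneg (ih _ _) (ih _ _))

/-- Freezing a generation makes the mass bounded, which supplies integrability in the inductions on
`n`. The moment bounds that follow do not depend on `n`, and Fatou's lemma removes the freezing
afterwards. -/
lemma frozenMass_le (hβ : 0 < β) (n : ℕ) {t : ℝ} (ht : 0 ≤ t) (c : List Bool → Mark) :
    frozenMass β n t c ≤ 2 ^ n := by
  induction n generalizing t c with
  | zero => simp [frozenMass]
  | succ n ih =>
    rw [frozenMass]
    split_ifs with h
    · exact (exp_neg_mul_le_one hβ ht).trans (one_le_pow₀ (by norm_num))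
    · have h' : 0 ≤ t - (c []).1 := by linarith
      calc _ ≤ 1 * ((2 : ℝ) ^ n + 2 ^ n) :=
            mul_le_mul (exp_neg_mul_le_one hβ (by positivity)) (add_le_add (ih h' _) (ih h' _))
              (add_nonneg (frozenMass_nonneg _ _ _) (frozenMass_nonneg _ _ _)) zero_le_one
        _ = _ := by ring

lemma integrable_frozenMass (hβ : 0 < β) {μ : Measure (List Bool → Mark)} [IsFiniteMeasure μ]
    (n : ℕ) {t : ℝ} (ht : 0 ≤ t) : Integrable (frozenMass β n t) μ :=
  .of_bound (measurable_frozenMass_right n t).aestronglyMeasurable (2 ^ n) (.of_forall fun c => by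
    rw [Real.norm_eq_abs, abs_of_nonneg (frozenMass_nonneg _ _ _)]
    exact frozenMass_le hβ n ht c)

lemma integral_integral_add_sq {X Y : Type*} [MeasurableSpace X] [MeasurableSpace Y]
    {μ : Measure X} {ν : Measure Y} [IsProbabilityMeasure μ] [IsProbabilityMeasure ν]
    {f : X → ℝ} {g : Y → ℝ} (hf : MemLp f 2 μ) (hg : MemLp g 2 ν) :
    ∫ x, ∫ y, (f x + g y) ^ 2 ∂ν ∂μ =
      ∫ x, f x ^ 2 ∂μ + 2 * (∫ x, f x ∂μ) * (∫ y, g y ∂ν) + ∫ y, g y ^ 2 ∂ν := by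
  have hf1 := hf.integrable one_le_two
  have hg1 := hg.integrable one_le_two
  have hf2 := hf.integrable_sq
  have hg2 := hg.integrable_sq
  have h : ∀ x, ∫ y, (f x + g y) ^ 2 ∂ν = f x ^ 2 + 2 * f x * (∫ y, g y ∂ν) + ∫ y, g y ^ 2 ∂ν := by
    intro x
    have : ∀ y, (f x + g y) ^ 2 = f x ^ 2 + 2 * f x * g y + g y ^ 2 := fun y => by ring
    simp_rw [this]
    have i1 : Integrable (fun y => f x ^ 2 + 2 * f x * g y) ν :=
      (integrable_const _).add (hg1.const_mul _)
    rw [integral_add i1 hg2,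
      integral_add (integrable_const _) (hg1.const_mul _), integral_const_mul]
    simp
  simp_rw [h]
  have i2 : Integrable (fun x => f x ^ 2 + 2 * f x * ∫ y, g y ∂ν) μ :=
    hf2.add ((hf1.const_mul 2).mul_const _)
  rw [integral_add i2 (integrable_const _), integral_add hf2 ((hf1.const_mul 2).mul_const _), integral_mul_const, integral_const_mul]
  simp

section Moments

variable {ν : List Bool → Measure Mark}

lemma memLp_frozenMass (hβ : 0 < β) {μ : Measure (List Bool → Mark)} [IsFiniteMeasure μ]
    (n : ℕ) {t : ℝ} (ht : 0 ≤ t) : MemLp (frozenMass β n t) 2 μ :=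
  MemLp.of_bound (measurable_frozenMass_right n t).aestronglyMeasurable (2 ^ n)
    (.of_forall fun c => by
      rw [Real.norm_eq_abs, abs_of_nonneg (frozenMass_nonneg _ _ _)]
      exact frozenMass_le hβ n ht c)

lemma integral_frozenMass (hβ : 0 < β) (hν : ∀ u, IsMarkLaw β C (ν u)) (n : ℕ) {t : ℝ}
    (ht : 0 ≤ t) : ∫ c, frozenMass β n t c ∂treeLaw ν = 1 := by
  induction n generalizing t ν with
  | zero =>
    have := fun u => (hν u).isProbabilityMeasure hβ
    simp [frozenMass]
  | succ n ih =>
    have := fun u => (hν u).isProbabilityMeasure hβ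
    rw [show (fun c => frozenMass β (n + 1) t c) = fun c => frozenMass β (n + 1) t c from rfl]
    simp only [frozenMass]
    rw [integral_treeLaw ν (F := fun m c₀ c₁ => if t < m.1 then Real.exp (-(β * t)) else
      Real.exp (-(β * m.1)) * (frozenMass β n (t - m.1) c₀ + frozenMass β n (t - m.1) c₁))
      (C := 2 ^ (n + 1))]
    · rw [← (hν []).integral_split hβ ht]
      refine integral_congr_ae (.of_forall fun m => ?_)
      simp only
      split_ifs with h
      · simp
      · have h' : 0 ≤ t - m.1 := by linarith
        simp_rw [integral_const_mul]
        congr 1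
        have i0 : ∀ c₀, ∫ c₁, (frozenMass β n (t - m.1) c₀ + frozenMass β n (t - m.1) c₁)
            ∂treeLaw (sub true ν) = frozenMass β n (t - m.1) c₀ + 1 := fun c₀ => by
          rw [integral_add (integrable_const _) (integrable_frozenMass hβ n h'),
            ih (ν := sub true ν) (fun u => hν _) h']
          simp
        simp_rw [i0]
        rw [integral_add (integrable_frozenMass hβ n h') (integrable_const _),
          ih (ν := sub false ν) (fun u => hν _) h']
        simp
    · refine Measurable.ite (measurableSet_lt (by fun_prop) (by fun_prop)) (by fun_prop) ?_
      refine Measurable.mul (by fun_prop) (Measurable.add ?_ ?_)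
      · exact (measurable_frozenMass n).comp
          (f := fun p : Mark × (List Bool → Mark) × (List Bool → Mark) => (t - p.1.1, p.2.1))
          (by fun_prop)
      · exact (measurable_frozenMass n).comp
          (f := fun p : Mark × (List Bool → Mark) × (List Bool → Mark) => (t - p.1.1, p.2.2))
          (by fun_prop)
    · intro m c₀ c₁
      have := frozenMass_le hβ (n + 1) ht (glue m c₀ c₁)
      have h0 := frozenMass_nonneg (β := β) (n + 1) t (glue m c₀ c₁)
      simp only [frozenMass, glue_nil, sub_false_glue, sub_true_glue] at this h0
      rw [abs_le]
      constructor <;> linarith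

/-- The constant 5 is the fixed point of x = 1 + (2x + 2)/3: the 1 bounds the case where the root is
still alive, 1/3 = E[e^(-2βτ)], and 2x + 2 is the second moment of the sum of two independent masses
of mean 1. -/
lemma integral_frozenMass_sq_le (hβ : 0 < β) (hν : ∀ u, IsMarkLaw β C (ν u)) (n : ℕ) {t : ℝ}
    (ht : 0 ≤ t) : ∫ c, frozenMass β n t c ^ 2 ∂treeLaw ν ≤ 5 := by
  induction n generalizing t ν with
  | zero =>
    have := fun u => (hν u).isProbabilityMeasure hβ
    simp [frozenMass]
  | succ n ih =>
    have := fun u => (hν u).isProbabilityMeasure hβ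
    simp only [frozenMass]
    rw [integral_treeLaw ν (F := fun m c₀ c₁ => (if t < m.1 then Real.exp (-(β * t)) else
      Real.exp (-(β * m.1)) * (frozenMass β n (t - m.1) c₀ + frozenMass β n (t - m.1) c₁)) ^ 2)
      (C := (2 ^ (n + 1)) ^ 2)]
    · have hi : Integrable (fun m : Mark => 1 + 12 * Real.exp (-(2 * β) * m.1)) (ν []) := by
        exact (integrable_const _).add ((integrable_exp_fst (by linarith)).const_mul _)
      have hval : ∫ m : Mark, (1 + 12 * Real.exp (-(2 * β) * m.1)) ∂ν [] = 5 := by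
        rw [integral_add (integrable_const _)
            ((integrable_exp_fst (by linarith)).const_mul _), integral_const_mul,
          (hν []).integral_exp_fst hβ (by linarith)]
        simp only [integral_const, probReal_univ, smul_eq_mul]; field_simp; norm_num
      rw [← hval]
      refine integral_mono_of_nonneg (.of_forall fun m => ?_) hi (.of_forall fun m => ?_)
      · exact integral_nonneg fun c₀ => integral_nonneg fun c₁ => sq_nonneg _
      · simp only
        split_ifs with h
        · simp only [integral_const, probReal_univ, smul_eq_mul, one_mul]
          have := exp_neg_mul_le_one hβ ht
          have h3 : 0 ≤ Real.exp (-(β * t)) := by positivity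
          have h4 : 0 ≤ Real.exp (-(2 * β) * m.1) := by positivity
          nlinarith
        · have h' : 0 ≤ t - m.1 := by linarith
          simp_rw [mul_pow, integral_const_mul]
          rw [integral_integral_add_sq (memLp_frozenMass hβ n h') (memLp_frozenMass hβ n h'),
            integral_frozenMass (ν := sub false ν) hβ (fun u => hν _) n h',
            integral_frozenMass (ν := sub true ν) hβ (fun u => hν _) n h']
          have h0 := ih (ν := sub false ν) (fun u => hν _) h'
          have h1 := ih (ν := sub true ν) (fun u => hν _) h'
          have e : Real.exp (-(β * m.1)) ^ 2 = Real.exp (-(2 * β) * m.1) := by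
            rw [← Real.exp_nat_mul]; push_cast; ring_nf
          rw [e]
          have h4 : 0 ≤ Real.exp (-(2 * β) * m.1) := by positivity
          nlinarith
    · refine Measurable.pow_const (Measurable.ite (measurableSet_lt (by fun_prop) (by fun_prop))
        (by fun_prop) ?_) _
      refine Measurable.mul (by fun_prop) (Measurable.add ?_ ?_)
      · exact (measurable_frozenMass n).comp
          (f := fun p : Mark × (List Bool → Mark) × (List Bool → Mark) => (t - p.1.1, p.2.1))
          (by fun_prop)
      · exact (measurable_frozenMass n).comp
          (f := fun p : Mark × (List Bool → Mark) × (List Bool → Mark) => (t - p.1.1, p.2.2))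
          (by fun_prop)
    · intro m c₀ c₁
      have := frozenMass_le hβ (n + 1) ht (glue m c₀ c₁)
      have h0 := frozenMass_nonneg (β := β) (n + 1) t (glue m c₀ c₁)
      simp only [frozenMass, glue_nil, sub_false_glue, sub_true_glue] at this h0
      rw [abs_of_nonneg (sq_nonneg _)]
      exact pow_le_pow_left₀ h0 this 2

/-- The constant solves x = 26 + 2x · 2/5, where 2/5 = E[e^(-3βτ/2)]; the exponent 3/2 is what
remains of e^(-2βτ) after the time shift in e^(-β(t-τ)/2). The 26 covers a root that is still alive
at time t. -/
lemma integral_frozenMass_sub_sq_le (hβ : 0 < β) (hν : ∀ u, IsMarkLaw β C (ν u)) (n : ℕ)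
    {t t' : ℝ} (ht : 0 ≤ t) (htt : t ≤ t') :
    ∫ c, (frozenMass β n t c - frozenMass β n t' c) ^ 2 ∂treeLaw ν ≤
      130 * Real.exp (-(β * t / 2)) := by
  induction n generalizing t t' ν with
  | zero =>
    have := fun u => (hν u).isProbabilityMeasure hβ
    simp only [frozenMass, sub_self, ne_eq, OfNat.ofNat_ne_zero, not_false_eq_true, zero_pow,
      integral_zero]
    positivity
  | succ n ih =>
    have := fun u => (hν u).isProbabilityMeasure hβ
    have ht' : 0 ≤ t' := ht.trans htt
    simp only [frozenMass]
    set F : ℝ → Mark → (List Bool → Mark) → (List Bool → Mark) → ℝ := fun t m c₀ c₁ =>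
      if t < m.1 then Real.exp (-(β * t)) else
      Real.exp (-(β * m.1)) * (frozenMass β n (t - m.1) c₀ + frozenMass β n (t - m.1) c₁) with hF
    have Fm : ∀ t, Measurable fun p : Mark × (List Bool → Mark) × (List Bool → Mark) =>
        F t p.1 p.2.1 p.2.2 := fun t => by
      refine (Measurable.ite (measurableSet_lt (by fun_prop) (by fun_prop)) (by fun_prop) ?_)
      refine Measurable.mul (by fun_prop) (Measurable.add ?_ ?_)
      · exact (measurable_frozenMass n).comp
          (f := fun p : Mark × (List Bool → Mark) × (List Bool → Mark) => (t - p.1.1, p.2.1))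
          (by fun_prop)
      · exact (measurable_frozenMass n).comp
          (f := fun p : Mark × (List Bool → Mark) × (List Bool → Mark) => (t - p.1.1, p.2.2))
          (by fun_prop)
    have Fb : ∀ t, 0 ≤ t → ∀ m c₀ c₁, 0 ≤ F t m c₀ c₁ ∧ F t m c₀ c₁ ≤ 2 ^ (n + 1) := by
      intro t ht m c₀ c₁
      have := frozenMass_le hβ (n + 1) ht (glue m c₀ c₁)
      have h0 := frozenMass_nonneg (β := β) (n + 1) t (glue m c₀ c₁)
      simp only [frozenMass, glue_nil, sub_false_glue, sub_true_glue] at this h0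
      exact ⟨h0, this⟩
    rw [integral_treeLaw ν (F := fun m c₀ c₁ => (F t m c₀ c₁ - F t' m c₀ c₁) ^ 2)
      (C := (2 ^ (n + 1)) ^ 2) (((Fm t).sub (Fm t')).pow_const 2)]
    · set E := Real.exp (-(β * t / 2))
      have hE : 0 < E := by positivity
      have hi : Integrable (fun m : Mark => 26 * E + 260 * E * Real.exp (-(3 / 2 * β) * m.1))
          (ν []) := by
        exact (integrable_const _).add ((integrable_exp_fst (by linarith)).const_mul _)
      have hval : ∫ m : Mark, (26 * E + 260 * E * Real.exp (-(3 / 2 * β) * m.1)) ∂ν [] =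
          130 * E := by
        rw [integral_add (integrable_const _)
            ((integrable_exp_fst (by linarith)).const_mul _), integral_const_mul (260 * E),
          (hν []).integral_exp_fst hβ (by linarith)]
        simp only [integral_const, probReal_univ, smul_eq_mul]
        have : β + 3 / 2 * β = 5 / 2 * β := by ring
        rw [this]; field_simp; norm_num
      rw [← hval]
      have hEE : Real.exp (-(2 * β) * t) ≤ E := by
        apply Real.exp_le_exp.2
        have := mul_nonneg hβ.le ht
        linarith
      refine integral_mono_of_nonneg (.of_forall fun m => ?_) hi (.of_forall fun m => ?_)
      · exact integral_nonneg fun c₀ => integral_nonneg fun c₁ => sq_nonneg _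
      · have hsq : ∀ t : ℝ, Real.exp (-(β * t)) ^ 2 = Real.exp (-(2 * β) * t) := fun t => by
          rw [← Real.exp_nat_mul]; push_cast; ring_nf
        have h4 : 0 ≤ 260 * E * Real.exp (-(3 / 2 * β) * m.1) := by positivity
        simp only [hF]
        rcases lt_or_ge t m.1 with h | h
        · simp only [h, if_true]
          rcases lt_or_ge t' m.1 with h' | h'
          · simp only [h', if_true, integral_const, probReal_univ, smul_eq_mul, one_mul]
            have h1 : Real.exp (-(β * t')) ≤ Real.exp (-(β * t)) :=
              Real.exp_le_exp.2 (by have := mul_le_mul_of_nonneg_left htt hβ.le; linarith)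
            have h2 : 0 < Real.exp (-(β * t')) := by positivity
            have := hsq t
            nlinarith
          -- The root dies between the two times. No cancellation is needed: its lifetime exceeds t,
          -- so both masses carry a factor at most e^(-βt).
          · simp only [not_lt.2 h', if_false]
            have h'' : 0 ≤ t' - m.1 := by linarith
            have e1 := hsq m.1
            have e2 : Real.exp (-(2 * β) * m.1) ≤ Real.exp (-(2 * β) * t) :=
              Real.exp_le_exp.2 (by have := mul_le_mul_of_nonneg_left h.le hβ.le; linarith)
            have hf := memLp_frozenMass (μ := treeLaw (sub false ν)) hβ n h''
            have hg := memLp_frozenMass (μ := treeLaw (sub true ν)) hβ n h''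
            have hfg := integral_integral_add_sq (hf.const_mul (-Real.exp (-(β * m.1))))
              ((memLp_const (Real.exp (-(β * t)))).sub (hg.const_mul (Real.exp (-(β * m.1)))))
            have e3 : ∀ c₀ c₁, (Real.exp (-(β * t)) - Real.exp (-(β * m.1)) *
                (frozenMass β n (t' - m.1) c₀ + frozenMass β n (t' - m.1) c₁)) ^ 2 =
                (-Real.exp (-(β * m.1)) * frozenMass β n (t' - m.1) c₀ + (Real.exp (-(β * t)) -
                Real.exp (-(β * m.1)) * frozenMass β n (t' - m.1) c₁)) ^ 2 := fun c₀ c₁ => by ring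
            have e4 : ∀ c₁, (Real.exp (-(β * t)) - Real.exp (-(β * m.1)) *
                frozenMass β n (t' - m.1) c₁) ^ 2 = Real.exp (-(β * t)) ^ 2 -
                2 * Real.exp (-(β * t)) * Real.exp (-(β * m.1)) * frozenMass β n (t' - m.1) c₁ +
                Real.exp (-(β * m.1)) ^ 2 * frozenMass β n (t' - m.1) c₁ ^ 2 := fun c₁ => by ring
            have i1 := integrable_frozenMass (μ := treeLaw (sub true ν)) hβ n h''
            have i2 : Integrable (fun c₁ => Real.exp (-(β * t)) ^ 2 - 2 * Real.exp (-(β * t)) *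
                Real.exp (-(β * m.1)) * frozenMass β n (t' - m.1) c₁) (treeLaw (sub true ν)) :=
              (integrable_const _).sub (i1.const_mul _)
            simp_rw [e3]
            refine hfg.le.trans ?_
            simp only [Pi.sub_apply]
            simp_rw [e4, mul_pow]
            rw [integral_add i2 (hg.integrable_sq.const_mul _), integral_sub (integrable_const _)
              (i1.const_mul _), integral_sub (integrable_const _) (i1.const_mul _)]
            simp_rw [integral_const_mul]
            rw [integral_frozenMass (ν := sub false ν) hβ (fun u => hν _) n h'',
              integral_frozenMass (ν := sub true ν) hβ (fun u => hν _) n h'']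
            simp only [integral_const, probReal_univ, smul_eq_mul]
            have w0 := integral_frozenMass_sq_le (ν := sub false ν) hβ (fun u => hν _) n h''
            have w1 := integral_frozenMass_sq_le (ν := sub true ν) hβ (fun u => hν _) n h''
            have hs2 := hsq t
            have p1 : 0 < Real.exp (-(β * m.1)) := by positivity
            have p2 : 0 < Real.exp (-(β * t)) := by positivity
            have p3 := mul_pos p1 p2
            have w2 := mul_le_mul_of_nonneg_left (add_le_add w0 w1) (sq_nonneg
              (Real.exp (-(β * m.1))))
            rw [neg_sq]
            nlinarith
        · simp only [not_lt.2 h, not_lt.2 (h.trans htt), if_false]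
          have h' : 0 ≤ t - m.1 := by linarith
          have h'' : 0 ≤ t' - m.1 := by linarith
          have e3 : ∀ c₀ c₁, (Real.exp (-(β * m.1)) *
              (frozenMass β n (t - m.1) c₀ + frozenMass β n (t - m.1) c₁) - Real.exp (-(β * m.1)) *
              (frozenMass β n (t' - m.1) c₀ + frozenMass β n (t' - m.1) c₁)) ^ 2 =
              Real.exp (-(2 * β) * m.1) *
              ((frozenMass β n (t - m.1) c₀ - frozenMass β n (t' - m.1) c₀) +
              (frozenMass β n (t - m.1) c₁ - frozenMass β n (t' - m.1) c₁)) ^ 2 := fun c₀ c₁ => by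
            rw [← hsq]; ring
          simp_rw [e3, integral_const_mul]
          have hL : ∀ μ : Measure (List Bool → Mark), [IsFiniteMeasure μ] → MemLp (fun c =>
              frozenMass β n (t - m.1) c - frozenMass β n (t' - m.1) c) 2 μ := fun μ _ =>
            (memLp_frozenMass hβ n h').sub (memLp_frozenMass hβ n h'')
          -- The mixed term vanishes, because each subtree has mean mass 1 at both times.
          rw [integral_integral_add_sq (hL _) (hL _)]
          rw [integral_sub (integrable_frozenMass hβ n h') (integrable_frozenMass hβ n h''),
            integral_frozenMass (ν := sub false ν) hβ (fun u => hν _) n h',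
            integral_frozenMass (ν := sub false ν) hβ (fun u => hν _) n h'']
          have h0 := ih (ν := sub false ν) (fun u => hν _) h' (t' := t' - m.1) (by linarith)
          have h1 := ih (ν := sub true ν) (fun u => hν _) h' (t' := t' - m.1) (by linarith)
          have e5 : Real.exp (-(2 * β) * m.1) * Real.exp (-(β * (t - m.1) / 2)) =
              E * Real.exp (-(3 / 2 * β) * m.1) := by
            rw [← Real.exp_add, ← Real.exp_add]; ring_nf
          have h6 : 0 ≤ Real.exp (-(2 * β) * m.1) := by positivity
          have h7 := mul_le_mul_of_nonneg_left (add_le_add h0 h1) h6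
          simp only [sub_self, mul_zero, zero_mul, add_zero]
          nlinarith
    · intro m c₀ c₁
      obtain ⟨h1, h2⟩ := Fb t ht m c₀ c₁
      obtain ⟨h3, h4⟩ := Fb t' ht' m c₀ c₁
      rw [abs_of_nonneg (sq_nonneg _)]
      exact sq_le_sq' (by linarith) (by linarith)

end Moments

variable {β : ℝ} {C : ℝ≥0}

/-! ### Almost sure behaviour of the population size -/

section Counts

variable {n : ℕ} {t t' : ℝ} {c : List Bool → Mark}

lemma bornCard_succ_eq_zero (h : bornCard n t c = 0) : bornCard (n + 1) t c = 0 := by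
  induction n generalizing t c with
  | zero => simp [bornCard] at h
  | succ n ih =>
    rw [bornCard] at h ⊢
    split_ifs at h ⊢ with h1
    · rfl
    · simp only [Nat.add_eq_zero_iff] at h
      rw [ih h.1, ih h.2]

lemma bornCard_eq_zero_of_le {m : ℕ} (hnm : n ≤ m) (h : bornCard n t c = 0) :
    bornCard m t c = 0 := by
  induction m, hnm using Nat.le_induction with
  | base => exact h
  | succ m _ ih => exact bornCard_succ_eq_zero ih

lemma bornCard_mono (n : ℕ) (htt : t ≤ t') (c : List Bool → Mark) :
    bornCard n t c ≤ bornCard n t' c := by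
  induction n generalizing t t' c with
  | zero => rfl
  | succ n ih =>
    rw [bornCard, bornCard]
    split_ifs with h1 h2 h2
    · rfl
    · exact Nat.zero_le _
    · linarith
    · exact add_le_add (ih (by linarith) _) (ih (by linarith) _)

lemma one_le_frozenCard (n : ℕ) (t : ℝ) (c : List Bool → Mark) : 1 ≤ frozenCard n t c := by
  induction n generalizing t c with
  | zero => rfl
  | succ n ih =>
    rw [frozenCard]
    split_ifs
    · rfl
    · exact (ih _ _).trans (Nat.le_add_right _ _)

lemma frozenCard_mono (n : ℕ) (htt : t ≤ t') (c : List Bool → Mark) :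
    frozenCard n t c ≤ frozenCard n t' c := by
  induction n generalizing t t' c with
  | zero => rfl
  | succ n ih =>
    rw [frozenCard, frozenCard]
    split_ifs with h1 h2 h2
    · rfl
    · exact (one_le_frozenCard _ _ _).trans (Nat.le_add_right _ _)
    · linarith
    · exact add_le_add (ih (by linarith) _) (ih (by linarith) _)

lemma frozenCard_le_succ (n : ℕ) (t : ℝ) (c : List Bool → Mark) :
    frozenCard n t c ≤ frozenCard (n + 1) t c := by
  induction n generalizing t c with
  | zero => exact one_le_frozenCard _ _ _
  | succ n ih =>
    rw [frozenCard, frozenCard]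
    split_ifs with h1
    · rfl
    · exact add_le_add (ih _ _) (ih _ _)

lemma frozenCard_succ (h : bornCard n t c = 0) : frozenCard (n + 1) t c = frozenCard n t c := by
  induction n generalizing t c with
  | zero => simp [bornCard] at h
  | succ n ih =>
    rw [bornCard] at h
    rw [frozenCard.eq_2 t c n, frozenCard.eq_2 t c (n + 1)]
    split_ifs at h ⊢ with h1
    · rfl
    · simp only [Nat.add_eq_zero_iff] at h
      rw [ih h.1, ih h.2]

lemma frozenCard_eq_of_le {m : ℕ} (hnm : n ≤ m) (h : bornCard n t c = 0) :
    frozenCard m t c = frozenCard n t c := by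
  induction m, hnm using Nat.le_induction with
  | base => rfl
  | succ m hm ih => rw [frozenCard_succ (bornCard_eq_zero_of_le hm h), ih]

lemma frozenMass_eq (h : bornCard n t c = 0) :
    frozenMass β n t c = Real.exp (-(β * t)) * frozenCard n t c := by
  induction n generalizing t c with
  | zero => simp [bornCard] at h
  | succ n ih =>
    rw [bornCard] at h
    rw [frozenCard, frozenMass]
    split_ifs at h ⊢ with h1
    · simp
    · simp only [Nat.add_eq_zero_iff] at h
      rw [ih h.1, ih h.2, ← mul_add, ← mul_assoc, ← Real.exp_add]
      push_cast
      congr 2; ring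

/-- A counted particle either is alive at time t and has mass e^(-βt), or is frozen in generation n
and has mass at most 1. As n grows the second kind disappears, which bounds the mean population from
below. -/
lemma frozenMass_le_add_bornCard (hβ : 0 < β) (n : ℕ) {t : ℝ} (ht : 0 ≤ t)
    (c : List Bool → Mark) :
    frozenMass β n t c ≤ Real.exp (-(β * t)) * frozenCard n t c + bornCard n t c := by
  induction n generalizing t c with
  | zero => simp [frozenMass, bornCard]; positivity
  | succ n ih =>
    rw [frozenMass, frozenCard, bornCard]
    split_ifs with h1
    · simp
    · have h' : 0 ≤ t - (c []).1 := by linarith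
      have e : Real.exp (-(β * t)) =
          Real.exp (-(β * (c []).1)) * Real.exp (-(β * (t - (c []).1))) := by
        rw [← Real.exp_add]; ring_nf
      have h2 := exp_neg_mul_le_one hβ (t := (c []).1) (by positivity)
      have h3 := mul_le_mul_of_nonneg_left (add_le_add (ih h' (sub false c)) (ih h' (sub true c)))
        (Real.exp_nonneg (-(β * (c []).1)))
      rw [e]
      push_cast
      have h4 : (0 : ℝ) ≤ (bornCard n (t - (c []).1) (sub false c)) +
        (bornCard n (t - (c []).1) (sub true c)) := by positivity
      nlinarith

end Counts

/-- The number of particles alive at time `t`. -/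
def population (t : ℝ) (c : List Bool → Mark) : ℝ≥0∞ := ⨆ n, (frozenCard n t c : ℝ≥0∞)

/-- At every time, only finitely many generations have been born. -/
def NonExplosive (c : List Bool → Mark) : Prop := ∀ t : ℝ, ∃ n, bornCard n t c = 0

lemma NonExplosive.sub {c : List Bool → Mark} (h : NonExplosive c) (b : Bool) :
    NonExplosive (sub b c) := by
  intro t
  -- The maximum with 0 makes the time at least the lifetime of the root, so that the recursion for
  -- `bornCard` is in its branching case.
  obtain ⟨n, hn⟩ := h (max t 0 + (c []).1)
  rcases n with _ | n
  · simp [bornCard] at hn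
  · have h0 := le_max_right t 0
    refine ⟨n, ?_⟩
    rw [bornCard, if_neg (by linarith)] at hn
    simp only [add_sub_cancel_right, Nat.add_eq_zero_iff] at hn
    have := bornCard_mono n (le_max_left t 0) (HypBBM.sub b c)
    cases b <;> omega

lemma population_eq {n : ℕ} {t : ℝ} {c : List Bool → Mark} (h : bornCard n t c = 0) :
    population t c = frozenCard n t c := by
  refine le_antisymm (iSup_le fun m => ?_) (le_iSup (fun n => (frozenCard n t c : ℝ≥0∞)) n)
  rcases le_total n m with hm | hm
  · rw [frozenCard_eq_of_le hm h]
  · exact_mod_cast monotone_nat_of_le_succ (fun n => frozenCard_le_succ n t c) hm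

lemma population_mono (c : List Bool → Mark) : Monotone fun t => population t c :=
  fun _ _ h => iSup_mono fun n => by exact_mod_cast frozenCard_mono n h c

lemma one_le_population (t : ℝ) (c : List Bool → Mark) : 1 ≤ population t c :=
  le_iSup_of_le 0 (by simp [frozenCard])

lemma population_eq_ite (t : ℝ) (c : List Bool → Mark) :
    population t c = if t < (c []).1 then 1 else
      population (t - (c []).1) (sub false c) + population (t - (c []).1) (sub true c) := by
  have : population t c = ⨆ n, (frozenCard (n + 1) t c : ℝ≥0∞) := by
    refine le_antisymm (iSup_mono fun n => ?_) (iSup_le fun n => ?_)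
    · exact_mod_cast frozenCard_le_succ n t c
    · exact le_iSup (fun n => (frozenCard n t c : ℝ≥0∞)) (n + 1)
  rw [this]
  simp only [frozenCard]
  split_ifs with h
  · simp
  · simp only [Nat.cast_add]
    rw [population, population, ENNReal.iSup_add_iSup_of_monotone]
    · exact fun m n hmn => by
        simpa using monotone_nat_of_le_succ (fun n => frozenCard_le_succ n _ _) hmn
    · exact fun m n hmn => by
        simpa using monotone_nat_of_le_succ (fun n => frozenCard_le_succ n _ _) hmn

@[fun_prop] lemma measurable_population : Measurable fun p : ℝ × (List Bool → Mark) =>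
    population p.1 p.2 :=
  Measurable.iSup fun n => (measurable_of_countable _).comp (measurable_frozenCard n)

lemma measurable_population_right (t : ℝ) : Measurable (population t) :=
  measurable_population.comp (f := fun c => (t, c)) (by fun_prop)

section Moments

variable {ν : List Bool → Measure Mark}

/-- The factor e^(3βt) is chosen so that each generation contributes 2 E[e^(-3βτ)] = 2 · 1/4 = 1/2.
Summability in n then excludes explosion. -/
lemma lintegral_bornCard_le (hβ : 0 < β) (hν : ∀ u, IsMarkLaw β C (ν u)) (n : ℕ) (t : ℝ) :
    ∫⁻ c, bornCard n t c ∂treeLaw ν ≤ .ofReal (Real.exp (3 * β * max t 0)) * 2⁻¹ ^ n := by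
  induction n generalizing t ν with
  | zero =>
    have := fun u => (hν u).isProbabilityMeasure hβ
    simp only [bornCard, Nat.cast_one, lintegral_const, measure_univ, mul_one, pow_zero]
    rw [← ENNReal.ofReal_one]
    exact ENNReal.ofReal_le_ofReal (Real.one_le_exp (by positivity))
  | succ n ih =>
    have := fun u => (hν u).isProbabilityMeasure hβ
    have hm : Measurable fun p : Mark × (List Bool → Mark) =>
        (bornCard n (t - p.1.1) p.2 : ℝ≥0∞) :=
      (measurable_of_countable (fun k : ℕ => (k : ℝ≥0∞))).comp ((measurable_bornCard n).comp
        (f := fun p : Mark × (List Bool → Mark) => (t - p.1.1, p.2)) (by fun_prop))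
    have h : ∀ c, ((bornCard (n + 1) t c : ℕ) : ℝ≥0∞) = if t < (c []).1 then 0 else
        ((bornCard n (t - (c []).1) (sub false c) : ℝ≥0∞) +
          bornCard n (t - (c []).1) (sub true c)) := fun c => by
      rw [bornCard]; split_ifs <;> simp
    simp_rw [h]
    rw [lintegral_treeLaw ν (F := fun m c₀ c₁ => if t < m.1 then 0 else
        ((bornCard n (t - m.1) c₀ : ℝ≥0∞) + bornCard n (t - m.1) c₁))]
    · calc _ ≤ ∫⁻ m : Mark, ENNReal.ofReal (Real.exp (3 * β * max t 0)) * 2⁻¹ ^ n * 2 *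
            .ofReal (Real.exp (-(3 * β) * m.1 + 0 * m.2.2.1)) ∂ν [] := by
            refine lintegral_mono fun m => ?_
            simp only
            split_ifs with h
            · simp
            · have h' : 0 ≤ t - m.1 := by linarith
              simp_rw [lintegral_add_left measurable_const]
              rw [lintegral_add_right _ measurable_const]
              simp only [lintegral_const, measure_univ, mul_one]
              refine (add_le_add (ih (ν := sub false ν) (fun u => hν _) _)
                (ih (ν := sub true ν) (fun u => hν _) _)).trans (le_of_eq ?_)
              rw [← two_mul, max_eq_left h', max_eq_left (h'.trans (by simp)),
                show 3 * β * (t - m.1) = 3 * β * t + (-(3 * β) * m.1 + 0 * m.2.2.1) by ring,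
                Real.exp_add, ENNReal.ofReal_mul (by positivity)]
              ring
        _ = _ := by
            rw [lintegral_const_mul' _ _ (by finiteness), (hν []).lintegral_exp hβ (by linarith),
              pow_succ]
            have : β / (β + 3 * β - 0 * (0 - 1) / 2) = 2⁻¹ * 2⁻¹ := by field_simp; ring
            rw [this, ENNReal.ofReal_mul (by norm_num), ENNReal.ofReal_inv_of_pos (by norm_num),
              ENNReal.ofReal_ofNat]
            have h2 : (2 : ℝ≥0∞) * 2⁻¹ = 1 := ENNReal.mul_inv_cancel (by simp) (by simp)
            calc _ = ENNReal.ofReal (Real.exp (3 * β * max t 0)) * 2⁻¹ ^ n * (2 * 2⁻¹) * 2⁻¹ := by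
                  ring
              _ = _ := by rw [h2]; ring
    · refine Measurable.ite (measurableSet_lt (by fun_prop) (by fun_prop)) (by fun_prop) ?_
      exact (hm.comp (f := fun p : Mark × (List Bool → Mark) × (List Bool → Mark) =>
        (p.1, p.2.1)) (by fun_prop)).add (hm.comp
        (f := fun p : Mark × (List Bool → Mark) × (List Bool → Mark) => (p.1, p.2.2)) (by fun_prop))

lemma ae_nonExplosive (hβ : 0 < β) (hν : ∀ u, IsMarkLaw β C (ν u)) :
    ∀ᵐ c ∂treeLaw ν, NonExplosive c := by
  have h : ∀ k : ℕ, ∀ᵐ c ∂treeLaw ν, ∃ n, bornCard n k c = 0 := by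
    intro k
    have hm : ∀ n, Measurable fun c => (bornCard n k c : ℝ≥0∞) := fun n =>
      (measurable_of_countable fun i : ℕ => (i : ℝ≥0∞)).comp (measurable_bornCard_right n k)
    have hsum : ∫⁻ c, ∑' n, (bornCard n k c : ℝ≥0∞) ∂treeLaw ν ≠ ∞ := by
      rw [lintegral_tsum fun n => (hm n).aemeasurable]
      refine ne_top_of_le_ne_top ?_ (ENNReal.tsum_le_tsum fun n =>
        lintegral_bornCard_le hβ hν n k)
      rw [ENNReal.tsum_mul_left, ENNReal.tsum_geometric]
      refine ENNReal.mul_ne_top ENNReal.ofReal_ne_top ?_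
      simp
    filter_upwards [ae_lt_top (Measurable.tsum hm) hsum] with c hc
    have := ENNReal.tendsto_atTop_zero_of_tsum_ne_top hc.ne
    obtain ⟨n, hn⟩ := (this.eventually (gt_mem_nhds one_pos)).exists
    exact ⟨n, Nat.lt_one_iff.1 (by exact_mod_cast hn)⟩
  filter_upwards [ae_all_iff.2 h] with c hc t
  obtain ⟨k, hk⟩ := exists_nat_ge t
  obtain ⟨n, hn⟩ := hc k
  exact ⟨n, Nat.le_zero.1 (hn ▸ bornCard_mono n hk c)⟩

/-- The size of the population at time `t`, normalised by its growth rate. -/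
def scaledPop (β t : ℝ) (c : List Bool → Mark) : ℝ := Real.exp (-(β * t)) * (population t c).toReal

lemma measurable_scaledPop (t : ℝ) : Measurable (scaledPop β t) := by
  have := measurable_population_right t
  unfold scaledPop; fun_prop

lemma scaledPop_nonneg (t : ℝ) (c : List Bool → Mark) : 0 ≤ scaledPop β t c := by
  unfold scaledPop; positivity

lemma NonExplosive.eventually_frozenMass_eq {c : List Bool → Mark} (hc : NonExplosive c) (t : ℝ) :
    ∀ᶠ n in atTop, frozenMass β n t c = scaledPop β t c := by
  obtain ⟨n, hn⟩ := hc t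
  filter_upwards [eventually_ge_atTop n] with m hm
  have := bornCard_eq_zero_of_le hm hn
  rw [frozenMass_eq this, scaledPop, population_eq this]
  simp

lemma lintegral_scaledPop_sq_le (hβ : 0 < β) (hν : ∀ u, IsMarkLaw β C (ν u)) {t : ℝ} (ht : 0 ≤ t) :
    ∫⁻ c, .ofReal (scaledPop β t c ^ 2) ∂treeLaw ν ≤ 5 := by
  have := fun u => (hν u).isProbabilityMeasure hβ
  calc _ = ∫⁻ c, liminf (fun n => ENNReal.ofReal (frozenMass β n t c ^ 2)) atTop ∂treeLaw ν := by
        refine lintegral_congr_ae ?_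
        filter_upwards [ae_nonExplosive hβ hν] with c hc
        refine (Tendsto.liminf_eq (tendsto_const_nhds.congr' ?_)).symm
        filter_upwards [hc.eventually_frozenMass_eq (β := β) t] with n hn
        rw [hn]
    _ ≤ _ := lintegral_liminf_le fun n => by
        have := measurable_frozenMass_right (β := β) n t
        fun_prop
    _ ≤ 5 := by
        refine Filter.liminf_le_of_le (by isBoundedDefault) fun b hb => ?_
        obtain ⟨n, hn⟩ := hb.exists
        refine hn.trans ?_
        rw [← ofReal_integral_eq_lintegral_ofReal (memLp_frozenMass hβ n ht).integrable_sq
          (.of_forall fun c => sq_nonneg _), ← ENNReal.ofReal_ofNat]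
        exact ENNReal.ofReal_le_ofReal (integral_frozenMass_sq_le hβ hν n ht)

lemma lintegral_scaledPop_sub_sq_le (hβ : 0 < β) (hν : ∀ u, IsMarkLaw β C (ν u)) {t t' : ℝ}
    (ht : 0 ≤ t) (htt : t ≤ t') :
    ∫⁻ c, .ofReal ((scaledPop β t c - scaledPop β t' c) ^ 2) ∂treeLaw ν ≤
      .ofReal (130 * Real.exp (-(β * t / 2))) := by
  have := fun u => (hν u).isProbabilityMeasure hβ
  calc _ = ∫⁻ c, liminf (fun n => ENNReal.ofReal ((frozenMass β n t c - frozenMass β n t' c) ^ 2))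
        atTop ∂treeLaw ν := by
        refine lintegral_congr_ae ?_
        filter_upwards [ae_nonExplosive hβ hν] with c hc
        refine (Tendsto.liminf_eq (tendsto_const_nhds.congr' ?_)).symm
        filter_upwards [hc.eventually_frozenMass_eq (β := β) t,
          hc.eventually_frozenMass_eq (β := β) t'] with n hn hn'
        rw [hn, hn']
    _ ≤ _ := lintegral_liminf_le fun n => by
        have := measurable_frozenMass_right (β := β) n t
        have := measurable_frozenMass_right (β := β) n t'
        fun_prop
    _ ≤ _ := by
        refine Filter.liminf_le_of_le (by isBoundedDefault) fun b hb => ?_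
        obtain ⟨n, hn⟩ := hb.exists
        refine hn.trans ?_
        have hL : MemLp (fun c => frozenMass β n t c - frozenMass β n t' c) 2 (treeLaw ν) :=
          (memLp_frozenMass hβ n ht).sub (memLp_frozenMass hβ n (ht.trans htt))
        rw [← ofReal_integral_eq_lintegral_ofReal hL.integrable_sq
          (.of_forall fun c => sq_nonneg _)]
        exact ENNReal.ofReal_le_ofReal (integral_frozenMass_sub_sq_le hβ hν n ht htt)

/-- Fatou's lemma only gives upper bounds, so the lower bound on the mean comes from the mean 1 of
`frozenMass`, up to the expected number of particles born in generation n, which tends to 0. -/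
lemma one_le_lintegral_scaledPop (hβ : 0 < β) (hν : ∀ u, IsMarkLaw β C (ν u)) {t : ℝ}
    (ht : 0 ≤ t) : 1 ≤ ∫⁻ c, .ofReal (scaledPop β t c) ∂treeLaw ν := by
  have := fun u => (hν u).isProbabilityMeasure hβ
  have h : ∀ n, 1 ≤ ∫⁻ c, .ofReal (scaledPop β t c) ∂treeLaw ν +
      .ofReal (Real.exp (3 * β * max t 0)) * 2⁻¹ ^ n := by
    intro n
    calc (1 : ℝ≥0∞) = ∫⁻ c, .ofReal (frozenMass β n t c) ∂treeLaw ν := by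
          rw [← ofReal_integral_eq_lintegral_ofReal (integrable_frozenMass hβ n ht)
            (.of_forall fun c => frozenMass_nonneg _ _ _), integral_frozenMass hβ hν n ht,
            ENNReal.ofReal_one]
      _ ≤ ∫⁻ c, (.ofReal (scaledPop β t c) + bornCard n t c) ∂treeLaw ν := by
          refine lintegral_mono_ae ?_
          filter_upwards [ae_nonExplosive hβ hν] with c hc
          obtain ⟨k, hk⟩ := hc t
          refine (ENNReal.ofReal_le_ofReal (frozenMass_le_add_bornCard hβ n ht c)).trans ?_
          rw [ENNReal.ofReal_add (by positivity) (by positivity), ENNReal.ofReal_natCast]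
          gcongr
          rw [scaledPop]
          gcongr
          refine ENNReal.toReal_mono (a := (frozenCard n t c : ℝ≥0∞)) ?_
            (le_iSup (fun n => (frozenCard n t c : ℝ≥0∞)) n)
          rw [population_eq hk]; simp
      _ ≤ _ := by
          rw [lintegral_add_left (measurable_scaledPop t).ennreal_ofReal]
          gcongr
          exact lintegral_bornCard_le hβ hν n t
  have hlim : Tendsto (fun n : ℕ => ∫⁻ c, .ofReal (scaledPop β t c) ∂treeLaw ν +
      .ofReal (Real.exp (3 * β * max t 0)) * 2⁻¹ ^ n) atTop
      (𝓝 (∫⁻ c, .ofReal (scaledPop β t c) ∂treeLaw ν +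
        .ofReal (Real.exp (3 * β * max t 0)) * 0)) := by
    refine tendsto_const_nhds.add (ENNReal.Tendsto.const_mul ?_ (.inr ENNReal.ofReal_ne_top))
    exact ENNReal.tendsto_pow_atTop_nhds_zero_of_lt_one (by simp)
  simpa using ge_of_tendsto' hlim h

lemma lintegral_scaledPop_sub_le (hβ : 0 < β) (hν : ∀ u, IsMarkLaw β C (ν u)) {t t' : ℝ}
    (ht : 0 ≤ t) (htt : t ≤ t') :
    ∫⁻ c, .ofReal |scaledPop β t c - scaledPop β t' c| ∂treeLaw ν ≤
      .ofReal (12 * Real.exp (-(β / 4) * t)) := by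
  have := fun u => (hν u).isProbabilityMeasure hβ
  have hm := measurable_scaledPop (β := β) t
  have hm' := measurable_scaledPop (β := β) t'
  have e : ∀ c, ENNReal.ofReal |scaledPop β t c - scaledPop β t' c| =
      (ENNReal.ofReal ((scaledPop β t c - scaledPop β t' c) ^ 2)) ^ (1 / 2 : ℝ) := fun c => by
    rw [ENNReal.ofReal_rpow_of_nonneg (by positivity) (by norm_num), ← Real.sqrt_eq_rpow,
      Real.sqrt_sq_eq_abs]
  simp_rw [e]
  calc _ ≤ _ := lintegral_rpow_le_rpow_lintegral _ (by fun_prop) (by norm_num) (by norm_num)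
    _ ≤ (ENNReal.ofReal (130 * Real.exp (-(β * t / 2)))) ^ (1 / 2 : ℝ) := by
      gcongr; exact lintegral_scaledPop_sub_sq_le hβ hν ht htt
    _ ≤ _ := by
      rw [ENNReal.ofReal_rpow_of_nonneg (by positivity) (by norm_num), ← Real.sqrt_eq_rpow]
      refine ENNReal.ofReal_le_ofReal (Real.sqrt_le_iff.2 ⟨by positivity, ?_⟩)
      rw [mul_pow, ← Real.exp_nat_mul, show ((2 : ℕ) : ℝ) * (-(β / 4) * t) = -(β * t / 2) by
        push_cast; ring]
      -- The constant 12 comes from 130 ≤ 12² = 144.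
      have : 0 < Real.exp (-(β * t / 2)) := by positivity
      linarith

/-- The limit of the normalised population size. -/
def yuleLimit (β : ℝ) (c : List Bool → Mark) : ℝ≥0∞ :=
  liminf (fun k : ℕ => ENNReal.ofReal (scaledPop β k c)) atTop

/-- An upper bound for the normalised population size at all times. -/
def supPop (β : ℝ) (c : List Bool → Mark) : ℝ≥0∞ :=
  .ofReal (Real.exp β) * ⨆ k : ℕ, ENNReal.ofReal (scaledPop β k c)

@[fun_prop] lemma measurable_yuleLimit : Measurable (yuleLimit β) :=
  .liminf fun k : ℕ => (measurable_scaledPop k).ennreal_ofReal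

@[fun_prop] lemma measurable_supPop : Measurable (supPop β) :=
  .const_mul (.iSup fun k : ℕ => (measurable_scaledPop k).ennreal_ofReal) _

lemma yuleLimit_le_supPop (hβ : 0 < β) (c : List Bool → Mark) : yuleLimit β c ≤ supPop β c := by
  have h1 : yuleLimit β c ≤ ⨆ k : ℕ, ENNReal.ofReal (scaledPop β k c) :=
    liminf_le_of_frequently_le' (Frequently.of_forall fun k =>
      le_iSup (fun k : ℕ => ENNReal.ofReal (scaledPop β k c)) k)
  refine h1.trans (le_mul_of_one_le_left zero_le ?_)
  rw [← ENNReal.ofReal_one]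
  exact ENNReal.ofReal_le_ofReal (Real.one_le_exp hβ.le)

lemma NonExplosive.population_ne_top {c : List Bool → Mark} (hc : NonExplosive c) (t : ℝ) :
    population t c ≠ ∞ := by
  obtain ⟨n, hn⟩ := hc t
  rw [population_eq hn]; simp

lemma NonExplosive.ofReal_exp_mul_population {c : List Bool → Mark} (hc : NonExplosive c) (t : ℝ) :
    .ofReal (Real.exp (-(β * t))) * population t c = ENNReal.ofReal (scaledPop β t c) := by
  rw [scaledPop, ENNReal.ofReal_mul (by positivity), ENNReal.ofReal_toReal (hc.population_ne_top t)]

/-- The population is monotone in time, so the normalised size can drop only through the factor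
e^(-βt). This substitutes for path regularity when passing from discrete to continuous time. -/
lemma NonExplosive.scaledPop_le_exp_mul {c : List Bool → Mark} (hc : NonExplosive c) {t t' : ℝ}
    (htt : t ≤ t') : scaledPop β t c ≤ Real.exp (β * (t' - t)) * scaledPop β t' c := by
  rw [scaledPop, scaledPop, ← mul_assoc, ← Real.exp_add,
    show β * (t' - t) + -(β * t') = -(β * t) by ring]
  gcongr
  · exact hc.population_ne_top t'
  · exact population_mono c htt

/-- Rounding t up to an integer costs at most the factor e^β that is built into `supPop`. -/
lemma NonExplosive.scaledPop_le_supPop (hβ : 0 < β) {c : List Bool → Mark} (hc : NonExplosive c)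
    {t : ℝ} (ht : 0 ≤ t) : ENNReal.ofReal (scaledPop β t c) ≤ supPop β c := by
  have h1 : t ≤ (⌊t⌋₊ + 1 : ℕ) := by push_cast; exact (Nat.lt_floor_add_one t).le
  refine (ENNReal.ofReal_le_ofReal (hc.scaledPop_le_exp_mul (β := β) h1)).trans ?_
  rw [ENNReal.ofReal_mul (by positivity), supPop]
  gcongr
  · have := Nat.floor_le ht
    push_cast
    nlinarith
  · exact le_iSup (fun k : ℕ => ENNReal.ofReal (scaledPop β k c)) _

lemma lintegral_scaledPop_le (hβ : 0 < β) (hν : ∀ u, IsMarkLaw β C (ν u)) {t : ℝ} (ht : 0 ≤ t) :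
    ∫⁻ c, .ofReal (scaledPop β t c) ∂treeLaw ν ≤ 6 := by
  have := fun u => (hν u).isProbabilityMeasure hβ
  calc _ ≤ ∫⁻ c, (.ofReal (scaledPop β t c ^ 2) + 1) ∂treeLaw ν := by
        refine lintegral_mono fun c => ?_
        rw [← ENNReal.ofReal_one, ← ENNReal.ofReal_add (by positivity) zero_le_one]
        exact ENNReal.ofReal_le_ofReal (by nlinarith [sq_nonneg (scaledPop β t c - 1)])
    _ ≤ 5 + 1 := by
        rw [lintegral_add_right _ measurable_const]
        simp only [lintegral_const, measure_univ, mul_one]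
        gcongr
        exact lintegral_scaledPop_sq_le hβ hν ht
    _ = 6 := by norm_num

lemma tsum_exp_ne_top (hβ : 0 < β) {δ : ℝ} (hδ : 0 < δ) :
    ∑' k : ℕ, ENNReal.ofReal (12 * Real.exp (-(β / 4) * (k * δ))) ≠ ∞ := by
  have e : ∀ k : ℕ, ENNReal.ofReal (12 * Real.exp (-(β / 4) * (k * δ))) =
      ENNReal.ofReal 12 * ENNReal.ofReal (Real.exp (-(β / 4 * δ))) ^ k := fun k => by
    rw [ENNReal.ofReal_mul (by norm_num), ← ENNReal.ofReal_pow (by positivity), ← Real.exp_nat_mul]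
    congr 3; ring
  simp_rw [e]
  rw [ENNReal.tsum_mul_left, ENNReal.tsum_geometric]
  refine ENNReal.mul_ne_top ENNReal.ofReal_ne_top (ENNReal.inv_ne_top.2 ?_)
  refine (tsub_pos_of_lt ?_).ne'
  rw [← ENNReal.ofReal_one]
  refine (ENNReal.ofReal_lt_ofReal_iff one_pos).2 (Real.exp_lt_one_iff.2 ?_)
  have : 0 < β / 4 * δ := by positivity
  linarith

lemma lintegral_tsum_scaledPop_le (hβ : 0 < β) (hν : ∀ u, IsMarkLaw β C (ν u)) {δ : ℝ}
    (hδ : 0 < δ) :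
    ∫⁻ c, ∑' k : ℕ, ENNReal.ofReal |scaledPop β (k * δ) c - scaledPop β ((k + 1 : ℕ) * δ) c|
      ∂treeLaw ν ≤ ∑' k : ℕ, ENNReal.ofReal (12 * Real.exp (-(β / 4) * (k * δ))) := by
  rw [lintegral_tsum fun k => by
    have hm := measurable_scaledPop (β := β) (k * δ)
    have hm' := measurable_scaledPop (β := β) ((k + 1 : ℕ) * δ)
    fun_prop]
  refine ENNReal.tsum_le_tsum fun k => lintegral_scaledPop_sub_le hβ hν (by positivity) ?_
  gcongr; simp

lemma exists_lintegral_supPop_le (hβ : 0 < β) (C : ℝ≥0) : ∃ K < ∞, ∀ ν : List Bool → Measure Mark,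
    (∀ u, IsMarkLaw β C (ν u)) → ∫⁻ c, supPop β c ∂treeLaw ν ≤ K := by
  refine ⟨.ofReal (Real.exp β) * (6 + ∑' k : ℕ, ENNReal.ofReal (12 * Real.exp (-(β / 4) *
    (k * 1)))), ENNReal.mul_lt_top ENNReal.ofReal_lt_top (ENNReal.add_lt_top.2
      ⟨by simp, (tsum_exp_ne_top hβ one_pos).lt_top⟩), fun ν hν => ?_⟩
  have := fun u => (hν u).isProbabilityMeasure hβ
  simp only [supPop]
  rw [lintegral_const_mul' _ _ ENNReal.ofReal_ne_top]
  gcongr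
  calc _ ≤ ∫⁻ c, (ENNReal.ofReal (scaledPop β 0 c) + ∑' k : ℕ, ENNReal.ofReal
        |scaledPop β (k * 1) c - scaledPop β ((k + 1 : ℕ) * 1) c|) ∂treeLaw ν := by
        refine lintegral_mono fun c => iSup_le fun k => ?_
        have : ENNReal.ofReal (scaledPop β k c) ≤ ENNReal.ofReal (scaledPop β 0 c) +
            ∑ i ∈ Finset.range k, ENNReal.ofReal
              |scaledPop β (i * 1) c - scaledPop β ((i + 1 : ℕ) * 1) c| := by
          induction k with
          | zero => simp
          | succ k ih =>
            rw [Finset.sum_range_succ, ← add_assoc]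
            refine le_trans ?_ (add_le_add_left ih _)
            rw [← ENNReal.ofReal_add (scaledPop_nonneg _ _) (abs_nonneg _)]
            refine ENNReal.ofReal_le_ofReal ?_
            rw [mul_one, mul_one]
            linarith [neg_abs_le (scaledPop β k c - scaledPop β (k + 1 : ℕ) c)]
        exact this.trans (by gcongr; exact ENNReal.sum_le_tsum _)
    _ ≤ _ := by
        rw [lintegral_add_left (measurable_scaledPop 0).ennreal_ofReal]
        gcongr
        · exact lintegral_scaledPop_le hβ hν le_rfl
        · exact lintegral_tsum_scaledPop_le hβ hν one_pos

/-- The population has the expected asymptotic size. -/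
structure Regular (β : ℝ) (c : List Bool → Mark) : Prop where
  nonExplosive : NonExplosive c
  supPop_ne_top : supPop β c ≠ ∞
  tendsto : Tendsto (fun t => scaledPop β t c) atTop (𝓝 (yuleLimit β c).toReal)

lemma ae_tendsto_scaledPop_mul (hβ : 0 < β) (hν : ∀ u, IsMarkLaw β C (ν u)) {δ : ℝ}
    (hδ : 0 < δ) : ∀ᵐ c ∂treeLaw ν, ∃ L : ℝ,
      Tendsto (fun k : ℕ => scaledPop β (k * δ) c) atTop (𝓝 L) := by
  have h := ne_top_of_le_ne_top (tsum_exp_ne_top hβ hδ) (lintegral_tsum_scaledPop_le hβ hν hδ)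
  filter_upwards [ae_lt_top (Measurable.tsum fun k => by
    have hm := measurable_scaledPop (β := β) (k * δ)
    have hm' := measurable_scaledPop (β := β) ((k + 1 : ℕ) * δ)
    fun_prop) h] with c hc
  exact cauchySeq_tendsto_of_complete (cauchySeq_of_edist_le_of_tsum_ne_top _
    (fun k => by rw [edist_dist, Real.dist_eq]) hc.ne)

/-- The increments along a grid of mesh δ are almost surely summable, so the normalised size
converges along all grids of mesh 1/(m+1). Between grid points it changes by a factor at most
e^(β/(m+1)) in one direction, which squeezes the limit over real times. -/
lemma ae_regular (hβ : 0 < β) (hν : ∀ u, IsMarkLaw β C (ν u)) :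
    ∀ᵐ c ∂treeLaw ν, Regular β c := by
  obtain ⟨K, hK, hsup⟩ := exists_lintegral_supPop_le hβ C
  have h1 := ae_all_iff.2 fun m : ℕ => ae_tendsto_scaledPop_mul hβ hν (δ := 1 / (m + 1 : ℕ))
    (by positivity)
  filter_upwards [h1, ae_nonExplosive hβ hν,
    ae_lt_top measurable_supPop (ne_top_of_le_ne_top hK.ne (hsup ν hν))] with c hc hne hfin
  refine ⟨hne, hfin.ne, ?_⟩
  choose L hL using hc
  have h0 : Tendsto (fun k : ℕ => scaledPop β k c) atTop (𝓝 (L 0)) := by simpa using hL 0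
  -- Every one of the grids contains the integers, hence a common subsequence.
  have hLeq : ∀ m, L m = L 0 := fun m => by
    refine tendsto_nhds_unique ((hL m).comp (tendsto_id.atTop_mul_const' (r := m + 1)
      (by positivity))) ?_
    refine h0.congr fun k => ?_
    simp only [Function.comp, id]
    congr 1
    push_cast
    field_simp
  have hL0 : 0 ≤ L 0 := ge_of_tendsto' h0 fun k => scaledPop_nonneg _ _
  have hlim : yuleLimit β c = ENNReal.ofReal (L 0) :=
    ((ENNReal.continuous_ofReal.tendsto _).comp h0).liminf_eq
  rw [hlim, ENNReal.toReal_ofReal hL0]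
  refine tendsto_order.2 ⟨fun a ha => ?_, fun a ha => ?_⟩
  · have hcont : Tendsto (fun m : ℕ => Real.exp (-(β * (1 / (m + 1 : ℝ)))) * L 0) atTop
        (𝓝 (Real.exp (-(β * 0)) * L 0)) :=
      ((Real.continuous_exp.tendsto _).comp
        (tendsto_one_div_add_atTop_nhds_zero_nat.const_mul β).neg).mul_const _
    rw [mul_zero, neg_zero, Real.exp_zero, one_mul] at hcont
    obtain ⟨m, hm⟩ := ((tendsto_order.1 hcont).1 a ha).exists
    have h2 := (hL m).const_mul (Real.exp (-(β * (1 / (m + 1 : ℝ)))))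
    rw [hLeq m] at h2
    have h3 := (tendsto_order.1 h2).1 a hm
    have h4 : Tendsto (fun t : ℝ => ⌊t * (m + 1)⌋₊) atTop atTop :=
      tendsto_nat_floor_atTop.comp (tendsto_id.atTop_mul_const (by positivity))
    filter_upwards [h4.eventually h3, eventually_ge_atTop 0] with t ht ht0
    refine ht.trans_le ?_
    have hm1 : (0 : ℝ) < m + 1 := by positivity
    have h5 : (⌊t * (m + 1)⌋₊ : ℝ) * (1 / (m + 1 : ℕ)) ≤ t := by
      have := Nat.floor_le (a := t * (m + 1)) (by positivity)
      push_cast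
      rw [mul_one_div, div_le_iff₀ hm1]; exact this
    have h6 := hne.scaledPop_le_exp_mul (β := β) h5
    have h7 : t - (⌊t * (m + 1)⌋₊ : ℝ) * (1 / (m + 1 : ℕ)) ≤ 1 / (m + 1) := by
      have := (Nat.lt_floor_add_one (t * (m + 1))).le
      push_cast
      rw [mul_one_div, sub_le_iff_le_add, ← add_div, le_div_iff₀ hm1]; linarith
    calc _ ≤ Real.exp (-(β * (1 / (m + 1 : ℝ)))) * (Real.exp (β * (1 / (m + 1))) *
          scaledPop β t c) := by
          gcongr
          refine h6.trans ?_
          gcongr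
          exact scaledPop_nonneg _ _
      _ = _ := by rw [← mul_assoc, ← Real.exp_add, neg_add_cancel, Real.exp_zero, one_mul]
  · have hcont : Tendsto (fun m : ℕ => Real.exp (β * (1 / (m + 1 : ℝ))) * L 0) atTop
        (𝓝 (Real.exp (β * 0) * L 0)) :=
      ((Real.continuous_exp.tendsto _).comp
        (tendsto_one_div_add_atTop_nhds_zero_nat.const_mul β)).mul_const _
    rw [mul_zero, Real.exp_zero, one_mul] at hcont
    obtain ⟨m, hm⟩ := ((tendsto_order.1 hcont).2 a ha).exists
    have h2 := (hL m).const_mul (Real.exp (β * (1 / (m + 1 : ℝ))))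
    rw [hLeq m] at h2
    have h3 := (tendsto_order.1 h2).2 a hm
    have h4 : Tendsto (fun t : ℝ => ⌊t * (m + 1)⌋₊ + 1) atTop atTop :=
      (tendsto_add_atTop_nat 1).comp
        (tendsto_nat_floor_atTop.comp (tendsto_id.atTop_mul_const (by positivity)))
    filter_upwards [h4.eventually h3, eventually_ge_atTop 0] with t ht ht0
    refine lt_of_le_of_lt ?_ ht
    have hm1 : (0 : ℝ) < m + 1 := by positivity
    have h5 : t ≤ ((⌊t * (m + 1)⌋₊ + 1 : ℕ) : ℝ) * (1 / (m + 1 : ℕ)) := by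
      have := (Nat.lt_floor_add_one (t * (m + 1))).le
      push_cast
      rw [mul_one_div, le_div_iff₀ hm1]; exact this
    refine (hne.scaledPop_le_exp_mul (β := β) h5).trans ?_
    have h7 : ((⌊t * (m + 1)⌋₊ + 1 : ℕ) : ℝ) * (1 / (m + 1 : ℕ)) - t ≤ 1 / (m + 1) := by
      have := Nat.floor_le (a := t * (m + 1)) (by positivity)
      push_cast
      rw [mul_one_div, sub_le_iff_le_add, div_le_iff₀ hm1, add_mul, one_div_mul_cancel hm1.ne']
      linarith
    gcongr
    exact scaledPop_nonneg _ _

lemma Regular.yuleLimit_ne_top (hβ : 0 < β) {c : List Bool → Mark} (hc : Regular β c) :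
    yuleLimit β c ≠ ∞ := ne_top_of_le_ne_top hc.supPop_ne_top (yuleLimit_le_supPop hβ c)

lemma scaledPop_eq_of_le {c : List Bool → Mark} (hc : NonExplosive c) {t : ℝ}
    (ht : (c []).1 ≤ t) : scaledPop β t c = Real.exp (-(β * (c []).1)) *
      (scaledPop β (t - (c []).1) (sub false c) + scaledPop β (t - (c []).1) (sub true c)) := by
  rw [scaledPop, population_eq_ite, if_neg (not_lt.2 ht), scaledPop, scaledPop,
    ENNReal.toReal_add ((hc.sub _).population_ne_top _) ((hc.sub _).population_ne_top _),
    ← mul_add, ← mul_assoc, ← Real.exp_add]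
  congr 2; ring

lemma Regular.yuleLimit_eq (hβ : 0 < β) {c : List Bool → Mark} (hc : Regular β c)
    (h : ∀ b, Regular β (sub b c)) : yuleLimit β c = .ofReal (Real.exp (-(β * (c []).1))) *
      (yuleLimit β (sub false c) + yuleLimit β (sub true c)) := by
  have h1 : Tendsto (fun t : ℝ => t - (c []).1) atTop atTop :=
    tendsto_atTop_add_const_right _ _ tendsto_id
  have h2 := ((((h false).tendsto.comp h1).add ((h true).tendsto.comp h1)).const_mul
    (Real.exp (-(β * (c []).1))))
  have h3 := tendsto_nhds_unique hc.tendsto (h2.congr' (by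
    filter_upwards [eventually_ge_atTop ((c []).1 : ℝ)] with t ht
    exact (scaledPop_eq_of_le hc.nonExplosive ht).symm))
  rw [← ENNReal.toReal_eq_toReal_iff' (hc.yuleLimit_ne_top hβ) (ENNReal.mul_ne_top
    ENNReal.ofReal_ne_top (ENNReal.add_ne_top.2 ⟨(h _).yuleLimit_ne_top hβ,
      (h _).yuleLimit_ne_top hβ⟩)), h3, ENNReal.toReal_mul, ENNReal.toReal_ofReal (by positivity),
    ENNReal.toReal_add ((h _).yuleLimit_ne_top hβ) ((h _).yuleLimit_ne_top hβ)]

lemma lintegral_yuleLimit_sq_le (hβ : 0 < β) (hν : ∀ u, IsMarkLaw β C (ν u)) :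
    ∫⁻ c, yuleLimit β c ^ 2 ∂treeLaw ν ≤ 5 := by
  calc _ ≤ ∫⁻ c, liminf (fun k : ℕ => ENNReal.ofReal (scaledPop β k c ^ 2)) atTop ∂treeLaw ν := by
        refine lintegral_mono_ae ?_
        filter_upwards [ae_regular hβ hν] with c hc
        have h1 : Tendsto (fun k : ℕ => scaledPop β k c) atTop (𝓝 (yuleLimit β c).toReal) :=
          hc.tendsto.comp tendsto_natCast_atTop_atTop
        have h2 := ((ENNReal.continuous_ofReal.tendsto _).comp (h1.pow 2)).liminf_eq
        simp only [Function.comp_def] at h2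
        rw [h2, ENNReal.ofReal_pow (by positivity), ENNReal.ofReal_toReal (hc.yuleLimit_ne_top hβ)]
    _ ≤ _ := lintegral_liminf_le fun k => ((measurable_scaledPop k).pow_const 2).ennreal_ofReal
    _ ≤ 5 := by
        refine Filter.liminf_le_of_le (by isBoundedDefault) fun b hb => ?_
        obtain ⟨n, hn⟩ := hb.exists
        exact hn.trans (lintegral_scaledPop_sq_le hβ hν (by positivity))

lemma one_le_lintegral_yuleLimit (hβ : 0 < β) (hν : ∀ u, IsMarkLaw β C (ν u)) :
    1 ≤ ∫⁻ c, yuleLimit β c ∂treeLaw ν := by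
  have h : ∀ k : ℕ, 1 ≤ ∫⁻ c, yuleLimit β c ∂treeLaw ν +
      .ofReal (12 * Real.exp (-(β / 4) * k)) := by
    intro k
    have h1 : ∫⁻ c, .ofReal |scaledPop β k c - (yuleLimit β c).toReal| ∂treeLaw ν ≤
        .ofReal (12 * Real.exp (-(β / 4) * k)) := by
      calc _ ≤ ∫⁻ c, liminf (fun j : ℕ => ENNReal.ofReal |scaledPop β k c - scaledPop β j c|) atTop
            ∂treeLaw ν := by
            refine lintegral_mono_ae ?_
            filter_upwards [ae_regular hβ hν] with c hc
            have h1 : Tendsto (fun k : ℕ => scaledPop β k c) atTop (𝓝 (yuleLimit β c).toReal) :=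
              hc.tendsto.comp tendsto_natCast_atTop_atTop
            exact ((ENNReal.continuous_ofReal.tendsto _).comp
              (tendsto_const_nhds.sub h1).abs).liminf_eq.ge
        _ ≤ _ := lintegral_liminf_le fun j => by
            have hm := measurable_scaledPop (β := β) k
            have hm' := measurable_scaledPop (β := β) j
            fun_prop
        _ ≤ _ := by
            refine Filter.liminf_le_of_le (by isBoundedDefault) fun b hb => ?_
            obtain ⟨j, hj, hkj⟩ := (hb.and (eventually_ge_atTop k)).exists
            exact hj.trans (lintegral_scaledPop_sub_le hβ hν (by positivity) (by exact_mod_cast hkj))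
    calc (1 : ℝ≥0∞) ≤ ∫⁻ c, .ofReal (scaledPop β k c) ∂treeLaw ν :=
          one_le_lintegral_scaledPop hβ hν (by positivity)
      _ ≤ ∫⁻ c, (yuleLimit β c + .ofReal |scaledPop β k c - (yuleLimit β c).toReal|)
          ∂treeLaw ν := by
          refine lintegral_mono_ae ?_
          filter_upwards [ae_regular hβ hν] with c hc
          nth_rewrite 1 [← ENNReal.ofReal_toReal (hc.yuleLimit_ne_top hβ)]
          rw [← ENNReal.ofReal_add (by positivity) (by positivity)]
          have := le_abs_self (scaledPop β k c - (yuleLimit β c).toReal)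
          exact ENNReal.ofReal_le_ofReal (by linarith)
      _ ≤ _ := by
          rw [lintegral_add_left measurable_yuleLimit]
          gcongr
  have hlim : Tendsto (fun k : ℕ => ∫⁻ c, yuleLimit β c ∂treeLaw ν +
      .ofReal (12 * Real.exp (-(β / 4) * k))) atTop (𝓝 (∫⁻ c, yuleLimit β c ∂treeLaw ν +
        .ofReal (12 * 0))) := by
    refine tendsto_const_nhds.add ((ENNReal.continuous_ofReal.tendsto _).comp
      (Tendsto.const_mul _ (Real.tendsto_exp_atBot.comp ?_)))
    exact tendsto_natCast_atTop_atTop.const_mul_atTop_of_neg (by linarith)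
  simpa using ge_of_tendsto' hlim h

/-- A Paley–Zygmund bound: w ≤ w²/10 + (5/2) 1_{w ≠ 0}, E[W] ≥ 1 and E[W²] ≤ 5 give 1 ≤ 1/2 + (5/2)
P(W ≠ 0). -/
lemma treeLaw_yuleLimit_eq_zero_le (hβ : 0 < β) (hν : ∀ u, IsMarkLaw β C (ν u)) :
    treeLaw ν {c | yuleLimit β c = 0} ≤ 4 / 5 := by
  have := fun u => (hν u).isProbabilityMeasure hβ
  have hms : MeasurableSet {c | yuleLimit β c = 0} := measurable_yuleLimit (measurableSet_singleton 0)
  have h1 : (1 : ℝ≥0∞) ≤ 10⁻¹ * 5 + 5 / 2 * treeLaw ν {c | yuleLimit β c = 0}ᶜ := by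
    calc 1 ≤ ∫⁻ c, yuleLimit β c ∂treeLaw ν := one_le_lintegral_yuleLimit hβ hν
      _ ≤ ∫⁻ c, (10⁻¹ * yuleLimit β c ^ 2 +
          5 / 2 * ({c | yuleLimit β c = 0}ᶜ).indicator 1 c) ∂treeLaw ν := by
          refine lintegral_mono_ae ?_
          filter_upwards [ae_regular hβ hν] with c hc
          by_cases h : yuleLimit β c = 0
          · simp [h]
          · rw [Set.indicator_of_mem (by exact h), Pi.one_apply, mul_one]
            lift yuleLimit β c to ℝ≥0 using hc.yuleLimit_ne_top hβ with w
            have h3 : w ≤ 10⁻¹ * w ^ 2 + 5 / 2 := by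
              rw [← NNReal.coe_le_coe]; push_cast
              nlinarith [sq_nonneg ((w : ℝ) - 5)]
            calc (w : ℝ≥0∞) ≤ ((10⁻¹ * w ^ 2 + 5 / 2 : ℝ≥0) : ℝ≥0∞) := by exact_mod_cast h3
              _ = _ := by
                push_cast
                simp [ENNReal.coe_inv]
      _ ≤ _ := by
          rw [lintegral_add_left (by fun_prop), lintegral_const_mul _ (by fun_prop),
            lintegral_const_mul' _ _ (by finiteness), lintegral_indicator_one hms.compl]
          gcongr
          exact lintegral_yuleLimit_sq_le hβ hν
  rw [prob_compl_eq_one_sub hms] at h1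
  set p := treeLaw ν {c | yuleLimit β c = 0}
  have hp : p ≤ 1 := prob_le_one
  have hp' : p ≠ ∞ := ne_top_of_le_ne_top ENNReal.one_ne_top hp
  have h2 := ENNReal.toReal_mono (by finiteness) h1
  rw [ENNReal.toReal_add (by finiteness) (by finiteness), ENNReal.toReal_mul, ENNReal.toReal_mul,
    ENNReal.toReal_sub_of_le hp (by simp), ENNReal.toReal_inv, ENNReal.toReal_div] at h2
  norm_num at h2
  refine (ENNReal.toReal_le_toReal hp' (by finiteness)).1 ?_
  rw [ENNReal.toReal_div]
  norm_num
  linarith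

/-- W vanishes only if it vanishes in both independent subtrees. Iterating the uniform bound 4/5
along a line of descent bounds the probability by (4/5)^n for all n. -/
lemma ae_yuleLimit_ne_zero (hβ : 0 < β) (hν : ∀ u, IsMarkLaw β C (ν u)) :
    ∀ᵐ c ∂treeLaw ν, yuleLimit β c ≠ 0 := by
  have hms : MeasurableSet {c | yuleLimit β c = 0} := measurable_yuleLimit (measurableSet_singleton 0)
  have h : ∀ n : ℕ, ∀ ν : List Bool → Measure Mark, (∀ u, IsMarkLaw β C (ν u)) →
      treeLaw ν {c | yuleLimit β c = 0} ≤ (4 / 5) ^ n := by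
    intro n
    induction n with
    | zero =>
      intro ν hν
      have := fun u => (hν u).isProbabilityMeasure hβ
      simpa using prob_le_one
    | succ n ih =>
      intro ν hν
      have := fun u => (hν u).isProbabilityMeasure hβ
      set f : (List Bool → Mark) → ℝ≥0∞ := {c | yuleLimit β c = 0}.indicator 1
      have hf : Measurable f := measurable_one.indicator hms
      calc treeLaw ν {c | yuleLimit β c = 0} = ∫⁻ c, f c ∂treeLaw ν :=
            (lintegral_indicator_one hms).symm
        _ ≤ ∫⁻ c, f (sub false c) * f (sub true c) ∂treeLaw ν := by
            refine lintegral_mono_ae ?_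
            filter_upwards [ae_regular hβ hν, ae_sub false (ae_regular hβ fun u => hν _),
              ae_sub true (ae_regular hβ fun u => hν _)] with c hc h0 h1
            by_cases h : yuleLimit β c = 0
            · have := hc.yuleLimit_eq hβ (Bool.forall_bool.2 ⟨h0, h1⟩)
              rw [h, eq_comm, mul_eq_zero, ENNReal.ofReal_eq_zero, add_eq_zero] at this
              rcases this with h' | ⟨h', h''⟩
              · exact absurd h' (not_le.2 (Real.exp_pos _))
              · simp [f, h, h', h'']
            · simp [f, h]
        _ = treeLaw (sub false ν) {c | yuleLimit β c = 0} *
            treeLaw (sub true ν) {c | yuleLimit β c = 0} := by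
            rw [lintegral_treeLaw ν (F := fun _ c₀ c₁ => f c₀ * f c₁) (by fun_prop)]
            simp_rw [lintegral_const_mul _ hf]
            rw [lintegral_mul_const _ hf]
            simp [f, lintegral_indicator_one hms]
        _ ≤ (4 / 5) ^ n * (4 / 5) := by
            gcongr
            · exact ih _ fun u => hν _
            · exact treeLaw_yuleLimit_eq_zero_le hβ fun u => hν _
        _ = _ := (pow_succ _ _).symm
  have h0 : Tendsto (fun n : ℕ => (4 / 5 : ℝ≥0∞) ^ n) atTop (𝓝 0) :=
    ENNReal.tendsto_pow_atTop_nhds_zero_of_lt_one (by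
      rw [ENNReal.div_lt_iff (by simp) (by simp)]; norm_num)
  have := ge_of_tendsto' h0 fun n => h n ν hν
  exact measure_eq_zero_iff_ae_notMem.1 (le_antisymm this zero_le)

end Moments

/-! ### Cascades -/

section Cascade

variable {α : Type*}

/-- The sum over generation `n` of the values of `Q` on the subtrees, weighted with the products of
the values of `w` along the ancestral line. -/
def cascade (w : α → ℝ≥0∞) (Q : (List Bool → α) → ℝ≥0∞) : ℕ → (List Bool → α) → ℝ≥0∞
  | 0, c => Q c
  | n + 1, c => w (c []) * (cascade w Q n (sub false c) + cascade w Q n (sub true c))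

variable [MeasurableSpace α]

lemma measurable_cascade {w : α → ℝ≥0∞} {Q : (List Bool → α) → ℝ≥0∞} (hw : Measurable w)
    (hQ : Measurable Q) (n : ℕ) : Measurable (cascade w Q n) := by
  induction n with
  | zero => exact hQ
  | succ n ih => simp only [cascade]; fun_prop

/-- The root mark is independent of the subtrees, so the expectation of the recursion factorises. -/
lemma lintegral_le_of_branching {ν : List Bool → Measure α} [∀ u, IsProbabilityMeasure (ν u)]
    {w : α → ℝ≥0∞} {X X' Q : (List Bool → α) → ℝ≥0∞} (hw : Measurable w) (hX : Measurable X)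
    (h : ∀ᵐ c ∂treeLaw ν, X' c ≤ Q c + w (c []) * (X (sub false c) + X (sub true c))) :
    ∫⁻ c, X' c ∂treeLaw ν ≤ ∫⁻ c, Q c ∂treeLaw ν + (∫⁻ m, w m ∂ν []) *
      (∫⁻ c, X c ∂treeLaw (sub false ν) + ∫⁻ c, X c ∂treeLaw (sub true ν)) := by
  refine (lintegral_mono_ae h).trans ?_
  rw [lintegral_add_right _ (by fun_prop)]
  gcongr
  rw [lintegral_treeLaw ν (F := fun m c₀ c₁ => w m * (X c₀ + X c₁)) (by fun_prop),
    ← lintegral_mul_const _ hw]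
  refine (lintegral_congr fun m => ?_).le
  simp_rw [mul_add]
  rw [← lintegral_const_mul _ hX, ← lintegral_const_mul _ hX]
  simp_rw [lintegral_add_left (measurable_const (a := w m * X _))]
  rw [lintegral_add_right _ measurable_const]
  simp

end Cascade

/-- The map K ↦ B + 2qK contracts; K = (B + B')/(1 - 2q) is stable under it and also exceeds the
starting value B'. Inductions over generations thus have bounds independent of the generation. -/
lemma exists_contraction_bound {q B B' : ℝ≥0∞} (hq : 2 * q < 1) (hB : B < ∞) (hB' : B' < ∞) :
    ∃ K < ∞, B' ≤ K ∧ B + q * (K + K) ≤ K := by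
  have hq' : q ≠ ∞ := by rintro rfl; simp at hq
  lift q to ℝ≥0 using hq'
  lift B to ℝ≥0 using hB.ne
  lift B' to ℝ≥0 using hB'.ne
  have hq1 : 2 * (q : ℝ) < 1 := by exact_mod_cast hq
  have h0 : 0 < 1 - 2 * (q : ℝ) := by linarith
  set K : ℝ≥0 := ⟨(B + B') / (1 - 2 * q), by positivity⟩
  have hK : (K : ℝ) = (B + B') / (1 - 2 * q) := rfl
  rw [eq_div_iff h0.ne'] at hK
  have hK0 := K.2
  refine ⟨K, ENNReal.coe_lt_top, ?_, ?_⟩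
  · norm_cast
    rw [← NNReal.coe_le_coe]
    nlinarith [q.2, B.2, B'.2]
  · norm_cast
    rw [← NNReal.coe_le_coe]
    push_cast
    nlinarith [q.2, B.2, B'.2]

variable {β : ℝ} {C : ℝ≥0}

lemma two_mul_ofReal_lt_one {x : ℝ} (h : 2 * x < 1) : 2 * ENNReal.ofReal x < 1 := by
  rw [← ENNReal.ofReal_ofNat, ← ENNReal.ofReal_mul (by norm_num), ← ENNReal.ofReal_one]
  exact (ENNReal.ofReal_lt_ofReal_iff one_pos).2 h

lemma lintegral_cascade_le (hβ : 0 < β) {w : Mark → ℝ≥0∞} {Q : (List Bool → Mark) → ℝ≥0∞}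
    (hw : Measurable w) (hQ : Measurable Q) {q B : ℝ≥0∞}
    (hq : ∀ ν, IsMarkLaw β C ν → ∫⁻ m, w m ∂ν ≤ q)
    (hB : ∀ ν : List Bool → Measure Mark, (∀ u, IsMarkLaw β C (ν u)) →
      ∫⁻ c, Q c ∂treeLaw ν ≤ B) (n : ℕ) {ν : List Bool → Measure Mark}
    (hν : ∀ u, IsMarkLaw β C (ν u)) :
    ∫⁻ c, cascade w Q n c ∂treeLaw ν ≤ (2 * q) ^ n * B := by
  induction n generalizing ν with
  | zero => simpa [cascade] using hB ν hν
  | succ n ih =>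
    have := fun u => (hν u).isProbabilityMeasure hβ
    calc _ ≤ ∫⁻ c, (fun _ => 0) c ∂treeLaw ν + (∫⁻ m, w m ∂ν []) *
          (∫⁻ c, cascade w Q n c ∂treeLaw (sub false ν) +
            ∫⁻ c, cascade w Q n c ∂treeLaw (sub true ν)) :=
          lintegral_le_of_branching hw (measurable_cascade hw hQ n)
            (.of_forall fun c => by simp [cascade])
      _ ≤ 0 + q * ((2 * q) ^ n * B + (2 * q) ^ n * B) := by
          gcongr
          · simp
          · exact hq _ (hν [])
          · exact ih (ν := sub false ν) fun u => hν _
          · exact ih (ν := sub true ν) fun u => hν _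
      _ = _ := by rw [pow_succ]; ring

lemma ae_tsum_cascade_ne_top (hβ : 0 < β) {w : Mark → ℝ≥0∞} {Q : (List Bool → Mark) → ℝ≥0∞}
    (hw : Measurable w) (hQ : Measurable Q) {q B : ℝ≥0∞} (hq1 : 2 * q < 1) (hB1 : B < ∞)
    (hq : ∀ ν, IsMarkLaw β C ν → ∫⁻ m, w m ∂ν ≤ q)
    (hB : ∀ ν : List Bool → Measure Mark, (∀ u, IsMarkLaw β C (ν u)) →
      ∫⁻ c, Q c ∂treeLaw ν ≤ B) {ν : List Bool → Measure Mark}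
    (hν : ∀ u, IsMarkLaw β C (ν u)) :
    ∀ᵐ c ∂treeLaw ν, ∑' n, cascade w Q n c ≠ ∞ := by
  have h : ∫⁻ c, ∑' n, cascade w Q n c ∂treeLaw ν < ∞ := by
    rw [lintegral_tsum fun n => (measurable_cascade hw hQ n).aemeasurable]
    refine lt_of_le_of_lt (ENNReal.tsum_le_tsum fun n => lintegral_cascade_le hβ hw hQ hq hB n hν) ?_
    rw [ENNReal.tsum_mul_right, ENNReal.tsum_geometric]
    refine ENNReal.mul_lt_top (ENNReal.inv_lt_top.2 (tsub_pos_of_lt hq1)) hB1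
  filter_upwards [ae_lt_top (Measurable.tsum fun n => measurable_cascade hw hQ n) h.ne] with c hc
    using hc.ne

lemma lintegral_tsum_cascade_le (hβ : 0 < β) {w : Mark → ℝ≥0∞} {Q : (List Bool → Mark) → ℝ≥0∞}
    (hw : Measurable w) (hQ : Measurable Q) {q B : ℝ≥0∞}
    (hq : ∀ ν, IsMarkLaw β C ν → ∫⁻ m, w m ∂ν ≤ q)
    (hB : ∀ ν : List Bool → Measure Mark, (∀ u, IsMarkLaw β C (ν u)) →
      ∫⁻ c, Q c ∂treeLaw ν ≤ B) {ν : List Bool → Measure Mark}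
    (hν : ∀ u, IsMarkLaw β C (ν u)) :
    ∫⁻ c, ∑' n, cascade w Q n c ∂treeLaw ν ≤ (1 - 2 * q)⁻¹ * B := by
  rw [lintegral_tsum fun n => (measurable_cascade hw hQ n).aemeasurable,
    ← ENNReal.tsum_geometric, ← ENNReal.tsum_mul_right]
  exact ENNReal.tsum_le_tsum fun n => lintegral_cascade_le hβ hw hQ hq hB n hν

/-! ### Displacement of the descendants -/

/-- The factor by which a particle weighs the displacements of its offspring. -/
def dispWeight (β : ℝ) (m : Mark) : ℝ≥0∞ := .ofReal (Real.exp (-β * m.1 + dispExp β * m.2.2.1))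

/-- The contribution of the initial particle to the displacement. -/
def rootDisp (β : ℝ) (c : List Bool → Mark) : ℝ≥0∞ :=
  (c []).2.2.2 ^ dispExp β * (1 + supPop β (sub false c) + supPop β (sub true c))

/-- A bound for the sum of the powers `dispExp β` of the displacements of all particles at time `t`,
divided by `e ^ (β t)`. -/
def totalDisp (β : ℝ) (c : List Bool → Mark) : ℝ≥0∞ := ∑' n, cascade (dispWeight β) (rootDisp β) n c

/-- The error when the particles are replaced by their ancestors in generation `n`. -/
def remainder (β : ℝ) : ℕ → (List Bool → Mark) → ℝ≥0∞ :=
  cascade (dispWeight β) fun c => totalDisp β c + 2 * supPop β c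

@[fun_prop] lemma measurable_dispWeight : Measurable (dispWeight β) := by
  unfold dispWeight; fun_prop

@[fun_prop] lemma measurable_rootDisp : Measurable (rootDisp β) := by
  unfold rootDisp; fun_prop

@[fun_prop] lemma measurable_totalDisp : Measurable (totalDisp β) :=
  .tsum fun n => measurable_cascade measurable_dispWeight measurable_rootDisp n

lemma totalDisp_eq (c : List Bool → Mark) : totalDisp β c =
    rootDisp β c + dispWeight β (c []) * (totalDisp β (sub false c) + totalDisp β (sub true c)) := by
  rw [totalDisp, tsum_eq_zero_add' ENNReal.summable]
  simp only [cascade, totalDisp]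
  rw [ENNReal.tsum_mul_left, ENNReal.tsum_add]

lemma IsMarkLaw.lintegral_dispWeight (hβ : 0 < β) {ν : Measure Mark} (hν : IsMarkLaw β C ν) :
    ∫⁻ m, dispWeight β m ∂ν =
      .ofReal (β / (β + β - dispExp β * (dispExp β - 1) / 2)) := by
  have h1 := dispExp_pos hβ
  have h2 := dispExp_le (β := β)
  exact hν.lintegral_exp hβ (by nlinarith)

/-- With a = `dispExp β` the factor is 2β / (2β + a(1-a)/2), and a(1-a) > 0. Displacements grow more
slowly than the population because fractional moments of Y decay. -/
lemma two_mul_dispWeight_lt_one (hβ : 0 < β) :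
    2 * ENNReal.ofReal (β / (β + β - dispExp β * (dispExp β - 1) / 2)) < 1 := by
  have h1 := dispExp_pos hβ
  have h2 := dispExp_le (β := β)
  refine two_mul_ofReal_lt_one ?_
  rw [mul_div_assoc', div_lt_one (by nlinarith)]
  nlinarith

lemma exists_lintegral_rootDisp_le (hβ : 0 < β) (C : ℝ≥0) : ∃ K < ∞, ∀ ν : List Bool → Measure Mark,
    (∀ u, IsMarkLaw β C (ν u)) → ∫⁻ c, rootDisp β c ∂treeLaw ν ≤ K := by
  obtain ⟨A, hA, hdisp⟩ := IsMarkLaw.exists_lintegral_displacement_le hβ C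
  obtain ⟨K, hK, hsup⟩ := exists_lintegral_supPop_le hβ C
  refine ⟨A + A * (K + K), by finiteness, fun ν hν => ?_⟩
  have := fun u => (hν u).isProbabilityMeasure hβ
  have hmap : ∫⁻ c, (c []).2.2.2 ^ dispExp β ∂treeLaw ν = ∫⁻ m, m.2.2.2 ^ dispExp β ∂ν [] := by
    rw [lintegral_treeLaw ν (F := fun m _ _ => m.2.2.2 ^ dispExp β) (by fun_prop)]
    simp
  refine (lintegral_le_of_branching (w := fun m => m.2.2.2 ^ dispExp β) (X := supPop β)
    (Q := fun c => (c []).2.2.2 ^ dispExp β) (by fun_prop) (by fun_prop)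
    (.of_forall fun c => le_of_eq ?_)).trans ?_
  · rw [rootDisp]; ring
  · rw [hmap]
    gcongr
    · exact hdisp _ (hν [])
    · exact hdisp _ (hν [])
    · exact hsup (sub false ν) fun u => hν _
    · exact hsup (sub true ν) fun u => hν _

/-- The expectation of the n-th remainder decays geometrically, so the remainders are almost surely
summable. -/
lemma ae_tendsto_remainder (hβ : 0 < β) {ν : List Bool → Measure Mark}
    (hν : ∀ u, IsMarkLaw β C (ν u)) :
    ∀ᵐ c ∂treeLaw ν, Tendsto (fun n => remainder β n c) atTop (𝓝 0) := by
  obtain ⟨K, hK, h⟩ := exists_lintegral_rootDisp_le hβ C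
  obtain ⟨K', hK', hsup⟩ := exists_lintegral_supPop_le hβ C
  set q := ENNReal.ofReal (β / (β + β - dispExp β * (dispExp β - 1) / 2))
  have hq := two_mul_dispWeight_lt_one hβ
  have hB : (1 - 2 * q)⁻¹ * K + 2 * K' < ∞ := ENNReal.add_lt_top.2
    ⟨ENNReal.mul_lt_top (ENNReal.inv_lt_top.2 (tsub_pos_of_lt hq)) hK,
      ENNReal.mul_lt_top (by simp) hK'⟩
  have hQ : ∀ ν : List Bool → Measure Mark, (∀ u, IsMarkLaw β C (ν u)) →
      ∫⁻ c, (totalDisp β c + 2 * supPop β c) ∂treeLaw ν ≤ (1 - 2 * q)⁻¹ * K + 2 * K' := by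
    intro ν hν
    rw [lintegral_add_left (by fun_prop), lintegral_const_mul _ (by fun_prop)]
    gcongr
    · exact lintegral_tsum_cascade_le hβ measurable_dispWeight measurable_rootDisp
        (fun ν hν => (hν.lintegral_dispWeight hβ).le) h hν
    · exact hsup ν hν
  filter_upwards [ae_tsum_cascade_ne_top hβ measurable_dispWeight
    (Q := fun c => totalDisp β c + 2 * supPop β c) (by fun_prop) hq hB
    (fun ν hν => (hν.lintegral_dispWeight hβ).le) hQ hν] with c hc
  exact ENNReal.tendsto_atTop_zero_of_tsum_ne_top hc

/-! ### Approximate densities of the limit measure -/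

lemma lintegral_affine {f : ℝ → ℝ≥0∞} (hf : Measurable f) (x η : ℝ) :
    ∫⁻ r, .ofReal (Real.exp (-η)) * f ((r - x) * Real.exp (-η)) = ∫⁻ u, f u := by
  rw [lintegral_const_mul _ (by fun_prop),
    lintegral_sub_right_eq_self (fun r => f (r * Real.exp (-η))) x]
  conv_rhs => rw [← Real.smul_map_volume_mul_right (Real.exp_pos (-η)).ne']
  rw [lintegral_smul_measure, lintegral_map hf (by fun_prop), abs_of_pos (Real.exp_pos _),
    smul_eq_mul]

section

variable {β : ℝ} {C : ℝ≥0}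

/-- The weight `e ^ (-β t)` of a particle with lifetime `t`. -/
def lifeWeight (β : ℝ) (m : Mark) : ℝ≥0∞ := .ofReal (Real.exp (-β * m.1))

@[fun_prop] lemma measurable_lifeWeight : Measurable (lifeWeight β) := by
  unfold lifeWeight; fun_prop

lemma IsMarkLaw.lintegral_lifeWeight (hβ : 0 < β) {ν : Measure Mark} (hν : IsMarkLaw β C ν) :
    ∫⁻ m, lifeWeight β m ∂ν = .ofReal (1 / 2) := by
  have := hν.lintegral_exp hβ (l := β) (q := 0) (by linarith)
  simp only [zero_mul, add_zero, zero_div, sub_zero] at this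
  rw [show β / (β + β) = 1 / 2 by field_simp; ring] at this
  exact this

/-- The density, in the half plane model, of the limit measure when the limit measures of the
subtrees of generation `n` are replaced by the uniform distribution on `[0, 1]`, of the same
mass. -/
def density (β : ℝ) : ℕ → (List Bool → Mark) → ℝ → ℝ≥0∞
  | 0, c, r => yuleLimit β c * (Set.Icc 0 1).indicator 1 r
  | n + 1, c, r => lifeWeight β (c []) * (.ofReal (Real.exp (-(c []).2.2.1)) *
      (density β n (sub false c) ((r - (c []).2.1) * Real.exp (-(c []).2.2.1)) +
        density β n (sub true c) ((r - (c []).2.1) * Real.exp (-(c []).2.2.1))))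

lemma measurable_density_uncurry (n : ℕ) :
    Measurable fun p : (List Bool → Mark) × ℝ => density β n p.1 p.2 := by
  induction n with
  | zero =>
    simp only [density]
    have : Measurable ((Set.Icc (0 : ℝ) 1).indicator (1 : ℝ → ℝ≥0∞)) :=
      measurable_one.indicator measurableSet_Icc
    fun_prop
  | succ n ih =>
    simp only [density]
    have h : ∀ b, Measurable fun p : (List Bool → Mark) × ℝ =>
        density β n (sub b p.1) ((p.2 - (p.1 []).2.1) * Real.exp (-(p.1 []).2.2.1)) :=
      fun b => ih.comp (f := fun p : (List Bool → Mark) × ℝ =>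
        (sub b p.1, (p.2 - (p.1 []).2.1) * Real.exp (-(p.1 []).2.2.1))) (by fun_prop)
    have h0 := h false
    have h1 := h true
    fun_prop

@[fun_prop] lemma Measurable.density {α : Type*} [MeasurableSpace α] {f : α → List Bool → Mark}
    {g : α → ℝ} (hf : Measurable f) (hg : Measurable g) (n : ℕ) :
    Measurable fun a => density β n (f a) (g a) :=
  (measurable_density_uncurry n).comp (hf.prodMk hg)

lemma lintegral_mul_density_zero (c : List Bool → Mark) {φ : ℝ → ℝ≥0∞} (hφ : Measurable φ) :
    ∫⁻ r, φ r * density β 0 c r = yuleLimit β c * ∫⁻ r in Set.Icc 0 1, φ r := by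
  rw [← lintegral_indicator measurableSet_Icc, ← lintegral_const_mul _
    (hφ.indicator measurableSet_Icc)]
  refine lintegral_congr fun r => ?_
  by_cases h : r ∈ Set.Icc (0 : ℝ) 1 <;> simp [density, h, mul_comm]

/-- The factor e^(-η) in `density` is the Jacobian of r ↦ x + e^η r, so that integrating against the
density means pushing the measures of the subtrees forward by the root map. -/
lemma lintegral_mul_density_succ (n : ℕ) (c : List Bool → Mark) {φ : ℝ → ℝ≥0∞}
    (hφ : Measurable φ) :
    ∫⁻ r, φ r * density β (n + 1) c r = lifeWeight β (c []) *
      ((∫⁻ r, φ ((c []).2.1 + Real.exp (c []).2.2.1 * r) * density β n (sub false c) r) +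
        ∫⁻ r, φ ((c []).2.1 + Real.exp (c []).2.2.1 * r) * density β n (sub true c) r) := by
  rw [← lintegral_add_left (by fun_prop), ← lintegral_const_mul _ (by fun_prop)]
  conv_rhs => rw [← lintegral_affine (by fun_prop) (c []).2.1 (c []).2.2.1]
  refine lintegral_congr fun r => ?_
  have : (c []).2.1 + Real.exp (c []).2.2.1 * ((r - (c []).2.1) * Real.exp (-(c []).2.2.1)) = r := by
    rw [mul_left_comm, ← Real.exp_add]; simp
  rw [this, density]
  ring

/-- The mass of the approximate densities. -/
def densityMass (β : ℝ) (n : ℕ) (c : List Bool → Mark) : ℝ≥0∞ := ∫⁻ r, density β n c r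

@[fun_prop] lemma measurable_densityMass (n : ℕ) : Measurable (densityMass β n) :=
  (measurable_density_uncurry n).lintegral_prod_right'

lemma densityMass_zero (c : List Bool → Mark) : densityMass β 0 c = yuleLimit β c := by
  simpa [densityMass] using lintegral_mul_density_zero (β := β) c (φ := 1) measurable_one

lemma densityMass_succ (n : ℕ) (c : List Bool → Mark) : densityMass β (n + 1) c =
    lifeWeight β (c []) * (densityMass β n (sub false c) + densityMass β n (sub true c)) := by
  simpa [densityMass] using lintegral_mul_density_succ (β := β) n c (φ := fun _ => 1) (by fun_prop)

/-- All subtrees are regular. -/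
def AllRegular (β : ℝ) (c : List Bool → Mark) : Prop := ∀ v, Regular β fun u => c (u ++ v)

lemma AllRegular.regular {c : List Bool → Mark} (h : AllRegular β c) : Regular β c := by
  simpa using h []

lemma AllRegular.sub {c : List Bool → Mark} (h : AllRegular β c) (b : Bool) :
    AllRegular β (sub b c) := fun v => by
  simpa [HypBBM.sub] using h (v ++ [b])

lemma ae_allRegular (hβ : 0 < β) {ν : List Bool → Measure Mark} (hν : ∀ u, IsMarkLaw β C (ν u)) :
    ∀ᵐ c ∂treeLaw ν, AllRegular β c :=
  have := fun u => (hν u).isProbabilityMeasure hβ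
  ae_forall_subtree fun v => ae_regular hβ fun u => hν (u ++ v)

/-- The Yule limit satisfies the same branching recursion as the masses, so smearing out a later
generation does not change the total mass. -/
lemma AllRegular.densityMass_eq (hβ : 0 < β) (n : ℕ) {c : List Bool → Mark} (h : AllRegular β c) :
    densityMass β n c = yuleLimit β c := by
  induction n generalizing c with
  | zero => exact densityMass_zero c
  | succ n ih =>
    rw [densityMass_succ, ih (h.sub _), ih (h.sub _),
      h.regular.yuleLimit_eq hβ fun b => (h.sub b).regular, lifeWeight, neg_mul]

/-- The mean mass is critical: 2 E[e^(-βτ)] = 1, so a bound for generation 0 persists without loss.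
-/
lemma exists_lintegral_densityMass_le (hβ : 0 < β) (C : ℝ≥0) :
    ∃ K < ∞, ∀ (n : ℕ) (ν : List Bool → Measure Mark), (∀ u, IsMarkLaw β C (ν u)) →
      ∫⁻ c, densityMass β n c ∂treeLaw ν ≤ K := by
  obtain ⟨K, hK, h⟩ := exists_lintegral_supPop_le hβ C
  refine ⟨K, hK, fun n => ?_⟩
  induction n with
  | zero =>
    intro ν hν
    simp_rw [densityMass_zero]
    exact (lintegral_mono fun c => yuleLimit_le_supPop hβ c).trans (h ν hν)
  | succ n ih =>
    intro ν hν
    have := fun u => (hν u).isProbabilityMeasure hβ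
    calc _ ≤ ∫⁻ c, (fun _ => 0) c ∂treeLaw ν + (∫⁻ m, lifeWeight β m ∂ν []) *
          (∫⁻ c, densityMass β n c ∂treeLaw (sub false ν) +
            ∫⁻ c, densityMass β n c ∂treeLaw (sub true ν)) :=
          lintegral_le_of_branching (by fun_prop) (by fun_prop)
            (.of_forall fun c => by simp [densityMass_succ])
      _ ≤ 0 + .ofReal (1 / 2) * (K + K) := by
          gcongr
          · simp
          · exact ((hν []).lintegral_lifeWeight hβ).le
          · exact ih (sub false ν) fun u => hν _
          · exact ih (sub true ν) fun u => hν _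
      _ = K := by
          rw [zero_add, ← two_mul, ← mul_assoc, ← ENNReal.ofReal_ofNat (n := 2),
            ← ENNReal.ofReal_mul (by norm_num)]
          simp

/-- Expectation of a sum of contributions of the two subtrees. -/
lemma lintegral_root_add {ν : List Bool → Measure Mark} [∀ u, IsProbabilityMeasure (ν u)]
    {G : Mark → (List Bool → Mark) → ℝ≥0∞}
    (hG : Measurable fun p : Mark × (List Bool → Mark) => G p.1 p.2) :
    ∫⁻ c, (G (c []) (sub false c) + G (c []) (sub true c)) ∂treeLaw ν =
      ∫⁻ m, ∫⁻ c, G m c ∂treeLaw (sub false ν) ∂ν [] +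
        ∫⁻ m, ∫⁻ c, G m c ∂treeLaw (sub true ν) ∂ν [] := by
  have h1 : ∀ m, Measurable (G m) := fun m => hG.comp measurable_prodMk_left
  have h0 : Measurable fun p : Mark × (List Bool → Mark) × (List Bool → Mark) =>
      G p.1 p.2.1 + G p.1 p.2.2 :=
    (hG.comp (f := fun p : Mark × (List Bool → Mark) × (List Bool → Mark) => (p.1, p.2.1))
      (by fun_prop)).add (hG.comp (f := fun p : Mark × (List Bool → Mark) × (List Bool → Mark) =>
        (p.1, p.2.2)) (by fun_prop))
  rw [lintegral_treeLaw ν (F := fun m c₀ c₁ => G m c₀ + G m c₁) h0,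
    ← lintegral_add_left hG.lintegral_prod_right']
  refine lintegral_congr fun m => ?_
  simp_rw [lintegral_add_left (measurable_const (a := G m _))]
  rw [lintegral_add_right _ measurable_const]
  simp

/-- Bound on the expectation of a quantity that is bilinear in the contributions of the two
subtrees. -/
lemma lintegral_le_of_pair_branching {ν : List Bool → Measure Mark}
    [∀ u, IsProbabilityMeasure (ν u)] {w : Mark → ℝ≥0∞}
    {X : (List Bool → Mark) → (List Bool → Mark) → ℝ≥0∞} (hw : Measurable w)
    (hX : Measurable fun p : (List Bool → Mark) × (List Bool → Mark) => X p.1 p.2) {k B : ℝ≥0∞}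
    (hk : ∀ b, ∫⁻ c, X c c ∂treeLaw (sub b ν) ≤ k)
    (hB : ∀ b b', ∫⁻ c, ∫⁻ c', X c c' ∂treeLaw (sub b' ν) ∂treeLaw (sub b ν) ≤ B) :
    ∫⁻ c, w (c []) * (X (sub false c) (sub false c) + X (sub true c) (sub true c) +
      (X (sub false c) (sub true c) + X (sub true c) (sub false c))) ∂treeLaw ν ≤
      (∫⁻ m, w m ∂ν []) * (k + k + (B + B)) := by
  have hX1 : ∀ c, Measurable fun c' => X c c' := fun c => hX.comp measurable_prodMk_left
  have hX2 : ∀ c', Measurable fun c => X c c' := fun c' => hX.comp measurable_prodMk_right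
  have hX3 : Measurable fun c => X c c := hX.comp (measurable_id.prodMk measurable_id)
  have hX4 : Measurable fun p : (List Bool → Mark) × (List Bool → Mark) => X p.2 p.1 :=
    hX.comp (measurable_snd.prodMk measurable_fst)
  have hF : Measurable fun p : Mark × (List Bool → Mark) × (List Bool → Mark) =>
      w p.1 * (X p.2.1 p.2.1 + X p.2.2 p.2.2 + (X p.2.1 p.2.2 + X p.2.2 p.2.1)) := by
    have h1 := hX3.comp (f := fun p : Mark × (List Bool → Mark) × (List Bool → Mark) => p.2.1)
      (by fun_prop)
    have h2 := hX3.comp (f := fun p : Mark × (List Bool → Mark) × (List Bool → Mark) => p.2.2)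
      (by fun_prop)
    have h3 := hX.comp (f := fun p : Mark × (List Bool → Mark) × (List Bool → Mark) => p.2)
      (by fun_prop)
    have h4 := hX4.comp (f := fun p : Mark × (List Bool → Mark) × (List Bool → Mark) => p.2)
      (by fun_prop)
    exact (hw.comp measurable_fst).mul ((h1.add h2).add (h3.add h4))
  rw [lintegral_treeLaw ν (F := fun m c₀ c₁ => w m * (X c₀ c₀ + X c₁ c₁ + (X c₀ c₁ + X c₁ c₀))) hF,
    ← lintegral_mul_const _ hw]
  refine lintegral_mono fun m => ?_
  have hin : ∀ c₀, Measurable fun c₁ => X c₀ c₀ + X c₁ c₁ + (X c₀ c₁ + X c₁ c₀) := fun c₀ =>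
    (measurable_const.add hX3).add ((hX1 c₀).add (hX2 c₀))
  have e : ∀ c₀, ∫⁻ c₁, w m * (X c₀ c₀ + X c₁ c₁ + (X c₀ c₁ + X c₁ c₀)) ∂treeLaw (sub true ν) =
      w m * (X c₀ c₀ + ∫⁻ c₁, X c₁ c₁ ∂treeLaw (sub true ν) +
        (∫⁻ c₁, X c₀ c₁ ∂treeLaw (sub true ν) + ∫⁻ c₁, X c₁ c₀ ∂treeLaw (sub true ν))) := by
    intro c₀
    have hin' : Measurable fun c₁ => X c₀ c₀ + X c₁ c₁ := measurable_const.add hX3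
    rw [lintegral_const_mul _ (hin c₀), lintegral_add_left hin',
      lintegral_add_left measurable_const, lintegral_add_left (hX1 c₀)]
    simp
  simp_rw [e]
  have m1 : Measurable fun c => ∫⁻ c', X c c' ∂treeLaw (sub true ν) := hX.lintegral_prod_right'
  have m2 : Measurable fun c => ∫⁻ c', X c' c ∂treeLaw (sub true ν) := hX4.lintegral_prod_right'
  have m3 : Measurable fun c => X c c + ∫⁻ c', X c' c' ∂treeLaw (sub true ν) :=
    hX3.add measurable_const
  have m4 : Measurable fun c => ∫⁻ c', X c c' ∂treeLaw (sub true ν) +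
      ∫⁻ c', X c' c ∂treeLaw (sub true ν) := m1.add m2
  rw [lintegral_const_mul _ (by exact m3.add m4), lintegral_add_left m3, lintegral_add_left hX3, lintegral_add_left m1,
    lintegral_const, measure_univ, mul_one]
  gcongr
  · exact hk false
  · exact hk true
  · exact hB false true
  · rw [lintegral_lintegral_swap hX4.aemeasurable]
    exact hB true false

lemma lintegral_mul_densityMass (n : ℕ) {ν : List Bool → Measure Mark}
    [∀ u, IsProbabilityMeasure (ν u)] {φ : ℝ → ℝ≥0∞} (hφ : Measurable φ) :
    ∫⁻ r, φ r * ∫⁻ c, density β n c r ∂treeLaw ν =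
      ∫⁻ c, ∫⁻ r, φ r * density β n c r ∂volume ∂treeLaw ν := by
  rw [lintegral_lintegral_swap (f := fun c r => φ r * density β n c r)
    (Measurable.aemeasurable (by fun_prop))]
  refine lintegral_congr fun r => ?_
  rw [lintegral_const_mul _ (by fun_prop)]

/-- The root motion alone supplies the smoothing. For a fixed position r in a subtree, the root mark
is integrated first, and `K` bounds this uniformly in r; only the mean masses of the subtrees
remain. -/
lemma lintegral_lintegral_density_succ_le (n : ℕ) {ν : List Bool → Measure Mark}
    [∀ u, IsProbabilityMeasure (ν u)] {φ : ℝ → ℝ≥0∞} (hφ : Measurable φ) {K : ℝ≥0∞}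
    (hK : ∀ r, ∫⁻ m, lifeWeight β m * φ (m.2.1 + Real.exp m.2.2.1 * r) ∂ν [] ≤ K) :
    ∫⁻ c, ∫⁻ r, φ r * density β (n + 1) c r ∂volume ∂treeLaw ν ≤
      K * (∫⁻ c, densityMass β n c ∂treeLaw (sub false ν) +
        ∫⁻ c, densityMass β n c ∂treeLaw (sub true ν)) := by
  set G : Mark → (List Bool → Mark) → ℝ≥0∞ := fun m c => lifeWeight β m *
    ∫⁻ r, φ (m.2.1 + Real.exp m.2.2.1 * r) * density β n c r with hGdef
  have hG : Measurable fun p : Mark × (List Bool → Mark) => G p.1 p.2 :=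
    Measurable.mul (by fun_prop) (Measurable.lintegral_prod_right'
      (f := fun p : (Mark × (List Bool → Mark)) × ℝ =>
        φ (p.1.1.2.1 + Real.exp p.1.1.2.2.1 * p.2) * density β n p.1.2 p.2) (by fun_prop))
  have hb : ∀ b, ∫⁻ m, ∫⁻ c, G m c ∂treeLaw (sub b ν) ∂ν [] ≤
      K * ∫⁻ c, densityMass β n c ∂treeLaw (sub b ν) := by
    intro b
    calc _ = ∫⁻ m, ∫⁻ c, ∫⁻ r, density β n c r * (lifeWeight β m *
          φ (m.2.1 + Real.exp m.2.2.1 * r)) ∂volume ∂treeLaw (sub b ν) ∂ν [] := by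
          refine lintegral_congr fun m => lintegral_congr fun c => ?_
          simp only [hGdef]
          rw [← lintegral_const_mul _ (by fun_prop)]
          refine lintegral_congr fun r => by ring
      _ = ∫⁻ c, ∫⁻ r, ∫⁻ m, density β n c r * (lifeWeight β m *
          φ (m.2.1 + Real.exp m.2.2.1 * r)) ∂ν [] ∂volume ∂treeLaw (sub b ν) := by
          rw [lintegral_lintegral_swap]
          · refine lintegral_congr fun c => ?_
            rw [lintegral_lintegral_swap]
            exact Measurable.aemeasurable (by fun_prop)
          · refine (Measurable.lintegral_prod_right' (f := fun p : (Mark × (List Bool → Mark)) × ℝ =>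
              density β n p.1.2 p.2 * (lifeWeight β p.1.1 *
                φ (p.1.1.2.1 + Real.exp p.1.1.2.2.1 * p.2))) (by fun_prop)).aemeasurable
      _ ≤ ∫⁻ c, ∫⁻ r, density β n c r * K ∂volume ∂treeLaw (sub b ν) := by
          gcongr with c r
          rw [lintegral_const_mul _ (by fun_prop)]
          gcongr
          exact hK r
      _ = _ := by
          rw [← lintegral_const_mul _ (by fun_prop)]
          refine lintegral_congr fun c => ?_
          rw [lintegral_mul_const _ (by fun_prop), mul_comm, densityMass]
  calc _ = ∫⁻ c, (G (c []) (sub false c) + G (c []) (sub true c)) ∂treeLaw ν := by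
        refine lintegral_congr fun c => ?_
        rw [lintegral_mul_density_succ n c hφ, mul_add]
    _ ≤ _ := by
        rw [lintegral_root_add hG, mul_add]
        exact add_le_add (hb false) (hb true)

/-- The mean densities are bounded if `β > 1/2`. -/
lemma exists_ae_lintegral_density_le (hβ : 1 / 2 < β) (C : ℝ≥0) :
    ∃ K < ∞, ∀ (n : ℕ) (ν : List Bool → Measure Mark), (∀ u, IsMarkLaw β C (ν u)) →
      ∀ᵐ r, ∫⁻ c, density β n c r ∂treeLaw ν ≤ K := by
  have hβ0 : 0 < β := by linarith
  obtain ⟨K₁, hK₁, h1⟩ := exists_lintegral_densityMass_le hβ0 C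
  obtain ⟨K₂, hK₂, h2⟩ := IsMarkLaw.exists_lintegral_density_le hβ C
  refine ⟨K₁ + 2 * (K₂ * K₁), by finiteness, fun n ν hν => ?_⟩
  have := fun u => (hν u).isProbabilityMeasure hβ0
  cases n with
  | zero =>
    refine .of_forall fun r => le_add_of_le_left ?_
    refine le_trans (lintegral_mono fun c => ?_) (h1 0 ν hν)
    rw [density, densityMass_zero]
    refine mul_le_of_le_one_right zero_le ?_
    exact Set.indicator_le_self' (fun _ _ => zero_le) r
  | succ n =>
    -- The mean density is compared with a constant by integrating over arbitrary sets, that is,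
    -- with indicators as test functions for the root kernel.
    refine ae_le_of_forall_setLIntegral_le_of_sigmaFinite
      (measurable_density_uncurry (n + 1)).lintegral_prod_left' fun s hs _ => ?_
    set φ : ℝ → ℝ≥0∞ := s.indicator 1
    have hφ : Measurable φ := measurable_one.indicator hs
    have e : ∫⁻ r in s, ∫⁻ c, density β (n + 1) c r ∂treeLaw ν =
        ∫⁻ r, φ r * ∫⁻ c, density β (n + 1) c r ∂treeLaw ν := by
      rw [← lintegral_indicator hs]
      refine lintegral_congr fun r => ?_
      by_cases h : r ∈ s <;> simp [φ, h]
    rw [e, lintegral_mul_densityMass _ hφ, lintegral_const, Measure.restrict_apply_univ]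
    calc _ ≤ K₂ * volume s * (K₁ + K₁) := by
          refine (lintegral_lintegral_density_succ_le n hφ (K := K₂ * volume s) fun r => ?_).trans ?_
          · refine (h2 _ (hν []) φ r hφ).trans (le_of_eq ?_)
            rw [lintegral_indicator_one hs]
          · gcongr
            · exact h1 n (sub false ν) fun u => hν _
            · exact h1 n (sub true ν) fun u => hν _
      _ = 2 * (K₂ * K₁) * volume s := by ring
      _ ≤ _ := by gcongr; exact le_add_self

/-- Writing (a+b)^p = (a+b)(a+b)^(p-1), the power p - 1 ≤ 1 is subadditive. This separates the
diagonal terms, which contract, from the mixed terms, whose factors come from independent subtrees.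
-/
lemma add_rpow_le_of_le_two (a b : ℝ≥0∞) {p : ℝ} (hp : 1 < p) (hp2 : p ≤ 2) :
    (a + b) ^ p ≤ a * a ^ (p - 1) + b * b ^ (p - 1) + (a * b ^ (p - 1) + b * a ^ (p - 1)) := by
  rw [show p = 1 + (p - 1) by ring, ENNReal.rpow_add_of_nonneg _ _ zero_le_one (by linarith),
    ENNReal.rpow_one]
  calc _ ≤ (a + b) * (a ^ (1 + (p - 1) - 1) + b ^ (1 + (p - 1) - 1)) := by
        rw [add_sub_cancel_left]
        gcongr
        exact ENNReal.rpow_add_le_add_rpow _ _ (by linarith) (by linarith)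
    _ = _ := by ring

/-- A diagonal term is multiplied by e^(-pβτ) Y^(1-p): the p-th power of the weight and of the
Jacobian, times the length element. The mixed terms are bounded through the mean density. -/
lemma exists_lintegral_density_rpow_le (hβ : 1 / 2 < β) {p : ℝ} (hp : 1 < p) (hp2 : p ≤ 2)
    (hpβ : p < 2 * β) (C : ℝ≥0) :
    ∃ K < ∞, ∀ (n : ℕ) (ν : List Bool → Measure Mark), (∀ u, IsMarkLaw β C (ν u)) →
      ∫⁻ c, ∫⁻ r, density β n c r * density β n c r ^ (p - 1) ∂volume ∂treeLaw ν ≤ K := by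
  have hβ0 : 0 < β := by linarith
  obtain ⟨K₁, hK₁, h1⟩ := exists_lintegral_densityMass_le hβ0 C
  obtain ⟨K₂, hK₂, h2⟩ := exists_ae_lintegral_density_le hβ C
  set q := ENNReal.ofReal (β / (β + p * β - (1 - p) * (1 - p - 1) / 2))
  -- Equivalent to (p - 1)(β - p/2) > 0, hence the condition p < 2β.
  have hden : 2 * β < β + p * β - (1 - p) * (1 - p - 1) / 2 := by nlinarith
  have hq : 2 * q < 1 := by
    refine two_mul_ofReal_lt_one ?_
    rw [mul_div_assoc', div_lt_one (by linarith)]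
    exact hden
  set B := K₁ * K₂ ^ (p - 1)
  have hB : B < ∞ := ENNReal.mul_lt_top hK₁
    (ENNReal.rpow_lt_top_of_nonneg (by linarith) hK₂.ne)
  -- The starting value 6 comes from generation 0, where the density is W on [0, 1]: W^p ≤ W² + 1
  -- has mean at most 5 + 1.
  obtain ⟨K, hK, hK6, hKq⟩ := exists_contraction_bound hq (B := q * (B + B)) (B' := 6)
    (ENNReal.mul_lt_top ENNReal.ofReal_lt_top (ENNReal.add_lt_top.2 ⟨hB, hB⟩)) (by simp)
  refine ⟨K, hK, fun n => ?_⟩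
  induction n with
  | zero =>
    intro ν hν
    have := fun u => (hν u).isProbabilityMeasure hβ0
    refine le_trans ?_ hK6
    have hle : ∀ c, ∫⁻ r, density β 0 c r * density β 0 c r ^ (p - 1) ≤
        yuleLimit β c ^ 2 + 1 := by
      intro c
      calc _ ≤ ∫⁻ r, (Set.Icc (0 : ℝ) 1).indicator (fun _ => yuleLimit β c ^ 2 + 1) r := by
            gcongr with r
            by_cases h : r ∈ Set.Icc (0 : ℝ) 1
            · simp only [density, h, Set.indicator_of_mem, Pi.one_apply, mul_one]
              nth_rewrite 1 [← ENNReal.rpow_one (yuleLimit β c)]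
              rw [← ENNReal.rpow_add_of_nonneg _ _ zero_le_one (by linarith), add_sub_cancel,
                ← ENNReal.rpow_natCast]
              rcases le_total (yuleLimit β c) 1 with h | h
              · exact le_add_of_le_right (ENNReal.rpow_le_one h (by linarith))
              · exact le_add_of_le_left (ENNReal.rpow_le_rpow_of_exponent_le h (by simpa))
            · simp [density, h]
        _ = _ := by rw [lintegral_indicator measurableSet_Icc]; simp
    refine (lintegral_mono hle).trans ?_
    rw [lintegral_add_right _ measurable_const]
    simp only [lintegral_const, measure_univ, mul_one]
    calc _ ≤ (5 : ℝ≥0∞) + 1 := by gcongr; exact lintegral_yuleLimit_sq_le hβ0 hν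
      _ = 6 := by norm_num
  | succ n ih =>
    intro ν hν
    have := fun u => (hν u).isProbabilityMeasure hβ0
    set w : Mark → ℝ≥0∞ := fun m => .ofReal (Real.exp (-(p * β) * m.1 + (1 - p) * m.2.2.1))
    have hw : Measurable w := by fun_prop
    set X : (List Bool → Mark) → (List Bool → Mark) → ℝ≥0∞ := fun c c' =>
      ∫⁻ r, density β n c r * density β n c' r ^ (p - 1)
    have hX : Measurable fun p : (List Bool → Mark) × (List Bool → Mark) => X p.1 p.2 :=
      Measurable.lintegral_prod_right' (f := fun q : ((List Bool → Mark) × (List Bool → Mark)) × ℝ =>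
        density β n q.1.1 q.2 * density β n q.1.2 q.2 ^ (p - 1)) (by fun_prop)
    have hstep : ∀ c, ∫⁻ r, density β (n + 1) c r * density β (n + 1) c r ^ (p - 1) ≤
        w (c []) * (X (sub false c) (sub false c) + X (sub true c) (sub true c) +
          (X (sub false c) (sub true c) + X (sub true c) (sub false c))) := by
      intro c
      set x := (c []).2.1
      set η := (c []).2.2.1
      have hpow : ∀ a : ℝ≥0∞, a * a ^ (p - 1) = a ^ p := fun a => by
        nth_rewrite 1 [← ENNReal.rpow_one a]
        rw [← ENNReal.rpow_add_of_nonneg _ _ zero_le_one (by linarith), add_sub_cancel]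
      simp only [X]
      rw [← lintegral_add_left (by fun_prop), ← lintegral_add_left (by fun_prop),
        ← lintegral_add_left (by fun_prop), ← lintegral_const_mul _ (by fun_prop)]
      conv_rhs => rw [← lintegral_affine (by fun_prop) x η]
      refine lintegral_mono fun r => ?_
      rw [hpow, density]
      set u := (r - x) * Real.exp (-η)
      rw [ENNReal.mul_rpow_of_nonneg _ _ (by linarith), ENNReal.mul_rpow_of_nonneg _ _ (by linarith)]
      refine (mul_le_mul_right (mul_le_mul_right (add_rpow_le_of_le_two _ _ hp hp2) _) _).trans
        (le_of_eq ?_)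
      rw [← mul_assoc, ← mul_assoc]
      congr 1
      rw [lifeWeight, ENNReal.ofReal_rpow_of_pos (by positivity),
        ENNReal.ofReal_rpow_of_pos (by positivity), ← ENNReal.ofReal_mul (by positivity),
        ← ENNReal.ofReal_mul (by positivity), ← Real.exp_mul, ← Real.exp_mul, ← Real.exp_add,
        ← Real.exp_add]
      congr 2
      ring
    -- Here the two subtrees are taken independent. Averaging the second one, Jensen's inequality
    -- for the concave power p - 1 replaces its density by the bounded mean density.
    have hcross : ∀ b b', ∫⁻ c, ∫⁻ c', X c c' ∂treeLaw (sub b' ν) ∂treeLaw (sub b ν) ≤ B := by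
      intro b b'
      have h3 : ∀ c, ∫⁻ c', X c c' ∂treeLaw (sub b' ν) ≤ densityMass β n c * K₂ ^ (p - 1) := by
        intro c
        rw [lintegral_lintegral_swap (Measurable.aemeasurable
          (by fun_prop)), densityMass,
          ← lintegral_mul_const _ (by fun_prop)]
        refine lintegral_mono_ae ?_
        filter_upwards [h2 n (sub b' ν) fun u => hν _] with r hr
        rw [lintegral_const_mul _ (by fun_prop)]
        gcongr
        refine (lintegral_rpow_le_rpow_lintegral _ (by fun_prop) (by linarith)
          (by linarith)).trans ?_
        gcongr
      refine (lintegral_mono h3).trans ?_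
      rw [lintegral_mul_const _ (by fun_prop)]
      exact mul_le_mul_left (h1 n (sub b ν) fun u => hν _) _
    refine (lintegral_mono hstep).trans ((lintegral_le_of_pair_branching hw hX (k := K) (B := B)
      (fun b => ih (sub b ν) fun u => hν _) hcross).trans ?_)
    rw [(hν []).lintegral_exp hβ0 (by linarith)]
    calc _ = q * (B + B) + q * (K + K) := by ring
      _ ≤ K := hKq

/-- The approximate densities are bounded in `L ^ p` along a subsequence, if `β > 1/2`. -/
lemma ae_liminf_density_rpow_ne_top (hβ : 1 / 2 < β) {p : ℝ} (hp : 1 < p) (hp2 : p ≤ 2)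
    (hpβ : p < 2 * β) {ν : List Bool → Measure Mark} (hν : ∀ u, IsMarkLaw β C (ν u)) :
    ∀ᵐ c ∂treeLaw ν,
      liminf (fun n => ∫⁻ r, density β n c r * density β n c r ^ (p - 1)) atTop ≠ ∞ := by
  obtain ⟨K, hK, h⟩ := exists_lintegral_density_rpow_le hβ hp hp2 hpβ C
  have hm : ∀ n, Measurable fun c : List Bool → Mark =>
      ∫⁻ r, density β n c r * density β n c r ^ (p - 1) := fun n =>
    Measurable.lintegral_prod_right' (f := fun q : (List Bool → Mark) × ℝ =>
        density β n q.1 q.2 * density β n q.1 q.2 ^ (p - 1)) (by fun_prop)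
  have hle : ∫⁻ c, liminf (fun n => ∫⁻ r, density β n c r * density β n c r ^ (p - 1)) atTop
      ∂treeLaw ν ≤ K :=
    (lintegral_liminf_le hm).trans (liminf_le_of_frequently_le'
      (Frequently.of_forall fun n => h n ν hν))
  filter_upwards [ae_lt_top (.liminf hm) (ne_top_of_le_ne_top hK.ne hle)] with c hc using hc.ne

end

/-! ### Energies of the approximate densities -/

section Energy

variable {β s : ℝ} {C : ℝ≥0}

@[fun_prop] lemma Measurable.riesz {α : Type*} [MeasurableSpace α] {f g : α → ℝ}
    (hf : Measurable f) (hg : Measurable g) (s : ℝ) :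
    Measurable fun x => riesz s (f x) (g x) := (measurable_riesz s).comp (hf.prodMk hg)

/-- The weight `|x| ^ (2 s)`. -/
def mom (s x : ℝ) : ℝ≥0∞ := .ofReal (|x| ^ (2 * s))

@[fun_prop] lemma measurable_mom (s : ℝ) : Measurable (mom s) := by unfold mom; fun_prop

/-- According to whether |x| ≤ δ e^η |r| or not, the sum is at most 1 + δ times the scaled point or
1 + 1/δ times the shift. The factor of the scaled point stays close to 1, so a strict contraction
survives; 2s ≤ 2 allows squares of the constants. -/
lemma mom_affine_le (hs : 0 < s) (hs1 : s < 1) {δ : ℝ} (hδ : 0 < δ) (x η r : ℝ) :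
    mom s (x + Real.exp η * r) ≤ .ofReal ((1 + δ) ^ 2) * (.ofReal (Real.exp (2 * s * η)) * mom s r) +
      .ofReal ((1 + 1 / δ) ^ 2) * mom s x := by
  have hpow : ∀ a : ℝ, 1 ≤ a → a ^ (2 * s) ≤ a ^ 2 := fun a ha => by
    rw [← Real.rpow_natCast]
    exact Real.rpow_le_rpow_of_exponent_le ha (by push_cast; linarith)
  have h1 : |x + Real.exp η * r| ≤ |x| + Real.exp η * |r| := by
    refine (abs_add_le _ _).trans ?_
    rw [abs_mul, abs_of_pos (Real.exp_pos _)]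
  have e : ENNReal.ofReal (Real.exp (2 * s * η)) * mom s r =
      .ofReal ((Real.exp η * |r|) ^ (2 * s)) := by
    rw [mom, ← ENNReal.ofReal_mul (by positivity), Real.mul_rpow (by positivity) (by positivity),
      ← Real.exp_mul, mul_comm η]
  rw [e, mom, mom, ← ENNReal.ofReal_mul (by positivity), ← ENNReal.ofReal_mul (by positivity)]
  have hr : 0 ≤ Real.exp η * |r| := by positivity
  rcases le_total |x| (δ * (Real.exp η * |r|)) with h | h
  · refine le_add_of_le_left (ENNReal.ofReal_le_ofReal ?_)
    calc _ ≤ ((1 + δ) * (Real.exp η * |r|)) ^ (2 * s) := by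
          gcongr; linarith
      _ = (1 + δ) ^ (2 * s) * (Real.exp η * |r|) ^ (2 * s) :=
          Real.mul_rpow (by positivity) (by positivity)
      _ ≤ _ := by gcongr; exact hpow _ (by linarith)
  · refine le_add_of_le_right (ENNReal.ofReal_le_ofReal ?_)
    calc _ ≤ ((1 + 1 / δ) * |x|) ^ (2 * s) := by
          gcongr
          have : Real.exp η * |r| ≤ |x| / δ := by rwa [le_div_iff₀ hδ, mul_comm]
          calc _ ≤ |x| + |x| / δ := by linarith
            _ = _ := by ring
      _ = (1 + 1 / δ) ^ (2 * s) * |x| ^ (2 * s) :=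
          Real.mul_rpow (by positivity) (by positivity)
      _ ≤ _ := by
          gcongr; exact hpow _ (by have : 0 < 1 / δ := by positivity
                                   linarith)

/-- The Riesz potential of an approximate density with the weight
`mom a`. -/
@[irreducible] def pot (β s a : ℝ) (n : ℕ) (c : List Bool → Mark) (y : ℝ) : ℝ≥0∞ :=
  ∫⁻ r, mom a r * riesz s r y * density β n c r

/-- The mutual energy of two approximate densities, the first one with the weight `mom a`. -/
def energy (β s a : ℝ) (n : ℕ) (c c' : List Bool → Mark) : ℝ≥0∞ :=
  ∫⁻ y, pot β s a n c y * density β n c' y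

variable {a : ℝ}

@[simp] lemma mom_zero (x : ℝ) : mom 0 x = 1 := by simp [mom]

lemma measurable_pot_uncurry (n : ℕ) :
    Measurable fun p : (List Bool → Mark) × ℝ => pot β s a n p.1 p.2 := by
  unfold pot
  exact Measurable.lintegral_prod_right' (f := fun p : ((List Bool → Mark) × ℝ) × ℝ =>
    mom a p.2 * riesz s p.2 p.1.2 * density β n p.1.1 p.2) (by fun_prop)

@[fun_prop] lemma measurable_pot {α : Type*} [MeasurableSpace α] {f : α → List Bool → Mark}
    {h : α → ℝ} (hf : Measurable f) (hh : Measurable h) (n : ℕ) :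
    Measurable fun x => pot β s a n (f x) (h x) :=
  (measurable_pot_uncurry (β := β) (s := s) (a := a) n).comp (hf.prodMk hh)

lemma measurable_energy (n : ℕ) :
    Measurable fun p : (List Bool → Mark) × (List Bool → Mark) => energy β s a n p.1 p.2 :=
  Measurable.lintegral_prod_right' (f := fun p : ((List Bool → Mark) × (List Bool → Mark)) × ℝ =>
    pot β s a n p.1.1 p.2 * density β n p.1.2 p.2) (by fun_prop)

lemma pot_one_succ (n : ℕ) (c : List Bool → Mark) (y : ℝ) :
    pot β s 0 (n + 1) c ((c []).2.1 + Real.exp (c []).2.2.1 * y) =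
      lifeWeight β (c []) * .ofReal (Real.exp (-s * (c []).2.2.1)) *
        (pot β s 0 n (sub false c) y + pot β s 0 n (sub true c) y) := by
  simp only [pot, mom_zero, one_mul]
  rw [lintegral_mul_density_succ n c (φ := fun r => riesz s r _) (by fun_prop), mul_assoc]
  congr 1
  simp_rw [riesz_affine, mul_assoc]
  rw [lintegral_const_mul _ (by fun_prop), lintegral_const_mul _ (by fun_prop), mul_add]

/-- Scaling by e^η multiplies the weight by e^(2sη) and the kernel by e^(-sη), so the weighted
potential carries e^(sη). The shift of the weight leaves an unweighted potential. -/
lemma pot_mom_succ_le (hs : 0 < s) (hs1 : s < 1) {δ : ℝ} (hδ : 0 < δ) (n : ℕ)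
    (c : List Bool → Mark) (y : ℝ) :
    pot β s s (n + 1) c ((c []).2.1 + Real.exp (c []).2.2.1 * y) ≤
      .ofReal ((1 + δ) ^ 2) * (lifeWeight β (c []) * .ofReal (Real.exp (s * (c []).2.2.1))) *
        (pot β s s n (sub false c) y + pot β s s n (sub true c) y) +
      .ofReal ((1 + 1 / δ) ^ 2) * (lifeWeight β (c []) *
        (.ofReal (Real.exp (-s * (c []).2.2.1)) * mom s (c []).2.1)) *
        (pot β s 0 n (sub false c) y + pot β s 0 n (sub true c) y) := by
  set x := (c []).2.1
  set η := (c []).2.2.1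
  have hb : ∀ b, ∫⁻ r, mom s (x + Real.exp η * r) * riesz s (x + Real.exp η * r)
      (x + Real.exp η * y) * density β n (sub b c) r ≤
      .ofReal ((1 + δ) ^ 2) * .ofReal (Real.exp (s * η)) * pot β s s n (sub b c) y +
      .ofReal ((1 + 1 / δ) ^ 2) * (.ofReal (Real.exp (-s * η)) * mom s x) *
        pot β s 0 n (sub b c) y := by
    intro b
    have hm := measurable_mom s
    rw [pot, pot, ← lintegral_const_mul _ (by fun_prop), ← lintegral_const_mul _ (by fun_prop),
      ← lintegral_add_left (by fun_prop)]
    refine lintegral_mono fun r => ?_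
    rw [riesz_affine]
    have he : ENNReal.ofReal (Real.exp (s * η)) =
        .ofReal (Real.exp (2 * s * η)) * .ofReal (Real.exp (-s * η)) := by
      rw [← ENNReal.ofReal_mul (by positivity), ← Real.exp_add]
      congr 2; ring
    rw [he, mom_zero, one_mul]
    calc _ ≤ (.ofReal ((1 + δ) ^ 2) * (.ofReal (Real.exp (2 * s * η)) * mom s r) +
          .ofReal ((1 + 1 / δ) ^ 2) * mom s x) * (.ofReal (Real.exp (-s * η)) * riesz s r y) *
            density β n (sub b c) r := by
          gcongr; exact mom_affine_le hs hs1 hδ x η r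
      _ = _ := by ring
  have hm := measurable_mom s
  rw [pot, lintegral_mul_density_succ n c (φ := fun r => mom s r * riesz s r _) (by fun_prop)]
  refine (mul_le_mul_right (add_le_add (hb false) (hb true)) _).trans (le_of_eq ?_)
  ring

lemma lintegral_Icc_riesz_le (hs : 0 < s) (hs1 : s < 1) (y : ℝ) :
    ∫⁻ r in Set.Icc 0 1, riesz s r y ≤ 1 + .ofReal (2 / (1 - s)) := by
  calc _ ≤ ∫⁻ r in Set.Icc 0 1, (1 + (Metric.ball y 1).indicator (fun r => riesz s r y) r) := by
        refine lintegral_mono fun r => ?_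
        by_cases h : r ∈ Metric.ball y 1
        · simp [h]
        · refine le_add_of_le_left ?_
          rw [Metric.mem_ball, not_lt, Real.dist_eq] at h
          rw [riesz, Real.enorm_eq_ofReal_abs]
          exact ENNReal.rpow_le_one_of_one_le_of_neg (by simpa using h) (by linarith)
    _ ≤ _ := by
        rw [lintegral_add_left measurable_const]
        gcongr
        · simp
        · refine (setLIntegral_le_lintegral _ _).trans ?_
          rw [lintegral_indicator measurableSet_ball]
          simpa using lintegral_riesz_ball_le hs1 one_pos y

lemma mom_le_one (ha : 0 ≤ a) : ∀ r ∈ Set.Icc (0 : ℝ) 1, mom a r ≤ 1 := fun r hr => by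
  rw [mom, ← ENNReal.ofReal_one]
  refine ENNReal.ofReal_le_ofReal (Real.rpow_le_one (abs_nonneg _) ?_ (by linarith))
  rw [abs_of_nonneg hr.1]; exact hr.2

lemma pot_zero_le (hs : 0 < s) (hs1 : s < 1) (ha : 0 ≤ a) (c : List Bool → Mark) (y : ℝ) :
    pot β s a 0 c y ≤ yuleLimit β c * (1 + .ofReal (2 / (1 - s))) := by
  rw [pot, lintegral_mul_density_zero c (by fun_prop)]
  gcongr
  refine le_trans (setLIntegral_mono' measurableSet_Icc fun r hr => ?_)
    (lintegral_Icc_riesz_le hs hs1 y)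
  exact mul_le_of_le_one_left zero_le (mom_le_one ha r hr)

/-- The root motion smooths the kernel uniformly in y, so no contraction is needed: only the mean
masses of the subtrees enter. -/
lemma exists_lintegral_pot_one_le (hβ : 0 < β) (hs : 0 < s) (hs1 : s < 1) (hsβ : s < β)
    (C : ℝ≥0) : ∃ K < ∞, ∀ (n : ℕ) (ν : List Bool → Measure Mark), (∀ u, IsMarkLaw β C (ν u)) →
      ∀ y, ∫⁻ c, pot β s 0 n c y ∂treeLaw ν ≤ K := by
  obtain ⟨K₁, hK₁, h1⟩ := exists_lintegral_densityMass_le hβ C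
  obtain ⟨K₂, hK₂, h2⟩ := IsMarkLaw.exists_lintegral_riesz_le hs hs1 (β := β) (by linarith) C
  refine ⟨K₁ * (1 + .ofReal (2 / (1 - s))) + K₂ * (K₁ + K₁), by finiteness, fun n ν hν y => ?_⟩
  have := fun u => (hν u).isProbabilityMeasure hβ
  cases n with
  | zero =>
    refine le_add_of_le_left ((lintegral_mono fun c => pot_zero_le hs hs1
      le_rfl c y).trans ?_)
    rw [lintegral_mul_const _ (by fun_prop)]
    gcongr
    simpa only [densityMass_zero] using h1 0 ν hν
  | succ n =>
    refine le_add_of_le_right ?_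
    simp only [pot, mom_zero, one_mul]
    refine (lintegral_lintegral_density_succ_le n (φ := fun r => riesz s r y) (by fun_prop)
      (K := K₂) fun r => h2 _ (hν []) r y).trans ?_
    gcongr
    · exact h1 n (sub false ν) fun u => hν _
    · exact h1 n (sub true ν) fun u => hν _

/-- The room s(1-s)/2 is the gain from the moment of order s of Y. With δ ≤ 1 the left side exceeds
2β by at most 6βδ, and δ ≤ s(1-s)/(24β) makes this at most half of the room. -/
lemma exists_slack (hβ : 0 < β) (hs : 0 < s) (hs1 : s < 1) :
    ∃ δ > 0, (1 + δ) ^ 2 * (2 * β) < 2 * β + s * (1 - s) / 2 := by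
  have h1 : 0 < s * (1 - s) := mul_pos hs (by linarith)
  refine ⟨min 1 (s * (1 - s) / (24 * β)), by positivity, ?_⟩
  set δ := min 1 (s * (1 - s) / (24 * β))
  have h0 : 0 < δ := by positivity
  have hδ1 : δ ≤ 1 := min_le_left _ _
  have hδ2 : δ * (24 * β) ≤ s * (1 - s) := by
    rw [← le_div_iff₀ (by positivity)]; exact min_le_right _ _
  have : δ * δ * β ≤ δ * 1 * β := by gcongr
  nlinarith

/-- The weighted potential satisfies a recursion with factor (1+δ)² β / (2β + s(1-s)/2) < 1/2 per
child. The inhomogeneous term is the shear moment times the unweighted potential. -/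
lemma exists_lintegral_pot_mom_le (hβ : 0 < β) (hs : 0 < s) (hs1 : s < 1) (hsβ : s < β)
    (C : ℝ≥0) : ∃ K < ∞, ∀ (n : ℕ) (ν : List Bool → Measure Mark), (∀ u, IsMarkLaw β C (ν u)) →
      ∀ y, ∫⁻ c, pot β s s n c y ∂treeLaw ν ≤ K := by
  obtain ⟨K₁, hK₁, h1⟩ := exists_lintegral_densityMass_le hβ C
  obtain ⟨V, hV, hpot⟩ := exists_lintegral_pot_one_le hβ hs hs1 hsβ C
  obtain ⟨S, hS, hshear⟩ := IsMarkLaw.exists_lintegral_shear_le hs hs1.le (β := β) (l := β)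
    (by linarith) C
  obtain ⟨δ, hδ, hslack⟩ := exists_slack hβ hs hs1
  have hden : 0 < β + β - s * (s - 1) / 2 := by nlinarith
  set q := ENNReal.ofReal ((1 + δ) ^ 2 * (β / (β + β - s * (s - 1) / 2)))
  have hq : 2 * q < 1 := by
    refine two_mul_ofReal_lt_one ?_
    rw [mul_div_assoc', mul_div_assoc', div_lt_one hden]
    linarith
  set B := ENNReal.ofReal ((1 + 1 / δ) ^ 2) * S
  obtain ⟨K, hK, hK0, hKq⟩ := exists_contraction_bound hq (B := B * (V + V))
    (B' := K₁ * (1 + .ofReal (2 / (1 - s)))) (by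
      have : B < ∞ := ENNReal.mul_lt_top ENNReal.ofReal_lt_top hS
      exact ENNReal.mul_lt_top this (ENNReal.add_lt_top.2 ⟨hV, hV⟩)) (by finiteness)
  refine ⟨K, hK, fun n => ?_⟩
  induction n with
  | zero =>
    intro ν hν y
    refine le_trans ((lintegral_mono fun c => pot_zero_le hs hs1
      hs.le c y).trans ?_) hK0
    rw [lintegral_mul_const _ (by fun_prop)]
    gcongr
    simpa only [densityMass_zero] using h1 0 ν hν
  | succ n ih =>
    intro ν hν y
    have := fun u => (hν u).isProbabilityMeasure hβ
    -- The preimage of y under the root map. The induction hypothesis is uniform in y, so it may be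
    -- applied at this random point, which is independent of the subtrees.
    set y' : Mark → ℝ := fun m => (y - m.2.1) * Real.exp (-m.2.2.1)
    have hy' : ∀ m : Mark, m.2.1 + Real.exp m.2.2.1 * y' m = y := fun m => by
      simp only [y']
      rw [mul_left_comm, ← Real.exp_add]; simp
    have hy'm : Measurable y' := by fun_prop
    have hm := measurable_mom s
    set F₁ : Mark → ℝ≥0∞ := fun m => .ofReal ((1 + δ) ^ 2) *
      (lifeWeight β m * .ofReal (Real.exp (s * m.2.2.1)))
    set F₂ : Mark → ℝ≥0∞ := fun m => .ofReal ((1 + 1 / δ) ^ 2) * (lifeWeight β m *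
        (.ofReal (Real.exp (-s * m.2.2.1)) * mom s m.2.1))
    have hF₁ : Measurable F₁ := by fun_prop
    have hF₂ : Measurable F₂ := by fun_prop
    have hF₁q : ∫⁻ m, F₁ m ∂ν [] = q := by
      have e : ∀ m : Mark, lifeWeight β m * .ofReal (Real.exp (s * m.2.2.1)) =
          .ofReal (Real.exp (-β * m.1 + s * m.2.2.1)) := fun m => by
        rw [lifeWeight, ← ENNReal.ofReal_mul (by positivity), Real.exp_add]
      simp only [F₁, e]
      rw [lintegral_const_mul' _ _ ENNReal.ofReal_ne_top, (hν []).lintegral_exp hβ hden,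
        ← ENNReal.ofReal_mul (by positivity)]
    have hF₂B : ∫⁻ m, F₂ m ∂ν [] ≤ B := by
      simp only [F₂]
      rw [lintegral_const_mul' _ _ ENNReal.ofReal_ne_top]
      exact mul_le_mul_right (hshear _ (hν [])) _
    set G : Mark → (List Bool → Mark) → ℝ≥0∞ := fun m c =>
      F₁ m * pot β s s n c (y' m) + F₂ m * pot β s 0 n c (y' m)
    have hG : Measurable fun p : Mark × (List Bool → Mark) => G p.1 p.2 := by
      simp only [G]
      fun_prop
    have hb : ∀ b, ∫⁻ m, ∫⁻ c, G m c ∂treeLaw (sub b ν) ∂ν [] ≤ q * K + B * V := by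
      intro b
      calc _ ≤ ∫⁻ m, (F₁ m * K + F₂ m * V) ∂ν [] := by
            refine lintegral_mono fun m => ?_
            simp only [G]
            rw [lintegral_add_left (by fun_prop), lintegral_const_mul _ (by fun_prop),
              lintegral_const_mul _ (by fun_prop)]
            gcongr
            · exact ih (sub b ν) (fun u => hν _) _
            · exact hpot n (sub b ν) (fun u => hν _) _
        _ ≤ _ := by
            rw [lintegral_add_left (by fun_prop), lintegral_mul_const _ hF₁,
              lintegral_mul_const _ hF₂, hF₁q]
            gcongr
    calc _ ≤ ∫⁻ c, (G (c []) (sub false c) + G (c []) (sub true c)) ∂treeLaw ν := by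
          refine lintegral_mono fun c => ?_
          have := pot_mom_succ_le (β := β) hs hs1 hδ n c (y' (c []))
          rw [hy' (c [])] at this
          refine this.trans (le_of_eq ?_)
          simp only [G, F₁, F₂]
          ring
      _ ≤ (q * K + B * V) + (q * K + B * V) := by
          rw [lintegral_root_add hG]
          exact add_le_add (hb false) (hb true)
      _ = B * (V + V) + q * (K + K) := by ring
      _ ≤ K := hKq

lemma energy_zero_le (hs : 0 < s) (hs1 : s < 1) (ha : 0 ≤ a) (c : List Bool → Mark) :
    energy β s a 0 c c ≤ yuleLimit β c ^ 2 * (1 + .ofReal (2 / (1 - s))) := by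
  rw [energy]
  calc _ ≤ ∫⁻ y, (yuleLimit β c * (1 + .ofReal (2 / (1 - s)))) * density β 0 c y := by
        gcongr with y; exact pot_zero_le hs hs1 ha c y
    _ = (yuleLimit β c * (1 + .ofReal (2 / (1 - s)))) * densityMass β 0 c :=
        lintegral_const_mul _ (by fun_prop)
    _ = _ := by rw [densityMass_zero]; ring

/-- For independent trees the potential is averaged first, uniformly in its argument, and the
remaining integral is the mean mass of the other tree. -/
lemma lintegral_energy_cross_le {K₁ V : ℝ≥0∞} (n : ℕ)
    {π₀ π₁ : Measure (List Bool → Mark)} [SFinite π₀] [SFinite π₁]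
    (hV : ∀ y, ∫⁻ c, pot β s a n c y ∂π₀ ≤ V) (hK₁ : ∫⁻ c, densityMass β n c ∂π₁ ≤ K₁) :
    ∫⁻ c, ∫⁻ c', energy β s a n c c' ∂π₁ ∂π₀ ≤ V * K₁ := by
  have hme := measurable_energy (β := β) (s := s) (a := a) n
  rw [lintegral_lintegral_swap (by exact hme.aemeasurable)]
  calc _ ≤ ∫⁻ c', V * densityMass β n c' ∂π₁ := by
        gcongr with c'
        simp only [energy]
        rw [lintegral_lintegral_swap (Measurable.aemeasurable (by fun_prop)), densityMass,
          ← lintegral_const_mul _ (by fun_prop)]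
        gcongr with y
        rw [lintegral_mul_const _ (by fun_prop)]
        gcongr
        exact hV y
    _ ≤ _ := by
        rw [lintegral_const_mul _ (by fun_prop)]
        gcongr

lemma energy_succ (n : ℕ) (c : List Bool → Mark) :
    energy β s a (n + 1) c c = lifeWeight β (c []) *
      ((∫⁻ r, pot β s a (n + 1) c ((c []).2.1 + Real.exp (c []).2.2.1 * r) *
        density β n (sub false c) r) +
      ∫⁻ r, pot β s a (n + 1) c ((c []).2.1 + Real.exp (c []).2.2.1 * r) *
        density β n (sub true c) r) := by
  rw [energy, lintegral_mul_density_succ n c (by fun_prop)]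

/-- The sum of the mutual energies of the contributions of the two subtrees. -/
def energySum (β s a : ℝ) (n : ℕ) (c₀ c₁ : List Bool → Mark) : ℝ≥0∞ :=
  energy β s a n c₀ c₀ + energy β s a n c₁ c₁ + (energy β s a n c₀ c₁ + energy β s a n c₁ c₀)

lemma lintegral_pot_add_mul (n : ℕ) (c₀ c₁ c : List Bool → Mark) :
    ∫⁻ r, (pot β s a n c₀ r + pot β s a n c₁ r) * density β n c r =
      energy β s a n c₀ c + energy β s a n c₁ c := by
  simp_rw [add_mul]
  rw [lintegral_add_left (by fun_prop)]
  rfl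

lemma energy_one_succ (n : ℕ) (c : List Bool → Mark) :
    energy β s 0 (n + 1) c c = lifeWeight β (c []) ^ 2 * .ofReal (Real.exp (-s * (c []).2.2.1)) *
      energySum β s 0 n (sub false c) (sub true c) := by
  have e : ∀ b, ∫⁻ r, pot β s 0 (n + 1) c ((c []).2.1 + Real.exp (c []).2.2.1 * r) *
        density β n (sub b c) r = lifeWeight β (c []) * .ofReal (Real.exp (-s * (c []).2.2.1)) *
          (energy β s 0 n (sub false c) (sub b c) + energy β s 0 n (sub true c) (sub b c)) := by
    intro b
    rw [← lintegral_pot_add_mul, ← lintegral_const_mul _ (by fun_prop)]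
    refine lintegral_congr fun r => ?_
    rw [pot_one_succ]; ring
  rw [energy_succ, e, e, energySum]
  ring

lemma energy_mom_succ_le (hs : 0 < s) (hs1 : s < 1) {δ : ℝ} (hδ : 0 < δ) (n : ℕ)
    (c : List Bool → Mark) :
    energy β s s (n + 1) c c ≤ .ofReal ((1 + δ) ^ 2) *
        (lifeWeight β (c []) ^ 2 * .ofReal (Real.exp (s * (c []).2.2.1))) *
          energySum β s s n (sub false c) (sub true c) +
      .ofReal ((1 + 1 / δ) ^ 2) * (lifeWeight β (c []) ^ 2 *
        (.ofReal (Real.exp (-s * (c []).2.2.1)) * mom s (c []).2.1)) *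
          energySum β s 0 n (sub false c) (sub true c) := by
  have hm := measurable_mom s
  set k₁ : ℝ≥0∞ := .ofReal ((1 + δ) ^ 2) *
    (lifeWeight β (c []) * .ofReal (Real.exp (s * (c []).2.2.1))) with hk₁
  set k₂ : ℝ≥0∞ := .ofReal ((1 + 1 / δ) ^ 2) * (lifeWeight β (c []) *
        (.ofReal (Real.exp (-s * (c []).2.2.1)) * mom s (c []).2.1)) with hk₂
  have e : ∀ b, ∫⁻ r, pot β s s (n + 1) c ((c []).2.1 + Real.exp (c []).2.2.1 * r) *
        density β n (sub b c) r ≤ k₁ *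
          (energy β s s n (sub false c) (sub b c) +
            energy β s s n (sub true c) (sub b c)) + k₂ *
          (energy β s 0 n (sub false c) (sub b c) + energy β s 0 n (sub true c) (sub b c)) := by
    intro b
    rw [← lintegral_pot_add_mul, ← lintegral_pot_add_mul,
      ← lintegral_const_mul _ (by fun_prop), ← lintegral_const_mul _ (by fun_prop),
      ← lintegral_add_left (by fun_prop)]
    refine lintegral_mono fun r => ?_
    rw [← mul_assoc, ← mul_assoc, ← add_mul]
    gcongr
    exact pot_mom_succ_le hs hs1 hδ n c r
  rw [energy_succ]
  refine (mul_le_mul_right (add_le_add (e false) (e true)) _).trans (le_of_eq ?_)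
  rw [hk₁, hk₂, energySum, energySum]
  ring

lemma lintegral_mul_energySum_le {ν : List Bool → Measure Mark}
    [∀ u, IsProbabilityMeasure (ν u)] {w : Mark → ℝ≥0∞} (hw : Measurable w) 
    (n : ℕ) {k V K₁ : ℝ≥0∞} (hk : ∀ b, ∫⁻ c, energy β s a n c c ∂treeLaw (sub b ν) ≤ k)
    (hV : ∀ b y, ∫⁻ c, pot β s a n c y ∂treeLaw (sub b ν) ≤ V)
    (hK₁ : ∀ b, ∫⁻ c, densityMass β n c ∂treeLaw (sub b ν) ≤ K₁) :
    ∫⁻ c, w (c []) * energySum β s a n (sub false c) (sub true c) ∂treeLaw ν ≤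
      (∫⁻ m, w m ∂ν []) * (k + k + (V * K₁ + V * K₁)) :=
  lintegral_le_of_pair_branching hw (measurable_energy n) hk fun b b' =>
    lintegral_energy_cross_le n (hV b) (hK₁ b')

/-- The diagonal factor 2 E[e^(-2βτ) Y^(-s)] = 2β / (3β - s(s+1)/2) is less than 1, since s(s+1)/2 <
s < β. The mixed terms are mutual energies of independent trees. -/
lemma exists_lintegral_energy_one_le (hβ : 0 < β) (hs : 0 < s) (hs1 : s < 1) (hsβ : s < β)
    (C : ℝ≥0) : ∃ K < ∞, ∀ (n : ℕ) (ν : List Bool → Measure Mark), (∀ u, IsMarkLaw β C (ν u)) →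
      ∫⁻ c, energy β s 0 n c c ∂treeLaw ν ≤ K := by
  obtain ⟨K₁, hK₁, h1⟩ := exists_lintegral_densityMass_le hβ C
  obtain ⟨V, hV, hpot⟩ := exists_lintegral_pot_one_le hβ hs hs1 hsβ C
  have hden : 2 * β < β + 2 * β - -s * (-s - 1) / 2 := by nlinarith
  set q := ENNReal.ofReal (β / (β + 2 * β - -s * (-s - 1) / 2))
  have hq : 2 * q < 1 := by
    refine two_mul_ofReal_lt_one ?_
    rw [mul_div_assoc', div_lt_one (by linarith)]
    exact hden
  obtain ⟨K, hK, hK0, hKq⟩ := exists_contraction_bound hq (B := q * (V * K₁ + V * K₁))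
    (B' := 5 * (1 + .ofReal (2 / (1 - s))))
    (ENNReal.mul_lt_top ENNReal.ofReal_lt_top (by finiteness)) (by finiteness)
  refine ⟨K, hK, fun n => ?_⟩
  induction n with
  | zero =>
    intro ν hν
    refine le_trans ((lintegral_mono fun c => energy_zero_le hs hs1
      le_rfl c).trans ?_) hK0
    rw [lintegral_mul_const _ (by fun_prop)]
    gcongr
    exact lintegral_yuleLimit_sq_le hβ hν
  | succ n ih =>
    intro ν hν
    have := fun u => (hν u).isProbabilityMeasure hβ
    simp_rw [energy_one_succ]
    refine (lintegral_mul_energySum_le (w := fun m => lifeWeight β m ^ 2 *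
      .ofReal (Real.exp (-s * m.2.2.1))) (by fun_prop) n (k := K)
      (fun b => ih (sub b ν) fun u => hν _) (fun b => hpot n (sub b ν) fun u => hν _)
      fun b => h1 n (sub b ν) fun u => hν _).trans ?_
    have e : ∀ m : Mark, lifeWeight β m ^ 2 * .ofReal (Real.exp (-s * m.2.2.1)) =
        .ofReal (Real.exp (-(2 * β) * m.1 + -s * m.2.2.1)) := fun m => by
      rw [lifeWeight, ← ENNReal.ofReal_pow (by positivity), ← ENNReal.ofReal_mul (by positivity),
        ← Real.exp_nat_mul, ← Real.exp_add]
      congr 2; push_cast; ring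
    simp_rw [e]
    rw [(hν []).lintegral_exp hβ (by linarith)]
    calc _ = q * (V * K₁ + V * K₁) + q * (K + K) := by ring
      _ ≤ K := hKq

/-- The same recursion with the weight: the diagonal factor is (1+δ)² β / (3β + s(1-s)/2) per child,
and the shift of the weight produces the unweighted energies, which are already bounded, times the
shear moment. -/
lemma exists_lintegral_energy_mom_le (hβ : 0 < β) (hs : 0 < s) (hs1 : s < 1) (hsβ : s < β)
    (C : ℝ≥0) : ∃ K < ∞, ∀ (n : ℕ) (ν : List Bool → Measure Mark), (∀ u, IsMarkLaw β C (ν u)) →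
      ∫⁻ c, energy β s s n c c ∂treeLaw ν ≤ K := by
  obtain ⟨K₁, hK₁, h1⟩ := exists_lintegral_densityMass_le hβ C
  obtain ⟨V, hV, hpot⟩ := exists_lintegral_pot_one_le hβ hs hs1 hsβ C
  obtain ⟨U, hU, hpot'⟩ := exists_lintegral_pot_mom_le hβ hs hs1 hsβ C
  obtain ⟨E₀, hE₀, hen⟩ := exists_lintegral_energy_one_le hβ hs hs1 hsβ C
  obtain ⟨S, hS, hshear⟩ := IsMarkLaw.exists_lintegral_shear_le hs hs1.le (β := β) (l := 2 * β)
    (by linarith) C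
  obtain ⟨δ, hδ, hslack⟩ := exists_slack hβ hs hs1
  have hden : 0 < β + 2 * β - s * (s - 1) / 2 := by nlinarith
  set q := ENNReal.ofReal ((1 + δ) ^ 2 * (β / (β + 2 * β - s * (s - 1) / 2)))
  have hq : 2 * q < 1 := by
    refine two_mul_ofReal_lt_one ?_
    rw [mul_div_assoc', mul_div_assoc', div_lt_one hden]
    linarith
  set B := ENNReal.ofReal ((1 + 1 / δ) ^ 2) * S
  have hB : B < ∞ := ENNReal.mul_lt_top ENNReal.ofReal_lt_top hS
  obtain ⟨K, hK, hK0, hKq⟩ := exists_contraction_bound hq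
    (B := q * (U * K₁ + U * K₁) + B * (E₀ + E₀ + (V * K₁ + V * K₁)))
    (B' := 5 * (1 + .ofReal (2 / (1 - s))))
    (ENNReal.add_lt_top.2 ⟨ENNReal.mul_lt_top ENNReal.ofReal_lt_top (by finiteness),
      ENNReal.mul_lt_top hB (by finiteness)⟩) (by finiteness)
  refine ⟨K, hK, fun n => ?_⟩
  have hm := measurable_mom s
  induction n with
  | zero =>
    intro ν hν
    refine le_trans ((lintegral_mono fun c => energy_zero_le hs hs1
      hs.le c).trans ?_) hK0
    rw [lintegral_mul_const _ (by fun_prop)]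
    gcongr
    exact lintegral_yuleLimit_sq_le hβ hν
  | succ n ih =>
    intro ν hν
    have := fun u => (hν u).isProbabilityMeasure hβ
    set F₁ : Mark → ℝ≥0∞ := fun m => .ofReal ((1 + δ) ^ 2) *
      (lifeWeight β m ^ 2 * .ofReal (Real.exp (s * m.2.2.1)))
    set F₂ : Mark → ℝ≥0∞ := fun m => .ofReal ((1 + 1 / δ) ^ 2) * (lifeWeight β m ^ 2 *
        (.ofReal (Real.exp (-s * m.2.2.1)) * mom s m.2.1))
    have hF₁ : Measurable F₁ := by fun_prop
    have hF₂ : Measurable F₂ := by fun_prop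
    have esq : ∀ m : Mark, lifeWeight β m ^ 2 = .ofReal (Real.exp (-(2 * β) * m.1)) := fun m => by
      rw [lifeWeight, ← ENNReal.ofReal_pow (by positivity), ← Real.exp_nat_mul]
      congr 2; push_cast; ring
    have hF₁q : ∫⁻ m, F₁ m ∂ν [] = q := by
      have e : ∀ m : Mark, lifeWeight β m ^ 2 * .ofReal (Real.exp (s * m.2.2.1)) =
          .ofReal (Real.exp (-(2 * β) * m.1 + s * m.2.2.1)) := fun m => by
        rw [esq, ← ENNReal.ofReal_mul (by positivity), Real.exp_add]
      simp only [F₁, e]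
      rw [lintegral_const_mul' _ _ ENNReal.ofReal_ne_top, (hν []).lintegral_exp hβ hden,
        ← ENNReal.ofReal_mul (by positivity)]
    have hF₂B : ∫⁻ m, F₂ m ∂ν [] ≤ B := by
      simp only [F₂, esq]
      rw [lintegral_const_mul' _ _ ENNReal.ofReal_ne_top]
      exact mul_le_mul_right (hshear _ (hν [])) _
    have hmE : ∀ a : ℝ, Measurable fun c : List Bool → Mark =>
        energySum β s a n (sub false c) (sub true c) := fun a => by
      have h := measurable_energy (β := β) (s := s) (a := a) n
      have h' : ∀ b b', Measurable fun c : List Bool → Mark => energy β s _ n (sub b c) (sub b' c) :=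
        fun b b' => h.comp (f := fun c : List Bool → Mark => (sub b c, sub b' c)) (by fun_prop)
      exact ((h' _ _).add (h' _ _)).add ((h' _ _).add (h' _ _))
    calc _ ≤ ∫⁻ c, (F₁ (c []) * energySum β s s n (sub false c) (sub true c) +
          F₂ (c []) * energySum β s 0 n (sub false c) (sub true c)) ∂treeLaw ν :=
          lintegral_mono fun c => energy_mom_succ_le hs hs1 hδ n c
      _ ≤ q * (K + K + (U * K₁ + U * K₁)) + B * (E₀ + E₀ + (V * K₁ + V * K₁)) := by
          have := hmE s
          rw [lintegral_add_left (by fun_prop)]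
          gcongr
          · rw [← hF₁q]
            exact lintegral_mul_energySum_le hF₁ n
              (fun b => ih (sub b ν) fun u => hν _) (fun b => hpot' n (sub b ν) fun u => hν _)
              fun b => h1 n (sub b ν) fun u => hν _
          · refine le_trans (lintegral_mul_energySum_le hF₂ n (k := E₀)
              (fun b => hen n (sub b ν) fun u => hν _) (fun b => hpot n (sub b ν) fun u => hν _)
              fun b => h1 n (sub b ν) fun u => hν _) ?_
            gcongr
      _ = q * (U * K₁ + U * K₁) + B * (E₀ + E₀ + (V * K₁ + V * K₁)) + q * (K + K) := by ring
      _ ≤ K := hKq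

/-- Fatou's lemma gives boundedness along a random subsequence, which is enough for the limit
measure. The combination is the energy with the weight 1 + |r|^(2s) + |r'|^(2s), by symmetry of the
kernel. -/
lemma ae_liminf_energy_ne_top (hβ : 0 < β) (hs : 0 < s) (hs1 : s < 1) (hsβ : s < β)
    {ν : List Bool → Measure Mark} (hν : ∀ u, IsMarkLaw β C (ν u)) :
    ∀ᵐ c ∂treeLaw ν,
      liminf (fun n => energy β s 0 n c c + 2 * energy β s s n c c) atTop ≠ ∞ := by
  obtain ⟨K, hK, h⟩ := exists_lintegral_energy_one_le hβ hs hs1 hsβ C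
  obtain ⟨K', hK', h'⟩ := exists_lintegral_energy_mom_le hβ hs hs1 hsβ C
  have hm : ∀ (a : ℝ) (n : ℕ), Measurable fun c : List Bool → Mark =>
      energy β s a n c c := fun a n =>
    (measurable_energy n).comp (f := fun c : List Bool → Mark => (c, c)) (by fun_prop)
  have hmm : ∀ n, Measurable fun c : List Bool → Mark =>
      energy β s 0 n c c + 2 * energy β s s n c c :=
    fun n => (hm 0 n).add ((hm s n).const_mul 2)
  have hle : ∫⁻ c, liminf (fun n => energy β s 0 n c c + 2 * energy β s s n c c) atTop
      ∂treeLaw ν ≤ K + 2 * K' := by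
    refine (lintegral_liminf_le hmm).trans (liminf_le_of_frequently_le'
      (Frequently.of_forall fun n => ?_))
    rw [lintegral_add_left (hm 0 n), lintegral_const_mul _ (hm s n)]
    gcongr
    · exact h n ν hν
    · exact h' n ν hν
  filter_upwards [ae_lt_top (.liminf hmm) (ne_top_of_le_ne_top (by finiteness) hle)] with c hc
    using hc.ne

end Energy

/-! ### The branching particle system -/

section System

variable {Ω : Type*} {τ : List Bool → Ω → ℝ} {Z : List Bool → ℝ≥0 → Ω → ℂ} {ω : Ω}
  {c : List Bool → Mark} {β : ℝ}

lemma tsum_words (f : List Bool → ℝ≥0∞) :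
    ∑' u, f u = f [] + (∑' u, f (u ++ [false]) + ∑' u, f (u ++ [true])) := by
  have inj : ∀ b : Bool, Function.Injective fun u : List Bool => u ++ [b] :=
    fun b u v h => by simpa using h
  set e : Option (Bool × List Bool) → List Bool := fun o => o.elim [] fun p => p.2 ++ [p.1]
  have he : Function.Bijective e := by
    constructor
    · rintro (_ | ⟨b, u⟩) (_ | ⟨b', u'⟩) h
      · rfl
      · simp [e] at h
      · simp [e] at h
      · have : u = u' ∧ b = b' := by simpa [e] using h
        rw [this.1, this.2]
    · intro u
      rcases word_cases u with rfl | ⟨v, b, rfl⟩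
      · exact ⟨none, rfl⟩
      · exact ⟨some (b, v), rfl⟩
  rw [← (Equiv.ofBijective e he).tsum_eq, ENNReal.tsum_eq_add_tsum_ite none]
  set F : Option (Bool × List Bool) → ℝ≥0∞ := fun o => o.elim 0 fun p => f (p.2 ++ [p.1])
  have hsupp : Function.support F ⊆ Set.range some := by
    intro o ho
    rcases o with _ | p
    · simp [F] at ho
    · exact ⟨p, rfl⟩
  rw [tsum_congr (g := F) fun o => by cases o <;> simp [F, e], ← (Option.some_injective _).tsum_eq hsupp,
    ENNReal.tsum_prod', tsum_bool]
  rfl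

lemma birthTime_append (b : Bool) (u : List Bool) :
    birthTime τ (u ++ [b]) ω = τ [] ω + birthTime (sub b τ) u ω := by
  induction u with
  | nil => simp [birthTime]
  | cons a u ih =>
    rw [List.cons_append, birthTime, ih, birthTime, sub]
    ring

lemma moveTo_I (w : ℂ) : moveTo Complex.I w = w := by simp [moveTo]

lemma moveTo_moveTo (z p w : ℂ) : moveTo (moveTo z p) w = moveTo z (moveTo p w) := by
  simp [moveTo]; ring

lemma moveTo_I_right (z : ℂ) : moveTo z Complex.I = z := Complex.re_add_im z

lemma birthPlace_append (b : Bool) (u : List Bool) :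
    birthPlace τ Z (u ++ [b]) ω =
      moveTo (Z [] (τ [] ω).toNNReal ω) (birthPlace (sub b τ) (sub b Z) u ω) := by
  induction u with
  | nil => simp [birthPlace, moveTo_I, moveTo_I_right]
  | cons a u ih => rw [List.cons_append, birthPlace, ih, moveTo_moveTo, birthPlace]; rfl

/-- The particles alive at the time `t`, as a real number. -/
def aliveAt (τ : List Bool → Ω → ℝ) (t : ℝ) (ω : Ω) : Set (List Bool) :=
  {u | birthTime τ u ω ≤ t ∧ t < birthTime τ u ω + τ u ω}

/-- The position of a particle at the time `t`, as a real number. -/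
def placeAt (τ : List Bool → Ω → ℝ) (Z : List Bool → ℝ≥0 → Ω → ℂ) (u : List Bool) (t : ℝ) (ω : Ω) :
    ℂ := moveTo (birthPlace τ Z u ω) (Z u (t - birthTime τ u ω).toNNReal ω)

/-- The empirical measure at time `t`, not normalised, in the half plane model. -/
def popMeasure (τ : List Bool → Ω → ℝ) (Z : List Bool → ℝ≥0 → Ω → ℂ) (t : ℝ) (ω : Ω) : Measure ℂ :=
  Measure.sum fun u : aliveAt τ t ω => Measure.dirac (placeAt τ Z u t ω)

lemma popMeasure_apply {t : ℝ} {s : Set ℂ} (hs : MeasurableSet s) : popMeasure τ Z t ω s =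
    ∑' u, (aliveAt τ t ω).indicator (fun u => s.indicator 1 (placeAt τ Z u t ω)) u := by
  rw [popMeasure, Measure.sum_apply _ hs, ← tsum_subtype]
  simp [hs]

lemma mem_aliveAt_append (b : Bool) (u : List Bool) (t : ℝ) :
    u ++ [b] ∈ aliveAt τ t ω ↔ u ∈ aliveAt (sub b τ) (t - τ [] ω) ω := by
  simp only [aliveAt, Set.mem_ofPred_eq, birthTime_append, le_sub_iff_add_le', sub_lt_iff_lt_add']
  rw [add_assoc]; rfl

lemma placeAt_append (b : Bool) (u : List Bool) (t : ℝ) :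
    placeAt τ Z (u ++ [b]) t ω =
      moveTo (Z [] (τ [] ω).toNNReal ω) (placeAt (sub b τ) (sub b Z) u (t - τ [] ω) ω) := by
  rw [placeAt, placeAt, birthPlace_append, moveTo_moveTo, birthTime_append, sub_sub]; rfl

/-- The marks `c` are those of the given motions. -/
structure Compat (τ : List Bool → Ω → ℝ) (Z : List Bool → ℝ≥0 → Ω → ℂ) (ω : Ω)
    (c : List Bool → Mark) : Prop where
  lifetime : ∀ u, ((c u).1 : ℝ) = τ u ω
  death : ∀ u, Z u (c u).1 ω = (c u).2.1 + Real.exp (c u).2.2.1 * Complex.I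
  displacement : ∀ u, ∀ s ≤ (c u).1, ‖Z u s ω - Complex.I‖ₑ ≤ (c u).2.2.2
  im_nonneg : ∀ u, ∀ s ≤ (c u).1, 0 ≤ (Z u s ω).im

lemma Compat.sub (h : Compat τ Z ω c) (b : Bool) : Compat (sub b τ) (sub b Z) ω (sub b c) :=
  ⟨fun _ => h.lifetime _, fun _ => h.death _, fun _ => h.displacement _, fun _ => h.im_nonneg _⟩

lemma Compat.birthTime_nonneg (h : Compat τ Z ω c) (u : List Bool) : 0 ≤ birthTime τ u ω := by
  induction u with
  | nil => exact le_rfl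
  | cons a u ih =>
    have := h.lifetime u
    rw [birthTime, ← this]
    positivity

/-- The isometry that maps `i` to the place where the initial particle dies. -/
def rootMap (c : List Bool → Mark) (w : ℂ) : ℂ := (c []).2.1 + Real.exp (c []).2.2.1 * w

lemma measurable_rootMap : Measurable (rootMap c) := by unfold rootMap; fun_prop

lemma Compat.moveTo_root (h : Compat τ Z ω c) :
    moveTo (Z [] (τ [] ω).toNNReal ω) = rootMap c := by
  have : (τ [] ω).toNNReal = (c []).1 := by rw [← h.lifetime, Real.toNNReal_coe]
  funext w
  rw [this, h.death, moveTo, rootMap]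
  simp

lemma Compat.popMeasure_of_lt (h : Compat τ Z ω c) {t : ℝ} (ht : 0 ≤ t) (htτ : t < τ [] ω) :
    popMeasure τ Z t ω = Measure.dirac (Z [] t.toNNReal ω) := by
  ext s hs
  rw [popMeasure_apply hs, tsum_eq_single []]
  · have : [] ∈ aliveAt τ t ω := ⟨ht, by simpa [birthTime] using htτ⟩
    rw [Set.indicator_of_mem this, Measure.dirac_apply' _ hs, placeAt]
    simp [birthTime, birthPlace, moveTo_I]
  · intro u hu
    refine Set.indicator_of_notMem (fun hu' => ?_) _
    rcases word_cases u with rfl | ⟨v, b, rfl⟩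
    · exact hu rfl
    · have h1 := hu'.1
      rw [birthTime_append] at h1
      have := (h.sub b).birthTime_nonneg v
      linarith

/-- Once the root is dead, every living particle is a word with a last letter. Removing it shifts
the time by the lifetime of the root and the place by the root isometry. -/
lemma Compat.popMeasure_of_le (h : Compat τ Z ω c) {t : ℝ} (htτ : τ [] ω ≤ t) :
    popMeasure τ Z t ω =
      (popMeasure (HypBBM.sub false τ) (HypBBM.sub false Z) (t - τ [] ω) ω).map (rootMap c) +
      (popMeasure (HypBBM.sub true τ) (HypBBM.sub true Z) (t - τ [] ω) ω).map (rootMap c) := by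
  ext s hs
  rw [Measure.add_apply, Measure.map_apply measurable_rootMap hs,
    Measure.map_apply measurable_rootMap hs, popMeasure_apply hs, tsum_words,
    popMeasure_apply (measurable_rootMap hs), popMeasure_apply (measurable_rootMap hs)]
  have h0 : [] ∉ aliveAt τ t ω := fun h => by
    have := h.2
    simp only [birthTime, zero_add] at this
    linarith
  rw [Set.indicator_of_notMem h0, zero_add]
  have hb : ∀ b u, (aliveAt τ t ω).indicator (fun u => s.indicator (1 : ℂ → ℝ≥0∞)
      (placeAt τ Z u t ω)) (u ++ [b]) =
      (aliveAt (HypBBM.sub b τ) (t - τ [] ω) ω).indicator (fun u => (rootMap c ⁻¹' s).indicator 1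
        (placeAt (HypBBM.sub b τ) (HypBBM.sub b Z) u (t - τ [] ω) ω)) u := by
    intro b u
    have := mem_aliveAt_append (τ := τ) (ω := ω) b u t
    by_cases hu : u ++ [b] ∈ aliveAt τ t ω
    · rw [Set.indicator_of_mem hu, Set.indicator_of_mem (this.1 hu), placeAt_append, h.moveTo_root]
      rfl
    · rw [Set.indicator_of_notMem hu, Set.indicator_of_notMem (fun h => hu (this.2 h))]
  simp_rw [hb]

/-- Induction over the genealogical tree. -/
lemma Compat.induction {motive : ℝ → (List Bool → Ω → ℝ) → (List Bool → ℝ≥0 → Ω → ℂ) →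
      (List Bool → Mark) → Prop}
    (root : ∀ t τ Z c, Compat τ Z ω c → 0 ≤ t → t < τ [] ω → motive t τ Z c)
    (branch : ∀ t τ Z c, Compat τ Z ω c → NonExplosive c → τ [] ω ≤ t →
      (∀ b, motive (t - τ [] ω) (HypBBM.sub b τ) (HypBBM.sub b Z) (HypBBM.sub b c)) →
        motive t τ Z c)
    (h : Compat τ Z ω c) (hc : NonExplosive c) {t : ℝ} (ht : 0 ≤ t) : motive t τ Z c := by
  obtain ⟨n, hn⟩ := hc t
  induction n generalizing τ Z c t with
  | zero => simp [bornCard] at hn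
  | succ n ih =>
    rcases lt_or_ge t (τ [] ω) with htτ | htτ
    · exact root t τ Z c h ht htτ
    · rw [bornCard, if_neg (by rw [h.lifetime]; exact not_lt.2 htτ), Nat.add_eq_zero_iff,
        h.lifetime] at hn
      refine branch t τ Z c h hc htτ fun b => ?_
      cases b
      · exact ih (h.sub false) (hc.sub false) (by linarith) hn.1
      · exact ih (h.sub true) (hc.sub true) (by linarith) hn.2

lemma Compat.popMeasure_univ (h : Compat τ Z ω c) (hc : NonExplosive c) {t : ℝ} (ht : 0 ≤ t) :
    popMeasure τ Z t ω Set.univ = population t c := by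
  refine Compat.induction (ω := ω)
    (motive := fun t τ Z c => popMeasure τ Z t ω Set.univ = population t c) ?_ ?_ h hc ht
  · intro t τ Z c h ht htτ
    rw [h.popMeasure_of_lt ht htτ, population_eq_ite, if_pos (by rwa [h.lifetime])]
    simp
  · intro t τ Z c h _ htτ ih
    rw [h.popMeasure_of_le htτ, population_eq_ite, if_neg (by rw [h.lifetime]; exact not_lt.2 htτ),
      Measure.add_apply, Measure.map_apply measurable_rootMap .univ,
      Measure.map_apply measurable_rootMap .univ, Set.preimage_univ, h.lifetime, ih, ih]

lemma Compat.isFiniteMeasure (h : Compat τ Z ω c) (hc : NonExplosive c) {t : ℝ} (ht : 0 ≤ t) :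
    IsFiniteMeasure (popMeasure τ Z t ω) :=
  ⟨by rw [h.popMeasure_univ hc ht]; exact (hc.population_ne_top t).lt_top⟩

lemma Compat.popMeasure_im_neg (h : Compat τ Z ω c) (hc : NonExplosive c) {t : ℝ} (ht : 0 ≤ t) :
    popMeasure τ Z t ω {z | z.im < 0} = 0 := by
  have hm : MeasurableSet {z : ℂ | z.im < 0} :=
    measurableSet_lt Complex.measurable_im measurable_const
  refine Compat.induction (ω := ω)
    (motive := fun t τ Z _ => popMeasure τ Z t ω {z | z.im < 0} = 0) ?_ ?_ h hc ht
  · intro t τ Z c h ht htτ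
    rw [h.popMeasure_of_lt ht htτ, Measure.dirac_apply' _ hm]
    have : 0 ≤ (Z [] t.toNNReal ω).im := h.im_nonneg [] _ ?_
    · simp [this]
    rw [← NNReal.coe_le_coe, Real.coe_toNNReal _ ht, h.lifetime]
    exact htτ.le
  · intro t τ Z c h _ htτ ih
    have hb : rootMap c ⁻¹' {z | z.im < 0} = {z | z.im < 0} := by
      ext z
      have : (rootMap c z).im = Real.exp (c []).2.2.1 * z.im := by
        rw [rootMap, Complex.add_im, Complex.ofReal_im, zero_add, Complex.im_ofReal_mul]
      simp [this, mul_neg_iff, Real.exp_pos, (Real.exp_pos _).le]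
    rw [h.popMeasure_of_le htτ, Measure.add_apply, Measure.map_apply measurable_rootMap hm,
      Measure.map_apply measurable_rootMap hm, hb, ih, ih, add_zero]

lemma Compat.ae_im_nonneg (h : Compat τ Z ω c) (hc : NonExplosive c) {t : ℝ} (ht : 0 ≤ t) :
    ∀ᵐ z ∂popMeasure τ Z t ω, 0 ≤ z.im := by
  have := measure_eq_zero_iff_ae_notMem.1 (h.popMeasure_im_neg hc ht)
  filter_upwards [this] with z hz using not_lt.1 hz

/-- The displacement of the image of a point under the isometry of the initial particle. -/
lemma rootMap_sub_I_le (h : Compat τ Z ω c) (hβ : 0 < β) (w : ℂ) :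
    ‖rootMap c w - Complex.I‖ₑ ^ dispExp β ≤ (c []).2.2.2 ^ dispExp β +
      .ofReal (Real.exp (dispExp β * (c []).2.2.1)) * ‖w - Complex.I‖ₑ ^ dispExp β := by
  have ha := dispExp_pos hβ
  have ha1 := dispExp_le (β := β)
  have h1 : rootMap c w - Complex.I =
      (Z [] (c []).1 ω - Complex.I) + (Real.exp (c []).2.2.1 : ℂ) * (w - Complex.I) := by
    rw [h.death, rootMap]; ring
  calc _ ≤ (‖Z [] (c []).1 ω - Complex.I‖ₑ +
        ‖(Real.exp (c []).2.2.1 : ℂ) * (w - Complex.I)‖ₑ) ^ dispExp β := by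
        rw [h1]
        gcongr
        exact enorm_add_le _ _
    _ ≤ ‖Z [] (c []).1 ω - Complex.I‖ₑ ^ dispExp β +
        ‖(Real.exp (c []).2.2.1 : ℂ) * (w - Complex.I)‖ₑ ^ dispExp β :=
        ENNReal.rpow_add_le_add_rpow _ _ ha.le (by linarith)
    _ ≤ _ := by
        gcongr
        · exact h.displacement [] _ le_rfl
        · rw [enorm_mul, ENNReal.mul_rpow_of_nonneg _ _ ha.le, ← ofReal_norm, Complex.norm_real, ofReal_norm, Real.enorm_eq_ofReal (by positivity),
            ENNReal.ofReal_rpow_of_pos (by positivity), ← Real.exp_mul, mul_comm (dispExp β)]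

/-- After the death of the root, each displacement to the power a ≤ 1 splits into that of the root,
counted once for each descendant, and e^(aη) times the displacement within a subtree. This
reproduces the recursion of `totalDisp`. -/
lemma Compat.lintegral_displacement_le (hβ : 0 < β) (h : Compat τ Z ω c) (hc : NonExplosive c)
    {t : ℝ} (ht : 0 ≤ t) :
    ∫⁻ z, ‖z - Complex.I‖ₑ ^ dispExp β ∂popMeasure τ Z t ω ≤
      .ofReal (Real.exp (β * t)) * totalDisp β c := by
  have ha := dispExp_pos hβ
  refine Compat.induction (ω := ω) (motive := fun t τ Z c => ∫⁻ z, ‖z - Complex.I‖ₑ ^ dispExp β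
    ∂popMeasure τ Z t ω ≤ .ofReal (Real.exp (β * t)) * totalDisp β c) ?_ ?_ h hc ht
  · intro t τ Z c h ht htτ
    rw [h.popMeasure_of_lt ht htτ, lintegral_dirac' _ (by fun_prop)]
    calc _ ≤ (c []).2.2.2 ^ dispExp β := by
          gcongr
          refine h.displacement [] _ ?_
          rw [← NNReal.coe_le_coe, Real.coe_toNNReal _ ht, h.lifetime]
          exact htτ.le
      _ ≤ rootDisp β c := by
          rw [rootDisp, add_assoc]
          exact le_mul_of_one_le_right zero_le (le_add_of_le_left le_rfl)
      _ ≤ totalDisp β c := by rw [totalDisp_eq]; exact le_add_of_le_left le_rfl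
      _ ≤ _ := le_mul_of_one_le_left zero_le (by
          rw [← ENNReal.ofReal_one]
          exact ENNReal.ofReal_le_ofReal (Real.one_le_exp (by positivity)))
  · intro t τ Z c h hc htτ ih
    have hτ0 : 0 ≤ τ [] ω := by rw [← h.lifetime]; positivity
    have htτ' : 0 ≤ t - τ [] ω := by linarith
    have hb : ∀ b, ∫⁻ z, ‖z - Complex.I‖ₑ ^ dispExp β
        ∂(popMeasure (HypBBM.sub b τ) (HypBBM.sub b Z) (t - τ [] ω) ω).map (rootMap c) ≤
        .ofReal (Real.exp (β * t)) * ((c []).2.2.2 ^ dispExp β * supPop β (HypBBM.sub b c) +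
          dispWeight β (c []) * totalDisp β (HypBBM.sub b c)) := by
      intro b
      rw [lintegral_map (by fun_prop) measurable_rootMap]
      refine (lintegral_mono fun w => rootMap_sub_I_le h hβ w).trans ?_
      rw [lintegral_add_left measurable_const, lintegral_const, lintegral_const_mul _ (by fun_prop),
        (h.sub b).popMeasure_univ (hc.sub b) htτ', mul_add]
      refine add_le_add ?_ ?_
      · rw [mul_left_comm]
        gcongr
        -- The number of descendants in one subtree is at most e^(β(t-τ)) times `supPop`.
        have h1 := (hc.sub b).scaledPop_le_supPop hβ htτ'
        rw [← (hc.sub b).ofReal_exp_mul_population] at h1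
        calc population (t - τ [] ω) (HypBBM.sub b c) = .ofReal (Real.exp (β * (t - τ [] ω))) *
              (.ofReal (Real.exp (-(β * (t - τ [] ω)))) *
                population (t - τ [] ω) (HypBBM.sub b c)) := by
              rw [← mul_assoc, ← ENNReal.ofReal_mul (by positivity), ← Real.exp_add]; simp
          _ ≤ _ := by gcongr; linarith
      · refine (mul_le_mul_right (ih b) _).trans (le_of_eq ?_)
        rw [dispWeight, ← mul_assoc, ← mul_assoc, ← ENNReal.ofReal_mul (by positivity),
          ← ENNReal.ofReal_mul (by positivity), ← Real.exp_add, ← Real.exp_add, h.lifetime]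
        congr 3; ring
    rw [h.popMeasure_of_le htτ, lintegral_add_measure]
    refine (add_le_add (hb false) (hb true)).trans ?_
    rw [← mul_add, totalDisp_eq c, rootDisp]
    refine mul_le_mul_right ?_ _
    calc _ = (c []).2.2.2 ^ dispExp β * (supPop β (HypBBM.sub false c) +
          supPop β (HypBBM.sub true c)) + dispWeight β (c []) *
            (totalDisp β (HypBBM.sub false c) + totalDisp β (HypBBM.sub true c)) := by ring
      _ ≤ _ := by
        refine add_le_add_left (mul_le_mul_right ?_ _) _
        rw [add_assoc]
        exact le_add_self

/-! ### Convergence of the empirical measures -/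

/-- The limit measure, in the half plane model, when the limit measures of the subtrees of
generation `n` are replaced by uniform distributions. -/
def approxLimit (β : ℝ) (n : ℕ) (c : List Bool → Mark) : Measure ℝ :=
  volume.withDensity (density β n c)

lemma lintegral_approxLimit (n : ℕ) (c : List Bool → Mark) {φ : ℝ → ℝ≥0∞} (hφ : Measurable φ) :
    ∫⁻ r, φ r ∂approxLimit β n c = ∫⁻ r, φ r * density β n c r := by
  rw [approxLimit, lintegral_withDensity_eq_lintegral_mul _ (by fun_prop) hφ]
  simp [mul_comm]

lemma approxLimit_univ (n : ℕ) (c : List Bool → Mark) :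
    approxLimit β n c Set.univ = densityMass β n c := by
  rw [approxLimit, withDensity_apply _ .univ, Measure.restrict_univ, densityMass]

lemma AllRegular.isFiniteMeasure (hβ : 0 < β) (h : AllRegular β c) (n : ℕ) :
    IsFiniteMeasure (approxLimit β n c) :=
  ⟨by rw [approxLimit_univ, h.densityMass_eq hβ]
      exact (h.regular.yuleLimit_ne_top hβ).lt_top⟩

lemma approxLimit_zero (c : List Bool → Mark) :
    approxLimit β 0 c = yuleLimit β c • volume.restrict (Set.Icc 0 1) := by
  refine Measure.ext_of_lintegral _ fun φ hφ => ?_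
  rw [lintegral_approxLimit _ _ hφ, lintegral_mul_density_zero c hφ, lintegral_smul_measure,
    smul_eq_mul]

lemma approxLimit_succ (n : ℕ) (c : List Bool → Mark) :
    approxLimit β (n + 1) c = lifeWeight β (c []) •
      ((approxLimit β n (sub false c)).map (fun r => (c []).2.1 + Real.exp (c []).2.2.1 * r) +
      (approxLimit β n (sub true c)).map fun r => (c []).2.1 + Real.exp (c []).2.2.1 * r) := by
  refine Measure.ext_of_lintegral _ fun φ hφ => ?_
  rw [lintegral_approxLimit _ _ hφ, lintegral_mul_density_succ n c hφ, lintegral_smul_measure,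
    lintegral_add_measure, lintegral_map hφ (by fun_prop), lintegral_map hφ (by fun_prop),
    lintegral_approxLimit _ _ (by fun_prop), lintegral_approxLimit _ _ (by fun_prop), smul_eq_mul]

/-- Bounded Hölder test functions on the upper half plane, with exponent `dispExp β`. -/
structure IsTest (β L : ℝ) (g : ℂ → ℝ) : Prop where
  nonneg : 0 ≤ L
  measurable : Measurable g
  bounded : ∃ M, ∀ z, |g z| ≤ M
  holder : ∀ z w : ℂ, 0 ≤ z.im → 0 ≤ w.im → |g z - g w| ≤ L * ‖z - w‖ ^ dispExp β

lemma IsTest.comp {L : ℝ} {g : ℂ → ℝ} (hg : IsTest β L g) (c : List Bool → Mark) :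
    IsTest β (L * Real.exp (dispExp β * (c []).2.2.1)) (g ∘ rootMap c) where
  nonneg := mul_nonneg hg.nonneg (by positivity)
  measurable := hg.measurable.comp measurable_rootMap
  bounded := hg.bounded.imp fun M hM z => hM _
  holder z w hz hw := by
    have him : ∀ z : ℂ, 0 ≤ z.im → 0 ≤ (rootMap c z).im := fun z hz => by
      rw [rootMap, Complex.add_im, Complex.ofReal_im, zero_add, Complex.im_ofReal_mul]
      positivity
    refine (hg.holder _ _ (him z hz) (him w hw)).trans (le_of_eq ?_)
    rw [show rootMap c z - rootMap c w = (Real.exp (c []).2.2.1 : ℂ) * (z - w) by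
      rw [rootMap, rootMap]; ring, norm_mul, Complex.norm_real, Real.norm_of_nonneg (by positivity),
      Real.mul_rpow (by positivity) (by positivity), ← Real.exp_mul, mul_comm (dispExp β), mul_assoc]

lemma IsTest.integrable {L : ℝ} {g : ℂ → ℝ} (hg : IsTest β L g) (μ : Measure ℂ)
    [IsFiniteMeasure μ] : Integrable g μ := by
  obtain ⟨M, hM⟩ := hg.bounded
  exact .of_bound hg.measurable.aestronglyMeasurable M (.of_forall hM)

/-- The sum of the values of a test function over the population, divided by the expected size. -/
def popMean (β : ℝ) (τ : List Bool → Ω → ℝ) (Z : List Bool → ℝ≥0 → Ω → ℂ) (g : ℂ → ℝ) (t : ℝ)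
    (ω : Ω) : ℝ := Real.exp (-(β * t)) * ∫ z, g z ∂popMeasure τ Z t ω

lemma popMean_eq {L : ℝ} {g : ℂ → ℝ} (hg : IsTest β L g) (h : Compat τ Z ω c)
    (hc : NonExplosive c) {t : ℝ} (htτ : τ [] ω ≤ t) :
    popMean β τ Z g t ω = Real.exp (-(β * τ [] ω)) *
      (popMean β (sub false τ) (sub false Z) (g ∘ rootMap c) (t - τ [] ω) ω +
        popMean β (sub true τ) (sub true Z) (g ∘ rootMap c) (t - τ [] ω) ω) := by
  have h0 : 0 ≤ t - τ [] ω := by linarith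
  have hfin := fun b => (h.sub b).isFiniteMeasure (hc.sub b) h0
  have hm := measurable_rootMap (c := c)
  have := hfin false
  have := hfin true
  rw [popMean, h.popMeasure_of_le htτ, integral_add_measure (hg.integrable _) (hg.integrable _),
    integral_map hm.aemeasurable hg.measurable.aestronglyMeasurable,
    integral_map hm.aemeasurable hg.measurable.aestronglyMeasurable, popMean, popMean, ← mul_add,
    ← mul_assoc, ← Real.exp_add]
  congr 2
  ring_nf

lemma integral_approxLimit_succ {L : ℝ} {g : ℂ → ℝ} (hβ : 0 < β) (hg : IsTest β L g)
    (hc : AllRegular β c) (n : ℕ) :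
    ∫ r, g (r : ℂ) ∂approxLimit β (n + 1) c = Real.exp (-(β * (c []).1)) *
      (∫ r, (g ∘ rootMap c) (r : ℂ) ∂approxLimit β n (sub false c) +
        ∫ r, (g ∘ rootMap c) (r : ℂ) ∂approxLimit β n (sub true c)) := by
  have := (hc.sub false).isFiniteMeasure hβ n
  have := (hc.sub true).isFiniteMeasure hβ n
  have hgm : Measurable fun r : ℝ => g r := hg.measurable.comp Complex.measurable_ofReal
  have hi : ∀ μ : Measure ℝ, IsFiniteMeasure μ → Integrable (fun r : ℝ => g r) μ := fun μ _ => by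
    obtain ⟨M, hM⟩ := hg.bounded
    exact .of_bound hgm.aestronglyMeasurable M (.of_forall fun r => hM _)
  rw [approxLimit_succ, integral_smul_measure, integral_add_measure (hi _ inferInstance)
    (hi _ inferInstance), integral_map (by fun_prop) hgm.aestronglyMeasurable,
    integral_map (by fun_prop) hgm.aestronglyMeasurable, lifeWeight,
    ENNReal.toReal_ofReal (by positivity), smul_eq_mul, neg_mul]
  simp [rootMap]

lemma IsTest.ofReal_abs_le {L : ℝ} {g : ℂ → ℝ} (hβ : 0 < β) (hg : IsTest β L g) {z : ℂ}
    (hz : 0 ≤ z.im) :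
    ENNReal.ofReal |g z - g Complex.I| ≤ .ofReal L * ‖z - Complex.I‖ₑ ^ dispExp β := by
  rw [← ofReal_norm, ENNReal.ofReal_rpow_of_nonneg (norm_nonneg _) (dispExp_pos hβ).le,
    ← ENNReal.ofReal_mul hg.nonneg]
  exact ENNReal.ofReal_le_ofReal (hg.holder _ _ hz (by simp))

/-- All particles are moved back to i; the Hölder property bounds the error by the total
displacement. This and the next lemma are the case n = 0 of the error estimate. -/
lemma popMean_sub_le {L : ℝ} {g : ℂ → ℝ} (hβ : 0 < β) (hg : IsTest β L g) (h : Compat τ Z ω c)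
    (hc : NonExplosive c) {t : ℝ} (ht : 0 ≤ t) :
    ENNReal.ofReal |popMean β τ Z g t ω - g Complex.I * scaledPop β t c| ≤
      .ofReal L * totalDisp β c := by
  have := h.isFiniteMeasure hc ht
  have e : popMean β τ Z g t ω - g Complex.I * scaledPop β t c =
      Real.exp (-(β * t)) * ∫ z, (g z - g Complex.I) ∂popMeasure τ Z t ω := by
    rw [integral_sub (hg.integrable _) (integrable_const _), integral_const, popMean, scaledPop,
      measureReal_def, h.popMeasure_univ hc ht, smul_eq_mul]
    ring
  rw [e, abs_mul, abs_of_pos (Real.exp_pos _), ENNReal.ofReal_mul (by positivity)]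
  calc _ ≤ ENNReal.ofReal (Real.exp (-(β * t))) *
        ∫⁻ z, .ofReal L * ‖z - Complex.I‖ₑ ^ dispExp β ∂popMeasure τ Z t ω := by
        gcongr
        rw [← Real.enorm_eq_ofReal_abs]
        refine (enorm_integral_le_lintegral_enorm _).trans (lintegral_mono_ae ?_)
        filter_upwards [h.ae_im_nonneg hc ht] with z hz
        rw [Real.enorm_eq_ofReal_abs]
        exact hg.ofReal_abs_le hβ hz
    _ ≤ ENNReal.ofReal (Real.exp (-(β * t))) * (.ofReal L * (.ofReal (Real.exp (β * t)) *
        totalDisp β c)) := by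
        rw [lintegral_const_mul' _ _ ENNReal.ofReal_ne_top]
        gcongr
        exact h.lintegral_displacement_le hβ hc ht
    _ = (ENNReal.ofReal (Real.exp (-(β * t))) * .ofReal (Real.exp (β * t))) *
        (.ofReal L * totalDisp β c) := by ring
    _ = _ := by
        rw [← ENNReal.ofReal_mul (by positivity), ← Real.exp_add, neg_add_cancel, Real.exp_zero,
          ENNReal.ofReal_one, one_mul]

/-- The mass W at i is spread over [0, 1], at distance at most 2 from i, and 2^a ≤ 2 for the Hölder
exponent a. -/
lemma integral_approxLimit_zero_sub_le {L : ℝ} {g : ℂ → ℝ} (hβ : 0 < β) (hg : IsTest β L g)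
    (hc : AllRegular β c) :
    ENNReal.ofReal |g Complex.I * (yuleLimit β c).toReal - ∫ r, g (r : ℂ) ∂approxLimit β 0 c| ≤
      .ofReal L * (2 * supPop β c) := by
  have := hc.isFiniteMeasure hβ 0
  have hgm : Measurable fun r : ℝ => g r := hg.measurable.comp Complex.measurable_ofReal
  have hi : Integrable (fun r : ℝ => g r) (approxLimit β 0 c) := by
    obtain ⟨M, hM⟩ := hg.bounded
    exact .of_bound hgm.aestronglyMeasurable M (.of_forall fun r => hM _)
  have e : g Complex.I * (yuleLimit β c).toReal - ∫ r, g (r : ℂ) ∂approxLimit β 0 c =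
      ∫ r, (g Complex.I - g (r : ℂ)) ∂approxLimit β 0 c := by
    rw [integral_sub (integrable_const _) hi, integral_const, measureReal_def, approxLimit_univ,
      densityMass_zero, smul_eq_mul, mul_comm]
  rw [e, ← Real.enorm_eq_ofReal_abs]
  refine (enorm_integral_le_lintegral_enorm _).trans ?_
  rw [approxLimit_zero, lintegral_smul_measure, smul_eq_mul]
  calc _ ≤ yuleLimit β c * ∫⁻ _ in Set.Icc (0 : ℝ) 1, .ofReal L * 2 := by
        refine mul_le_mul_right (setLIntegral_mono' measurableSet_Icc fun r hr => ?_) _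
        rw [← enorm_neg, neg_sub, Real.enorm_eq_ofReal_abs]
        refine (hg.ofReal_abs_le hβ (by simp)).trans ?_
        gcongr
        have h2 : ‖(r : ℂ) - Complex.I‖ₑ ≤ 2 := by
          refine (enorm_sub_le (a := (r : ℂ)) (b := Complex.I)).trans ?_
          have h1 : ‖(r : ℂ)‖ₑ ≤ 1 := by
            rw [← ofReal_norm, Complex.norm_real, Real.norm_of_nonneg hr.1, ← ENNReal.ofReal_one]
            exact ENNReal.ofReal_le_ofReal hr.2
          have h3 : ‖Complex.I‖ₑ = 1 := by rw [← ofReal_norm]; simp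
          rw [h3, ← one_add_one_eq_two]
          gcongr
        calc _ ≤ (2 : ℝ≥0∞) ^ dispExp β := by
              have := dispExp_pos hβ
              gcongr
          _ ≤ 2 ^ (1 : ℝ) := ENNReal.rpow_le_rpow_of_exponent_le (by norm_num)
              (dispExp_le.trans (by norm_num))
          _ = 2 := by simp
    _ = .ofReal L * (2 * yuleLimit β c) := by
        rw [setLIntegral_const]
        simp
        ring
    _ ≤ _ := by
        gcongr
        exact yuleLimit_le_supPop hβ c

/-- The error made when the particles are replaced by their ancestors in generation `n`. -/
lemma eventually_popMean_sub_le (hβ : 0 < β) (n : ℕ) {L : ℝ} {g : ℂ → ℝ} (hg : IsTest β L g)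
    (h : Compat τ Z ω c) (hc : AllRegular β c) {ε : ℝ} (hε : 0 < ε) :
    ∀ᶠ t in atTop, ENNReal.ofReal |popMean β τ Z g t ω - ∫ r, g (r : ℂ) ∂approxLimit β n c| ≤
      .ofReal L * remainder β n c + .ofReal ε := by
  induction n generalizing L g τ Z c ε with
  | zero =>
    have h1 : Tendsto (fun t => |g Complex.I * scaledPop β t c -
        g Complex.I * (yuleLimit β c).toReal|) atTop (𝓝 0) := by
      have := (hc.regular.tendsto.const_mul (g Complex.I)).sub_const
        (g Complex.I * (yuleLimit β c).toReal)
      rw [sub_self] at this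
      simpa using this.abs
    filter_upwards [h1.eventually (gt_mem_nhds hε), eventually_ge_atTop 0] with t ht ht0
    have h2 := popMean_sub_le hβ hg h hc.regular.nonExplosive ht0
    have h3 := integral_approxLimit_zero_sub_le hβ hg hc
    calc _ ≤ ENNReal.ofReal (|popMean β τ Z g t ω - g Complex.I * scaledPop β t c| +
          |g Complex.I * (yuleLimit β c).toReal - ∫ r, g (r : ℂ) ∂approxLimit β 0 c| + ε) := by
          refine ENNReal.ofReal_le_ofReal ?_
          have h4 := abs_add_three (popMean β τ Z g t ω - g Complex.I * scaledPop β t c)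
            (g Complex.I * (yuleLimit β c).toReal - ∫ r, g (r : ℂ) ∂approxLimit β 0 c)
            (g Complex.I * scaledPop β t c - g Complex.I * (yuleLimit β c).toReal)
          have h5 : popMean β τ Z g t ω - ∫ r, g (r : ℂ) ∂approxLimit β 0 c =
            (popMean β τ Z g t ω - g Complex.I * scaledPop β t c) +
            (g Complex.I * (yuleLimit β c).toReal - ∫ r, g (r : ℂ) ∂approxLimit β 0 c) +
            (g Complex.I * scaledPop β t c - g Complex.I * (yuleLimit β c).toReal) := by ring
          rw [h5]
          linarith
      _ ≤ .ofReal L * totalDisp β c + .ofReal L * (2 * supPop β c) + .ofReal ε := by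
          rw [ENNReal.ofReal_add (by positivity) hε.le, ENNReal.ofReal_add (by positivity)
            (by positivity)]
          gcongr
      _ = _ := by rw [remainder, cascade, mul_add]
  | succ n ih =>
    have h0 := ih (hg.comp c) (h.sub false) (hc.sub false) (half_pos hε)
    have h1 := ih (hg.comp c) (h.sub true) (hc.sub true) (half_pos hε)
    have hsh : Tendsto (fun t => t - τ [] ω) atTop atTop :=
      tendsto_atTop_add_const_right _ _ tendsto_id
    filter_upwards [hsh.eventually h0, hsh.eventually h1, eventually_ge_atTop (τ [] ω)] with
      t ht0 ht1 htτ
    have hτ0 : 0 ≤ τ [] ω := by rw [← h.lifetime]; positivity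
    rw [popMean_eq hg h hc.regular.nonExplosive htτ, integral_approxLimit_succ hβ hg hc,
      h.lifetime, ← mul_sub, abs_mul, abs_of_pos (Real.exp_pos _), add_sub_add_comm,
      ENNReal.ofReal_mul (by positivity)]
    refine (mul_le_mul_right ((ENNReal.ofReal_le_ofReal (abs_add_le _ _)).trans
      (ENNReal.ofReal_add_le.trans (add_le_add ht0 ht1))) _).trans ?_
    -- Composition with the root map multiplies the Hölder constant by e^(aη). Together with the
    -- mass factor e^(-βτ) this is exactly the cascade weight of `remainder`.
    have e1 : ENNReal.ofReal (Real.exp (-(β * τ [] ω))) *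
        .ofReal (L * Real.exp (dispExp β * (c []).2.2.1)) = .ofReal L * dispWeight β (c []) := by
      rw [dispWeight, ← ENNReal.ofReal_mul (by positivity), ← ENNReal.ofReal_mul hg.nonneg,
        Real.exp_add, h.lifetime, neg_mul]
      congr 1; ring
    have e2 : ENNReal.ofReal (ε / 2) + .ofReal (ε / 2) = .ofReal ε := by
      rw [← ENNReal.ofReal_add (by positivity) (by positivity), add_halves]
    have e3 : ENNReal.ofReal (Real.exp (-(β * τ [] ω))) ≤ 1 := by
      rw [← ENNReal.ofReal_one]
      exact ENNReal.ofReal_le_ofReal (Real.exp_le_one_iff.2 (by nlinarith))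
    calc _ = (ENNReal.ofReal (Real.exp (-(β * τ [] ω))) *
          .ofReal (L * Real.exp (dispExp β * (c []).2.2.1))) *
            (remainder β n (sub false c) + remainder β n (sub true c)) +
          ENNReal.ofReal (Real.exp (-(β * τ [] ω))) * (.ofReal (ε / 2) + .ofReal (ε / 2)) := by ring
      _ ≤ .ofReal L * dispWeight β (c []) *
            (remainder β n (sub false c) + remainder β n (sub true c)) + 1 * .ofReal ε := by
          rw [e1, e2]; gcongr
      _ = _ := by rw [one_mul, remainder, cascade, mul_assoc]

/-- The limit along any filter finer than `atTop` determines the limit in t, since the error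
estimate only asks for one suitable generation. This permits the use of an ultrafilter, along which
limits exist by compactness. -/
lemma tendsto_popMean (hβ : 0 < β) {L : ℝ} {g : ℂ → ℝ} (hg : IsTest β L g)
    (h : Compat τ Z ω c) (hc : AllRegular β c)
    (hrem : Tendsto (fun n => remainder β n c) atTop (𝓝 0)) {l : Filter ℕ} [l.NeBot]
    (hl : l ≤ atTop) {A : ℝ}
    (hA : Tendsto (fun n => ∫ r, g (r : ℂ) ∂approxLimit β n c) l (𝓝 A)) :
    Tendsto (fun t => popMean β τ Z g t ω) atTop (𝓝 A) := by
  rw [Metric.tendsto_nhds]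
  intro ε hε
  have h1 : Tendsto (fun n => ENNReal.ofReal L * remainder β n c) l (𝓝 0) := by
    simpa using ENNReal.Tendsto.const_mul (hrem.mono_left hl) (.inr ENNReal.ofReal_ne_top)
  have hε3 : 0 < ENNReal.ofReal (ε / 3) := by simpa using hε
  obtain ⟨n, hn1, hn2⟩ := ((h1.eventually (gt_mem_nhds hε3)).and
    (Metric.tendsto_nhds.1 hA (ε / 3) (by positivity))).exists
  filter_upwards [eventually_popMean_sub_le hβ n hg h hc (ε := ε / 3) (by positivity)] with t ht
  have h2 : ENNReal.ofReal |popMean β τ Z g t ω - ∫ r, g (r : ℂ) ∂approxLimit β n c| <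
      .ofReal (ε / 3 + ε / 3) := by
    rw [ENNReal.ofReal_add (by positivity) (by positivity)]
    exact ht.trans_lt (ENNReal.add_lt_add_right ENNReal.ofReal_ne_top hn1)
  have h3 := (ENNReal.ofReal_lt_ofReal_iff (by positivity)).1 h2
  rw [Real.dist_eq] at hn2 ⊢
  calc _ ≤ |popMean β τ Z g t ω - ∫ r, g (r : ℂ) ∂approxLimit β n c| +
        |∫ r, g (r : ℂ) ∂approxLimit β n c - A| := abs_sub_le _ _ _
    _ < ε := by linarith

end System

/-! ### The limit of the empirical measures -/

section Disk

lemma add_I_ne_zero {z : ℂ} (hz : 0 ≤ z.im) : z + Complex.I ≠ 0 := fun h => by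
  have := congrArg Complex.im h
  simp at this
  linarith

lemma one_le_norm_add_I {z : ℂ} (hz : 0 ≤ z.im) : 1 ≤ ‖z + Complex.I‖ := by
  refine le_trans ?_ (Complex.abs_im_le_norm _)
  rw [Complex.add_im, Complex.I_im]
  exact le_trans (by linarith) (le_abs_self _)

lemma toDisk_sub_toDisk {z w : ℂ} (hz : 0 ≤ z.im) (hw : 0 ≤ w.im) : toDisk z - toDisk w =
    2 * Complex.I * (z - w) / ((z + Complex.I) * (w + Complex.I)) := by
  have h1 := add_I_ne_zero hz
  have h2 := add_I_ne_zero hw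
  rw [toDisk, toDisk]
  field_simp
  ring

lemma norm_toDisk_sub_toDisk {z w : ℂ} (hz : 0 ≤ z.im) (hw : 0 ≤ w.im) :
    ‖toDisk z - toDisk w‖ = 2 * ‖z - w‖ / (‖z + Complex.I‖ * ‖w + Complex.I‖) := by
  rw [toDisk_sub_toDisk hz hw]
  simp

lemma norm_toDisk_sub_toDisk_le {z w : ℂ} (hz : 0 ≤ z.im) (hw : 0 ≤ w.im) :
    ‖toDisk z - toDisk w‖ ≤ 2 * ‖z - w‖ := by
  rw [norm_toDisk_sub_toDisk hz hw]
  exact div_le_self (by positivity)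
    (one_le_mul_of_one_le_of_one_le (one_le_norm_add_I hz) (one_le_norm_add_I hw))

@[fun_prop] lemma measurable_toDisk : Measurable toDisk := by unfold toDisk; fun_prop

lemma norm_real_add_I (r : ℝ) : ‖(r : ℂ) + Complex.I‖ = √(1 + r ^ 2) := by
  rw [Complex.norm_def, Complex.normSq_apply]
  simp
  ring_nf

lemma norm_toDisk_real (r : ℝ) : ‖toDisk r‖ = 1 := by
  have h : ‖(r : ℂ) - Complex.I‖ = ‖(r : ℂ) + Complex.I‖ := by
    rw [Complex.norm_def, Complex.norm_def, Complex.normSq_apply, Complex.normSq_apply]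
    simp
  rw [toDisk, norm_div, h, div_self]
  exact norm_ne_zero_iff.2 (add_I_ne_zero (by simp))

/-- The map from the real line to the unit circle. -/
def circlePoint (r : ℝ) : Metric.sphere (0 : ℂ) 1 := ⟨toDisk r, by simp [norm_toDisk_real]⟩

@[fun_prop] lemma measurable_circlePoint : Measurable circlePoint :=
  Measurable.subtype_mk (measurable_toDisk.comp Complex.measurable_ofReal)

/-- For points at distance at most 1 the Lipschitz bound applies (`toDisk` has Lipschitz constant 2
on the closed half plane) and the distance is below its power of order a < 1; for larger distances
the oscillation C suffices. -/
lemma isTest_comp_toDisk {β : ℝ} (hβ : 0 < β) {f : ℂ → ℝ} {C : ℝ} (hf : ∀ x y, dist (f x) (f y) ≤ C)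
    {K : ℝ≥0} (hK : LipschitzWith K f) : IsTest β (C + 2 * K) (f ∘ toDisk) where
  nonneg := add_nonneg (dist_nonneg.trans (hf 0 0)) (by positivity)
  measurable := hK.continuous.measurable.comp measurable_toDisk
  bounded := ⟨C + |f 0|, fun z => by
    have h1 := hf (toDisk z) 0
    rw [Real.dist_eq] at h1
    have h2 := abs_sub_abs_le_abs_sub (f (toDisk z)) (f 0)
    rw [Function.comp_apply]
    linarith⟩
  holder z w hz hw := by
    have ha := dispExp_pos hβ
    have ha1 := dispExp_le (β := β)
    have hC : 0 ≤ C := dist_nonneg.trans (hf 0 0)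
    rw [← Real.dist_eq, Function.comp_apply, Function.comp_apply]
    rcases le_total ‖z - w‖ 1 with h | h
    · have h1 : ‖z - w‖ ≤ ‖z - w‖ ^ dispExp β := by
        conv_lhs => rw [← Real.rpow_one ‖z - w‖]
        exact Real.rpow_le_rpow_of_exponent_ge' (norm_nonneg _) h ha.le (by linarith)
      calc _ ≤ K * dist (toDisk z) (toDisk w) := hK.dist_le_mul _ _
        _ ≤ K * (2 * ‖z - w‖) := by
          rw [dist_eq_norm]
          gcongr
          exact norm_toDisk_sub_toDisk_le hz hw
        _ ≤ (2 * K) * ‖z - w‖ ^ dispExp β := by rw [← mul_assoc, mul_comm (K : ℝ)]; gcongr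
        _ ≤ _ := by gcongr; linarith
    · have h1 : 1 ≤ ‖z - w‖ ^ dispExp β := Real.one_le_rpow h ha.le
      refine (hf _ _).trans ((le_mul_of_one_le_right hC h1).trans ?_)
      gcongr
      have : (0 : ℝ) ≤ K := K.2
      linarith

end Disk

/-! ### The weak limit, from compactness of the circle -/

section Limit

variable {Ω : Type*} {τ : List Bool → Ω → ℝ} {Z : List Bool → ℝ≥0 → Ω → ℂ} {ω : Ω}
  {c : List Bool → Mark} {β : ℝ}

/-- The almost sure properties of the marks on which the convergence of the empirical measures
depends. -/
structure IsTypical (β : ℝ) (c : List Bool → Mark) : Prop where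
  allRegular : AllRegular β c
  yuleLimit_ne_zero : yuleLimit β c ≠ 0
  remainder : Tendsto (fun n => remainder β n c) atTop (𝓝 0)
  energy : ∀ s : ℚ, 0 < (s : ℝ) → (s : ℝ) < 1 → (s : ℝ) < β →
    liminf (fun n => energy β s 0 n c c + 2 * energy β s s n c c) atTop ≠ ∞
  power : 1 / 2 < β → ∃ p : ℝ, 1 < p ∧
    liminf (fun n => ∫⁻ r, density β n c r * density β n c r ^ (p - 1)) atTop ≠ ∞

lemma ae_isTypical (hβ : 0 < β) {C : ℝ≥0} {ν : List Bool → Measure Mark}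
    (hν : ∀ u, IsMarkLaw β C (ν u)) : ∀ᵐ c ∂treeLaw ν, IsTypical β c := by
  have h1 : ∀ᵐ c ∂treeLaw ν, ∀ s : ℚ, 0 < (s : ℝ) → (s : ℝ) < 1 → (s : ℝ) < β →
      liminf (fun n => HypBBM.energy β s 0 n c c + 2 * HypBBM.energy β s s n c c) atTop ≠ ∞ := by
    rw [ae_all_iff]
    intro s
    by_cases hs : 0 < (s : ℝ) ∧ (s : ℝ) < 1 ∧ (s : ℝ) < β
    · filter_upwards [ae_liminf_energy_ne_top hβ hs.1 hs.2.1 hs.2.2 hν] with c hc _ _ _ using hc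
    · exact .of_forall fun c h1 h2 h3 => absurd ⟨h1, h2, h3⟩ hs
  have h2 : ∀ᵐ c ∂treeLaw ν, 1 / 2 < β → ∃ p : ℝ, 1 < p ∧
      liminf (fun n => ∫⁻ r, density β n c r * density β n c r ^ (p - 1)) atTop ≠ ∞ := by
    by_cases h : 1 / 2 < β
    · obtain ⟨p, hp, hp'⟩ := exists_between (show 1 < min 2 (2 * β) from
        lt_min (by norm_num) (by linarith))
      filter_upwards [ae_liminf_density_rpow_ne_top h hp (hp'.le.trans (min_le_left _ _))
        (hp'.trans_le (min_le_right _ _)) hν] with c hc _ using ⟨p, hp, hc⟩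
    · exact .of_forall fun c h' => absurd h' h
  filter_upwards [ae_allRegular hβ hν, ae_yuleLimit_ne_zero hβ hν, ae_tendsto_remainder hβ hν,
    h1, h2] with c a1 a2 a3 a4 a5 using ⟨a1, a2, a3, a4, a5⟩

lemma IsTypical.yuleLimit_ne_top (hβ : 0 < β) (h : IsTypical β c) : yuleLimit β c ≠ ∞ :=
  h.allRegular.regular.yuleLimit_ne_top hβ

/-- The approximate limit measure on the circle, normalised. -/
def circleApprox (hβ : 0 < β) (h : IsTypical β c) (n : ℕ) :
    ProbabilityMeasure (Metric.sphere (0 : ℂ) 1) :=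
  ⟨(yuleLimit β c)⁻¹ • (approxLimit β n c).map circlePoint, ⟨by
    rw [Measure.smul_apply, Measure.map_apply measurable_circlePoint .univ, Set.preimage_univ,
      approxLimit_univ, h.allRegular.densityMass_eq hβ, smul_eq_mul,
      ENNReal.inv_mul_cancel h.yuleLimit_ne_zero (h.yuleLimit_ne_top hβ)]⟩⟩

/-- The approximate limit measure in the disk model, normalised. -/
def diskApprox (hβ : 0 < β) (h : IsTypical β c) (n : ℕ) : ProbabilityMeasure ℂ :=
  (circleApprox hβ h n).map (f := Subtype.val) measurable_subtype_coe.aemeasurable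

lemma diskApprox_toMeasure (hβ : 0 < β) (h : IsTypical β c) (n : ℕ) :
    (diskApprox hβ h n : Measure ℂ) =
      (yuleLimit β c)⁻¹ • (approxLimit β n c).map fun r : ℝ => toDisk r := by
  change ((yuleLimit β c)⁻¹ • (approxLimit β n c).map circlePoint).map Subtype.val = _
  rw [Measure.map_smul, Measure.map_map measurable_subtype_coe measurable_circlePoint]
  rfl

lemma integral_diskApprox (hβ : 0 < β) (h : IsTypical β c) (n : ℕ) {f : ℂ → ℝ} (hf : Measurable f) :
    ∫ z, f z ∂(diskApprox hβ h n : Measure ℂ) = (yuleLimit β c).toReal⁻¹ *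
      ∫ r, (f ∘ toDisk) (r : ℂ) ∂approxLimit β n c := by
  rw [diskApprox_toMeasure, integral_smul_measure, integral_map (by fun_prop)
    hf.aestronglyMeasurable, ENNReal.toReal_inv, smul_eq_mul]
  rfl

/-- The integrals of test functions with respect to approximate limit measures converge as soon as
they do along an ultrafilter. -/
lemma tendsto_integral_approxLimit (hβ : 0 < β) {L : ℝ} {g : ℂ → ℝ} (hg : IsTest β L g)
    (h : Compat τ Z ω c) (hc : AllRegular β c)
    (hrem : Tendsto (fun n => remainder β n c) atTop (𝓝 0)) {A : ℝ}
    (hA : Tendsto (fun t => popMean β τ Z g t ω) atTop (𝓝 A)) :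
    Tendsto (fun n => ∫ r, g (r : ℂ) ∂approxLimit β n c) atTop (𝓝 A) := by
  rw [Metric.tendsto_nhds]
  intro ε hε
  have h1 : Tendsto (fun n => ENNReal.ofReal L * remainder β n c) atTop (𝓝 0) := by
    simpa using ENNReal.Tendsto.const_mul hrem (.inr ENNReal.ofReal_ne_top)
  have hε3 : 0 < ENNReal.ofReal (ε / 3) := by simpa using hε
  filter_upwards [h1.eventually (gt_mem_nhds hε3)] with n hn1
  obtain ⟨t, ht, hn2⟩ := ((eventually_popMean_sub_le hβ n hg h hc (ε := ε / 3) (by positivity)).and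
    (Metric.tendsto_nhds.1 hA (ε / 3) (by positivity))).exists
  have h2 : ENNReal.ofReal |popMean β τ Z g t ω - ∫ r, g (r : ℂ) ∂approxLimit β n c| <
      .ofReal (ε / 3 + ε / 3) := by
    rw [ENNReal.ofReal_add (by positivity) (by positivity)]
    exact ht.trans_lt (ENNReal.add_lt_add_right ENNReal.ofReal_ne_top hn1)
  have h3 := (ENNReal.ofReal_lt_ofReal_iff (by positivity)).1 h2
  rw [Real.dist_eq] at hn2 ⊢
  rw [abs_sub_comm] at h3
  calc _ ≤ |∫ r, g (r : ℂ) ∂approxLimit β n c - popMean β τ Z g t ω| +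
        |popMean β τ Z g t ω - A| := abs_sub_le _ _ _
    _ < ε := by linarith

/-- An ultrafilter limit μ of the approximations exists on the compact circle. It determines the
limit of the population means, and these in turn force the whole sequence of approximations to
converge to μ. -/
lemma exists_tendsto_diskApprox (hβ : 0 < β) (h : Compat τ Z ω c) (hc : IsTypical β c) :
    ∃ μ : ProbabilityMeasure ℂ, (μ : Measure ℂ) (Metric.sphere 0 1)ᶜ = 0 ∧
      Tendsto (diskApprox hβ hc) atTop (𝓝 μ) ∧
      ∀ f : ℂ → ℝ, (∃ C : ℝ, ∀ x y, dist (f x) (f y) ≤ C) → (∃ K, LipschitzWith K f) →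
        Tendsto (fun t => popMean β τ Z (f ∘ toDisk) t ω) atTop
          (𝓝 ((yuleLimit β c).toReal * ∫ z, f z ∂(μ : Measure ℂ))) := by
  have : CompactSpace (Metric.sphere (0 : ℂ) 1) :=
    isCompact_iff_compactSpace.1 (isCompact_sphere _ _)
  -- The probability measures on a compact space form a compact space, so this ultrafilter
  -- converges. Working on the sphere itself also ensures that the limit is carried by it.
  set F : Ultrafilter (ProbabilityMeasure (Metric.sphere (0 : ℂ) 1)) :=
    (hyperfilter ℕ).map (circleApprox hβ hc)
  have hF : Tendsto (circleApprox hβ hc) (hyperfilter ℕ) (𝓝 F.lim) := F.le_nhds_lim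
  have hW : (yuleLimit β c).toReal ≠ 0 :=
    ENNReal.toReal_ne_zero.2 ⟨hc.yuleLimit_ne_zero, hc.yuleLimit_ne_top hβ⟩
  set μ : ProbabilityMeasure ℂ :=
    F.lim.map (f := Subtype.val) continuous_subtype_val.measurable.aemeasurable
  have hμ : Tendsto (diskApprox hβ hc) (hyperfilter ℕ) (𝓝 μ) :=
    ProbabilityMeasure.tendsto_map_of_tendsto_of_continuous _ _ hF continuous_subtype_val
  have hpop : ∀ f : ℂ → ℝ, (∃ C : ℝ, ∀ x y, dist (f x) (f y) ≤ C) → (∃ K, LipschitzWith K f) →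
        Tendsto (fun t => popMean β τ Z (f ∘ toDisk) t ω) atTop
          (𝓝 ((yuleLimit β c).toReal * ∫ z, f z ∂(μ : Measure ℂ))) := by
    rintro f ⟨C, hC⟩ ⟨K, hK⟩
    have h1 : Tendsto (fun n => ∫ z, f z ∂(diskApprox hβ hc n : Measure ℂ)) (hyperfilter ℕ)
        (𝓝 (∫ z, f z ∂(μ : Measure ℂ))) := by
      rw [ProbabilityMeasure.tendsto_iff_forall_integral_tendsto] at hμ
      exact hμ ⟨⟨f, hK.continuous⟩, C, hC⟩
    refine tendsto_popMean hβ (isTest_comp_toDisk hβ hC hK) h hc.allRegular hc.remainder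
      Nat.hyperfilter_le_atTop ((h1.const_mul (yuleLimit β c).toReal).congr fun n => ?_)
    rw [integral_diskApprox hβ hc n hK.continuous.measurable, mul_inv_cancel_left₀ hW]
  refine ⟨μ, ?_, ?_, hpop⟩
  · change (F.lim : Measure (Metric.sphere (0 : ℂ) 1)).map Subtype.val _ = 0
    rw [Measure.map_apply measurable_subtype_coe Metric.isClosed_sphere.measurableSet.compl]
    convert! measure_empty (μ := (F.lim : Measure (Metric.sphere (0 : ℂ) 1)))
    ext x
    simp
  · rw [tendsto_iff_forall_lipschitz_integral_tendsto]
    rintro f ⟨C, hC⟩ ⟨K, hK⟩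
    have h1 := (tendsto_integral_approxLimit hβ (isTest_comp_toDisk hβ hC hK) h hc.allRegular
      hc.remainder (hpop f ⟨C, hC⟩ ⟨K, hK⟩)).const_mul (yuleLimit β c).toReal⁻¹
    rw [inv_mul_cancel_left₀ hW] at h1
    exact h1.congr fun n => (integral_diskApprox hβ hc n hK.continuous.measurable).symm

lemma empiricalMeasure_eq (t : ℝ≥0) :
    empiricalMeasure τ Z t ω = (popMeasure τ Z t ω Set.univ)⁻¹ •
      (popMeasure τ Z t ω).map toDisk := by
  have h1 : popMeasure τ Z t ω Set.univ = ((alive τ t ω).encard : ℝ≥0∞) := by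
    rw [popMeasure, Measure.sum_apply _ .univ, ← ENNReal.tsum_set_one]
    simp only [measure_univ]
    rfl
  rw [h1, empiricalMeasure]
  congr 1
  refine Measure.ext fun s hs => ?_
  rw [Measure.map_apply measurable_toDisk hs, popMeasure, Measure.sum_apply _ hs,
    Measure.sum_apply _ (measurable_toDisk hs)]
  refine tsum_congr fun u => ?_
  rw [Measure.dirac_apply' _ hs, Measure.dirac_apply' _ (measurable_toDisk hs)]
  rfl

/-- The empirical integral is the quotient of the population mean, which tends to W ∫ f dμ, by the
normalised size, which tends to W; since W ≠ 0, it cancels. Bounded Lipschitz functions suffice for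
weak convergence. -/
lemma Compat.isLimitMeasure (hβ : 0 < β) (h : Compat τ Z ω c) (hc : IsTypical β c)
    {μ : ProbabilityMeasure ℂ} (hμ : (μ : Measure ℂ) (Metric.sphere 0 1)ᶜ = 0)
    (hpop : ∀ f : ℂ → ℝ, (∃ C : ℝ, ∀ x y, dist (f x) (f y) ≤ C) → (∃ K, LipschitzWith K f) →
        Tendsto (fun t => popMean β τ Z (f ∘ toDisk) t ω) atTop
          (𝓝 ((yuleLimit β c).toReal * ∫ z, f z ∂(μ : Measure ℂ)))) :
    IsLimitMeasure τ Z ω μ := by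
  have hne := hc.allRegular.regular.nonExplosive
  have huniv : ∀ t : ℝ≥0, popMeasure τ Z t ω Set.univ = population t c :=
    fun t => h.popMeasure_univ hne t.2
  have h0 : ∀ t : ℝ≥0, population t c ≠ 0 := fun t =>
    (zero_lt_one.trans_le (one_le_population _ c)).ne'
  have hW : (yuleLimit β c).toReal ≠ 0 :=
    ENNReal.toReal_ne_zero.2 ⟨hc.yuleLimit_ne_zero, hc.yuleLimit_ne_top hβ⟩
  let e : ℝ≥0 → ProbabilityMeasure ℂ := fun t => ⟨empiricalMeasure τ Z t ω, ⟨by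
    rw [empiricalMeasure_eq, Measure.smul_apply, Measure.map_apply measurable_toDisk .univ,
      Set.preimage_univ, huniv, smul_eq_mul,
      ENNReal.inv_mul_cancel (h0 t) (hne.population_ne_top t)]⟩⟩
  have he : Tendsto e atTop (𝓝 μ) := by
    rw [tendsto_iff_forall_lipschitz_integral_tendsto]
    rintro f hC ⟨K, hK⟩
    have h1 := ((hpop f hC ⟨K, hK⟩).div hc.allRegular.regular.tendsto hW).comp
      (NNReal.tendsto_coe_atTop.2 tendsto_id)
    rw [mul_div_cancel_left₀ _ hW] at h1
    refine h1.congr fun t => ?_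
    change _ = ∫ z, f z ∂empiricalMeasure τ Z t ω
    rw [empiricalMeasure_eq, integral_smul_measure, integral_map (by fun_prop)
      hK.continuous.measurable.aestronglyMeasurable, huniv, ENNReal.toReal_inv, smul_eq_mul]
    simp only [Function.comp_apply, Pi.div_apply, popMean, scaledPop, id]
    rw [mul_div_mul_left _ _ (Real.exp_pos _).ne', div_eq_inv_mul]
  exact ⟨inferInstance, hμ, ProbabilityMeasure.tendsto_iff_forall_integral_tendsto.1 he⟩

end Limit

/-! ### Regularity of the limit measure -/

section Regularity

variable {c : List Bool → Mark} {β : ℝ}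

/-- The chordal distance is 2|r - r'| / √((1+r²)(1+r'²)), so |r - r'| ≤ δ(1 + r² + r'²); the power s
< 1 is subadditive. Hence the weights |r|^(2s) in the energies. -/
lemma norm_sub_rpow_le {s δ : ℝ} (hs : 0 < s) (hs1 : s < 1) (hδ : 0 < δ) {r r' : ℝ}
    (h : ‖toDisk r - toDisk r'‖ ≤ δ) :
    |r - r'| ^ s ≤ δ ^ s * (1 + |r| ^ (2 * s) + |r'| ^ (2 * s)) := by
  rw [norm_toDisk_sub_toDisk (by simp) (by simp), norm_real_add_I, norm_real_add_I,
    div_le_iff₀ (by positivity), ← Complex.ofReal_sub, Complex.norm_real, Real.norm_eq_abs] at h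
  have h1 : √(1 + r ^ 2) * √(1 + r' ^ 2) ≤ 1 + r ^ 2 + r' ^ 2 := by
    have := two_mul_le_add_sq √(1 + r ^ 2) √(1 + r' ^ 2)
    rw [Real.sq_sqrt (by positivity), Real.sq_sqrt (by positivity)] at this
    nlinarith [sq_nonneg r, sq_nonneg r']
  have h2 : |r - r'| ≤ δ * (1 + r ^ 2 + r' ^ 2) := by
    have := mul_le_mul_of_nonneg_left h1 hδ.le
    have := abs_nonneg (r - r')
    linarith
  have sq : ∀ x : ℝ, (x ^ 2) ^ s = |x| ^ (2 * s) := fun x => by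
    rw [← sq_abs, ← Real.rpow_natCast, ← Real.rpow_mul (abs_nonneg x)]; norm_num
  calc _ ≤ (δ * (1 + r ^ 2 + r' ^ 2)) ^ s := Real.rpow_le_rpow (abs_nonneg _) h2 hs.le
    _ = δ ^ s * (1 + r ^ 2 + r' ^ 2) ^ s := Real.mul_rpow hδ.le (by positivity)
    _ ≤ δ ^ s * ((1 + r ^ 2) ^ s + (r' ^ 2) ^ s) := by
      gcongr
      exact Real.rpow_add_le_add_rpow (by positivity) (by positivity) hs.le hs1.le
    _ ≤ δ ^ s * ((1 ^ s + (r ^ 2) ^ s) + (r' ^ 2) ^ s) := by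
      gcongr
      exact Real.rpow_add_le_add_rpow (by positivity) (by positivity) hs.le hs1.le
    _ = _ := by rw [Real.one_rpow, sq, sq]

lemma one_le_mul_riesz {s δ : ℝ} (hs : 0 < s) (hs1 : s < 1) (hδ : 0 < δ) {r r' : ℝ}
    (h : ‖toDisk r - toDisk r'‖ ≤ δ) :
    1 ≤ ENNReal.ofReal (δ ^ s) * ((1 + mom s r + mom s r') * riesz s r r') := by
  have h1 : ‖r - r'‖ₑ ^ s ≤ ENNReal.ofReal (δ ^ s) * (1 + mom s r + mom s r') := by
    rw [Real.enorm_eq_ofReal_abs, ENNReal.ofReal_rpow_of_nonneg (abs_nonneg _) hs.le, mom, mom,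
      ← ENNReal.ofReal_one, ← ENNReal.ofReal_add (by positivity) (by positivity),
      ← ENNReal.ofReal_add (by positivity) (by positivity), ← ENNReal.ofReal_mul (by positivity)]
    exact ENNReal.ofReal_le_ofReal (norm_sub_rpow_le hs hs1 hδ h)
  rw [← mul_assoc, riesz, ENNReal.rpow_neg]
  -- On the diagonal the kernel is infinite and its prefactor is positive.
  by_cases h0 : ‖r - r'‖ₑ ^ s = 0
  · rw [h0, ENNReal.inv_zero, ENNReal.mul_top]
    · exact le_top
    · refine mul_ne_zero (by simpa using Real.rpow_pos_of_pos hδ s) ?_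
      rw [add_assoc]
      exact (zero_lt_one.trans_le (le_add_of_nonneg_right zero_le)).ne'
  · calc (1 : ℝ≥0∞) = ‖r - r'‖ₑ ^ s * (‖r - r'‖ₑ ^ s)⁻¹ := (ENNReal.mul_inv_cancel h0
          (ENNReal.rpow_ne_top_of_nonneg hs.le enorm_ne_top)).symm
      _ ≤ _ := by gcongr

/-- By symmetry of the kernel the weight may sit on either variable. -/
lemma lintegral_mom_right (s : ℝ) (n : ℕ) (c : List Bool → Mark) :
    ∫⁻ y, (∫⁻ r, mom s y * riesz s r y * density β n c r) * density β n c y =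
      energy β s s n c c := by
  rw [energy]
  simp_rw [pot]
  have h1 : ∀ y, (∫⁻ r, mom s y * riesz s r y * density β n c r) * density β n c y =
      ∫⁻ r, mom s y * riesz s r y * density β n c r * density β n c y := fun y =>
    (lintegral_mul_const _ (by fun_prop)).symm
  have h2 : ∀ y, (∫⁻ r, mom s r * riesz s r y * density β n c r) * density β n c y =
      ∫⁻ r, mom s r * riesz s r y * density β n c r * density β n c y := fun y =>
    (lintegral_mul_const _ (by fun_prop)).symm
  simp_rw [h1, h2]
  rw [lintegral_lintegral_swap (by
    refine Measurable.aemeasurable ?_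
    unfold Function.uncurry
    fun_prop)]
  refine lintegral_congr fun r => lintegral_congr fun y => ?_
  rw [riesz_comm s r y]
  ring

/-- The approximate limit measure of a small set is controlled by the energies. -/
lemma approxLimit_sq_le {s δ : ℝ} (hs : 0 < s) (hs1 : s < 1) (hδ : 0 < δ) (n : ℕ)
    (c : List Bool → Mark) {V : Set ℝ} (hV : MeasurableSet V)
    (hVδ : ∀ r ∈ V, ∀ r' ∈ V, ‖toDisk r - toDisk r'‖ ≤ δ) :
    approxLimit β n c V ^ 2 ≤
      .ofReal (δ ^ s) * (energy β s 0 n c c + 2 * energy β s s n c c) := by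
  have hm : ∀ a (y : ℝ), Measurable fun r => mom a r * riesz s r y * density β n c r :=
    fun a y => by fun_prop
  have e1 : ∀ y, ∫⁻ r, (1 + mom s r + mom s y) * riesz s r y * density β n c r =
      pot β s 0 n c y + pot β s s n c y + ∫⁻ r, mom s y * riesz s r y * density β n c r := by
    intro y
    rw [pot, pot, ← lintegral_add_left (hm 0 y), ← lintegral_add_left (by exact (hm 0 y).add (hm s y))]
    refine lintegral_congr fun r => ?_
    rw [mom_zero]; ring
  have hD : approxLimit β n c V = ∫⁻ r in V, density β n c r := by
    rw [approxLimit, withDensity_apply _ hV]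
  have m1 : Measurable fun y => pot β s 0 n c y * density β n c y := by fun_prop
  have m2 : Measurable fun y => pot β s s n c y * density β n c y := by fun_prop
  calc approxLimit β n c V ^ 2
      = ∫⁻ y in V, (∫⁻ r in V, density β n c r) * density β n c y := by
        rw [lintegral_const_mul _ (by fun_prop), hD, sq]
    _ ≤ ∫⁻ y in V, (∫⁻ r, .ofReal (δ ^ s) * ((1 + mom s r + mom s y) * riesz s r y *
          density β n c r)) * density β n c y := by
        refine setLIntegral_mono' hV fun y hy => mul_le_mul_left ?_ _
        refine (setLIntegral_mono' hV fun r hr => ?_).trans (setLIntegral_le_lintegral V _)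
        rw [← mul_assoc]
        exact le_mul_of_one_le_left zero_le (one_le_mul_riesz hs hs1 hδ (hVδ r hr y hy))
    _ ≤ ∫⁻ y, (∫⁻ r, .ofReal (δ ^ s) * ((1 + mom s r + mom s y) * riesz s r y *
          density β n c r)) * density β n c y := setLIntegral_le_lintegral V _
    _ = ∫⁻ y, .ofReal (δ ^ s) * ((pot β s 0 n c y * density β n c y +
          pot β s s n c y * density β n c y) +
          (∫⁻ r, mom s y * riesz s r y * density β n c r) * density β n c y) := by
        refine lintegral_congr fun y => ?_
        rw [lintegral_const_mul _ (by fun_prop), e1]; ring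
    _ = .ofReal (δ ^ s) * (energy β s 0 n c c + 2 * energy β s s n c c) := by
        rw [lintegral_const_mul' _ _ ENNReal.ofReal_ne_top,
          lintegral_add_left (by exact m1.add m2), lintegral_add_left m1, lintegral_mom_right,
          ← energy, ← energy]
        ring

/-- The measures of the open sets under the limit measure are controlled by those under the
approximate limit measures. -/
lemma measure_le_of_frequently (hβ : 0 < β) (hc : IsTypical β c) {μ : ProbabilityMeasure ℂ}
    (hμ : Tendsto (diskApprox hβ hc) atTop (𝓝 μ)) {U : Set ℂ} (hU : IsOpen U) {K : ℝ≥0∞}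
    (h : ∃ᶠ n in atTop, approxLimit β n c ((fun r : ℝ => toDisk r) ⁻¹' U) ≤ K) :
    (μ : Measure ℂ) U ≤ (yuleLimit β c)⁻¹ * K := by
  refine (ProbabilityMeasure.le_liminf_measure_open_of_tendsto hμ hU).trans
    (liminf_le_of_frequently_le' (h.mono fun n hn => ?_))
  rw [diskApprox_toMeasure, Measure.smul_apply, Measure.map_apply (by fun_prop) hU.measurableSet,
    smul_eq_mul]
  gcongr

/-- The energy bounds the square of the mass by δ^s, so the mass is at most of order δ^(s/2). Open
sets are used because their measure is lower semicontinuous under weak convergence, and then a bound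
along a subsequence is enough. -/
lemma exists_measure_le_rpow (hβ : 0 < β) (hc : IsTypical β c) {μ : ProbabilityMeasure ℂ}
    (hμ : Tendsto (diskApprox hβ hc) atTop (𝓝 μ)) {s : ℚ} (hs : 0 < (s : ℝ)) (hs1 : (s : ℝ) < 1)
    (hsβ : (s : ℝ) < β) : ∃ K : ℝ≥0, ∀ (U : Set ℂ) (δ : ℝ), IsOpen U → 0 < δ →
      (∀ z ∈ U, ∀ w ∈ U, ‖z - w‖ ≤ δ) → (μ : Measure ℂ) U ≤ K * .ofReal (δ ^ (s / 2 : ℝ)) := by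
  obtain ⟨K, hK, hK'⟩ := exists_between (lt_top_iff_ne_top.2 (hc.energy s hs hs1 hsβ))
  have hfr := frequently_lt_of_liminf_lt (by isBoundedDefault) hK
  have hfin : (yuleLimit β c)⁻¹ * K ^ (1 / 2 : ℝ) ≠ ∞ := ENNReal.mul_ne_top
    (ENNReal.inv_ne_top.2 hc.yuleLimit_ne_zero) (ENNReal.rpow_ne_top_of_nonneg (by norm_num) hK'.ne)
  refine ⟨((yuleLimit β c)⁻¹ * K ^ (1 / 2 : ℝ)).toNNReal, fun U δ hU hδ hUδ => ?_⟩
  rw [ENNReal.coe_toNNReal hfin, mul_assoc]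
  refine measure_le_of_frequently hβ hc hμ hU (hfr.mono fun n hn => ?_)
  have h1 := approxLimit_sq_le (β := β) hs hs1 hδ n c
    (hU.measurableSet.preimage (by fun_prop : Measurable fun r : ℝ => toDisk r))
    fun r hr r' hr' => hUδ _ hr _ hr'
  calc _ = (approxLimit β n c ((fun r : ℝ => toDisk r) ⁻¹' U) ^ 2) ^ (1 / 2 : ℝ) := by
        rw [← ENNReal.rpow_natCast, ← ENNReal.rpow_mul]; norm_num
    _ ≤ (.ofReal (δ ^ (s : ℝ)) * K) ^ (1 / 2 : ℝ) := by
        gcongr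
        exact h1.trans (by gcongr)
    _ = _ := by
        rw [ENNReal.mul_rpow_of_nonneg _ _ (by norm_num), ENNReal.ofReal_rpow_of_nonneg
          (by positivity) (by norm_num), ← Real.rpow_mul hδ.le, mul_comm, mul_one_div]

lemma measure_ball_le {μ : ProbabilityMeasure ℂ} {K : ℝ≥0} {s : ℝ}
    (h : ∀ (U : Set ℂ) (δ : ℝ), IsOpen U → 0 < δ →
      (∀ z ∈ U, ∀ w ∈ U, ‖z - w‖ ≤ δ) → (μ : Measure ℂ) U ≤ K * .ofReal (δ ^ s))
    (z : ℂ) {ε : ℝ} (hε : 0 < ε) :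
    (μ : Measure ℂ) (Metric.ball z ε) ≤ K * .ofReal ((2 * ε) ^ s) :=
  h _ _ Metric.isOpen_ball (by positivity) fun x hx y hy => by
    rw [← dist_eq_norm]
    have := dist_triangle_right x y z
    rw [Metric.mem_ball] at hx hy
    linarith

lemma measure_singleton_eq_zero (hβ : 0 < β) (hc : IsTypical β c) {μ : ProbabilityMeasure ℂ}
    (hμ : Tendsto (diskApprox hβ hc) atTop (𝓝 μ)) (z : ℂ) : (μ : Measure ℂ) {z} = 0 := by
  obtain ⟨s, hs, hs'⟩ := exists_rat_btwn (show 0 < min 1 β from lt_min one_pos hβ)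
  obtain ⟨K, hK⟩ := exists_measure_le_rpow hβ hc hμ hs (hs'.trans_le (min_le_left _ _))
    (hs'.trans_le (min_le_right _ _))
  have h1 : Tendsto (fun ε : ℝ => (K : ℝ≥0∞) * .ofReal ((2 * ε) ^ (s / 2 : ℝ))) (𝓝[>] 0) (𝓝 0) := by
    have h2 : Tendsto (fun ε : ℝ => (2 * ε) ^ (s / 2 : ℝ)) (𝓝[>] 0) (𝓝 0) := by
      have : Continuous fun ε : ℝ => (2 * ε) ^ (s / 2 : ℝ) :=
        (continuous_const.mul continuous_id).rpow_const fun _ => .inr (by positivity)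
      have := this.tendsto 0
      simp only [mul_zero] at this
      rw [Real.zero_rpow (by positivity)] at this
      exact this.mono_left nhdsWithin_le_nhds
    simpa using ENNReal.Tendsto.const_mul (ENNReal.tendsto_ofReal h2) (.inr ENNReal.coe_ne_top)
  refine le_antisymm (ge_of_tendsto h1 ?_) zero_le
  filter_upwards [self_mem_nhdsWithin] with ε hε
  exact (measure_mono (Set.singleton_subset_iff.2 (Metric.mem_ball_self hε))).trans
    (measure_ball_le hK z hε)

lemma norm_exp_mul_I_sub_le (x y : ℝ) :
    ‖Complex.exp (x * Complex.I) - Complex.exp (y * Complex.I)‖ ≤ |x - y| := by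
  have h : Complex.exp (x * Complex.I) - Complex.exp (y * Complex.I) =
      Complex.exp (y * Complex.I) * (Complex.exp (Complex.I * (x - y : ℝ)) - 1) := by
    rw [mul_sub, ← Complex.exp_add, mul_one]
    congr 2
    push_cast
    ring
  rw [h, norm_mul, Complex.norm_exp_ofReal_mul_I, one_mul]
  exact Real.norm_exp_I_mul_ofReal_sub_one_le

lemma measurableSet_arc (θ : ℝ) : MeasurableSet (arc θ) := by
  refine (isCompact_Icc.image ?_).isClosed.measurableSet
  fun_prop

/-- Points of the larger arc that are not on the smaller one have an angle in (x, y], hence lie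
within y - x of e^(ix). The factor 2 accommodates the open ball. -/
lemma circleCDF_sub_le (μ : Measure ℂ) [IsFiniteMeasure μ] {x y : ℝ} (hxy : x < y) :
    |circleCDF μ y - circleCDF μ x| ≤
      μ.real (Metric.ball (Complex.exp (x * Complex.I)) (2 * (y - x))) := by
  have hsub : arc x ⊆ arc y := Set.image_mono (Set.Icc_subset_Icc_right hxy.le)
  rw [circleCDF, circleCDF, ← measureReal_sdiff hsub (measurableSet_arc x),
    abs_of_nonneg measureReal_nonneg]
  refine measureReal_mono ?_
  rintro _ ⟨⟨φ, ⟨h0, hφ⟩, rfl⟩, hn⟩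
  have hxφ : x < φ := by
    by_contra! h
    exact hn ⟨φ, ⟨h0, h⟩, rfl⟩
  rw [Metric.mem_ball, dist_eq_norm]
  refine (norm_exp_mul_I_sub_le _ _).trans_lt ?_
  rw [abs_of_pos (by linarith)]
  linarith

/-- A rational s with 2γ < s < min(1, β) leaves room for the exponent s/2 > γ of the mass bound. -/
lemma exists_holderOnWith (hβ : 0 < β) (hc : IsTypical β c) {μ : ProbabilityMeasure ℂ}
    (hμ : Tendsto (diskApprox hβ hc) atTop (𝓝 μ)) {γ : ℝ≥0} (hγ : (γ : ℝ) < min (1 / 2) (β / 2))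
    (S : Set ℝ) : ∃ C : ℝ≥0, HolderOnWith C γ (circleCDF μ) S := by
  have hγ1 := hγ.trans_le (min_le_left _ _)
  have hγ2 := hγ.trans_le (min_le_right _ _)
  have hγ0 : (0 : ℝ) ≤ γ := γ.2
  obtain ⟨s, hs, hs'⟩ := exists_rat_btwn (show 2 * (γ : ℝ) < min 1 β from
    lt_min (by linarith) (by linarith))
  obtain ⟨K, hK⟩ := exists_measure_le_rpow hβ hc hμ (by linarith) (hs'.trans_le (min_le_left _ _))
    (hs'.trans_le (min_le_right _ _))
  have key : ∀ x y : ℝ, x < y →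
      |circleCDF μ y - circleCDF μ x| ≤ (K * 4 + 1) * (y - x) ^ (γ : ℝ) := by
    intro x y hxy
    have hyx : 0 < y - x := sub_pos.2 hxy
    have hK0 : (0 : ℝ) ≤ K := K.2
    refine (circleCDF_sub_le μ hxy).trans ?_
    rcases le_total (y - x) 1 with h | h
    · have h1 := measure_ball_le hK (Complex.exp (x * Complex.I)) (ε := 2 * (y - x)) (by positivity)
      have h2 : (μ : Measure ℂ).real (Metric.ball (Complex.exp (x * Complex.I)) (2 * (y - x))) ≤
          K * (2 * (2 * (y - x))) ^ (s / 2 : ℝ) := by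
        rw [Measure.real]
        refine ENNReal.toReal_le_of_le_ofReal (by positivity) (h1.trans_eq ?_)
        rw [ENNReal.ofReal_mul hK0, ENNReal.ofReal_coe_nnreal]
      -- The radius is 2(y - x) and the diameter twice that; the constant satisfies 4^(s/2) ≤ 4.
      -- Increments over distances above 1 are at most 1, which is the 1 in `K * 4 + 1`.
      have h3 : (2 * (2 * (y - x))) ^ (s / 2 : ℝ) ≤ 4 * (y - x) ^ (γ : ℝ) := by
        rw [← mul_assoc, Real.mul_rpow (by norm_num) hyx.le]
        have hs1 := hs'.trans_le (min_le_left 1 β)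
        refine mul_le_mul ?_ ?_ (by positivity) (by norm_num)
        · calc _ ≤ (2 * 2 : ℝ) ^ (1 : ℝ) :=
                Real.rpow_le_rpow_of_exponent_le (by norm_num) (by linarith)
            _ = 4 := by norm_num
        · exact Real.rpow_le_rpow_of_exponent_ge' hyx.le h hγ0 (by linarith)
      calc _ ≤ K * (4 * (y - x) ^ (γ : ℝ)) := h2.trans (by gcongr)
        _ ≤ _ := by
          rw [← mul_assoc]
          gcongr
          linarith
    · refine measureReal_le_one.trans ?_
      have := Real.one_le_rpow h hγ0
      nlinarith
  refine ⟨K * 4 + 1, fun x _ y _ => ?_⟩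
  have key' : dist (circleCDF μ x) (circleCDF μ y) ≤ (K * 4 + 1) * dist x y ^ (γ : ℝ) := by
    rcases lt_trichotomy x y with h | rfl | h
    · rw [dist_comm, dist_comm x, Real.dist_eq, Real.dist_eq, abs_of_pos (sub_pos.2 h)]
      exact key x y h
    · rw [dist_self]; positivity
    · rw [Real.dist_eq, Real.dist_eq, abs_of_pos (sub_pos.2 h)]
      exact key y x h
  rw [edist_dist, edist_dist, ENNReal.ofReal_rpow_of_nonneg dist_nonneg hγ0,
    ← ENNReal.ofReal_coe_nnreal, ← ENNReal.ofReal_mul (by positivity)]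
  exact ENNReal.ofReal_le_ofReal (by simpa using key')

/-! ### Absolute continuity -/

/-- Hölder's inequality with exponent p against the indicator of V: boundedness in L^p is uniform
integrability. -/
lemma approxLimit_le_of_rpow {p : ℝ} (hp : 1 < p) (n : ℕ) (c : List Bool → Mark) {V : Set ℝ}
    (hV : MeasurableSet V) {K : ℝ≥0∞}
    (hK : ∫⁻ r, density β n c r * density β n c r ^ (p - 1) ≤ K) :
    approxLimit β n c V ≤ K ^ (1 / p) * volume V ^ (1 - 1 / p) := by
  have hp0 : 0 < p := by linarith
  have hpq : p.HolderConjugate p.conjExponent := .conjExponent hp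
  have h1 := ENNReal.lintegral_mul_le_Lp_mul_Lq (volume.restrict V) hpq
    (f := density β n c) (g := 1) (by fun_prop) aemeasurable_const
  rw [approxLimit, withDensity_apply _ hV]
  calc _ = ∫⁻ r in V, (density β n c * 1) r := by simp
    _ ≤ _ := h1
    _ ≤ _ := by
      gcongr
      · refine (setLIntegral_le_lintegral V _).trans (le_trans (lintegral_mono fun r => ?_) hK)
        refine le_of_eq ?_
        conv_rhs => rw [← ENNReal.rpow_one (density β n c r)]
        rw [ENNReal.rpow_one, mul_comm]
        conv_lhs => rw [show p = (p - 1) + 1 by ring]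
        rw [ENNReal.rpow_add_of_nonneg _ _ (by linarith) (by norm_num), ENNReal.rpow_one]
      · have := hpq.inv_add_inv_eq_one
        simp
        refine le_of_eq ?_
        congr 1
        linarith

/-- The inverse of the map from the line to the circle, in terms of the angle. -/
def lineOfAngle (θ : ℝ) : ℝ := -Real.cos (θ / 2) / Real.sin (θ / 2)

lemma sin_half_pos {θ : ℝ} (hθ : θ ∈ Set.Ioo 0 (2 * Real.pi)) : 0 < Real.sin (θ / 2) :=
  Real.sin_pos_of_pos_of_lt_pi (by linarith [hθ.1]) (by linarith [hθ.2])

/-- With c + is = e^(iθ/2) the image of -c/s is (-c - is)/(-c + is) = (c + is)/(c - is) = (c + is)².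
-/
lemma toDisk_lineOfAngle {θ : ℝ} (hθ : θ ∈ Set.Ioo 0 (2 * Real.pi)) :
    toDisk (lineOfAngle θ) = Complex.exp (θ * Complex.I) := by
  have hs : (Real.sin (θ / 2) : ℂ) ≠ 0 := by exact_mod_cast (sin_half_pos hθ).ne'
  have h1 := add_I_ne_zero (z := lineOfAngle θ) (by simp)
  have h2 : Complex.exp (θ * Complex.I) =
      (Real.cos (θ / 2) + Real.sin (θ / 2) * Complex.I) ^ 2 := by
    rw [Complex.ofReal_cos, Complex.ofReal_sin, ← Complex.exp_mul_I, ← Complex.exp_nat_mul]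
    congr 1
    push_cast
    ring
  have h3 : (Real.cos (θ / 2) : ℂ) ^ 2 + (Real.sin (θ / 2) : ℂ) ^ 2 = 1 := by
    exact_mod_cast Real.cos_sq_add_sin_sq _
  rw [toDisk, div_eq_iff h1, h2, lineOfAngle]
  push_cast at hs h3 ⊢
  field_simp
  generalize Complex.cos ((θ : ℂ) / 2) = a at *
  generalize Complex.sin ((θ : ℂ) / 2) = b at *
  have hI : Complex.I ^ 2 = -1 := Complex.I_sq
  have : (-a - b * Complex.I) = (-a + b * Complex.I) * (a + b * Complex.I) ^ 2 := by
    linear_combination (a + b * Complex.I) * h3 - (a + b * Complex.I) * b ^ 2 * hI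
  first
  | exact this
  | linear_combination this

lemma lineOfAngle_surj (r : ℝ) : ∃ θ ∈ Set.Ioo 0 (2 * Real.pi), lineOfAngle θ = r := by
  refine ⟨Real.pi + 2 * Real.arctan r, ⟨?_, ?_⟩, ?_⟩
  · linarith [Real.neg_pi_div_two_lt_arctan r]
  · linarith [Real.arctan_lt_pi_div_two r]
  · rw [lineOfAngle, show (Real.pi + 2 * Real.arctan r) / 2 = Real.arctan r + Real.pi / 2 by ring,
      Real.cos_add_pi_div_two, Real.sin_add_pi_div_two, neg_neg, ← Real.tan_eq_sin_div_cos,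
      Real.tan_arctan]

/-- Differentiable maps of the line send null sets to null sets, and `lineOfAngle` is differentiable
on the open interval of angles. Hence sets of arc length zero correspond to Lebesgue null sets of
the line. -/
lemma volume_preimage_eq_zero {N : Set ℂ} (hN : MeasurableSet N) (h : circleLebesgue N = 0) :
    volume ((fun r : ℝ => toDisk r) ⁻¹' N) = 0 := by
  have hm : Measurable fun φ : ℝ => Complex.exp (φ * Complex.I) := by fun_prop
  rw [circleLebesgue, Measure.map_apply hm hN, Measure.restrict_apply (hm hN)] at h
  set A := (fun φ : ℝ => Complex.exp (φ * Complex.I)) ⁻¹' N ∩ Set.Ioo 0 (2 * Real.pi)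
  have hA : volume A = 0 :=
    measure_mono_null (Set.inter_subset_inter_right _ Set.Ioo_subset_Ico_self) h
  have hd : DifferentiableOn ℝ lineOfAngle A := by
    intro θ hθ
    refine DifferentiableAt.differentiableWithinAt ?_
    unfold lineOfAngle
    have := (sin_half_pos hθ.2).ne'
    fun_prop (disch := assumption)
  refine measure_mono_null ?_
    (addHaar_image_eq_zero_of_differentiableOn_of_addHaar_eq_zero volume hd hA)
  intro r hr
  obtain ⟨θ, hθ, rfl⟩ := lineOfAngle_surj r
  exact ⟨θ, ⟨by rw [Set.mem_preimage, toDisk_lineOfAngle hθ] at hr; exact hr, hθ⟩, rfl⟩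

lemma exists_toDisk_eq {z : ℂ} (hz : ‖z‖ = 1) (hz1 : z ≠ 1) : ∃ r : ℝ, toDisk r = z := by
  obtain ⟨θ, hθ, rfl⟩ : ∃ θ ∈ Set.Ico 0 (2 * Real.pi), Complex.exp (θ * Complex.I) = z := by
    refine ⟨toIcoMod Real.two_pi_pos 0 z.arg, ?_, ?_⟩
    · simpa using toIcoMod_mem_Ico Real.two_pi_pos 0 z.arg
    · have h1 := Complex.norm_mul_exp_arg_mul_I z
      rw [hz, Complex.ofReal_one, one_mul] at h1
      conv_rhs => rw [← h1]
      rw [toIcoMod, Complex.exp_eq_exp_iff_exists_int]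
      exact ⟨-toIcoDiv Real.two_pi_pos 0 z.arg, by push_cast [zsmul_eq_mul]; ring⟩
  have hθ0 : θ ≠ 0 := by rintro rfl; simp at hz1
  exact ⟨lineOfAngle θ, toDisk_lineOfAngle ⟨lt_of_le_of_ne hθ.1 hθ0.symm, hθ.2⟩⟩

lemma toDisk_real_ne_one (r : ℝ) : toDisk r ≠ 1 := by
  rw [toDisk, Ne, div_eq_one_iff_eq (add_I_ne_zero (by simp))]
  intro h
  have := congrArg Complex.im h
  norm_num at this

lemma ofDisk_toDisk (r : ℝ) : Complex.I * (1 + toDisk r) / (1 - toDisk r) = r := by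
  have h1 := add_I_ne_zero (z := r) (by simp)
  have h2 : 1 - toDisk r ≠ 0 := sub_ne_zero.2 (toDisk_real_ne_one r).symm
  rw [div_eq_iff h2, toDisk]
  field_simp
  ring

/-- Weak limits only control open sets, so a null set is enclosed in an open set whose trace on the
line has small volume. There the L^p bound makes the approximations, and then μ, small. -/
lemma absolutelyContinuous (hβ : 0 < β) (hc : IsTypical β c) {μ : ProbabilityMeasure ℂ}
    (hμ : Tendsto (diskApprox hβ hc) atTop (𝓝 μ)) (hμ0 : (μ : Measure ℂ) (Metric.sphere 0 1)ᶜ = 0)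
    (hβ2 : 1 / 2 < β) : (μ : Measure ℂ) ≪ circleLebesgue := by
  obtain ⟨p, hp, hpK⟩ := hc.power hβ2
  obtain ⟨K, hK, hK'⟩ := exists_between (lt_top_iff_ne_top.2 hpK)
  have hfr := frequently_lt_of_liminf_lt (by isBoundedDefault) hK
  refine Measure.AbsolutelyContinuous.mk fun N hN h0 => ?_
  have hvol := volume_preimage_eq_zero hN h0
  have hq : 0 < 1 - 1 / p := by
    rw [sub_pos, div_lt_one (by linarith)]; exact hp
  have hbound : ∀ ε : ℝ≥0∞, 0 < ε →
      (μ : Measure ℂ) N ≤ (yuleLimit β c)⁻¹ * (K ^ (1 / p) * ε ^ (1 - 1 / p)) := by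
    intro ε hε
    -- Outer regularity on the line; V is then carried back to an open set of the plane by the real
    -- part of z ↦ i(1+z)/(1-z), which is continuous off 1.
    obtain ⟨V, hV, hVo, hVε⟩ := Set.exists_isOpen_lt_of_lt _ ε (hvol ▸ hε)
    set U : Set ℂ := {z | z ≠ 1 ∧ (Complex.I * (1 + z) / (1 - z)).re ∈ V}
    have hU : IsOpen U := by
      have hcont : ContinuousOn (fun z : ℂ => (Complex.I * (1 + z) / (1 - z)).re) {1}ᶜ := by
        refine Complex.continuous_re.comp_continuousOn (ContinuousOn.div (by fun_prop)
          (by fun_prop) fun z hz => sub_ne_zero.2 (Ne.symm hz))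
      exact hcont.isOpen_inter_preimage isOpen_compl_singleton hVo
    have hUV : (fun r : ℝ => toDisk r) ⁻¹' U = V := by
      ext r
      have : toDisk r ∈ U ↔ r ∈ V := by
        change toDisk r ≠ 1 ∧ _ ↔ _
        rw [ofDisk_toDisk, Complex.ofReal_re, and_iff_right (toDisk_real_ne_one r)]
      exact this
    -- The point 1 corresponds to infinity on the line and is not covered by U; μ does not charge
    -- it, having no atoms.
    have hNU : N ⊆ (Metric.sphere 0 1)ᶜ ∪ ({1} ∪ U) := by
      intro z hz
      by_cases hz1 : z = 1
      · exact .inr (.inl hz1)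
      by_cases hzs : ‖z‖ = 1
      · obtain ⟨r, rfl⟩ := exists_toDisk_eq hzs hz1
        exact .inr (.inr (show r ∈ (fun r : ℝ => toDisk r) ⁻¹' U from hUV ▸ hV hz))
      · exact .inl (by simpa using hzs)
    calc _ ≤ (μ : Measure ℂ) (Metric.sphere 0 1)ᶜ + ((μ : Measure ℂ) {1} + (μ : Measure ℂ) U) :=
          (measure_mono hNU).trans ((measure_union_le _ _).trans
            (add_le_add_right (measure_union_le _ _) _))
      _ = (μ : Measure ℂ) U := by
          rw [hμ0, measure_singleton_eq_zero hβ hc hμ, zero_add, zero_add]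
      _ ≤ _ := measure_le_of_frequently hβ hc hμ hU (hfr.mono fun n hn => by
          rw [hUV]
          refine (approxLimit_le_of_rpow hp n c hVo.measurableSet hn.le).trans ?_
          gcongr)
  have hlim : Tendsto (fun ε : ℝ≥0∞ => (yuleLimit β c)⁻¹ * (K ^ (1 / p) * ε ^ (1 - 1 / p)))
      (𝓝[>] 0) (𝓝 0) := by
    have h1 : Tendsto (fun ε : ℝ≥0∞ => ε ^ (1 - 1 / p)) (𝓝[>] 0) (𝓝 0) := by
      have := (ENNReal.continuous_rpow_const (y := 1 - 1 / p)).tendsto 0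
      rw [ENNReal.zero_rpow_of_pos hq] at this
      exact this.mono_left nhdsWithin_le_nhds
    have h2 := ENNReal.Tendsto.const_mul (a := (yuleLimit β c)⁻¹) (ENNReal.Tendsto.const_mul
      (a := K ^ (1 / p)) h1 (.inr (ENNReal.rpow_ne_top_of_nonneg (by positivity) hK'.ne)))
      (.inr (ENNReal.inv_ne_top.2 hc.yuleLimit_ne_zero))
    simpa using h2
  refine le_antisymm (ge_of_tendsto hlim ?_) zero_le
  filter_upwards [self_mem_nhdsWithin] with ε hε using hbound ε hε

instance : IsFiniteMeasure circleLebesgue := by unfold circleLebesgue; infer_instance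

end Regularity

/-- The properties of the limit of the empirical measures for typical marks. -/
theorem Compat.exists_isLimitMeasure {Ω : Type*} {τ : List Bool → Ω → ℝ}
    {Z : List Bool → ℝ≥0 → Ω → ℂ} {ω : Ω} {c : List Bool → Mark} {β : ℝ} (hβ : 0 < β)
    (h : Compat τ Z ω c) (hc : IsTypical β c) :
    ∃ μ : Measure ℂ, IsLimitMeasure τ Z ω μ ∧ (∀ z : ℂ, μ {z} = 0) ∧
      (∀ γ : ℝ≥0, (γ : ℝ) < min (1 / 2) (β / 2) →
        ∃ C : ℝ≥0, HolderOnWith C γ (circleCDF μ) (Set.Icc 0 (2 * Real.pi))) ∧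
      (1 / 2 < β → ∃ ρ : ℂ → ℝ≥0∞, Measurable ρ ∧ μ = circleLebesgue.withDensity ρ) := by
  obtain ⟨μ, hμ0, hμ, hpop⟩ := exists_tendsto_diskApprox hβ h hc
  refine ⟨μ, h.isLimitMeasure hβ hc hμ0 hpop, measure_singleton_eq_zero hβ hc hμ,
    fun γ hγ => exists_holderOnWith hβ hc hμ hγ _, fun hβ2 => ?_⟩
  exact ⟨(μ : Measure ℂ).rnDeriv circleLebesgue, Measure.measurable_rnDeriv _ _,
    (Measure.withDensity_rnDeriv_eq _ _ (absolutelyContinuous hβ hc hμ hμ0 hβ2)).symm⟩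

/-! ### Gaussian computations -/

section Gaussian

lemma lintegral_exp_gaussianReal (v : ℝ≥0) (q : ℝ) :
    ∫⁻ x, .ofReal (Real.exp (q * x)) ∂gaussianReal 0 v = .ofReal (Real.exp (v * q ^ 2 / 2)) := by
  rw [← ofReal_integral_eq_lintegral_ofReal (integrable_exp_mul_gaussianReal q)
    (.of_forall fun x => (Real.exp_pos _).le)]
  congr 1
  have := congrFun (mgf_id_gaussianReal (μ := 0) (v := v)) q
  simpa [mgf] using this

lemma gaussianReal_eq_map (v : ℝ≥0) :
    gaussianReal 0 v = (gaussianReal 0 1).map fun x => √(v : ℝ) * x := by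
  rw [gaussianReal_map_const_mul, mul_zero]
  congr 1
  ext
  simp

lemma lintegral_sq_gaussianReal (v : ℝ≥0) :
    ∫⁻ x, .ofReal (x ^ 2) ∂gaussianReal 0 v = v := by
  have h1 : ∫ x, x ^ 2 ∂gaussianReal 0 v = v := by
    have := variance_fun_id_gaussianReal (μ := 0) (v := v)
    rwa [variance_of_integral_eq_zero aemeasurable_id' integral_id_gaussianReal] at this
  have h2 : Integrable (fun x : ℝ => x ^ 2) (gaussianReal 0 v) :=
    (memLp_id_gaussianReal (μ := 0) (v := v) 2).integrable_sq
  rw [← ofReal_integral_eq_lintegral_ofReal h2 (.of_forall fun x => sq_nonneg x), h1,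
    ENNReal.ofReal_coe_nnreal]

/-- By scaling, the fourth moment is v² times that of the standard normal law, of which only
finiteness is used. -/
lemma exists_lintegral_pow_four_gaussianReal :
    ∃ K : ℝ≥0, ∀ v : ℝ≥0, ∫⁻ x, .ofReal (x ^ 4) ∂gaussianReal 0 v ≤ K * (v : ℝ≥0∞) ^ 2 := by
  have h : ∫⁻ x, .ofReal (x ^ 4) ∂gaussianReal 0 1 ≠ ∞ := by
    have := (memLp_id_gaussianReal (μ := 0) (v := 1) 4).integrable_norm_pow (by norm_num)
    have h2 : Integrable (fun x : ℝ => x ^ 4) (gaussianReal 0 1) := by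
      refine this.congr (.of_forall fun x => ?_)
      simp [pow_abs, abs_of_nonneg (show (0 : ℝ) ≤ x ^ 4 by positivity)]
    exact h2.lintegral_lt_top.ne
  refine ⟨(∫⁻ x, .ofReal (x ^ 4) ∂gaussianReal 0 1).toNNReal, fun v => ?_⟩
  rw [ENNReal.coe_toNNReal h, gaussianReal_eq_map v, lintegral_map (by fun_prop) (by fun_prop),
    mul_comm, ← lintegral_const_mul _ (by fun_prop)]
  refine (lintegral_congr fun x => ?_).le
  rw [mul_pow, ENNReal.ofReal_mul (by positivity), show √(v : ℝ) ^ 4 = (√(v : ℝ) ^ 2) ^ 2 by ring,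
    Real.sq_sqrt (NNReal.coe_nonneg v), ENNReal.ofReal_pow (NNReal.coe_nonneg v), ENNReal.ofReal_coe_nnreal]

/-- The Gaussian density is at most 1/√(2πv) ≤ 1/√v. -/
lemma lintegral_gaussianReal_le {v : ℝ≥0} (hv : v ≠ 0) {φ : ℝ → ℝ≥0∞} (hφ : Measurable φ) (x : ℝ) :
    ∫⁻ s, φ (s + x) ∂gaussianReal 0 v ≤ .ofReal ((√(v : ℝ))⁻¹) * ∫⁻ s, φ s := by
  have hv0 : (0 : ℝ) < v := lt_of_le_of_ne v.2 (by exact_mod_cast hv.symm)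
  rw [gaussianReal_of_var_ne_zero _ hv, lintegral_withDensity_eq_lintegral_mul _
    (measurable_gaussianPDF _ _) (by fun_prop), ← lintegral_add_right_eq_self φ x,
    ← lintegral_const_mul _ (by fun_prop)]
  refine lintegral_mono fun s => ?_
  rw [Pi.mul_apply, gaussianPDF, gaussianPDFReal]
  refine mul_le_mul_left (ENNReal.ofReal_le_ofReal ?_) _
  have h1 : √(v : ℝ) ≤ √(2 * Real.pi * v) := by
    refine Real.sqrt_le_sqrt ?_
    have := Real.pi_gt_three
    nlinarith
  calc _ ≤ (√(2 * Real.pi * v))⁻¹ * 1 := by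
        gcongr
        rw [Real.exp_le_one_iff, neg_div]
        exact neg_nonpos.2 (by positivity)
    _ ≤ _ := by
        rw [mul_one]
        exact inv_anti₀ (Real.sqrt_pos.2 hv0) h1

/-- Geometric Brownian motion. -/
def geom {Ω : Type*} (B : ℝ≥0 → Ω → ℝ) (t : ℝ≥0) (ω : Ω) : ℝ := Real.exp (-(t : ℝ) / 2 + B t ω)

lemma geom_pos {Ω : Type*} {B : ℝ≥0 → Ω → ℝ} (t : ℝ≥0) (ω : Ω) : 0 < geom B t ω := Real.exp_pos _

variable {Ω : Type*} [MeasurableSpace Ω] {P : Measure Ω} {W B : ℝ≥0 → Ω → ℝ}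

/-- Linear combinations of the increments of a Brownian motion are Gaussian. -/
lemma map_sum_increments (hW : IsPreBrownianReal W P) (h : ℝ≥0) (a : ℕ → ℝ) (n : ℕ) :
    P.map (fun ω => ∑ k ∈ Finset.range n, a k * (W ((k + 1 : ℕ) * h) ω - W (k * h) ω)) =
      gaussianReal 0 (h * ∑ k ∈ Finset.range n, ‖a k‖₊ ^ 2) := by
  have := hW.isGaussianProcess.isProbabilityMeasure
  induction n with
  | zero => simp
  | succ n ih =>
    -- The first n increments are functions of the path up to time nh, and the next one is
    -- independent of that past.
    have hi := hW.indepFun_shift (n * h)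
    have hX : IndepFun (fun ω => ∑ k ∈ Finset.range n,
        a k * (W ((k + 1 : ℕ) * h) ω - W (k * h) ω))
        (fun ω => a n * (W (n * h + h) ω - W (n * h) ω)) P := by
      have hle : ∀ k ∈ Finset.range n, (k + 1 : ℕ) * h ≤ n * h := fun k hk => by
        gcongr
        exact_mod_cast Finset.mem_range.1 hk
      have hle' : ∀ k ∈ Finset.range n, (k : ℝ≥0) * h ≤ n * h := fun k hk => by
        gcongr
        exact (Finset.mem_range.1 hk).le
      have h1 := hi.symm.comp (φ := fun w : Set.Iic ((n : ℝ≥0) * h) → ℝ =>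
          ∑ k ∈ (Finset.range n).attach, a k * (w ⟨_, hle k k.2⟩ - w ⟨_, hle' k k.2⟩))
        (ψ := fun w : ℝ≥0 → ℝ => a n * w h) (by fun_prop) (by fun_prop)
      convert! h1 using 1
      ext ω
      exact (Finset.sum_attach (Finset.range n)
        (fun k => a k * (W ((k + 1 : ℕ) * h) ω - W (k * h) ω))).symm
    have h2 : P.map (fun ω => a n * (W (n * h + h) ω - W (n * h) ω)) =
        gaussianReal 0 (‖a n‖₊ ^ 2 * h) := by
      have h3 := gaussianReal_const_mul ((hW.shift (n * h)).hasLaw_eval h) (a n)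
      rw [h3.map_eq, mul_zero]
      congr 2
      ext
      simp
    have h4 := gaussianReal_add_gaussianReal_of_indepFun hX ih h2
    rw [add_zero] at h4
    convert! h4 using 2
    · ext ω
      rw [Finset.sum_range_succ, Pi.add_apply]
      congr 4
      push_cast
      ring
    · rw [Finset.sum_range_succ]
      ring

/-- Functions of the sum of the increments of a Brownian motion with coefficients that depend on an
independent Brownian motion. -/
lemma lintegral_sum_increments (hW : IsPreBrownianReal W P) (hB : IsPreBrownianReal B P)
    (hind : IndepFun (fun ω t => W t ω) (fun ω t => B t ω) P) (h : ℝ≥0)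
    {a : (ℕ → ℝ) → ℕ → ℝ} (ha : Measurable a) (n : ℕ) {G : ℝ → (ℕ → ℝ) → ℝ≥0∞}
    (hG : Measurable fun p : ℝ × (ℕ → ℝ) => G p.1 p.2) :
    ∫⁻ ω, G (∑ k ∈ Finset.range n, a (fun k => B (k * h) ω) k *
        (W ((k + 1 : ℕ) * h) ω - W (k * h) ω)) (fun k => B (k * h) ω) ∂P =
      ∫⁻ ω, ∫⁻ s, G s (fun k => B (k * h) ω)
        ∂gaussianReal 0 (h * ∑ k ∈ Finset.range n, ‖a (fun k => B (k * h) ω) k‖₊ ^ 2) ∂P := by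
  have := hW.isGaussianProcess.isProbabilityMeasure
  set w : Ω → ℕ → ℝ := fun ω k => W (k * h) ω
  set b : Ω → ℕ → ℝ := fun ω k => B (k * h) ω
  have hw : AEMeasurable w P := aemeasurable_pi_lambda _ fun k => hW.aemeasurable _
  have hb : AEMeasurable b P := aemeasurable_pi_lambda _ fun k => hB.aemeasurable _
  have hi : IndepFun w b P := hind.comp (φ := fun f : ℝ≥0 → ℝ => fun k : ℕ => f (k * h))
    (ψ := fun f : ℝ≥0 → ℝ => fun k : ℕ => f (k * h)) (by fun_prop) (by fun_prop)
  have hF : Measurable fun p : (ℕ → ℝ) × (ℕ → ℝ) =>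
      G (∑ k ∈ Finset.range n, a p.2 k * (p.1 (k + 1) - p.1 k)) p.2 :=
    hG.comp (f := fun p : (ℕ → ℝ) × (ℕ → ℝ) =>
      (∑ k ∈ Finset.range n, a p.2 k * (p.1 (k + 1) - p.1 k), p.2)) (by fun_prop)
  have h1 := (indepFun_iff_map_prod_eq_prod_map_map hw hb).1 hi
  have := Measure.isProbabilityMeasure_map hw
  have := Measure.isProbabilityMeasure_map hb
  calc _ = ∫⁻ p, G (∑ k ∈ Finset.range n, a p.2 k * (p.1 (k + 1) - p.1 k)) p.2
        ∂(P.map fun ω => (w ω, b ω)) := by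
        rw [lintegral_map' hF.aemeasurable (hw.prodMk hb)]
    _ = ∫⁻ y, ∫⁻ x, G (∑ k ∈ Finset.range n, a y k * (x (k + 1) - x k)) y ∂(P.map w) ∂(P.map b) := by
        rw [h1, lintegral_prod_symm' _ hF]
    _ = ∫⁻ y, ∫⁻ s, G s y ∂gaussianReal 0 (h * ∑ k ∈ Finset.range n, ‖a y k‖₊ ^ 2) ∂(P.map b) := by
        refine lintegral_congr fun y => ?_
        have hGy : Measurable fun s => G s y := hG.comp (f := fun s : ℝ => (s, y)) (by fun_prop)
        have hx : Measurable fun x : ℕ → ℝ => ∑ k ∈ Finset.range n, a y k * (x (k + 1) - x k) := by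
          fun_prop
        rw [← map_sum_increments hW h (a y) n, ← lintegral_map hGy hx,
          AEMeasurable.map_map_of_aemeasurable hx.aemeasurable hw]
        rfl
    _ = _ := by
        have h2 : Measurable fun y => ∫⁻ s, G s y
            ∂gaussianReal 0 (h * ∑ k ∈ Finset.range n, ‖a y k‖₊ ^ 2) := by
          -- Rescaling to the standard normal law moves the dependence on y from the measure to the
          -- integrand, which gives measurability in y.
          have h3 : ∀ y, ∫⁻ s, G s y ∂gaussianReal 0 (h * ∑ k ∈ Finset.range n, ‖a y k‖₊ ^ 2) =
              ∫⁻ x, G (√((h * ∑ k ∈ Finset.range n, ‖a y k‖₊ ^ 2 : ℝ≥0) : ℝ) * x) y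
                ∂gaussianReal 0 1 := fun y => by
            have hGy : Measurable fun s => G s y := hG.comp (f := fun s : ℝ => (s, y)) (by fun_prop)
            rw [gaussianReal_eq_map, lintegral_map hGy (by fun_prop)]
          simp_rw [h3]
          refine Measurable.lintegral_prod_right' (f := fun p : (ℕ → ℝ) × ℝ =>
            G (√((h * ∑ k ∈ Finset.range n, ‖a p.1 k‖₊ ^ 2 : ℝ≥0) : ℝ) * p.2) p.1) ?_
          exact hG.comp (f := fun p : (ℕ → ℝ) × ℝ =>
            (√((h * ∑ k ∈ Finset.range n, ‖a p.1 k‖₊ ^ 2 : ℝ≥0) : ℝ) * p.2, p.1)) (by fun_prop)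
        rw [lintegral_map' h2.aemeasurable hb]

lemma aemeasurable_geom (hB : IsPreBrownianReal B P) (t : ℝ≥0) : AEMeasurable (geom B t) P :=
  Real.measurable_exp.comp_aemeasurable ((hB.aemeasurable t).const_add _)

lemma lintegral_exp_mul_geom (hB : IsPreBrownianReal B P) (q : ℝ) (t : ℝ≥0) :
    ∫⁻ ω, .ofReal (Real.exp (q * (-(t : ℝ) / 2 + B t ω))) ∂P =
      .ofReal (Real.exp (q * (q - 1) / 2 * t)) := by
  have h1 : ∀ ω, ENNReal.ofReal (Real.exp (q * (-(t : ℝ) / 2 + B t ω))) =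
      .ofReal (Real.exp (-(q * t) / 2)) * .ofReal (Real.exp (q * B t ω)) := fun ω => by
    rw [← ENNReal.ofReal_mul (by positivity), ← Real.exp_add]
    congr 2
    ring
  simp_rw [h1]
  rw [lintegral_const_mul' _ _ ENNReal.ofReal_ne_top,
    (hB.hasLaw_eval t).lintegral_comp (f := fun x => ENNReal.ofReal (Real.exp (q * x)))
      (by fun_prop), lintegral_exp_gaussianReal, ← ENNReal.ofReal_mul (by positivity),
    ← Real.exp_add]
  congr 2
  ring

lemma lintegral_geom_pow (hB : IsPreBrownianReal B P) (q : ℕ) (t : ℝ≥0) :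
    ∫⁻ ω, .ofReal (geom B t ω ^ q) ∂P = .ofReal (Real.exp (q * (q - 1) / 2 * t)) := by
  rw [← lintegral_exp_mul_geom hB]
  refine lintegral_congr fun ω => ?_
  rw [geom, ← Real.exp_nat_mul]

lemma lintegral_geom_inv (hB : IsPreBrownianReal B P) (t : ℝ≥0) :
    ∫⁻ ω, .ofReal ((geom B t ω)⁻¹) ∂P = .ofReal (Real.exp t) := by
  have h1 : ∀ ω, (geom B t ω)⁻¹ = Real.exp (-1 * (-(t : ℝ) / 2 + B t ω)) := fun ω => by
    rw [geom, ← Real.exp_neg, neg_one_mul]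
  simp_rw [h1]
  rw [lintegral_exp_mul_geom hB]
  congr 2
  ring

lemma lintegral_mul_increment (hB : IsPreBrownianReal B P) (s h : ℝ≥0) {F G : ℝ → ℝ≥0∞}
    (hF : Measurable F) (hG : Measurable G) :
    ∫⁻ ω, F (B s ω) * G (B (s + h) ω - B s ω) ∂P =
      (∫⁻ ω, F (B s ω) ∂P) * ∫⁻ x, G x ∂gaussianReal 0 h := by
  have hi := (hB.indepFun_shift s).symm.comp (φ := fun f : Set.Iic s → ℝ => F (f ⟨s, Set.mem_Iic.2 le_rfl⟩))
    (ψ := fun f : ℝ≥0 → ℝ => G (f h)) (by fun_prop) (by fun_prop)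
  have m1 := hB.aemeasurable s
  have m2 := hB.aemeasurable (s + h)
  have h1 := lintegral_mul_eq_lintegral_mul_lintegral_of_indepFun'' (f := fun ω => F (B s ω))
    (g := fun ω => G (B (s + h) ω - B s ω)) (by fun_prop) (by fun_prop) hi
  rw [← ((hB.shift s).hasLaw_eval h).lintegral_comp hG.aemeasurable]
  exact h1

/-- Y_s² / Y_{s+h} is the product of Y_s, of mean 1, and the independent ratio Y_s / Y_{s+h}, of
mean e^h. -/
lemma lintegral_geom_sq_div (hB : IsPreBrownianReal B P) (s h : ℝ≥0) :
    ∫⁻ ω, .ofReal (geom B s ω ^ 2 / geom B (s + h) ω) ∂P = .ofReal (Real.exp h) := by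
  have h1 : ∀ ω, ENNReal.ofReal (geom B s ω ^ 2 / geom B (s + h) ω) =
      .ofReal (Real.exp (1 * (-(s : ℝ) / 2 + B s ω))) *
        .ofReal (Real.exp (h / 2) * Real.exp (-1 * (B (s + h) ω - B s ω))) := fun ω => by
    rw [← ENNReal.ofReal_mul (by positivity), geom, geom, ← Real.exp_nat_mul, ← Real.exp_sub,
      ← Real.exp_add, ← Real.exp_add]
    congr 2
    push_cast
    ring
  simp_rw [h1]
  rw [lintegral_mul_increment hB s h
    (F := fun x => ENNReal.ofReal (Real.exp (1 * (-(s : ℝ) / 2 + x))))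
    (G := fun x => .ofReal (Real.exp (h / 2) * Real.exp (-1 * x))) (by fun_prop) (by fun_prop),
    lintegral_exp_mul_geom hB]
  simp_rw [ENNReal.ofReal_mul (Real.exp_pos ((h : ℝ) / 2)).le]
  rw [lintegral_const_mul' _ _ ENNReal.ofReal_ne_top, lintegral_exp_gaussianReal,
    ← ENNReal.ofReal_mul (by positivity), ← ENNReal.ofReal_mul (by positivity),
    ← Real.exp_add, ← Real.exp_add]
  congr 2
  ring

/-- With E = e^h the moment is E⁶ - 4E³ + 6E - 3, which has a double zero at E = 1. The resulting
order h² is what dyadic chaining requires. -/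
lemma lintegral_geom_increment_gaussianReal (h : ℝ≥0) :
    ∫⁻ x, .ofReal ((Real.exp (-(h : ℝ) / 2 + x) - 1) ^ 4) ∂gaussianReal 0 h ≤
      .ofReal (16 * h ^ 2 * Real.exp (6 * h)) := by
  have hi : ∀ q : ℝ, Integrable (fun x => Real.exp (q * x)) (gaussianReal 0 h) :=
    fun q => integrable_exp_mul_gaussianReal q
  have he : ∀ q : ℝ, ∫ x, Real.exp (q * x) ∂gaussianReal 0 h = Real.exp (h * q ^ 2 / 2) := fun q => by
    have := congrFun (mgf_id_gaussianReal (μ := 0) (v := h)) q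
    simpa [mgf] using this
  set u : ℝ := Real.exp (-(h : ℝ) / 2)
  have hexp : ∀ x : ℝ, (Real.exp (-(h : ℝ) / 2 + x) - 1) ^ 4 = u ^ 4 * Real.exp (4 * x) -
      4 * u ^ 3 * Real.exp (3 * x) + 6 * u ^ 2 * Real.exp (2 * x) - 4 * u * Real.exp (1 * x) + 1 := by
    intro x
    rw [Real.exp_add, one_mul, show 4 * x = ((4 : ℕ) : ℝ) * x by norm_num,
      show 3 * x = ((3 : ℕ) : ℝ) * x by norm_num, show 2 * x = ((2 : ℕ) : ℝ) * x by norm_num,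
      Real.exp_nat_mul, Real.exp_nat_mul, Real.exp_nat_mul]
    ring
  have i4 := (hi 4).const_mul (u ^ 4)
  have i3 := (hi 3).const_mul (4 * u ^ 3)
  have i2 := (hi 2).const_mul (6 * u ^ 2)
  have i1 := (hi 1).const_mul (4 * u)
  have hI : Integrable (fun x : ℝ => u ^ 4 * Real.exp (4 * x) -
      4 * u ^ 3 * Real.exp (3 * x) + 6 * u ^ 2 * Real.exp (2 * x) - 4 * u * Real.exp (1 * x) + 1)
      (gaussianReal 0 h) := (((i4.sub i3).add i2).sub i1).add (integrable_const 1)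
  have hval : ∫ x, (u ^ 4 * Real.exp (4 * x) -
      4 * u ^ 3 * Real.exp (3 * x) + 6 * u ^ 2 * Real.exp (2 * x) - 4 * u * Real.exp (1 * x) + 1)
      ∂gaussianReal 0 h = Real.exp h ^ 6 - 4 * Real.exp h ^ 3 + 6 * Real.exp h - 3 := by
    have e1 : ∀ (k m : ℕ) (q : ℝ), (h : ℝ) * q ^ 2 / 2 - k * (h / 2) = m * h →
        u ^ k * Real.exp (h * q ^ 2 / 2) = Real.exp h ^ m := by
      intro k m q hq
      rw [← Real.exp_nat_mul, ← Real.exp_nat_mul, ← Real.exp_add, ← hq]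
      congr 1
      ring
    rw [integral_add (by exact ((i4.sub i3).add i2).sub i1) (integrable_const 1),
      integral_sub (by exact (i4.sub i3).add i2) i1, integral_add (by exact i4.sub i3) i2,
      integral_sub i4 i3,
      integral_const_mul, integral_const_mul, integral_const_mul, integral_const_mul,
      he, he, he, he, mul_assoc, mul_assoc, mul_assoc 4 u, e1 4 6 4 (by push_cast; ring),
      e1 3 3 3 (by push_cast; ring), e1 2 1 2 (by push_cast; ring), ← pow_one u,
      e1 1 0 1 (by push_cast; ring)]
    simp
    ring
  simp_rw [hexp]
  rw [← ofReal_integral_eq_lintegral_ofReal hI (.of_forall fun x => by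
    exact (Even.pow_nonneg (by decide) _).trans_eq (hexp x)), hval]
  refine ENNReal.ofReal_le_ofReal ?_
  have hh : (0 : ℝ) ≤ h := h.2
  have h1 : 0 ≤ Real.exp h - 1 := by linarith [Real.add_one_le_exp (h : ℝ)]
  have h2 : Real.exp h - 1 ≤ h * Real.exp h := by
    have h3 := Real.add_one_le_exp (-(h : ℝ))
    have h4 : Real.exp h * Real.exp (-h) = 1 := by rw [← Real.exp_add]; simp
    nlinarith [Real.exp_pos (h : ℝ)]
  have h6 : Real.exp (6 * h) = Real.exp h ^ 6 := by
    rw [← Real.exp_nat_mul]; norm_num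
  rw [h6]
  set E := Real.exp (h : ℝ)
  set y := E - 1
  have hE : E = 1 + y := by simp [y]
  -- Expansion in y = E - 1; the coefficients 3, 16, 15, 6, 1 are dominated by those of 16(1 + y)⁴.
  calc _ = y ^ 2 * (3 + 16 * y + 15 * y ^ 2 + 6 * y ^ 3 + y ^ 4) := by rw [hE]; ring
    _ ≤ y ^ 2 * (16 * (1 + y) ^ 4) := by
      gcongr
      nlinarith [pow_nonneg h1 2, pow_nonneg h1 3, pow_nonneg h1 4]
    _ ≤ (h * E) ^ 2 * (16 * (1 + y) ^ 4) := by gcongr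
    _ = _ := by rw [← hE]; ring

lemma lintegral_geom_sub_pow_four_le (hB : IsPreBrownianReal B P) (s h : ℝ≥0) :
    ∫⁻ ω, .ofReal ((geom B (s + h) ω - geom B s ω) ^ 4) ∂P ≤
      .ofReal (16 * h ^ 2 * Real.exp (6 * (s + h))) := by
  have h1 : ∀ ω, ENNReal.ofReal ((geom B (s + h) ω - geom B s ω) ^ 4) =
      .ofReal (Real.exp (4 * (-(s : ℝ) / 2 + B s ω))) *
        .ofReal ((Real.exp (-(h : ℝ) / 2 + (B (s + h) ω - B s ω)) - 1) ^ 4) := fun ω => by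
    rw [← ENNReal.ofReal_mul (by positivity), show (4 : ℝ) * (-(s : ℝ) / 2 + B s ω) =
      ((4 : ℕ) : ℝ) * (-(s : ℝ) / 2 + B s ω) by norm_num, Real.exp_nat_mul, ← mul_pow, mul_sub,
      ← Real.exp_add, geom, geom, mul_one]
    congr 4
    push_cast
    ring
  simp_rw [h1]
  rw [lintegral_mul_increment hB s h
    (F := fun x => ENNReal.ofReal (Real.exp (4 * (-(s : ℝ) / 2 + x))))
    (G := fun x => .ofReal ((Real.exp (-(h : ℝ) / 2 + x) - 1) ^ 4)) (by fun_prop) (by fun_prop),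
    lintegral_exp_mul_geom hB]
  refine (mul_le_mul_right (lintegral_geom_increment_gaussianReal h) _).trans (le_of_eq ?_)
  rw [← ENNReal.ofReal_mul (by positivity), mul_left_comm, ← Real.exp_add]
  congr 3
  ring

end Gaussian

/-! ### Hyperbolic Brownian motion -/

section Riemann

/-- The Riemann sums between the times `i * h` and `j * h` of the stochastic integral of a geometric
Brownian motion. -/
def riemannSum {Ω : Type*} (W B : ℝ≥0 → Ω → ℝ) (h : ℝ≥0) (i j : ℕ) (ω : Ω) : ℝ :=
  ∑ k ∈ Finset.Ico i j, geom B (k * h) ω * (W ((k + 1 : ℕ) * h) ω - W (k * h) ω)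

lemma sum_Ico_eq_sum_range_ite {M : Type*} [AddCommMonoid M] (i j : ℕ) (f : ℕ → M) :
    ∑ k ∈ Finset.Ico i j, f k = ∑ k ∈ Finset.range j, if i ≤ k then f k else 0 := by
  rw [← Finset.sum_filter]
  congr 1
  ext k
  simp [and_comm]

/-- The quadratic variation of the Riemann sums. -/
def riemannVar {Ω : Type*} (B : ℝ≥0 → Ω → ℝ) (h : ℝ≥0) (i j : ℕ) (ω : Ω) : ℝ≥0 :=
  h * ∑ k ∈ Finset.Ico i j, ‖geom B (k * h) ω‖₊ ^ 2

lemma coe_riemannVar {Ω : Type*} (B : ℝ≥0 → Ω → ℝ) (h : ℝ≥0) (i j : ℕ) (ω : Ω) :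
    (riemannVar B h i j ω : ℝ) = h * ∑ k ∈ Finset.Ico i j, geom B (k * h) ω ^ 2 := by
  simp [riemannVar]

variable {Ω : Type*} [MeasurableSpace Ω] {P : Measure Ω} {W B : ℝ≥0 → Ω → ℝ}

/-- Given the geometric Brownian motion, the Riemann sums are Gaussian. -/
lemma lintegral_riemannSum (hW : IsPreBrownianReal W P) (hB : IsPreBrownianReal B P)
    (hind : IndepFun (fun ω t => W t ω) (fun ω t => B t ω) P) (h : ℝ≥0) (i j : ℕ)
    {G : ℝ → (ℕ → ℝ) → ℝ≥0∞} (hG : Measurable fun p : ℝ × (ℕ → ℝ) => G p.1 p.2) :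
    ∫⁻ ω, G (riemannSum W B h i j ω) (fun k => B (k * h) ω) ∂P =
      ∫⁻ ω, ∫⁻ s, G s (fun k => B (k * h) ω) ∂gaussianReal 0 (riemannVar B h i j ω) ∂P := by
  have ha : Measurable fun (b : ℕ → ℝ) (k : ℕ) =>
      if i ≤ k then Real.exp (-((k * h : ℝ≥0) : ℝ) / 2 + b k) else 0 := by
    refine measurable_pi_lambda _ fun k => ?_
    split_ifs <;> fun_prop
  have h1 := lintegral_sum_increments hW hB hind h ha j hG
  convert! h1 using 3 with ω ω
  · rw [riemannSum, sum_Ico_eq_sum_range_ite ]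
    congr 1
    refine Finset.sum_congr rfl fun k _ => ?_
    split_ifs <;> simp [geom]
  · rw [riemannVar, sum_Ico_eq_sum_range_ite]
    congr 3
    refine Finset.sum_congr rfl fun k _ => ?_
    split_ifs <;> simp [geom]

lemma aemeasurable_riemannSum (hW : IsPreBrownianReal W P) (hB : IsPreBrownianReal B P) (h : ℝ≥0)
    (i j : ℕ) : AEMeasurable (riemannSum W B h i j) P := by
  have h1 := fun k : ℕ => aemeasurable_geom hB (k * h)
  have h2 := fun k : ℕ => hW.aemeasurable (k * h)
  unfold riemannSum
  exact Finset.aemeasurable_fun_sum _ fun k _ => (h1 k).mul ((h2 (k + 1)).sub (h2 k))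

lemma lintegral_riemannSum_pow_four_le {K : ℝ≥0}
    (hK : ∀ v : ℝ≥0, ∫⁻ x, .ofReal (x ^ 4) ∂gaussianReal 0 v ≤ K * (v : ℝ≥0∞) ^ 2)
    (hW : IsPreBrownianReal W P) (hB : IsPreBrownianReal B P)
    (hind : IndepFun (fun ω t => W t ω) (fun ω t => B t ω) P) (h : ℝ≥0) (i n : ℕ) :
    ∫⁻ ω, .ofReal (riemannSum W B h i (i + n) ω ^ 4) ∂P ≤
      K * .ofReal ((n * h) ^ 2 * Real.exp (6 * ((i + n) * h))) := by
  rw [lintegral_riemannSum hW hB hind h i (i + n) (G := fun s _ => .ofReal (s ^ 4)) (by fun_prop)]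
  refine (lintegral_mono fun ω => hK _).trans ?_
  rw [lintegral_const_mul' _ _ ENNReal.coe_ne_top]
  refine mul_le_mul_right ?_ _
  have h1 : ∀ ω, (riemannVar B h i (i + n) ω : ℝ≥0∞) ^ 2 ≤
      ∑ k ∈ Finset.Ico i (i + n), .ofReal (n * h ^ 2) * .ofReal (geom B (k * h) ω ^ 4) := by
    intro ω
    have hg := fun k : ℕ => (geom_pos (B := B) (k * h) ω).le
    rw [← ENNReal.ofReal_coe_nnreal, coe_riemannVar, ← ENNReal.ofReal_pow
      (mul_nonneg (NNReal.coe_nonneg h) (Finset.sum_nonneg fun k _ => sq_nonneg _)), ← Finset.mul_sum,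
      ← ENNReal.ofReal_sum_of_nonneg (fun k _ => pow_nonneg (hg k) 4),
      ← ENNReal.ofReal_mul (by positivity)]
    refine ENNReal.ofReal_le_ofReal ?_
    -- Cauchy–Schwarz turns the squared conditional variance into fourth powers of Y, whose means
    -- are explicit.
    have h2 := sq_sum_le_card_mul_sum_sq (s := Finset.Ico i (i + n))
      (f := fun k : ℕ => geom B (k * h) ω ^ 2)
    rw [Nat.card_Ico, Nat.add_sub_cancel_left] at h2
    simp_rw [← pow_mul] at h2
    norm_num at h2
    calc _ = (h : ℝ) ^ 2 * (∑ k ∈ Finset.Ico i (i + n), geom B (k * h) ω ^ 2) ^ 2 := by ring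
      _ ≤ (h : ℝ) ^ 2 * (n * ∑ k ∈ Finset.Ico i (i + n), geom B (k * h) ω ^ 4) := by gcongr
      _ = _ := by ring
  refine (lintegral_mono h1).trans ?_
  have hm := fun k : ℕ => aemeasurable_geom hB (k * h)
  rw [lintegral_finsetSum' _ fun k _ => by have := hm k; fun_prop]
  calc _ ≤ ∑ k ∈ Finset.Ico i (i + n), ENNReal.ofReal (n * h ^ 2) *
        .ofReal (Real.exp (6 * ((i + n) * h))) := by
        refine Finset.sum_le_sum fun k hk => ?_
        rw [lintegral_const_mul' _ _ ENNReal.ofReal_ne_top, lintegral_geom_pow hB 4]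
        refine mul_le_mul_right (ENNReal.ofReal_le_ofReal (Real.exp_le_exp.2 ?_)) _
        have hk2 : (k : ℝ) ≤ i + n := by exact_mod_cast (Finset.mem_Ico.1 hk).2.le
        have := mul_le_mul_of_nonneg_right hk2 h.2
        push_cast
        norm_num at *
        linarith
    _ = _ := by
        rw [Finset.sum_const, Nat.card_Ico, Nat.add_sub_cancel_left, nsmul_eq_mul,
          ← ENNReal.ofReal_mul (by positivity), ← ENNReal.ofReal_natCast n,
          ← ENNReal.ofReal_mul (by positivity)]
        congr 1
        ring

/-- Given B the squared sum has mean h ∑ Y_k², and each E[Y_k² / Y_n] = e^((n-k)h) is at most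
e^(nh). -/
lemma lintegral_riemannSum_sq_div_le (hW : IsPreBrownianReal W P) (hB : IsPreBrownianReal B P)
    (hind : IndepFun (fun ω t => W t ω) (fun ω t => B t ω) P) (h : ℝ≥0) (n : ℕ) :
    ∫⁻ ω, .ofReal (riemannSum W B h 0 n ω ^ 2 / geom B (n * h) ω) ∂P ≤
      .ofReal (n * h * Real.exp (n * h)) := by
  have e1 := lintegral_riemannSum hW hB hind h 0 n
    (G := fun s b => .ofReal (s ^ 2) * .ofReal ((Real.exp (-((n * h : ℝ≥0) : ℝ) / 2 + b n))⁻¹))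
    (by fun_prop)
  have e2 : ∀ ω, ENNReal.ofReal (riemannSum W B h 0 n ω ^ 2 / geom B (n * h) ω) =
      .ofReal (riemannSum W B h 0 n ω ^ 2) * .ofReal ((geom B (n * h) ω)⁻¹) := fun ω => by
    rw [← ENNReal.ofReal_mul (by positivity), div_eq_mul_inv]
  simp_rw [e2]
  refine e1.le.trans ?_
  have e3 : ∀ ω, ∫⁻ s, .ofReal (s ^ 2) *
      .ofReal ((Real.exp (-((n * h : ℝ≥0) : ℝ) / 2 + B (n * h) ω))⁻¹)
      ∂gaussianReal 0 (riemannVar B h 0 n ω) = ∑ k ∈ Finset.range n, ENNReal.ofReal h *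
        .ofReal (geom B (k * h) ω ^ 2 / geom B (n * h) ω) := by
    intro ω
    rw [lintegral_mul_const _ (by fun_prop), lintegral_sq_gaussianReal,
      ← ENNReal.ofReal_coe_nnreal, coe_riemannVar, ← Finset.mul_sum,
      ← ENNReal.ofReal_sum_of_nonneg fun k _ => by have := geom_pos (B := B) (n * h) ω; positivity,
      ← ENNReal.ofReal_mul (by positivity), ← ENNReal.ofReal_mul (by positivity),
      ← Finset.sum_div, ← Finset.range_eq_Ico, geom]
    congr 1
    ring
  simp_rw [e3]
  have hm := fun k : ℕ => aemeasurable_geom hB (k * h)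
  rw [lintegral_finsetSum' _ fun k _ => by have := hm k; have := hm n; fun_prop]
  calc _ ≤ ∑ k ∈ Finset.range n, ENNReal.ofReal h * .ofReal (Real.exp (n * h)) := by
        refine Finset.sum_le_sum fun k hk => ?_
        have hkn := (Finset.mem_range.1 hk).le
        have e4 : (n : ℝ≥0) * h = k * h + (n - k : ℕ) * h := by
          rw [← add_mul, ← Nat.cast_add, Nat.add_sub_cancel' hkn]
        rw [lintegral_const_mul' _ _ ENNReal.ofReal_ne_top, e4, lintegral_geom_sq_div hB]
        refine mul_le_mul_right (ENNReal.ofReal_le_ofReal (Real.exp_le_exp.2 ?_)) _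
        push_cast
        gcongr
        exact_mod_cast Nat.sub_le n k
    _ = _ := by
        rw [Finset.sum_const, Finset.card_range, nsmul_eq_mul,
          ← ENNReal.ofReal_mul (by positivity), ← ENNReal.ofReal_natCast n,
          ← ENNReal.ofReal_mul (by positivity), mul_assoc]

/-- Jensen's inequality for the convex function u ↦ u^(-1/2) at u = y². It replaces the inverse root
of the conditional variance by an average of 1/Y, whose mean is explicit. -/
lemma inv_sqrt_sum_sq_le {n : ℕ} (hn : 0 < n) {h : ℝ} (hh : 0 < h) {y : ℕ → ℝ} (hy : ∀ k, 0 < y k) :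
    (√(h * ∑ k ∈ Finset.range n, y k ^ 2))⁻¹ ≤
      (√(n * h))⁻¹ * ((n : ℝ)⁻¹ * ∑ k ∈ Finset.range n, (y k)⁻¹) := by
  have hn' : (0 : ℝ) < n := by exact_mod_cast hn
  have hS : 0 < ∑ k ∈ Finset.range n, y k ^ 2 :=
    Finset.sum_pos (fun k _ => by have := hy k; positivity) ⟨0, Finset.mem_range.2 hn⟩
  set r := √((∑ k ∈ Finset.range n, y k ^ 2) / n)
  have hr : 0 < r := Real.sqrt_pos.2 (by positivity)
  have hr2 : ∑ k ∈ Finset.range n, y k ^ 2 = n * r ^ 2 := by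
    rw [Real.sq_sqrt (by positivity), mul_div_cancel₀ _ hn'.ne']
  rw [hr2, show h * (n * r ^ 2) = n * h * r ^ 2 by ring, Real.sqrt_mul (by positivity),
    Real.sqrt_sq hr.le, mul_inv]
  refine mul_le_mul_of_nonneg_left ?_ (by positivity)
  -- The tangent line at u = r², where r is the root mean square; the gap is (y - r)²(y + 2r) /
  -- (2r³y).
  have h1 : ∀ k ∈ Finset.range n, 3 / (2 * r) - y k ^ 2 / (2 * r ^ 3) ≤ (y k)⁻¹ := fun k _ => by
    have := hy k
    rw [← sub_nonneg]
    have h2 : (y k)⁻¹ - (3 / (2 * r) - y k ^ 2 / (2 * r ^ 3)) =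
        (y k - r) ^ 2 * (y k + 2 * r) / (2 * r ^ 3 * y k) := by
      field_simp
      ring
    rw [h2]
    positivity
  have h3 := Finset.sum_le_sum h1
  rw [Finset.sum_sub_distrib, Finset.sum_const, Finset.card_range, ← Finset.sum_div, hr2,
    nsmul_eq_mul] at h3
  calc r⁻¹ = (n : ℝ)⁻¹ * (n * (3 / (2 * r)) - n * r ^ 2 / (2 * r ^ 3)) := by field_simp; ring
    _ ≤ _ := by gcongr

/-- Given B the sum is Gaussian, so its density is at most the inverse root of its variance; the
shift by Y r is a function of B and does not affect this bound. -/
lemma lintegral_riemannSum_le (hW : IsPreBrownianReal W P) (hB : IsPreBrownianReal B P)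
    (hind : IndepFun (fun ω t => W t ω) (fun ω t => B t ω) P) {h : ℝ≥0} (hh : 0 < h) {n : ℕ}
    (hn : 0 < n) {φ : ℝ → ℝ≥0∞} (hφ : Measurable φ) (r : ℝ) :
    ∫⁻ ω, φ (riemannSum W B h 0 n ω + geom B (n * h) ω * r) ∂P ≤
      .ofReal ((√(n * h))⁻¹ * Real.exp (n * h)) * ∫⁻ x, φ x := by
  have e1 := lintegral_riemannSum hW hB hind h 0 n
    (G := fun s b => φ (s + Real.exp (-((n * h : ℝ≥0) : ℝ) / 2 + b n) * r))
    (by fun_prop)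
  refine e1.le.trans ?_
  have hm := fun k : ℕ => aemeasurable_geom hB (k * h)
  have hh' : (0 : ℝ) < h := hh
  have e2 : ∀ ω, ∫⁻ s, φ (s + Real.exp (-((n * h : ℝ≥0) : ℝ) / 2 + B (n * h) ω) * r)
      ∂gaussianReal 0 (riemannVar B h 0 n ω) ≤
      (.ofReal ((√(n * h))⁻¹ * (n : ℝ)⁻¹) * ∑ k ∈ Finset.range n,
        .ofReal ((geom B (k * h) ω)⁻¹)) * ∫⁻ x, φ x := by
    intro ω
    have hg := fun k : ℕ => geom_pos (B := B) (k * h) ω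
    have hv : riemannVar B h 0 n ω ≠ 0 := by
      have : (0 : ℝ) < riemannVar B h 0 n ω := by
        rw [coe_riemannVar]
        refine mul_pos hh' (Finset.sum_pos (fun k _ => pow_pos (hg k) 2) ?_)
        exact ⟨0, by simpa using hn⟩
      exact_mod_cast this.ne'
    refine (lintegral_gaussianReal_le hv hφ _).trans (mul_le_mul_left ?_ _)
    rw [coe_riemannVar, ← ENNReal.ofReal_sum_of_nonneg fun k _ => (inv_pos.2 (hg k)).le,
      ← ENNReal.ofReal_mul (by positivity), mul_assoc, ← Finset.range_eq_Ico]
    exact ENNReal.ofReal_le_ofReal (inv_sqrt_sum_sq_le hn hh' hg)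
  refine (lintegral_mono e2).trans ?_
  have hms : AEMeasurable (fun ω => ∑ k ∈ Finset.range n,
      ENNReal.ofReal ((geom B (k * h) ω)⁻¹)) P :=
    Finset.aemeasurable_fun_sum _ fun k _ => by have := hm k; fun_prop
  rw [lintegral_mul_const'' _ (hms.const_mul _), lintegral_const_mul'' _ hms,
    lintegral_finsetSum' _ fun k _ => by have := hm k; fun_prop]
  refine mul_le_mul_left ?_ _
  calc _ ≤ ENNReal.ofReal ((√(n * h))⁻¹ * (n : ℝ)⁻¹) *
        ∑ k ∈ Finset.range n, .ofReal (Real.exp (n * h)) := by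
        gcongr with k hk
        rw [lintegral_geom_inv hB]
        refine ENNReal.ofReal_le_ofReal (Real.exp_le_exp.2 ?_)
        push_cast
        gcongr
        exact (Finset.mem_range.1 hk).le
    _ = _ := by
        have hn' : (n : ℝ) ≠ 0 := by exact_mod_cast hn.ne'
        rw [Finset.sum_const, Finset.card_range, nsmul_eq_mul, ← ENNReal.ofReal_natCast n,
          ← ENNReal.ofReal_mul (by positivity), ← ENNReal.ofReal_mul (by positivity)]
        congr 1
        field_simp

end Riemann

/-! ### Passage from Riemann sums to the stochastic integral -/

section Motion

variable {Ω : Type*} [MeasurableSpace Ω] {P : Measure Ω} {W B : ℝ≥0 → Ω → ℝ} {Z : ℝ≥0 → Ω → ℂ}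

lemma lintegral_le_of_le_liminf {F : ℕ → Ω → ℝ≥0∞} {F' : Ω → ℝ≥0∞} {K : ℝ≥0∞}
    (hF : ∀ n, AEMeasurable (F n) P) (hK : ∀ n, ∫⁻ ω, F n ω ∂P ≤ K)
    (h : ∀ᵐ ω ∂P, F' ω ≤ liminf (fun n => F n ω) atTop) : ∫⁻ ω, F' ω ∂P ≤ K :=
  (lintegral_mono_ae h).trans ((lintegral_liminf_le' hF).trans
    (liminf_le_of_frequently_le' (Frequently.of_forall hK)))

lemma tendstoInMeasure_riemannSum
    (him : ∀ᵐ ω ∂P, ∀ t : ℝ≥0, (Z t ω).im = geom B t ω)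
    (hI : ∀ t : ℝ≥0, IsItoIntegral (fun s ω => (Z s ω).im) W t (fun ω => (Z t ω).re) P)
    {s : ℝ≥0} {h : ℕ → ℝ≥0} {n : ℕ → ℕ} (hn : Tendsto n atTop atTop) (hs : ∀ N, n N * h N = s) :
    TendstoInMeasure P (fun N => riemannSum W B (h N) 0 (n N)) atTop fun ω => (Z s ω).re := by
  have h1 : TendstoInMeasure P (fun N => itoSum (fun s ω => (Z s ω).im) W s (n N)) atTop
      fun ω => (Z s ω).re := (hI s).comp hn
  refine h1.congr' ?_ ae_eq_rfl
  filter_upwards [hn.eventually_gt_atTop 0] with N hN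
  filter_upwards [him] with ω hω
  have hN' : (n N : ℝ≥0) ≠ 0 := by exact_mod_cast hN.ne'
  have e : ∀ x : ℝ≥0, x * s / n N = x * h N := fun x => by
    rw [← hs N, mul_left_comm, mul_div_cancel_left₀ _ hN']
  simp_rw [itoSum, riemannSum, hω, e, ← Finset.range_eq_Ico, Nat.cast_add, Nat.cast_one]

lemma re_zero_ae_eq_zero
    (hI : ∀ t : ℝ≥0, IsItoIntegral (fun s ω => (Z s ω).im) W t (fun ω => (Z t ω).re) P) :
    ∀ᵐ ω ∂P, (Z 0 ω).re = 0 := by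
  obtain ⟨ns, -, h⟩ := (hI 0).exists_seq_tendsto_ae
  filter_upwards [h] with ω hω
  have : ∀ n, itoSum (fun s ω => (Z s ω).im) W 0 n ω = 0 := fun n => by simp [itoSum]
  simp_rw [this] at hω
  exact tendsto_nhds_unique hω tendsto_const_nhds

/-- The increments of the real part on a grid are almost sure limits of Riemann sums. -/
lemma exists_tendsto_riemannSum
    (him : ∀ᵐ ω ∂P, ∀ t : ℝ≥0, (Z t ω).im = geom B t ω)
    (hI : ∀ t : ℝ≥0, IsItoIntegral (fun s ω => (Z s ω).im) W t (fun ω => (Z t ω).re) P)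
    (h : ℝ≥0) (i j : ℕ) (hij : i ≤ j) : ∃ ns : ℕ → ℕ, ∀ᵐ ω ∂P,
      Tendsto (fun N => riemannSum W B (h / (ns N + 1 : ℕ)) (i * (ns N + 1)) (j * (ns N + 1)) ω) atTop
        (𝓝 ((Z (j * h) ω).re - (Z (i * h) ω).re)) := by
  have hs : ∀ (l N : ℕ), ((l * (N + 1) : ℕ) : ℝ≥0) * (h / (N + 1 : ℕ)) = l * h := fun l N => by
    have : ((N + 1 : ℕ) : ℝ≥0) ≠ 0 := by exact_mod_cast N.succ_ne_zero
    rw [Nat.cast_mul, mul_assoc, mul_div_cancel₀ _ this]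
  have key : ∀ (l : ℕ) (ns : ℕ → ℕ), Tendsto ns atTop atTop → ∃ ms : ℕ → ℕ, Tendsto ms atTop atTop ∧
      ∀ᵐ ω ∂P, Tendsto (fun N => riemannSum W B (h / (ns (ms N) + 1 : ℕ)) 0
        (l * (ns (ms N) + 1)) ω) atTop (𝓝 ((Z (l * h) ω).re)) := by
    intro l ns hns
    -- For l = 0 the number of steps does not grow, so convergence of Itô sums is not available;
    -- both sides vanish instead.
    rcases Nat.eq_zero_or_pos l with rfl | hl
    · refine ⟨id, tendsto_id, ?_⟩
      filter_upwards [re_zero_ae_eq_zero hI] with ω hω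
      simp [riemannSum, hω]
    · have h1 := tendstoInMeasure_riemannSum (h := fun N => h / (ns N + 1 : ℕ))
        (n := fun N => l * (ns N + 1)) him hI
        (tendsto_atTop_mono (fun N => (Nat.le_succ _).trans (Nat.le_mul_of_pos_left _ hl)) hns)
        fun N => hs l (ns N)
      obtain ⟨ms, hms, h2⟩ := h1.exists_seq_tendsto_ae
      exact ⟨ms, hms.tendsto_atTop, h2⟩
  -- A subsequence for the left endpoint is refined once more for the right one, so that both
  -- converge on a common mesh.
  obtain ⟨ns, hns, h1⟩ := key i id tendsto_id
  obtain ⟨ms, hms, h2⟩ := key j ns hns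
  refine ⟨ns ∘ ms, ?_⟩
  filter_upwards [h1, h2] with ω a1 a2
  refine (a2.sub (a1.comp hms)).congr fun N => ?_
  have hle : i * (ns (ms N) + 1) ≤ j * (ns (ms N) + 1) := by gcongr
  simp only [Function.comp_apply, id, riemannSum]
  rw [Finset.sum_Ico_eq_sub _ hle, Finset.range_eq_Ico, Finset.range_eq_Ico]

lemma lintegral_re_sub_pow_four_le {K : ℝ≥0}
    (hK : ∀ v : ℝ≥0, ∫⁻ x, .ofReal (x ^ 4) ∂gaussianReal 0 v ≤ K * (v : ℝ≥0∞) ^ 2)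
    (hW : IsPreBrownianReal W P) (hB : IsPreBrownianReal B P)
    (hind : IndepFun (fun ω t => W t ω) (fun ω t => B t ω) P)
    (him : ∀ᵐ ω ∂P, ∀ t : ℝ≥0, (Z t ω).im = geom B t ω)
    (hI : ∀ t : ℝ≥0, IsItoIntegral (fun s ω => (Z s ω).im) W t (fun ω => (Z t ω).re) P)
    (h : ℝ≥0) (i : ℕ) :
    ∫⁻ ω, .ofReal (((Z ((i + 1 : ℕ) * h) ω).re - (Z (i * h) ω).re) ^ 4) ∂P ≤
      K * .ofReal (h ^ 2 * Real.exp (6 * ((i + 1) * h))) := by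
  obtain ⟨ns, hns⟩ := exists_tendsto_riemannSum him hI h i (i + 1) i.le_succ
  refine lintegral_le_of_le_liminf (F := fun N ω => .ofReal (riemannSum W B (h / (ns N + 1 : ℕ))
    (i * (ns N + 1)) ((i + 1) * (ns N + 1)) ω ^ 4)) (fun N => ?_) (fun N => ?_) ?_
  · have := aemeasurable_riemannSum hW hB (h / (ns N + 1 : ℕ)) (i * (ns N + 1))
      ((i + 1) * (ns N + 1))
    fun_prop
  · have hpos : ((ns N + 1 : ℕ) : ℝ) ≠ 0 := by exact_mod_cast (ns N).succ_ne_zero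
    have h1 := lintegral_riemannSum_pow_four_le hK hW hB hind (h / (ns N + 1 : ℕ)) (i * (ns N + 1))
      (ns N + 1)
    rw [← Nat.succ_mul, NNReal.coe_div, NNReal.coe_natCast, mul_div_cancel₀ _ hpos] at h1
    refine h1.trans_eq ?_
    congr 5
    rw [Nat.cast_mul, ← add_one_mul, mul_assoc, mul_div_cancel₀ _ hpos]
  · filter_upwards [hns] with ω hω
    exact (ENNReal.tendsto_ofReal (hω.pow 4)).liminf_eq.ge

lemma lintegral_norm_sub_pow_four_le {K : ℝ≥0}
    (hK : ∀ v : ℝ≥0, ∫⁻ x, .ofReal (x ^ 4) ∂gaussianReal 0 v ≤ K * (v : ℝ≥0∞) ^ 2)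
    (hW : IsPreBrownianReal W P) (hB : IsPreBrownianReal B P)
    (hind : IndepFun (fun ω t => W t ω) (fun ω t => B t ω) P) (hZ : ∀ t, Measurable (Z t))
    (him : ∀ᵐ ω ∂P, ∀ t : ℝ≥0, (Z t ω).im = geom B t ω)
    (hI : ∀ t : ℝ≥0, IsItoIntegral (fun s ω => (Z s ω).im) W t (fun ω => (Z t ω).re) P)
    (h : ℝ≥0) (i : ℕ) :
    ∫⁻ ω, .ofReal (‖Z ((i + 1 : ℕ) * h) ω - Z (i * h) ω‖ ^ 4) ∂P ≤
      .ofReal ((2 * K + 32) * (h ^ 2 * Real.exp (6 * ((i + 1) * h)))) := by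
  have h1 : ∀ z : ℂ, ENNReal.ofReal (‖z‖ ^ 4) ≤
      2 * .ofReal (z.re ^ 4) + 2 * .ofReal (z.im ^ 4) := by
    intro z
    have e : ‖z‖ ^ 4 = (z.re ^ 2 + z.im ^ 2) ^ 2 := by
      rw [show ‖z‖ ^ 4 = (‖z‖ ^ 2) ^ 2 by ring, Complex.sq_norm, Complex.normSq_apply]
      ring
    rw [← ENNReal.ofReal_ofNat 2, ← ENNReal.ofReal_mul (by norm_num),
      ← ENNReal.ofReal_mul (by norm_num), ← ENNReal.ofReal_add (by positivity) (by positivity), e]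
    exact ENNReal.ofReal_le_ofReal (by nlinarith [sq_nonneg (z.re ^ 2 - z.im ^ 2)])
  have m1 := hZ ((i + 1 : ℕ) * h)
  have m2 := hZ (i * h)
  refine (lintegral_mono fun ω => h1 _).trans ?_
  rw [lintegral_add_left (by fun_prop), lintegral_const_mul _ (by fun_prop),
    lintegral_const_mul _ (by fun_prop)]
  have h2 : ∫⁻ ω, .ofReal ((Z ((i + 1 : ℕ) * h) ω - Z (i * h) ω).im ^ 4) ∂P ≤
      .ofReal (16 * h ^ 2 * Real.exp (6 * (i * h + h))) := by
    refine le_trans (lintegral_mono_ae ?_) (lintegral_geom_sub_pow_four_le hB (i * h) h)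
    filter_upwards [him] with ω hω
    rw [Complex.sub_im, hω, hω, Nat.cast_succ, add_one_mul]
  have h3 := lintegral_re_sub_pow_four_le hK hW hB hind him hI h i
  simp_rw [Complex.sub_re]
  refine (add_le_add (mul_le_mul_right h3 2) (mul_le_mul_right h2 2)).trans_eq ?_
  have hK0 : (0 : ℝ) ≤ K := K.2
  rw [← ENNReal.ofReal_coe_nnreal, ← ENNReal.ofReal_mul hK0, ← ENNReal.ofReal_ofNat 2,
    ← ENNReal.ofReal_mul (by norm_num), ← ENNReal.ofReal_mul (by norm_num),
    ← ENNReal.ofReal_add (by positivity) (by positivity), add_one_mul]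
  congr 1
  ring

lemma lintegral_re_sq_div_le
    (hW : IsPreBrownianReal W P) (hB : IsPreBrownianReal B P)
    (hind : IndepFun (fun ω t => W t ω) (fun ω t => B t ω) P)
    (him : ∀ᵐ ω ∂P, ∀ t : ℝ≥0, (Z t ω).im = geom B t ω)
    (hI : ∀ t : ℝ≥0, IsItoIntegral (fun s ω => (Z s ω).im) W t (fun ω => (Z t ω).re) P)
    (t : ℝ≥0) :
    ∫⁻ ω, .ofReal ((Z t ω).re ^ 2 / geom B t ω) ∂P ≤ .ofReal (t * Real.exp t) := by
  obtain ⟨ns, hns⟩ := exists_tendsto_riemannSum him hI t 0 1 zero_le_one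
  refine lintegral_le_of_le_liminf (F := fun N ω => .ofReal (riemannSum W B (t / (ns N + 1 : ℕ))
    0 (ns N + 1) ω ^ 2 / geom B t ω)) (fun N => ?_) (fun N => ?_) ?_
  · have m1 := aemeasurable_riemannSum hW hB (t / (ns N + 1 : ℕ)) 0 (ns N + 1)
    have m2 := aemeasurable_geom hB t
    exact ((m1.pow_const 2).div m2).ennreal_ofReal
  · have hpos : ((ns N + 1 : ℕ) : ℝ≥0) ≠ 0 := by exact_mod_cast (ns N).succ_ne_zero
    have h1 := lintegral_riemannSum_sq_div_le hW hB hind (t / (ns N + 1 : ℕ)) (ns N + 1)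
    rwa [mul_div_cancel₀ _ hpos, ← NNReal.coe_natCast, ← NNReal.coe_mul,
      mul_div_cancel₀ _ hpos] at h1
  · filter_upwards [hns, re_zero_ae_eq_zero hI] with ω hω h0
    simp only [zero_mul, one_mul, Nat.cast_zero, Nat.cast_one, h0, sub_zero] at hω
    exact (ENNReal.tendsto_ofReal ((hω.pow 2).div_const _)).liminf_eq.ge

/-- The bound states that the law of X + Y r is dominated by a multiple of Lebesgue measure, so it
is enough to compare measures of open sets. -/
lemma lintegral_re_add_le
    (hW : IsPreBrownianReal W P) (hB : IsPreBrownianReal B P)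
    (hind : IndepFun (fun ω t => W t ω) (fun ω t => B t ω) P) (hZ : ∀ t, Measurable (Z t))
    (him : ∀ᵐ ω ∂P, ∀ t : ℝ≥0, (Z t ω).im = geom B t ω)
    (hI : ∀ t : ℝ≥0, IsItoIntegral (fun s ω => (Z s ω).im) W t (fun ω => (Z t ω).re) P)
    {t : ℝ≥0} (ht : t ≠ 0) (r : ℝ) {φ : ℝ → ℝ≥0∞} (hφ : Measurable φ) :
    ∫⁻ ω, φ ((Z t ω).re + geom B t ω * r) ∂P ≤
      .ofReal ((√t)⁻¹ * Real.exp t) * ∫⁻ x, φ x := by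
  set K := ENNReal.ofReal ((√t)⁻¹ * Real.exp t)
  have ht0 : 0 < t := pos_iff_ne_zero.2 ht
  have hK0 : K ≠ 0 := by
    have : (0 : ℝ) < t := ht0
    simp only [K, ne_eq, ENNReal.ofReal_eq_zero, not_le]
    positivity
  have hK1 : K ≠ ∞ := ENNReal.ofReal_ne_top
  have m1 := hZ t
  have m2 := aemeasurable_geom hB t
  have mX : AEMeasurable (fun ω => (Z t ω).re + geom B t ω * r) P := by fun_prop
  obtain ⟨ns, hns⟩ := exists_tendsto_riemannSum him hI t 0 1 zero_le_one
  -- Indicators of open sets are lower semicontinuous, as Fatou's lemma requires along the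
  -- approximating sums.
  have hopen : ∀ U : Set ℝ, IsOpen U →
      P.map (fun ω => (Z t ω).re + geom B t ω * r) U ≤ K * volume U := by
    intro U hU
    have hUm : Measurable (U.indicator (1 : ℝ → ℝ≥0∞)) :=
      measurable_one.indicator hU.measurableSet
    rw [← lintegral_indicator_one hU.measurableSet, ← lintegral_indicator_one hU.measurableSet,
      lintegral_map' hUm.aemeasurable mX]
    refine lintegral_le_of_le_liminf (F := fun N ω => U.indicator 1 (riemannSum W B
      (t / (ns N + 1 : ℕ)) 0 (ns N + 1) ω + geom B t ω * r)) (fun N => ?_) (fun N => ?_) ?_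
    · have m1 := aemeasurable_riemannSum hW hB (t / (ns N + 1 : ℕ)) 0 (ns N + 1)
      exact hUm.comp_aemeasurable (m1.add (m2.mul_const r))
    · have hpos : ((ns N + 1 : ℕ) : ℝ≥0) ≠ 0 := by exact_mod_cast (ns N).succ_ne_zero
      have h1 := lintegral_riemannSum_le hW hB hind (h := t / (ns N + 1 : ℕ)) (by positivity)
        (Nat.succ_pos (ns N)) hUm r
      rwa [mul_div_cancel₀ _ hpos, ← NNReal.coe_natCast, ← NNReal.coe_mul,
        mul_div_cancel₀ _ hpos] at h1
    · filter_upwards [hns, re_zero_ae_eq_zero hI] with ω hω h0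
      simp only [zero_mul, one_mul, Nat.cast_zero, Nat.cast_one, h0, sub_zero] at hω
      by_cases hU' : (Z t ω).re + geom B t ω * r ∈ U
      · have h2 := (hω.add_const (geom B t ω * r)).eventually (hU.mem_nhds hU')
        have h3 : Tendsto (fun N => U.indicator (1 : ℝ → ℝ≥0∞) (riemannSum W B
            (t / (ns N + 1 : ℕ)) 0 (ns N + 1) ω + geom B t ω * r)) atTop (𝓝 1) :=
          tendsto_const_nhds.congr' (h2.mono fun N hN =>
            (Set.indicator_of_mem (f := (1 : ℝ → ℝ≥0∞)) hN).symm)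
        rw [h3.liminf_eq, Set.indicator_of_mem hU']
        rfl
      · simp [hU']
  -- Outer regularity of Lebesgue measure extends the domination from open sets to all sets.
  have hle : P.map (fun ω => (Z t ω).re + geom B t ω * r) ≤ K • volume := by
    refine Measure.le_iff.2 fun s _ => ENNReal.le_of_forall_pos_le_add fun ε hε _ => ?_
    obtain ⟨U, hsU, hU, hUε⟩ := s.exists_isOpen_le_add volume (ε := ε / K)
      (ENNReal.div_pos (by exact_mod_cast hε.ne') hK1).ne'
    calc _ ≤ K * volume U := (measure_mono hsU).trans (hopen U hU)
      _ ≤ K * (volume s + ε / K) := by gcongr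
      _ = _ := by rw [mul_add, ENNReal.mul_div_cancel hK0 hK1]; rfl
  rw [← lintegral_map' hφ.aemeasurable mX]
  refine (lintegral_mono' hle le_rfl).trans_eq ?_
  rw [lintegral_smul_measure, smul_eq_mul]

end Motion

/-! ### Maximal displacement by dyadic chaining -/

section Chaining

lemma tendsto_dyadic_floor (t : ℝ≥0) :
    Tendsto (fun n : ℕ => (⌊t * 2 ^ n⌋₊ : ℝ≥0) / 2 ^ n) atTop (𝓝 t) := by
  rw [← NNReal.tendsto_coe]
  refine ((tendsto_nat_floor_mul_div_atTop (R := ℝ) t.2).comp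
    (tendsto_pow_atTop_atTop_of_one_lt (r := (2 : ℝ)) (by norm_num))).congr fun n => ?_
  have : ⌊(t : ℝ) * 2 ^ n⌋₊ = ⌊t * 2 ^ n⌋₊ := by
    rw [← NNReal.coe_ofNat, ← NNReal.coe_pow, ← NNReal.coe_mul]
    rfl
  simp only [Function.comp_apply]
  push_cast
  exact congrArg (fun k : ℕ => (k : ℝ) / 2 ^ n) this

variable {Ω : Type*} [MeasurableSpace Ω] {P : Measure Ω} {W B : ℝ≥0 → Ω → ℝ} {Z : ℝ≥0 → Ω → ℂ}

/-- A bound for the increments of a path over the intervals of the dyadic partition of `[0, t]` of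
level `m`. -/
def chainTerm (t : ℝ≥0) (m : ℕ) (z : ℝ≥0 → ℂ) : ℝ≥0∞ :=
  .ofReal ((9 / 10) ^ m) + .ofReal ((1000 / 729) ^ m) * ∑ j ∈ Finset.range (2 ^ m),
    .ofReal (‖z ((j + 1 : ℕ) * (t / 2 ^ m)) - z (j * (t / 2 ^ m))‖ ^ 4)

lemma enorm_increment_le_chainTerm (t : ℝ≥0) (m : ℕ) (z : ℝ≥0 → ℂ) {j : ℕ} (hj : j < 2 ^ m) :
    ‖z ((j + 1 : ℕ) * (t / 2 ^ m)) - z (j * (t / 2 ^ m))‖ₑ ≤ chainTerm t m z := by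
  set d := ‖z ((j + 1 : ℕ) * (t / 2 ^ m)) - z (j * (t / 2 ^ m))‖
  have hd : 0 ≤ d := norm_nonneg _
  set a : ℝ := (9 / 10) ^ m
  have ha : 0 < a := by positivity
  have hab : ((1000 / 729 : ℝ)) ^ m * a ^ 3 = 1 := by
    rw [← pow_mul, mul_comm m 3, pow_mul, ← mul_pow]
    norm_num
  -- With a = (9/10)^m one has d ≤ a or d ≤ d⁴/a³, and a^(-3) = (1000/729)^m. In expectation the 2^m
  -- fourth powers, each of order 4^(-m), give (1000/1458)^m, so both parts are summable.
  have h1 : d ≤ a + (1000 / 729) ^ m * d ^ 4 := by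
    rcases le_total d a with h | h
    · have : 0 ≤ (1000 / 729 : ℝ) ^ m * d ^ 4 := by positivity
      linarith
    · have h2 : a ^ 3 ≤ d ^ 3 := by gcongr
      have h3 : (1000 / 729 : ℝ) ^ m * a ^ 3 * d ≤ (1000 / 729 : ℝ) ^ m * d ^ 3 * d := by gcongr
      rw [hab] at h3
      calc d ≤ (1000 / 729 : ℝ) ^ m * d ^ 3 * d := by linarith
        _ ≤ _ := by nlinarith
  rw [← ofReal_norm]
  refine (ENNReal.ofReal_le_ofReal h1).trans ?_
  rw [ENNReal.ofReal_add ha.le (by positivity), ENNReal.ofReal_mul (by positivity), chainTerm]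
  gcongr
  exact Finset.single_le_sum (f := fun j : ℕ =>
    ENNReal.ofReal (‖z ((j + 1 : ℕ) * (t / 2 ^ m)) - z (j * (t / 2 ^ m))‖ ^ 4))
    (fun _ _ => zero_le) (Finset.mem_range.2 hj)

/-- An even grid point lies on the coarser grid; an odd one is a single step of its own level away
from such a point. So each level contributes at most one increment. -/
lemma enorm_grid_le (t : ℝ≥0) (z : ℝ≥0 → ℂ) (m j : ℕ) (hj : j ≤ 2 ^ m) :
    ‖z (j * (t / 2 ^ m)) - z 0‖ₑ ≤ ∑ l ∈ Finset.range (m + 1), chainTerm t l z := by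
  induction m generalizing j with
  | zero =>
    rcases Nat.eq_zero_or_pos j with rfl | h
    · simp
    · obtain rfl : j = 1 := le_antisymm (by simpa using hj) h
      have := enorm_increment_le_chainTerm t 0 z (j := 0) (by norm_num)
      simpa using this
  | succ m ih =>
    have he : ∀ i : ℕ, ((2 * i : ℕ) : ℝ≥0) * (t / 2 ^ (m + 1)) = i * (t / 2 ^ m) := fun i => by
      rw [pow_succ]
      push_cast
      field_simp
    rw [Finset.sum_range_succ]
    obtain ⟨i, rfl | rfl⟩ := Nat.even_or_odd' j
    · rw [he]
      exact (ih i (by rw [pow_succ] at hj; omega)).trans (le_add_of_nonneg_right zero_le)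
    · have h1 := ih i (by rw [pow_succ] at hj; omega)
      have h2 := enorm_increment_le_chainTerm t (m + 1) z (j := 2 * i) (by omega)
      rw [he] at h2
      rw [add_comm (Finset.sum _ _)]
      calc _ = ‖(z ((2 * i + 1 : ℕ) * (t / 2 ^ (m + 1))) - z (i * (t / 2 ^ m))) +
            (z (i * (t / 2 ^ m)) - z 0)‖ₑ := by rw [sub_add_sub_cancel]
        _ ≤ _ := (enorm_add_le _ _).trans (add_le_add h2 h1)

lemma enorm_sub_le_tsum_chainTerm {t s : ℝ≥0} (hs : s ≤ t) {z : ℝ≥0 → ℂ} (hz : Continuous z) :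
    ‖z s - z 0‖ₑ ≤ ∑' m, chainTerm t m z := by
  rcases eq_or_ne t 0 with rfl | ht
  · obtain rfl : s = 0 := le_antisymm hs zero_le
    simp
  set u : ℕ → ℝ≥0 := fun m => (⌊(s / t) * 2 ^ m⌋₊ : ℝ≥0) * (t / 2 ^ m)
  have hu : Tendsto u atTop (𝓝 s) := by
    have h1 := tendsto_dyadic_floor (s / t)
    have h2 := h1.mul_const t
    rw [div_mul_cancel₀ _ ht] at h2
    exact h2.congr fun m => by simp only [u]; rw [div_mul_eq_mul_div, mul_div_assoc]
  have h1 : Tendsto (fun m => ‖z (u m) - z 0‖ₑ) atTop (𝓝 ‖z s - z 0‖ₑ) :=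
    (((hz.tendsto s).comp hu).sub_const (z 0)).enorm
  refine le_of_tendsto h1 (.of_forall fun m => (enorm_grid_le t z m _ ?_).trans
    (ENNReal.sum_le_tsum _))
  have h3 : (s / t) * 2 ^ m ≤ ((2 ^ m : ℕ) : ℝ≥0) := by
    push_cast
    exact mul_le_of_le_one_left zero_le (div_le_one_of_le₀ hs zero_le)
  exact Nat.floor_le_of_le h3

lemma lintegral_chainTerm_le {L : ℝ≥0} (t : ℝ≥0) (m : ℕ) (hP : IsProbabilityMeasure P)
    (hZ : ∀ t, Measurable (Z t))
    (hL : ∀ (h : ℝ≥0) (i : ℕ), ∫⁻ ω, .ofReal (‖Z ((i + 1 : ℕ) * h) ω - Z (i * h) ω‖ ^ 4) ∂P ≤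
      .ofReal (L * (h ^ 2 * Real.exp (6 * ((i + 1) * h))))) :
    ∫⁻ ω, chainTerm t m (fun s => Z s ω) ∂P ≤
      .ofReal (((9 / 10) ^ m + L * (1000 / 1458) ^ m) * Real.exp (8 * t)) := by
  have hL0 : (0 : ℝ) ≤ L := L.2
  have ht0 : (0 : ℝ) ≤ t := t.2
  unfold chainTerm
  have hm : ∀ j : ℕ, Measurable fun ω =>
      ENNReal.ofReal (‖Z ((j + 1 : ℕ) * (t / 2 ^ m)) ω - Z (j * (t / 2 ^ m)) ω‖ ^ 4) := fun j => by
    have := hZ ((j + 1 : ℕ) * (t / 2 ^ m))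
    have := hZ (j * (t / 2 ^ m))
    fun_prop
  rw [lintegral_add_left measurable_const, lintegral_const, measure_univ, mul_one,
    lintegral_const_mul _ (Finset.measurable_fun_sum _ fun j _ => hm j),
    lintegral_finsetSum _ fun j _ => hm j]
  calc _ ≤ ENNReal.ofReal ((9 / 10) ^ m) + .ofReal ((1000 / 729) ^ m) *
        ∑ j ∈ Finset.range (2 ^ m), .ofReal (L * ((t / 2 ^ m) ^ 2 * Real.exp (6 * t))) := by
        gcongr with j hj
        refine (hL _ j).trans (ENNReal.ofReal_le_ofReal ?_)
        push_cast
        gcongr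
        have : (j + 1 : ℝ) ≤ 2 ^ m := by exact_mod_cast Finset.mem_range.1 hj
        rw [mul_div_assoc', div_le_iff₀ (by positivity), mul_comm]
        gcongr
    _ = .ofReal ((9 / 10) ^ m + L * (1000 / 1458) ^ m * (t ^ 2 * Real.exp (6 * t))) := by
        rw [Finset.sum_const, Finset.card_range, nsmul_eq_mul, ← ENNReal.ofReal_natCast,
          ← ENNReal.ofReal_mul (by positivity), ← ENNReal.ofReal_mul (by positivity),
          ← ENNReal.ofReal_add (by positivity) (by positivity)]
        congr 2
        rw [show (1000 / 1458 : ℝ) = 1000 / 729 / 2 by norm_num, div_pow _ 2]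
        push_cast
        field_simp
    _ ≤ _ := by
        refine ENNReal.ofReal_le_ofReal ?_
        have h1 : (t : ℝ) ^ 2 * Real.exp (6 * t) ≤ Real.exp (8 * t) := by
          have h2 : (t : ℝ) ≤ Real.exp t := by linarith [Real.add_one_le_exp (t : ℝ)]
          have h3 : Real.exp (8 * t) = Real.exp t ^ 2 * Real.exp (6 * t) := by
            rw [← Real.exp_nat_mul, ← Real.exp_add]
            congr 1
            push_cast
            ring
          rw [h3]
          gcongr
        have h4 : 1 ≤ Real.exp (8 * t) := Real.one_le_exp (by positivity)
        rw [add_mul]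
        refine add_le_add (le_mul_of_one_le_right (by positivity) h4) ?_
        gcongr

lemma exists_lintegral_tsum_chainTerm_le (L : ℝ≥0) : ∃ C : ℝ≥0,
    ∀ {Ω : Type*} [MeasurableSpace Ω] {P : Measure Ω} {Z : ℝ≥0 → Ω → ℂ} (t : ℝ≥0),
    IsProbabilityMeasure P → (∀ t, Measurable (Z t)) →
    (∀ (h : ℝ≥0) (i : ℕ), ∫⁻ ω, .ofReal (‖Z ((i + 1 : ℕ) * h) ω - Z (i * h) ω‖ ^ 4) ∂P ≤
      .ofReal (L * (h ^ 2 * Real.exp (6 * ((i + 1) * h))))) →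
    ∫⁻ ω, ∑' m, chainTerm t m (fun s => Z s ω) ∂P ≤ .ofReal (C * Real.exp (8 * t)) := by
  have hL0 : (0 : ℝ) ≤ L := L.2
  have h1 : Summable fun m : ℕ => ((9 / 10 : ℝ) ^ m + L * (1000 / 1458) ^ m) :=
    (summable_geometric_of_lt_one (by norm_num) (by norm_num)).add
      ((summable_geometric_of_lt_one (by norm_num) (by norm_num)).mul_left _)
  refine ⟨⟨∑' m : ℕ, ((9 / 10 : ℝ) ^ m + L * (1000 / 1458) ^ m),
    tsum_nonneg fun m => by positivity⟩, fun {Ω _ P Z} t hP hZ hL => ?_⟩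
  have hm : ∀ m, AEMeasurable (fun ω => chainTerm t m fun s => Z s ω) P := fun m => by
    refine Measurable.aemeasurable ?_
    have h2 : Measurable fun ω => ∑ j ∈ Finset.range (2 ^ m),
        ENNReal.ofReal (‖Z ((j + 1 : ℕ) * (t / 2 ^ m)) ω - Z (j * (t / 2 ^ m)) ω‖ ^ 4) := by
      refine Finset.measurable_fun_sum _ fun j _ => ?_
      have := hZ ((j + 1 : ℕ) * (t / 2 ^ m))
      have := hZ (j * (t / 2 ^ m))
      fun_prop
    exact (h2.const_mul _).const_add _
  rw [lintegral_tsum hm]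
  refine (ENNReal.tsum_le_tsum fun m => lintegral_chainTerm_le t m hP hZ hL).trans_eq ?_
  rw [← ENNReal.ofReal_tsum_of_nonneg (fun m => by positivity) (h1.mul_right _), tsum_mul_right]
  rfl

end Chaining

/-! ### Marks as measurable functions of paths -/

section Marks

/-- The value at time `t` of a path, computed from its values at dyadic times. -/
def pathRe (p : ℝ≥0 × (ℝ≥0 → ℂ)) : ℝ :=
  limsup (fun n : ℕ => (p.2 ((⌊p.1 * 2 ^ n⌋₊ : ℝ≥0) / 2 ^ n)).re) atTop

/-- The logarithm of the imaginary part at time `t` of a path, computed from its values at dyadic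
times. -/
def pathLogIm (p : ℝ≥0 × (ℝ≥0 → ℂ)) : ℝ :=
  Real.log (limsup (fun n : ℕ => (p.2 ((⌊p.1 * 2 ^ n⌋₊ : ℝ≥0) / 2 ^ n)).im) atTop)

/-- The largest displacement until time `t` of a path, computed from its values at dyadic times. -/
def pathSup (p : ℝ≥0 × (ℝ≥0 → ℂ)) : ℝ≥0∞ :=
  ⨆ (n : ℕ) (k : ℕ), if (k : ℝ≥0) / 2 ^ n ≤ p.1 then ‖p.2 ((k : ℝ≥0) / 2 ^ n) - Complex.I‖ₑ else 0

/-- The mark of a path run for the time `t`. -/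
def pathMark (p : ℝ≥0 × (ℝ≥0 → ℂ)) : ℝ × ℝ × ℝ≥0∞ := (pathRe p, pathLogIm p, pathSup p)

lemma measurable_eval_dyadic (n : ℕ) : Measurable fun p : ℝ≥0 × (ℝ≥0 → ℂ) =>
    p.2 ((⌊p.1 * 2 ^ n⌋₊ : ℝ≥0) / 2 ^ n) := by
  have h1 : Measurable fun q : ℕ × (ℝ≥0 → ℂ) => q.2 ((q.1 : ℝ≥0) / 2 ^ n) :=
    measurable_from_prod_countable_right fun k =>
      (measurable_pi_apply ((k : ℝ≥0) / 2 ^ n) : Measurable fun z : ℝ≥0 → ℂ => z _)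
  have h2 : Measurable fun p : ℝ≥0 × (ℝ≥0 → ℂ) => ⌊p.1 * 2 ^ n⌋₊ :=
    Nat.measurable_floor.comp (measurable_fst.mul_const _)
  exact h1.comp (h2.prodMk measurable_snd)

/-- Path space carries the product σ-algebra, so a mark may use only countably many coordinates.
Dyadic times provide this, and for continuous paths the values agree with the true ones. -/
lemma measurable_pathMark : Measurable pathMark := by
  refine Measurable.prodMk ?_ (Measurable.prodMk ?_ ?_)
  · exact Measurable.limsup fun n => Complex.measurable_re.comp (measurable_eval_dyadic n)
  · exact Real.measurable_log.comp
      (Measurable.limsup fun n => Complex.measurable_im.comp (measurable_eval_dyadic n))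
  · refine Measurable.iSup fun n => Measurable.iSup fun k => Measurable.ite ?_ ?_ measurable_const
    · exact measurableSet_le measurable_const measurable_fst
    · have : Measurable fun p : ℝ≥0 × (ℝ≥0 → ℂ) => p.2 ((k : ℝ≥0) / 2 ^ n) :=
        (measurable_pi_apply _).comp measurable_snd
      fun_prop

lemma pathRe_eq {z : ℝ≥0 → ℂ} (hz : Continuous z) (t : ℝ≥0) : pathRe (t, z) = (z t).re :=
  (((Complex.continuous_re.comp hz).tendsto t).comp (tendsto_dyadic_floor t)).limsup_eq

lemma pathLogIm_eq {z : ℝ≥0 → ℂ} (hz : Continuous z) (t : ℝ≥0) :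
    pathLogIm (t, z) = Real.log (z t).im :=
  congrArg Real.log (((Complex.continuous_im.comp hz).tendsto t).comp
    (tendsto_dyadic_floor t)).limsup_eq

lemma enorm_sub_I_le_pathSup {z : ℝ≥0 → ℂ} (hz : Continuous z) {s t : ℝ≥0} (hs : s ≤ t) :
    ‖z s - Complex.I‖ₑ ≤ pathSup (t, z) := by
  have h1 : Tendsto (fun n : ℕ => ‖z ((⌊s * 2 ^ n⌋₊ : ℝ≥0) / 2 ^ n) - Complex.I‖ₑ) atTop
      (𝓝 ‖z s - Complex.I‖ₑ) :=
    (((hz.tendsto s).comp (tendsto_dyadic_floor s)).sub_const _).enorm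
  refine le_of_tendsto h1 (.of_forall fun n => ?_)
  refine le_iSup_of_le n (le_iSup_of_le ⌊s * 2 ^ n⌋₊ ?_)
  have h2 : (⌊s * 2 ^ n⌋₊ : ℝ≥0) / 2 ^ n ≤ t := by
    rw [div_le_iff₀ (by positivity)]
    exact (Nat.floor_le zero_le).trans (by gcongr)
  simp only
  rw [if_pos h2]

lemma pathSup_le {z : ℝ≥0 → ℂ} {t : ℝ≥0} {K : ℝ≥0∞}
    (h : ∀ s ≤ t, ‖z s - Complex.I‖ₑ ≤ K) : pathSup (t, z) ≤ K := by
  refine iSup_le fun n => iSup_le fun k => ?_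
  split_ifs with hk
  · exact h _ hk
  · exact zero_le

variable {Ω : Type*} [MeasurableSpace Ω] {P : Measure Ω} {Z : ℝ≥0 → Ω → ℂ}

/-- The law of the mark of a hyperbolic Brownian motion run for the time `t`. -/
def motionLaw (P : Measure Ω) (Z : ℝ≥0 → Ω → ℂ) (t : ℝ≥0) : Measure (ℝ × ℝ × ℝ≥0∞) :=
  P.map fun ω => pathMark (t, fun s => Z s ω)

end Marks

/-! ### Verification of the assumptions for the branching process -/

section Input

variable {Ω : Type*} [MeasurableSpace Ω] {P : Measure Ω}

lemma IsHyperbolicBM.ae_im_pos {Z : ℝ≥0 → Ω → ℂ} (h : IsHyperbolicBM Z P) :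
    ∀ᵐ ω ∂P, ∀ t, 0 < (Z t ω).im := by
  obtain ⟨W, B, -, -, -, him, -⟩ := h.sde
  filter_upwards [him] with ω hω t
  rw [hω]
  exact Real.exp_pos _

lemma measurable_pathMark_motion {Z : ℝ≥0 → Ω → ℂ} (hZ : ∀ t, Measurable (Z t)) (t : ℝ≥0) :
    Measurable fun ω => pathMark (t, fun s => Z s ω) :=
  measurable_pathMark.comp (measurable_const.prodMk (measurable_pi_lambda _ hZ))

/-- The marginal laws of hyperbolic Brownian motion have the properties that we need. -/
lemma exists_isMotionLaw (P : Measure Ω) [IsProbabilityMeasure P] : ∃ C : ℝ≥0,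
    ∀ Z : ℝ≥0 → Ω → ℂ, IsHyperbolicBM Z P → ∀ t, IsMotionLaw C t (motionLaw P Z t) := by
  obtain ⟨K, hK⟩ := exists_lintegral_pow_four_gaussianReal
  obtain ⟨C, hC⟩ := exists_lintegral_tsum_chainTerm_le (2 * K + 32)
  refine ⟨C, fun Z hZ t => ?_⟩
  obtain ⟨W, B, hW, hB, hind, him, hI⟩ := hZ.sde
  replace hW := hW.toIsPreBrownianReal
  replace hB := hB.toIsPreBrownianReal
  have hm := measurable_pathMark_motion hZ.measurable t
  have hmark : ∀ᵐ ω ∂P, pathMark (t, fun s => Z s ω) =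
      ((Z t ω).re, -(t : ℝ) / 2 + B t ω, pathSup (t, fun s => Z s ω)) := by
    filter_upwards [hZ.continuous, him] with ω h1 h2
    rw [pathMark, pathRe_eq h1, pathLogIm_eq h1, h2, Real.log_exp]
  refine ⟨Measure.isProbabilityMeasure_map hm.aemeasurable, fun q => ?_, ?_, fun ht φ r hφ => ?_, ?_⟩
  · rw [motionLaw, lintegral_map (by fun_prop) hm, ← lintegral_exp_mul_geom hB]
    refine lintegral_congr_ae ?_
    filter_upwards [hmark] with ω hω
    rw [hω]
  · rw [motionLaw, lintegral_map (by fun_prop) hm]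
    refine le_trans (lintegral_mono_ae ?_) (lintegral_re_sq_div_le hW hB hind him hI t)
    filter_upwards [hmark] with ω hω
    rw [hω, geom, mul_comm, Real.exp_neg, ← div_eq_mul_inv]
  · rw [motionLaw, lintegral_map (by fun_prop) hm]
    refine le_trans (lintegral_mono_ae ?_) ((lintegral_re_add_le hW hB hind hZ.measurable him hI ht r
      hφ).trans_eq ?_)
    · filter_upwards [hmark] with ω hω
      rw [hω, geom]
    · rw [Real.sqrt_eq_rpow, ← Real.rpow_neg (NNReal.coe_nonneg t)]
  · rw [motionLaw, lintegral_map (by fun_prop) hm]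
    refine le_trans (lintegral_mono_ae ?_) (hC (Z := Z) t inferInstance hZ.measurable fun h i => ?_)
    · filter_upwards [hZ.continuous, re_zero_ae_eq_zero hI, him, hB.eval_zero_ae_eq_zero]
        with ω h1 h2 h3 h4
      have h0 : Z 0 ω = Complex.I := by
        apply Complex.ext
        · simpa using h2
        · rw [h3, h4]; simp
      refine pathSup_le fun s hs => ?_
      rw [← h0]
      exact enorm_sub_le_tsum_chainTerm hs h1
    · refine (lintegral_norm_sub_pow_four_le hK hW hB hind hZ.measurable him hI h i).trans_eq ?_
      push_cast
      rfl

variable {β : ℝ} {τ : List Bool → Ω → ℝ} {Z : List Bool → ℝ≥0 → Ω → ℂ}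

/-- The marks of the particles. -/
def markOf (τ : List Bool → Ω → ℝ) (Z : List Bool → ℝ≥0 → Ω → ℂ) (ω : Ω) (u : List Bool) : Mark :=
  ((τ u ω).toNNReal, pathMark ((τ u ω).toNNReal, fun t => Z u t ω))

lemma measurable_mark : Measurable fun p : ℝ × (ℝ≥0 → ℂ) =>
    ((p.1.toNNReal, pathMark (p.1.toNNReal, p.2)) : Mark) := by
  have h1 : Measurable fun p : ℝ × (ℝ≥0 → ℂ) => p.1.toNNReal := by fun_prop
  exact h1.prodMk (measurable_pathMark.comp (h1.prodMk measurable_snd))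

lemma IsBBMInput.measurable_markOf (h : IsBBMInput β τ Z P) (u : List Bool) :
    Measurable fun ω => markOf τ Z ω u :=
  measurable_mark.comp ((h.measurable_lifetime u).prodMk
    (measurable_pi_lambda _ (h.motion u).measurable))

/-- Lifetime and motion are independent, so conditioning on the lifetime leaves the motion at a
deterministic time. -/
lemma IsBBMInput.isMarkLaw [IsProbabilityMeasure P] {C : ℝ≥0}
    (hC : ∀ Z : ℝ≥0 → Ω → ℂ, IsHyperbolicBM Z P → ∀ t, IsMotionLaw C t (motionLaw P Z t))
    (h : IsBBMInput β τ Z P) (u : List Bool) :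
    IsMarkLaw β C (P.map fun ω => markOf τ Z ω u) := by
  refine ⟨fun t => motionLaw P (Z u) t, hC _ (h.motion u), fun F hF => ?_⟩
  have hZ := (h.motion u).measurable
  have m1 : Measurable fun ω => fun t => Z u t ω := measurable_pi_lambda _ hZ
  have m2 := h.measurable_lifetime u
  have hi := (indepFun_iff_map_prod_eq_prod_map_map m2.aemeasurable m1.aemeasurable).1
    (h.indep_lifetime_motion u)
  have := Measure.isProbabilityMeasure_map (μ := P) m1.aemeasurable
  have := Measure.isProbabilityMeasure_map (μ := P) m2.aemeasurable
  have hF' : Measurable fun p : ℝ≥0 × (ℝ≥0 → ℂ) => F (p.1, pathMark p) :=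
    hF.comp (measurable_fst.prodMk measurable_pathMark)
  have hF'' : Measurable fun p : ℝ × (ℝ≥0 → ℂ) => F (p.1.toNNReal, pathMark (p.1.toNNReal, p.2)) :=
    hF.comp measurable_mark
  have hF3 : Measurable fun t : ℝ≥0 => ∫⁻ p, F (t, pathMark (t, p)) ∂(P.map fun ω t => Z u t ω) :=
    hF'.lintegral_prod_right'
  calc _ = ∫⁻ p, F (p.1.toNNReal, pathMark (p.1.toNNReal, p.2))
        ∂(P.map fun ω => (τ u ω, fun t => Z u t ω)) := by
        rw [lintegral_map hF (h.measurable_markOf u), lintegral_map hF'' (m2.prodMk m1)]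
        rfl
    _ = ∫⁻ s, ∫⁻ p, F (s.toNNReal, pathMark (s.toNNReal, p)) ∂(P.map fun ω t => Z u t ω)
        ∂(P.map (τ u)) := by
        rw [hi, lintegral_prod _ hF''.aemeasurable]
    _ = ∫⁻ t, ∫⁻ p, F (t, pathMark (t, p)) ∂(P.map fun ω t => Z u t ω) ∂lifeLaw β := by
        rw [lifeLaw, lintegral_map hF3 (by fun_prop), (h.lifetime_law u).map_eq]
    _ = _ := by
        refine lintegral_congr fun t => ?_
        have hFt : Measurable fun z => F (t, z) := hF.comp (measurable_const.prodMk measurable_id)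
        change _ = ∫⁻ z, F (t, z) ∂motionLaw P (Z u) t
        have hFp : Measurable fun p : ℝ≥0 → ℂ => F (t, pathMark (t, p)) :=
          hF'.comp (f := fun p : ℝ≥0 → ℂ => (t, p)) (measurable_const.prodMk measurable_id)
        rw [motionLaw, lintegral_map hFt (measurable_pathMark_motion hZ t), lintegral_map hFp m1]

/-- Each mark is a measurable function of the lifetime and motion of one particle, so independence
of the particles makes the joint law a product. -/
lemma IsBBMInput.map_markOf [IsProbabilityMeasure P] (h : IsBBMInput β τ Z P) :
    P.map (markOf τ Z) = treeLaw fun u => P.map fun ω => markOf τ Z ω u := by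
  have hi : iIndepFun (fun u ω => markOf τ Z ω u) P :=
    h.indep_particles.comp (fun _ (p : ℝ × (ℝ≥0 → ℂ)) =>
      ((p.1.toNNReal, pathMark (p.1.toNNReal, p.2)) : Mark)) fun _ => measurable_mark
  exact (iIndepFun_iff_map_fun_eq_infinitePi_map h.measurable_markOf).1 hi

lemma expMeasure_ae_nonneg (β : ℝ) : ∀ᵐ x ∂expMeasure β, 0 ≤ x := by
  have h0 : expMeasure β (Set.Iio 0) = 0 := by
    rw [expMeasure, gammaMeasure, withDensity_apply _ measurableSet_Iio,
      setLIntegral_congr_fun measurableSet_Iio (g := fun _ => 0)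
        fun x hx => by simp [gammaPDF_of_neg hx]]
    simp
  filter_upwards [measure_eq_zero_iff_ae_notMem.1 h0] with x hx using not_lt.1 hx

lemma IsBBMInput.ae_compat (h : IsBBMInput β τ Z P) :
    ∀ᵐ ω ∂P, Compat τ Z ω (markOf τ Z ω) := by
  have h1 : ∀ᵐ ω ∂P, ∀ u, 0 ≤ τ u ω := ae_all_iff.2 fun u =>
    ((h.lifetime_law u).ae_iff (p := fun x => 0 ≤ x) (by fun_prop)).2 (expMeasure_ae_nonneg β)
  have h2 : ∀ᵐ ω ∂P, ∀ u, Continuous fun t => Z u t ω := ae_all_iff.2 fun u => (h.motion u).continuous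
  have h3 : ∀ᵐ ω ∂P, ∀ u t, 0 < (Z u t ω).im := ae_all_iff.2 fun u => (h.motion u).ae_im_pos
  filter_upwards [h1, h2, h3] with ω a1 a2 a3
  refine ⟨fun u => Real.coe_toNNReal _ (a1 u), fun u => ?_,
    fun u s hs => enorm_sub_I_le_pathSup (a2 u) hs, fun u s _ => (a3 u s).le⟩
  simp only [markOf, pathMark]
  rw [pathRe_eq (a2 u), pathLogIm_eq (a2 u), Real.exp_log (a3 u _), Complex.re_add_im]

end Input

end HypBBM

end

theorem theorem2 {Ω : Type*} [MeasurableSpace Ω] (P : Measure Ω) [IsProbabilityMeasure P]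
    (β : ℝ) (hβ : 0 < β)
    (τ : List Bool → Ω → ℝ) (Z : List Bool → ℝ≥0 → Ω → ℂ)
    (hBBM : HypBBM.IsBBMInput β τ Z P) :
    ∀ᵐ ω ∂P, ∃ μ : Measure ℂ, HypBBM.IsLimitMeasure τ Z ω μ ∧
      (∀ z : ℂ, μ {z} = 0) ∧
      (∀ γ : ℝ≥0, (γ : ℝ) < min (1 / 2) (β / 3) →
        ∃ C : ℝ≥0, HolderOnWith C γ (HypBBM.circleCDF μ) (Set.Icc 0 (2 * Real.pi))) ∧
      (1 / 2 < β → ∃ ρ : ℂ → ℝ≥0∞, Measurable ρ ∧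
        μ = HypBBM.circleLebesgue.withDensity ρ) := by
  obtain ⟨C, hC⟩ := HypBBM.exists_isMotionLaw P
  have htyp : ∀ᵐ ω ∂P, HypBBM.IsTypical β (HypBBM.markOf τ Z ω) := by
    have h := HypBBM.ae_isTypical hβ fun u => hBBM.isMarkLaw hC u
    rw [← hBBM.map_markOf] at h
    exact ae_of_ae_map (measurable_pi_lambda _ hBBM.measurable_markOf).aemeasurable h
  filter_upwards [htyp, hBBM.ae_compat] with ω h1 h2
  obtain ⟨μ, hμ, h3, h4, h5⟩ := h2.exists_isLimitMeasure hβ h1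
  -- The proof yields exponents up to min(1/2, β/2), and β/3 ≤ β/2.
  exact ⟨μ, hμ, h3, fun γ hγ => h4 γ (hγ.trans_le (min_le_min_left _ (by linarith))), h5⟩
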